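/- Computations take place on a word RAM with unit-cost instructions. For $r\ge 1$, an $r$-VC of a finite graph $G$ is a vertex cover of $G$ whose size is at most $r$ times that of a minimum vertex cover. The arboricity of $G$ is $\max_{U}\lceil |E(U)|/(|U|-1)\rceil$ over the vertex sets $U$ with $|U|\ge 2$. **Theorem.** For every $t\ge 1$ there is a constant $c>0$ such that for every $\varepsilon>0$ and every static program $P$ there is a dynamic program $Q$ with the following property. Let $n,\alpha$ be integers with $\alpha\ge 1$, let $\mathcal G$ be a family of graphs on the vertex set $\{0,\dots,n-1\}$ of arboricity at most $\alpha$ that is closed under edge removals, and let $T:\mathbb N\to\mathbb N$ satisfy $T(n)\ge n$ and $T(j)/j\le T(n)/n$ for $1\le j\le n$. Suppose that, given $\alpha$ and the adjacency lists of any $j$-vertex subgraph $H$ of a member of $\mathcal G$ ($1\le j\le n$), $P$ computes a $t$-VC of $H$ in at most $T(j)$ steps, using words of $O(\log(j+\alpha+T(j)))$ bits. Then $Q$, which is given $n$, $\alpha$ and $T(n)$ and uses words of $O(\log(n+\alpha+T(n)))$ bits, maintains a $(t+\varepsilon)$-VC under every sequence of edge insertions and deletions that starts from the edgeless graph and stays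 in $\mathcal G$. Each update takes at most $$B=\frac{T(n)}{c\,(n/\alpha)\,\min(\varepsilon,1)^2}$$ steps in the worst case, and membership of a vertex in the cover can be queried in constant time. Moreover, for every $m$, the total number of changes to the cover during the first $m$ updates (the sum of the sizes of the symmetric differences of consecutive covers) is at most $B\cdot m$; that is, the amortized number of changes per update is at most $B$. The constant $c$ depends on $t$ only. The program $Q$ depends on $t$, $\varepsilon$, $P$ and the constant in the $O(\cdot)$ of the word size of $P$, and the constant in the $O(\cdot)$ of the word size of $Q$ depends only on these. -/

import Mathlib

/-! ### Graphs -/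

/-- The arboricity `max_U ⌈|E(U)| / (|U| - 1)⌉` of a finite graph, the maximum being over all vertex
sets `U` with at least two elements (it is `0` if there is no such set). -/
noncomputable def arboricity {n : ℕ} (G : SimpleGraph (Fin n)) : ℕ :=
  (Finset.univ.filter fun U : Finset (Fin n) => 2 ≤ U.card).sup fun U =>
    ⌈((G.induce (U : Set (Fin n))).edgeSet.ncard : ℚ) / ((U.card : ℚ) - 1)⌉₊

/-- `C` is an `r`-approximate minimum vertex cover (an `r`-VC) of `G`: it covers all edges and its
size is at most `r` times the size of any (hence of a minimum) vertex cover. -/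
def IsApproxVC {n : ℕ} (G : SimpleGraph (Fin n)) (r : ℝ) (C : Set (Fin n)) : Prop :=
  G.IsVertexCover C ∧ ∀ D : Set (Fin n), G.IsVertexCover D → (C.ncard : ℝ) ≤ r * (D.ncard : ℝ)

/-! ### The word RAM -/

/-- The arithmetic and bitwise operations on words. -/
inductive WordOp where
  | add | sub | mul | div | mod | land | lor | xor | shl | shr

/-- The value of an operation. Subtraction is truncated at `0`, division rounds down. -/
def WordOp.eval : WordOp → ℕ → ℕ → ℕ
  | .add, a, b => a + b
  | .sub, a, b => a - b
  | .mul, a, b => a * b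
  | .div, a, b => a / b
  | .mod, a, b => a % b
  | .land, a, b => a &&& b
  | .lor, a, b => a ||| b
  | .xor, a, b => a ^^^ b
  | .shl, a, b => a <<< b
  | .shr, a, b => a >>> b

/-- The instructions; `d`, `a`, `b` are register numbers and `l` is a position in the program. -/
inductive Instr where
  /-- `R[d] := c` -/
  | const (d c : ℕ)
  /-- `R[d] := R[a] f R[b]` -/
  | op (f : WordOp) (d a b : ℕ)
  /-- `R[d] := M[R[a]]` -/
  | load (d a : ℕ)
  /-- `M[R[a]] := R[b]` -/
  | store (a b : ℕ)
  /-- go to `l` if `R[a] = 0` -/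
  | jumpZero (a l : ℕ)
  /-- go to `l` if `R[a] < R[b]` -/
  | jumpLess (a b l : ℕ)
  /-- go to `R[a]` -/
  | jumpReg (a : ℕ)

/-- A program is a finite list of instructions. -/
abbrev Program := List Instr

/-- A configuration: program counter, registers and memory. -/
structure Config where
  pc : ℕ
  reg : ℕ → ℕ
  mem : ℕ → ℕ

/-- The effect of one instruction. -/
def Instr.exec : Instr → Config → Config
  | .const d c, s => ⟨s.pc + 1, Function.update s.reg d c, s.mem⟩
  | .op f d a b, s => ⟨s.pc + 1, Function.update s.reg d (f.eval (s.reg a) (s.reg b)), s.mem⟩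
  | .load d a, s => ⟨s.pc + 1, Function.update s.reg d (s.mem (s.reg a)), s.mem⟩
  | .store a b, s => ⟨s.pc + 1, s.reg, Function.update s.mem (s.reg a) (s.reg b)⟩
  | .jumpZero a l, s => ⟨if s.reg a = 0 then l else s.pc + 1, s.reg, s.mem⟩
  | .jumpLess a b l, s => ⟨if s.reg a < s.reg b then l else s.pc + 1, s.reg, s.mem⟩
  | .jumpReg a, s => ⟨s.reg a, s.reg, s.mem⟩

/-- One step, at unit cost. The machine has halted once the program counter is past the end of the
program; it then stays where it is. -/
def step (P : Program) (s : Config) : Config :=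
  match P[s.pc]? with
  | some I => I.exec s
  | none => s

/-- All words of the configuration are at most `W`. -/
def Config.BoundedBy (s : Config) (W : ℕ) : Prop :=
  ∀ i, s.reg i ≤ W ∧ s.mem i ≤ W

/-- Started in `s`, the program `P` halts in `s'` after at most `τ` steps, and no word ever exceeds
`W` on the way (so words of about `log₂ W` bits suffice). -/
def RunsTo (P : Program) (W : ℕ) (s : Config) (τ : ℕ) (s' : Config) : Prop :=
  (step P)^[τ] s = s' ∧ P.length ≤ s'.pc ∧ ∀ i ≤ τ, ((step P)^[i] s).BoundedBy W

/-! ### Static algorithms -/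

/-- The memory `m` holds the adjacency lists of `H`, in an arbitrary order each: the number `j` of
vertices in cell `0`, the start of the list of the vertex `v` in cell `v + 1`, its end (which is the
start of the next list) in cell `v + 2`, then the lists themselves one after the other, then zeros.
As a list has as many cells as the vertex has neighbours, each neighbour occurs exactly once. -/
structure IsAdjLists {j : ℕ} (H : SimpleGraph (Fin j)) (m : ℕ → ℕ) : Prop where
  size : m 0 = j
  first : m 1 = j + 2
  next : ∀ v : Fin j, m (v + 2) = m (v + 1) + (H.neighborSet v).ncard
  lists : ∀ v w : Fin j, H.Adj v w ↔ ∃ i, m (v + 1) ≤ i ∧ i < m (v + 2) ∧ m i = w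
  rest : ∀ i, m (j + 1) ≤ i → m i = 0

/-- Started on the adjacency lists of any `j`-vertex subgraph `H` of a member of `𝒢`
(`1 ≤ j`; the parameter `α` is in register `0`), the program `P` halts within `T j` steps and leaves
the characteristic vector of a `t`-VC of `H` in the cells `0, …, j - 1`. Words have
`O(log (j + α + T j))` bits, the hidden constant being `k`. -/
def ComputesVC (P : Program) (k : ℕ) (t : ℝ) {n : ℕ} (𝒢 : Set (SimpleGraph (Fin n))) (α : ℕ)
    (T : ℕ → ℕ) : Prop :=
  ∀ G ∈ 𝒢, ∀ j : ℕ, 1 ≤ j → ∀ H : SimpleGraph (Fin j), H.IsContained G →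
    ∀ m : ℕ → ℕ, IsAdjLists H m →
      ∃ s' : Config,
        RunsTo P ((j + α + T j + 2) ^ k) ⟨0, fun i => if i = 0 then α else 0, m⟩ (T j) s' ∧
        IsApproxVC H t {v : Fin j | s'.mem v ≠ 0}

/-! ### Dynamic algorithms -/

/-- The insertion (`ins = true`) or deletion (`ins = false`) of the edge between `u` and `v`. -/
structure Update (n : ℕ) where
  ins : Bool
  u : Fin n
  v : Fin n

/-- `e` is a legal update of `G` (a new edge is inserted, or an existing one is deleted) and turns it
into `G'`. -/
def Update.Takes {n : ℕ} (e : Update n) (G G' : SimpleGraph (Fin n)) : Prop :=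
  e.u ≠ e.v ∧
    if e.ins then ¬ G.Adj e.u e.v ∧ G' = G ⊔ SimpleGraph.edge e.u e.v
    else G.Adj e.u e.v ∧ G' = G \ SimpleGraph.edge e.u e.v

/-- `G 0, …, G m` is a sequence of graphs in `𝒢` that starts with the edgeless graph and is produced
by the updates `e 0, …, e (m - 1)`. -/
structure IsUpdateSeq {n : ℕ} (𝒢 : Set (SimpleGraph (Fin n))) (m : ℕ) (e : ℕ → Update n)
    (G : ℕ → SimpleGraph (Fin n)) : Prop where
  start : G 0 = ⊥
  mem : ∀ i ≤ m, G i ∈ 𝒢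
  takes : ∀ i < m, (e i).Takes (G i) (G (i + 1))

/-- The initial configuration of a dynamic algorithm: everything is zero, except for three registers
that hold parameters. -/
def initConfig (n α τ : ℕ) : Config :=
  ⟨0, fun i => if i = 3 then n else if i = 4 then α else if i = 5 then τ else 0, fun _ => 0⟩

/-- The call of the update procedure: the update is written to the registers `0`, `1`, `2` and the
program is started at its beginning; everything else is as the previous call left it. -/
def Update.call {n : ℕ} (e : Update n) (s : Config) : Config :=
  ⟨0, Function.update (Function.update (Function.update s.reg 0 (if e.ins then 1 else 0)) 1 e.u) 2 e.v,
    s.mem⟩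

/-- The vertex set that a configuration represents. Cell `0` holds the address of an array of `n`
cells, its characteristic vector; so a membership query takes constant time. -/
def Config.cover (n : ℕ) (s : Config) : Set (Fin n) :=
  {v | s.mem (s.mem 0 + v) ≠ 0}

/-- For every update sequence in `𝒢`, the program `P`, called for one update after the other, keeps
an `r`-VC of the current graph. Each single call takes at most `B` steps, and the total number of
changes to the cover over the first `m` updates is at most `B * m`, for every `m`. The number `τ` is
a parameter that `P` is given, along with `n` and `α`, and `W` bounds all words. -/
def MaintainsVC (P : Program) (W : ℕ) (r : ℝ) {n : ℕ} (𝒢 : Set (SimpleGraph (Fin n))) (α τ : ℕ)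
    (B : ℝ) : Prop :=
  ∀ (m : ℕ) (e : ℕ → Update n) (G : ℕ → SimpleGraph (Fin n)), IsUpdateSeq 𝒢 m e G →
    ∃ s : ℕ → Config, s 0 = initConfig n α τ ∧
      (∀ i < m, ∃ q : ℕ, (q : ℝ) ≤ B ∧ RunsTo P W ((e i).call (s i)) q (s (i + 1))) ∧
      (∀ i ≤ m, IsApproxVC (G i) r ((s i).cover n)) ∧
      ((∑ i ∈ Finset.range m, (symmDiff ((s i).cover n) ((s (i + 1)).cover n)).ncard : ℕ) : ℝ)
        ≤ B * m

/-! Time is cut into phases. During a phase an old cover Z is served while a new cover Y is computed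
in the background. An insertion puts one end of the new edge into Z at once, so Z always covers the
current graph and degrades by at most one vertex per update.

Fix an integer L of order t / min(ε, 1) and call a vertex high if its degree exceeds d = α(L + 1). A
phase works on a snapshot of the graph: the updates after its first one wait on a queue. Since Z
covers the snapshot, every edge has an end in Z. The high vertices of Z and the high neighbours of
low vertices of Z go into Y. Every edge that is then uncovered joins two low vertices, one of them
in Z, and is found by scanning the at most d neighbours of each low vertex of Z. These edges live on
an instance with at most |Z|(d + 1) vertices. Write θ = ⌊T(n)/n⌋ + 1. By the hypothesis on T, the
static program needs at most θ steps per vertex of the instance. It is interpreted one instruction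
at a time, its writes are logged, and the log is used afterwards to restore zeros. Finally the queue
is replayed, with one end of every inserted edge added to Y, and a pointer is redirected from Z to
Y.

Quality. A vertex outside a vertex cover D sends all its edges into D. Counting the edges of the
subgraph on D and the high vertices outside D against the arboricity shows that there are at most
|D|/L of the latter (`high_sdiff_le`). So taking the high vertices and solving the low instance
costs a ratio of t + 1/L (`high_low_le`).

Speed. Let opt be the size of a minimum cover of the snapshot. As |Z| = O(opt), the work of a phase
is of order (1 + opt)(d + 1)θ (`start_work`). With K microsteps per update, where K is of order Lθ(d
+ 1), a phase spans at most opt/L updates (`Tm.rest`). A cover is made during one phase and served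
until the end of the next one, and the optimum moves by at most one per update, so the ratio never
exceeds t + 13t/L (`stale_nat_le`). The cost of an update is of order θαL², which is the bound B.

Changes. A swap may replace all of Z by all of Y. The potential in `Chg` adds |Z| + 2|Y| to the
changes made so far; a microstep adds at most one vertex to Y, and the swap is paid for by what has
been stored.

Machine. Each microstep is a loop-free program of bounded length. `run_compile` translates such
programs to the word RAM, `grow` bounds their words, and `run_loop` runs a budget of them. `Inv` is
the invariant of a microstep (`Ctx.Good.goodStep`), `Rest` that of a call (`Rest.run`). `Ctx.Good`
separates the machine from graph theory; `goodRun` supplies the latter. -/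

namespace DynVC

/-! ### Runs of the word RAM with bounded words -/

/-- `Q` goes from `c` to `c'` in exactly `k` steps, none of which is a halt, with words bounded by
`W`. -/
inductive Reach (Q : Program) (W : ℕ) : Config → ℕ → Config → Prop
  | refl (c : Config) : c.BoundedBy W → Reach Q W c 0 c
  | head {c c' : Config} {I : Instr} {k : ℕ} : Q[c.pc]? = some I → c.BoundedBy W →
      Reach Q W (I.exec c) k c' → Reach Q W c (k + 1) c'

theorem Reach.trans {Q : Program} {W : ℕ} {c c' c'' : Config} {k l : ℕ}
    (h : Reach Q W c k c') (h' : Reach Q W c' l c'') : Reach Q W c (k + l) c'' := by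
  induction h with
  | refl => simpa using h'
  | head h1 h2 _ ih =>
    rw [Nat.add_right_comm]
    exact .head h1 h2 (ih h')

theorem Reach.snoc {Q : Program} {W : ℕ} {c c' : Config} {k : ℕ} {I : Instr}
    (h : Reach Q W c k c') (hI : Q[c'.pc]? = some I) (hb : (I.exec c').BoundedBy W)
    (hc : c'.BoundedBy W) : Reach Q W c (k + 1) (I.exec c') :=
  h.trans (.head hI hc (.refl _ hb))

theorem step_of_halted {Q : Program} {c : Config} (h : Q.length ≤ c.pc) : step Q c = c := by
  simp [step, List.getElem?_eq_none h]

theorem iterate_of_halted {Q : Program} {c : Config} (h : Q.length ≤ c.pc) (k : ℕ) :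
    (step Q)^[k] c = c :=
  Function.iterate_fixed (step_of_halted h) k

/-- A halted machine stays where it is, so a run can be padded to any larger time bound. This is why
all calls can later be given the same number of steps. -/
theorem Reach.runsTo {Q : Program} {W : ℕ} {c c' : Config} {k τ : ℕ} (h : Reach Q W c k c')
    (hp : Q.length ≤ c'.pc) (hk : k ≤ τ) : RunsTo Q W c τ c' := by
  induction h generalizing τ with
  | refl c hb =>
    refine ⟨iterate_of_halted hp τ, hp, fun i _ => ?_⟩
    rw [iterate_of_halted hp]
    exact hb
  | @head c c' I k h1 h2 _ ih =>
    obtain ⟨τ, rfl⟩ : ∃ τ', τ = τ' + 1 := ⟨τ - 1, by omega⟩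
    obtain ⟨e1, e2, e3⟩ := ih hp (τ := τ) (by omega)
    have hs : step Q c = I.exec c := by simp [step, h1]
    refine ⟨by rw [Function.iterate_succ_apply, hs, e1], e2, fun i hi => ?_⟩
    cases i with
    | zero => exact h2
    | succ i =>
      rw [Function.iterate_succ_apply, hs]
      exact e3 i (by omega)

/-- The program `Q` contains the code `l` at position `p`. -/
def CodeAt (Q : Program) (p : ℕ) (l : List Instr) : Prop :=
  ∀ (i : ℕ) (I : Instr), l[i]? = some I → Q[p + i]? = some I

theorem CodeAt.left {Q : Program} {p : ℕ} {l l' : List Instr} (h : CodeAt Q p (l ++ l')) :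
    CodeAt Q p l := fun i I hi => h i I (by
  rw [List.getElem?_append_left ((List.getElem?_eq_some_iff.mp hi).1)]; exact hi)

theorem CodeAt.right {Q : Program} {p : ℕ} {l l' : List Instr} (h : CodeAt Q p (l ++ l')) :
    CodeAt Q (p + l.length) l' := fun i I hi => by
  have := h (l.length + i) I (by rw [List.getElem?_append_right (by omega)]; simpa using hi)
  rwa [← add_assoc] at this

theorem CodeAt.head {Q : Program} {p : ℕ} {I : Instr} {l : List Instr}
    (h : CodeAt Q p (I :: l)) : Q[p]? = some I := h 0 I (by simp)

theorem CodeAt.tail {Q : Program} {p : ℕ} {I : Instr} {l : List Instr}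
    (h : CodeAt Q p (I :: l)) : CodeAt Q (p + 1) l := fun i J hi => by
  have := h (i + 1) J (by simpa using hi)
  rwa [show p + (i + 1) = p + 1 + i by omega] at this

/-! ### A loop-free language with variables and arrays -/

/-- An injective pairing that is computed with two additions and one multiplication. -/
def pr (x y : ℕ) : ℕ := (x + y) * (x + y) + x

/-- The value lies between (x + y)² and (x + y + 1)², the latter excluded. So it determines x + y,
and then x. -/
theorem pr_inj {x y x' y' : ℕ} (h : pr x y = pr x' y') : x = x' ∧ y = y' := by
  unfold pr at h
  have key : x + y = x' + y' := by
    rcases lt_trichotomy (x + y) (x' + y') with h1 | h1 | h1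
    · exfalso
      nlinarith [Nat.mul_le_mul (Nat.succ_le_of_lt h1) (Nat.succ_le_of_lt h1)]
    · exact h1
    · exfalso
      nlinarith [Nat.mul_le_mul (Nat.succ_le_of_lt h1) (Nat.succ_le_of_lt h1)]
  rw [key] at h
  omega

/-- The state of a program of the language: variables, one contiguous array that is at the bottom of
the memory, and infinitely many two-dimensional arrays. -/
structure St where
  v : ℕ → ℕ
  cov : ℕ → ℕ
  a : ℕ → ℕ → ℕ → ℕ

namespace St

def setv (S : St) (r x : ℕ) : St := ⟨Function.update S.v r x, S.cov, S.a⟩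
def setc (S : St) (i x : ℕ) : St := ⟨S.v, Function.update S.cov i x, S.a⟩
def seta (S : St) (k i j x : ℕ) : St :=
  ⟨S.v, S.cov, Function.update S.a k (Function.update (S.a k) i (Function.update (S.a k i) j x))⟩

variable (S : St) (r x i j k y : ℕ)

@[simp] theorem setv_v : (S.setv r x).v y = if y = r then x else S.v y := by
  simp [setv, Function.update_apply]
@[simp] theorem setv_cov : (S.setv r x).cov = S.cov := rfl
@[simp] theorem setv_a : (S.setv r x).a = S.a := rfl
@[simp] theorem setc_v : (S.setc i x).v = S.v := rfl
@[simp] theorem setc_cov : (S.setc i x).cov = Function.update S.cov i x := rfl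
@[simp] theorem setc_a : (S.setc i x).a = S.a := rfl
@[simp] theorem seta_v : (S.seta k i j x).v = S.v := rfl
@[simp] theorem seta_cov : (S.seta k i j x).cov = S.cov := rfl
@[simp] theorem seta_a : (S.seta k i j x).a y =
    if y = k then Function.update (S.a k) i (Function.update (S.a k i) j x) else S.a y := by
  by_cases h : y = k
  · subst h; simp [seta]
  · simp [seta, h]

end St

/-- An operand: a variable or a constant. -/
inductive Opd
  | r (i : ℕ)
  | c (k : ℕ)

def Opd.val (S : St) : Opd → ℕ
  | .r i => S.v i
  | .c k => k

/-- Loop-free programs. Indices into the contiguous array are taken modulo its size. -/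
inductive Code
  | skip
  | op (f : WordOp) (d : ℕ) (x y : Opd)
  | get (d k : ℕ) (x y : Opd)
  | put (k : ℕ) (x y z : Opd)
  | getc (d : ℕ) (x : Opd)
  | putc (x z : Opd)
  | seq (c₁ c₂ : Code)
  | ifz (x : Opd) (c₁ c₂ : Code)
  | iflt (x y : Opd) (c₁ c₂ : Code)

/-- The meaning of a program; `off` is the size of the contiguous array. -/
def exec (off : ℕ) : Code → St → St
  | .skip, S => S
  | .op f d x y, S => S.setv d (f.eval (x.val S) (y.val S))
  | .get d k x y, S => S.setv d (S.a k (x.val S) (y.val S))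
  | .put k x y z, S => S.seta k (x.val S) (y.val S) (z.val S)
  | .getc d x, S => S.setv d (S.cov (x.val S % off))
  | .putc x z, S => S.setc (x.val S % off) (z.val S)
  | .seq c₁ c₂, S => exec off c₂ (exec off c₁ S)
  | .ifz x c₁ c₂, S => if x.val S = 0 then exec off c₁ S else exec off c₂ S
  | .iflt x y c₁ c₂, S => if x.val S < y.val S then exec off c₁ S else exec off c₂ S

/-- The address of the cell `(x, y)` of the array `k`. -/
def addr (off k x y : ℕ) : ℕ := off + pr k (pr x y)

/-- All words that occur in the execution of a program are at most `W`. -/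
def Bdd (off W : ℕ) : Code → St → Prop
  | .skip, _ => True
  | .op f _ x y, S => x.val S ≤ W ∧ y.val S ≤ W ∧ f.eval (x.val S) (y.val S) ≤ W
  | .get _ k x y, S => addr off k (x.val S) (y.val S) ≤ W
  | .put k x y z, S => addr off k (x.val S) (y.val S) ≤ W ∧ z.val S ≤ W
  | .getc _ x, S => x.val S ≤ W
  | .putc x z, S => x.val S ≤ W ∧ z.val S ≤ W
  | .seq c₁ c₂, S => Bdd off W c₁ S ∧ Bdd off W c₂ (exec off c₁ S)
  | .ifz x c₁ c₂, S => x.val S ≤ W ∧ if x.val S = 0 then Bdd off W c₁ S else Bdd off W c₂ S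
  | .iflt x y c₁ c₂, S => x.val S ≤ W ∧ y.val S ≤ W ∧
      if x.val S < y.val S then Bdd off W c₁ S else Bdd off W c₂ S

/-! ### Compilation -/

/-- The register of a variable. The registers `6`, …, `11` are reserved: `6` holds the size of the
contiguous array, `10` is always zero, the others are scratch. -/
def vreg (r : ℕ) : ℕ := if r < 6 then r else r + 6

theorem vreg_inj {r s : ℕ} (h : vreg r = vreg s) : r = s := by
  unfold vreg at h; split_ifs at h <;> omega

theorem vreg_ne {r T : ℕ} (h : 6 ≤ T) (h' : T ≤ 11) : vreg r ≠ T := by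
  unfold vreg; split_ifs <;> omega

def Opd.mv (T : ℕ) : Opd → Instr
  | .r i => .op .add T (vreg i) 10
  | .c k => .const T k

/-- Code that puts the address of a cell into the register `7`. -/
def addrCode (k : ℕ) (x y : Opd) : List Instr :=
  [x.mv 7, y.mv 8, .op .add 9 7 8, .op .mul 9 9 9, .op .add 9 9 7,
   .const 8 k, .op .add 7 8 9, .op .mul 7 7 7, .op .add 7 7 8, .op .add 7 7 6]

def Code.len : Code → ℕ
  | .skip => 0
  | .op .. => 3
  | .get .. => 11
  | .put .. => 12
  | .getc .. => 3
  | .putc .. => 4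
  | .seq c₁ c₂ => c₁.len + c₂.len
  | .ifz _ c₁ c₂ => 3 + (c₁.len + c₂.len)
  | .iflt _ _ c₁ c₂ => 4 + (c₁.len + c₂.len)

/-- The instructions of a program that starts at position `p`. -/
def compile : Code → ℕ → List Instr
  | .skip, _ => []
  | .op f d x y, _ => [x.mv 7, y.mv 8, .op f (vreg d) 7 8]
  | .get d k x y, _ => addrCode k x y ++ [.load (vreg d) 7]
  | .put k x y z, _ => addrCode k x y ++ [z.mv 8, .store 7 8]
  | .getc d x, _ => [x.mv 7, .op .mod 7 7 6, .load (vreg d) 7]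
  | .putc x z, _ => [x.mv 7, .op .mod 7 7 6, z.mv 8, .store 7 8]
  | .seq c₁ c₂, p => compile c₁ p ++ compile c₂ (p + c₁.len)
  -- The branch for a failed test comes first. Register `10` is always zero, so `jumpZero 10` is an
  -- unconditional jump.
  | .ifz x c₁ c₂, p => [x.mv 7, .jumpZero 7 (p + 3 + c₂.len)] ++ (compile c₂ (p + 2) ++
      ([.jumpZero 10 (p + (3 + (c₁.len + c₂.len)))] ++ compile c₁ (p + 3 + c₂.len)))
  | .iflt x y c₁ c₂, p => [x.mv 7, y.mv 8, .jumpLess 7 8 (p + 4 + c₂.len)] ++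
      (compile c₂ (p + 3) ++ ([.jumpZero 10 (p + (4 + (c₁.len + c₂.len)))] ++
        compile c₁ (p + 4 + c₂.len)))

theorem length_compile (c : Code) : ∀ p, (compile c p).length = c.len := by
  induction c with
  | seq c₁ c₂ h₁ h₂ => intro p; simp [compile, Code.len, h₁, h₂]
  | ifz x c₁ c₂ h₁ h₂ => intro p; simp [compile, Code.len, h₁, h₂]; omega
  | iflt x y c₁ c₂ h₁ h₂ => intro p; simp [compile, Code.len, h₁, h₂]; omega
  | _ => intro p; simp [compile, Code.len, addrCode]

/-- The configuration `c` represents the state `S`. -/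
structure Rel (off W : ℕ) (c : Config) (S : St) : Prop where
  bdd : c.BoundedBy W
  var : ∀ r, c.reg (vreg r) = S.v r
  off_eq : c.reg 6 = off
  zero : c.reg 10 = 0
  cov : ∀ i < off, c.mem i = S.cov i
  arr : ∀ k x y, c.mem (addr off k x y) = S.a k x y

theorem boundedBy_reg {c : Config} {W d x p : ℕ} (h : c.BoundedBy W) (hx : x ≤ W) :
    (⟨p, Function.update c.reg d x, c.mem⟩ : Config).BoundedBy W := fun i => by
  refine ⟨?_, (h i).2⟩
  simp only [Function.update_apply]
  split_ifs
  · exact hx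
  · exact (h i).1

theorem boundedBy_mem {c : Config} {W d x p : ℕ} (h : c.BoundedBy W) (hx : x ≤ W) :
    (⟨p, c.reg, Function.update c.mem d x⟩ : Config).BoundedBy W := fun i => by
  refine ⟨(h i).1, ?_⟩
  simp only [Function.update_apply]
  split_ifs
  · exact hx
  · exact (h i).2

/-! ### Correctness of compiled code -/

section

variable {Q : Program} {off W : ℕ} {c c₁ : Config} {S : St} {k : ℕ}

theorem Rel.pc (h : Rel off W c S) (p : ℕ) : Rel off W ⟨p, c.reg, c.mem⟩ S :=
  ⟨h.bdd, h.var, h.off_eq, h.zero, h.cov, h.arr⟩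

theorem Rel.scratch (h : Rel off W c S) {T x p : ℕ} (hT : T = 7 ∨ T = 8 ∨ T = 9) (hx : x ≤ W) :
    Rel off W ⟨p, Function.update c.reg T x, c.mem⟩ S where
  bdd := boundedBy_reg h.bdd hx
  var r := by
    have : vreg r ≠ T := vreg_ne (by omega) (by omega)
    simpa [Function.update_apply, this] using h.var r
  off_eq := by
    have : (6 : ℕ) ≠ T := by omega
    simpa [Function.update_apply, this] using h.off_eq
  zero := by
    have : (10 : ℕ) ≠ T := by omega
    simpa [Function.update_apply, this] using h.zero
  cov := h.cov
  arr := h.arr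

theorem Rel.setv (h : Rel off W c S) {d x p : ℕ} (hx : x ≤ W) :
    Rel off W ⟨p, Function.update c.reg (vreg d) x, c.mem⟩ (S.setv d x) where
  bdd := boundedBy_reg h.bdd hx
  var r := by
    by_cases hr : r = d
    · subst hr; simp
    · have : vreg r ≠ vreg d := fun e => hr (vreg_inj e)
      simpa [Function.update_apply, this, hr] using h.var r
  off_eq := by
    have : (6 : ℕ) ≠ vreg d := (vreg_ne (by omega) (by omega)).symm
    simpa [Function.update_apply, this] using h.off_eq
  zero := by
    have : (10 : ℕ) ≠ vreg d := (vreg_ne (by omega) (by omega)).symm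
    simpa [Function.update_apply, this] using h.zero
  cov := h.cov
  arr := h.arr

/-- The contiguous array occupies the cells below `off`, while every address `addr off k x y` is at
least `off`, so the two kinds of array never interfere. -/
theorem Rel.setc (h : Rel off W c S) {i x p : ℕ} (hi : i < off) (hx : x ≤ W) :
    Rel off W ⟨p, c.reg, Function.update c.mem i x⟩ (S.setc i x) where
  bdd := boundedBy_mem h.bdd hx
  var := h.var
  off_eq := h.off_eq
  zero := h.zero
  cov j hj := by
    simp only [Function.update_apply, St.setc_cov]
    rw [h.cov j hj]
  arr k y z := by
    have : addr off k y z ≠ i := by unfold addr; omega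
    simpa [Function.update_apply, this] using h.arr k y z

theorem addr_inj {k x y k' x' y' : ℕ} (h : addr off k x y = addr off k' x' y') :
    k = k' ∧ x = x' ∧ y = y' := by
  unfold addr at h
  obtain ⟨h1, h2⟩ := pr_inj (Nat.add_left_cancel h)
  obtain ⟨h2, h3⟩ := pr_inj h2
  exact ⟨h1, h2, h3⟩

theorem Rel.seta (h : Rel off W c S) {k x y z p : ℕ} (hz : z ≤ W) :
    Rel off W ⟨p, c.reg, Function.update c.mem (addr off k x y) z⟩ (S.seta k x y z) where
  bdd := boundedBy_mem h.bdd hz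
  var := h.var
  off_eq := h.off_eq
  zero := h.zero
  cov j hj := by
    have : j ≠ addr off k x y := by unfold addr; omega
    simpa [Function.update_apply, this] using h.cov j hj
  arr k' x' y' := by
    by_cases e : addr off k' x' y' = addr off k x y
    · obtain ⟨rfl, rfl, rfl⟩ := addr_inj e
      simp
    · have := h.arr k' x' y'
      simp only [Function.update_apply, e, if_false, this, St.seta_a]
      by_cases hk : k' = k
      · subst hk
        by_cases hx : x' = x
        · subst hx
          have hy : y' ≠ y := fun h => e (by rw [h])
          simp [hy]
        · simp [hx]
      · simp [hk]

/-- Executing an instruction that writes a scratch register. -/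
theorem Reach.scratch (h : Reach Q W c k c₁) (hr : Rel off W c₁ S) {f : WordOp} {T a b p x : ℕ}
    (hp : c₁.pc = p)
    (hQ : Q[p]? = some (.op f T a b)) (hT : T = 7 ∨ T = 8 ∨ T = 9)
    (hv : f.eval (c₁.reg a) (c₁.reg b) = x) (hx : x ≤ W) :
    ∃ c₂, Reach Q W c (k + 1) c₂ ∧ Rel off W c₂ S ∧ c₂.pc = p + 1 ∧
      c₂.reg = Function.update c₁.reg T x := by
  subst hp hv
  have := hr.scratch (p := c₁.pc + 1) hT hx
  exact ⟨_, h.snoc hQ this.bdd hr.bdd, this, rfl, rfl⟩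

theorem Reach.opd (h : Reach Q W c k c₁) (hr : Rel off W c₁ S) {x : Opd} {T p : ℕ}
    (hp : c₁.pc = p)
    (hQ : Q[p]? = some (x.mv T)) (hT : T = 7 ∨ T = 8 ∨ T = 9) (hv : x.val S ≤ W) :
    ∃ c₂, Reach Q W c (k + 1) c₂ ∧ Rel off W c₂ S ∧ c₂.pc = p + 1 ∧
      c₂.reg = Function.update c₁.reg T (x.val S) := by
  subst hp
  have := hr.scratch (p := c₁.pc + 1) hT hv
  cases x with
  | r i =>
    have e : (Instr.op .add T (vreg i) 10).exec c₁ =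
        ⟨c₁.pc + 1, Function.update c₁.reg T (S.v i), c₁.mem⟩ := by
      simp [Instr.exec, WordOp.eval, hr.var, hr.zero]
    refine ⟨_, h.snoc hQ ?_ hr.bdd, ?_, ?_, ?_⟩
    · rw [Opd.mv, e]; exact this.bdd
    · rw [Opd.mv, e]; exact this
    · rw [Opd.mv, e]
    · rw [Opd.mv, e]; rfl
  | c i => exact ⟨_, h.snoc hQ this.bdd hr.bdd, this, rfl, rfl⟩

theorem run_addrCode (h : Reach Q W c k c₁) (hr : Rel off W c₁ S) {p i : ℕ} {x y : Opd}
    (hp : c₁.pc = p) (hQ : CodeAt Q p (addrCode i x y))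
    (hW : addr off i (x.val S) (y.val S) ≤ W) :
    ∃ c₂, Reach Q W c (k + 10) c₂ ∧ Rel off W c₂ S ∧ c₂.pc = p + 10 ∧
      c₂.reg 7 = addr off i (x.val S) (y.val S) := by
  obtain ⟨X, hX⟩ : ∃ X, x.val S = X := ⟨_, rfl⟩
  obtain ⟨Y, hY⟩ : ∃ Y, y.val S = Y := ⟨_, rfl⟩
  rw [hX, hY] at hW ⊢
  have b1 : off + ((i + ((X + Y) * (X + Y) + X)) * (i + ((X + Y) * (X + Y) + X)) + i) ≤ W := hW
  -- A number is at most its square, so every intermediate value is at most the final address. Hence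
  -- a bound on the address alone is enough.
  have b2 := Nat.le_mul_self (i + ((X + Y) * (X + Y) + X))
  have b3 := Nat.le_mul_self (X + Y)
  obtain ⟨d1, r1, s1, p1, q1⟩ := h.opd hr hp hQ.head (by simp) (by omega)
  obtain ⟨d2, r2, s2, p2, q2⟩ := r1.opd s1 p1 hQ.tail.head (by simp) (by omega)
  rw [q1, hX, hY] at q2
  obtain ⟨d3, r3, s3, p3, q3⟩ := r2.scratch s2 p2 hQ.tail.tail.head (x := X + Y) (by simp)
    (by simp [q2, WordOp.eval]) (by omega)
  rw [q2] at q3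
  obtain ⟨d4, r4, s4, p4, q4⟩ := r3.scratch s3 p3 hQ.tail.tail.tail.head
    (x := (X + Y) * (X + Y)) (by simp) (by simp [q3, WordOp.eval]) (by omega)
  rw [q3] at q4
  obtain ⟨d5, r5, s5, p5, q5⟩ := r4.scratch s4 p4 hQ.tail.tail.tail.tail.head
    (x := (X + Y) * (X + Y) + X) (by simp) (by simp [q4, WordOp.eval]) (by omega)
  rw [q4] at q5
  obtain ⟨d6, r6, s6, p6, q6⟩ := r5.opd (x := .c i) s5 p5 hQ.tail.tail.tail.tail.tail.head (by simp)
    (show i ≤ W by omega)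
  rw [q5] at q6
  obtain ⟨q, hq⟩ : ∃ q, (X + Y) * (X + Y) + X = q := ⟨_, rfl⟩
  rw [hq] at q6 b1 b2
  obtain ⟨d7, r7, s7, p7, q7⟩ := r6.scratch s6 p6 hQ.tail.tail.tail.tail.tail.tail.head
    (x := i + q) (by simp) (by simp [q6, WordOp.eval, Opd.val]) (by omega)
  rw [q6] at q7
  obtain ⟨d8, r8, s8, p8, q8⟩ := r7.scratch s7 p7 hQ.tail.tail.tail.tail.tail.tail.tail.head
    (x := (i + q) * (i + q)) (by simp) (by simp [q7, WordOp.eval]) (by omega)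
  rw [q7] at q8
  obtain ⟨d9, r9, s9, p9, q9⟩ := r8.scratch s8 p8 hQ.tail.tail.tail.tail.tail.tail.tail.tail.head
    (x := (i + q) * (i + q) + i) (by simp) (by simp [q8, WordOp.eval, Opd.val]) (by omega)
  rw [q8] at q9
  obtain ⟨d10, r10, s10, p10, q10⟩ := r9.scratch s9 p9
    hQ.tail.tail.tail.tail.tail.tail.tail.tail.tail.head (x := (i + q) * (i + q) + i + off)
    (by simp) (by rw [s9.off_eq]; simp [q9, WordOp.eval]) (by omega)
  refine ⟨d10, r10, s10, p10, ?_⟩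
  rw [q10, Function.update_self, addr, pr, pr, hq]
  omega

/-- Induction on the program. `len` counts both branches of a conditional, so it bounds the number
of steps without being exact. Positivity of `off` is needed because indices into the contiguous
array are reduced modulo `off`, which keeps these accesses in range whatever the state is. -/
theorem run_compile (hoff : 0 < off) (b : Code) : ∀ {p : ℕ} {c : Config} {S : St},
    CodeAt Q p (compile b p) → c.pc = p → Rel off W c S → Bdd off W b S →
    ∃ k ≤ b.len, ∃ c', Reach Q W c k c' ∧ c'.pc = p + b.len ∧ Rel off W c' (exec off b S) := by
  induction b with
  | skip =>
    intro p c S _ hp hr _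
    exact ⟨0, le_rfl, c, .refl _ hr.bdd, hp, hr⟩
  | op f d x y =>
    intro p c S hQ hp hr hb
    obtain ⟨d1, r1, s1, p1, q1⟩ := (Reach.refl c hr.bdd).opd hr hp hQ.head (by simp) hb.1
    obtain ⟨d2, r2, s2, p2, q2⟩ := r1.opd s1 p1 hQ.tail.head (by simp) hb.2.1
    rw [q1] at q2
    have := s2.setv (p := p + 1 + 1 + 1) (d := d) hb.2.2
    have e : (Instr.op f (vreg d) 7 8).exec d2 =
        ⟨p + 1 + 1 + 1, Function.update d2.reg (vreg d) (f.eval (x.val S) (y.val S)), d2.mem⟩ := by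
      simp [Instr.exec, p2, q2]
    refine ⟨3, le_rfl, _, r2.snoc (p2 ▸ hQ.tail.tail.head) (by rw [e]; exact this.bdd) s2.bdd, ?_, ?_⟩
    · rw [e]; rfl
    · rw [e]; exact this
  | get d i x y =>
    intro p c S hQ hp hr hb
    obtain ⟨d1, r1, s1, p1, q1⟩ := run_addrCode (.refl c hr.bdd) hr hp hQ.left hb
    have hv : d1.mem (d1.reg 7) = S.a i (x.val S) (y.val S) := by rw [q1]; exact s1.arr ..
    have := s1.setv (p := p + 11) (d := d) (x := S.a i (x.val S) (y.val S))
      (by rw [← hv]; exact (s1.bdd _).2)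
    have e : (Instr.load (vreg d) 7).exec d1 =
        ⟨p + 11, Function.update d1.reg (vreg d) (S.a i (x.val S) (y.val S)), d1.mem⟩ := by
      simp [Instr.exec, p1, hv]
    have hq := hQ.right.head
    refine ⟨11, le_rfl, _, r1.snoc (p1 ▸ hq) (by rw [e]; exact this.bdd) s1.bdd, ?_, ?_⟩
    · rw [e]; rfl
    · rw [e]; exact this
  | put i x y z =>
    intro p c S hQ hp hr hb
    obtain ⟨d1, r1, s1, p1, q1⟩ := run_addrCode (.refl c hr.bdd) hr hp hQ.left hb.1
    obtain ⟨d2, r2, s2, p2, q2⟩ := r1.opd s1 p1 hQ.right.head (by simp) hb.2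
    have := s2.seta (p := p + 12) (k := i) (x := x.val S) (y := y.val S) (z := z.val S) hb.2
    have e : (Instr.store 7 8).exec d2 = ⟨p + 12, d2.reg,
        Function.update d2.mem (addr off i (x.val S) (y.val S)) (z.val S)⟩ := by
      simp [Instr.exec, p2, q2, q1]
    have hq := hQ.right.tail.head
    refine ⟨12, le_rfl, _, r2.snoc (p2 ▸ hq) (by rw [e]; exact this.bdd) s2.bdd, ?_, ?_⟩
    · rw [e]; rfl
    · rw [e]; exact this
  | getc d x =>
    intro p c S hQ hp hr hb
    obtain ⟨d1, r1, s1, p1, q1⟩ := (Reach.refl c hr.bdd).opd hr hp hQ.head (by simp) hb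
    obtain ⟨d2, r2, s2, p2, q2⟩ := r1.scratch s1 p1 hQ.tail.head (by simp)
      (x := x.val S % off) (by rw [s1.off_eq, q1]; simp [WordOp.eval]) ((Nat.mod_le _ _).trans hb)
    rw [q1] at q2
    have hv : d2.mem (d2.reg 7) = S.cov (x.val S % off) := by
      simp only [q2, Function.update_self]
      exact s2.cov _ (Nat.mod_lt _ hoff)
    have := s2.setv (p := p + 1 + 1 + 1) (d := d) (x := S.cov (x.val S % off))
      (by rw [← hv]; exact (s2.bdd _).2)
    have e : (Instr.load (vreg d) 7).exec d2 =
        ⟨p + 1 + 1 + 1, Function.update d2.reg (vreg d) (S.cov (x.val S % off)), d2.mem⟩ := by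
      simp [Instr.exec, p2, hv]
    refine ⟨3, le_rfl, _, r2.snoc (p2 ▸ hQ.tail.tail.head) (by rw [e]; exact this.bdd) s2.bdd, ?_, ?_⟩
    · rw [e]; rfl
    · rw [e]; exact this
  | putc x z =>
    intro p c S hQ hp hr hb
    obtain ⟨d1, r1, s1, p1, q1⟩ := (Reach.refl c hr.bdd).opd hr hp hQ.head (by simp) hb.1
    obtain ⟨d2, r2, s2, p2, q2⟩ := r1.scratch s1 p1 hQ.tail.head (by simp)
      (x := x.val S % off) (by rw [s1.off_eq, q1]; simp [WordOp.eval]) ((Nat.mod_le _ _).trans hb.1)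
    rw [q1] at q2
    obtain ⟨d3, r3, s3, p3, q3⟩ := r2.opd s2 p2 hQ.tail.tail.head (by simp) hb.2
    rw [q2] at q3
    have := s3.setc (p := p + 1 + 1 + 1 + 1) (Nat.mod_lt (x.val S) hoff) hb.2
    have e : (Instr.store 7 8).exec d3 = ⟨p + 1 + 1 + 1 + 1, d3.reg,
        Function.update d3.mem (x.val S % off) (z.val S)⟩ := by
      simp [Instr.exec, p3, q3]
    refine ⟨4, le_rfl, _, r3.snoc (p3 ▸ hQ.tail.tail.tail.head) (by rw [e]; exact this.bdd)
      s3.bdd, ?_, ?_⟩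
    · rw [e]; rfl
    · rw [e]; exact this
  | seq b₁ b₂ h₁ h₂ =>
    intro p c S hQ hp hr hb
    obtain ⟨k1, hk1, c1, r1, p1, s1⟩ := h₁ hQ.left hp hr hb.1
    have := hQ.right
    rw [length_compile] at this
    obtain ⟨k2, hk2, c2, r2, p2, s2⟩ := h₂ this p1 s1 hb.2
    exact ⟨k1 + k2, by simp only [Code.len]; omega, c2, r1.trans r2,
      by simp only [Code.len]; omega, s2⟩
  | ifz x b₁ b₂ h₁ h₂ =>
    intro p c S hQ hp hr hb
    obtain ⟨d1, r1, s1, p1, q1⟩ := (Reach.refl c hr.bdd).opd hr hp hQ.left.head (by simp) hb.1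
    have hq := hQ.left.tail.head
    have q7 : d1.reg 7 = x.val S := by simp [q1]
    have e : (Instr.jumpZero 7 (p + 3 + b₂.len)).exec d1 =
        ⟨if x.val S = 0 then p + 3 + b₂.len else p + 2, d1.reg, d1.mem⟩ := by
      simp [Instr.exec, p1, q7]
    have r2 := r1.snoc (p1 ▸ hq) (by rw [e]; exact (s1.pc _).bdd) s1.bdd
    rw [e] at r2
    have hQ2 : CodeAt Q (p + 2) _ := hQ.right.left
    have hQ3 := hQ.right.right
    rw [length_compile] at hQ3
    by_cases hx : x.val S = 0
    · have hb' := hb.2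
      rw [if_pos hx] at hb' r2
      have hQ4 := hQ3.right
      simp only [List.length_cons, List.length_nil] at hQ4
      rw [show p + (0 + 1 + 1) + b₂.len + (0 + 1) = p + 3 + b₂.len by omega] at hQ4
      obtain ⟨k2, hk2, c2, r3, p3, s3⟩ := h₁ hQ4 rfl (s1.pc _) hb'
      refine ⟨_, ?_, c2, r2.trans r3, ?_, ?_⟩
      · simp only [Code.len]; omega
      · simp only [Code.len]; omega
      · simpa [exec, hx] using s3
    · have hb' := hb.2
      rw [if_neg hx] at hb' r2
      obtain ⟨k2, hk2, c2, r3, p3, s3⟩ := h₂ hQ2 rfl (s1.pc _) hb'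
      have e2 : (Instr.jumpZero 10 (p + (3 + (b₁.len + b₂.len)))).exec c2 =
          ⟨p + (3 + (b₁.len + b₂.len)), c2.reg, c2.mem⟩ := by
        simp [Instr.exec, s3.zero]
      have r4 := (r2.trans r3).snoc (by rw [p3]; exact hQ3.left.head)
        (by rw [e2]; exact (s3.pc _).bdd) s3.bdd
      rw [e2] at r4
      refine ⟨_, ?_, _, r4, ?_, ?_⟩
      · simp only [Code.len]; omega
      · simp only [Code.len]
      · simpa [exec, hx] using s3.pc _
  | iflt x y b₁ b₂ h₁ h₂ =>
    intro p c S hQ hp hr hb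
    obtain ⟨d0, r0, s0, p0, q0⟩ := (Reach.refl c hr.bdd).opd hr hp hQ.left.head (by simp) hb.1
    obtain ⟨d1, r1, s1, p1, q1⟩ := r0.opd s0 p0 hQ.left.tail.head (by simp) hb.2.1
    rw [q0] at q1
    have hq := hQ.left.tail.tail.head
    have q7 : d1.reg 7 = x.val S := by simp [q1]
    have q8 : d1.reg 8 = y.val S := by simp [q1]
    have e : (Instr.jumpLess 7 8 (p + 4 + b₂.len)).exec d1 =
        ⟨if x.val S < y.val S then p + 4 + b₂.len else p + 3, d1.reg, d1.mem⟩ := by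
      simp [Instr.exec, p1, q7, q8]
    have r2 := r1.snoc (p1 ▸ hq) (by rw [e]; exact (s1.pc _).bdd) s1.bdd
    rw [e] at r2
    have hQ2 : CodeAt Q (p + 3) _ := hQ.right.left
    have hQ3 := hQ.right.right
    rw [length_compile] at hQ3
    by_cases hx : x.val S < y.val S
    · have hb' := hb.2.2
      rw [if_pos hx] at hb' r2
      have hQ4 := hQ3.right
      simp only [List.length_cons, List.length_nil] at hQ4
      rw [show p + (0 + 1 + 1 + 1) + b₂.len + (0 + 1) = p + 4 + b₂.len by omega] at hQ4
      obtain ⟨k2, hk2, c2, r3, p3, s3⟩ := h₁ hQ4 rfl (s1.pc _) hb'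
      refine ⟨_, ?_, c2, r2.trans r3, ?_, ?_⟩
      · simp only [Code.len]; omega
      · simp only [Code.len]; omega
      · simpa [exec, hx] using s3
    · have hb' := hb.2.2
      rw [if_neg hx] at hb' r2
      obtain ⟨k2, hk2, c2, r3, p3, s3⟩ := h₂ hQ2 rfl (s1.pc _) hb'
      have e2 : (Instr.jumpZero 10 (p + (4 + (b₁.len + b₂.len)))).exec c2 =
          ⟨p + (4 + (b₁.len + b₂.len)), c2.reg, c2.mem⟩ := by
        simp [Instr.exec, s3.zero]
      have r4 := (r2.trans r3).snoc (by rw [p3]; exact hQ3.left.head)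
        (by rw [e2]; exact (s3.pc _).bdd) s3.bdd
      rw [e2] at r4
      refine ⟨_, ?_, _, r4, ?_, ?_⟩
      · simp only [Code.len]; omega
      · simp only [Code.len]
      · simpa [exec, hx] using s3.pc _

end

/-! ### Growth of the words in a loop-free program -/

def Opd.Ok (V : ℕ) : Opd → Prop
  | .r _ => True
  | .c k => k ≤ V

/-- All constants are at most `V` and there are no operations other than `+`, `-`, `*`, `/`. -/
def Code.Ok (V : ℕ) : Code → Prop
  | .skip => True
  | .op f _ x y => (f = .add ∨ f = .sub ∨ f = .mul ∨ f = .div) ∧ x.Ok V ∧ y.Ok V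
  | .get _ k x y => k ≤ V ∧ x.Ok V ∧ y.Ok V
  | .put k x y z => k ≤ V ∧ x.Ok V ∧ y.Ok V ∧ z.Ok V
  | .getc _ x => x.Ok V
  | .putc x z => x.Ok V ∧ z.Ok V
  | .seq c₁ c₂ => c₁.Ok V ∧ c₂.Ok V
  | .ifz x c₁ c₂ => x.Ok V ∧ c₁.Ok V ∧ c₂.Ok V
  | .iflt x y c₁ c₂ => x.Ok V ∧ y.Ok V ∧ c₁.Ok V ∧ c₂.Ok V

/-- All words of the state are at most `V`. -/
def St.Le (V : ℕ) (S : St) : Prop :=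
  (∀ r, S.v r ≤ V) ∧ (∀ i, S.cov i ≤ V) ∧ ∀ k i j, S.a k i j ≤ V

/-- Bounds the number of operations on any path that may enlarge words. Both branches of a
conditional are added up; a maximum would be sharper, but any constant will do. -/
def Code.depth : Code → ℕ
  | .skip => 0
  | .seq c₁ c₂ => c₁.depth + c₂.depth
  | .ifz _ c₁ c₂ => c₁.depth + c₂.depth
  | .iflt _ _ c₁ c₂ => c₁.depth + c₂.depth
  | _ => 1

section

variable {U V W off : ℕ} {S : St}

theorem Opd.Ok.mono {x : Opd} (h : x.Ok U) (hUV : U ≤ V) : x.Ok V := by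
  cases x with
  | r => trivial
  | c k => exact le_trans h hUV

theorem Code.Ok.mono {c : Code} (h : c.Ok U) (hUV : U ≤ V) : c.Ok V := by
  induction c with
  | skip => trivial
  | op f d x y => exact ⟨h.1, h.2.1.mono hUV, h.2.2.mono hUV⟩
  | get d k x y => exact ⟨h.1.trans hUV, h.2.1.mono hUV, h.2.2.mono hUV⟩
  | put k x y z => exact ⟨h.1.trans hUV, h.2.1.mono hUV, h.2.2.1.mono hUV, h.2.2.2.mono hUV⟩
  | getc d x => exact Opd.Ok.mono h hUV
  | putc x z => exact ⟨h.1.mono hUV, h.2.mono hUV⟩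
  | seq c₁ c₂ h₁ h₂ => exact ⟨h₁ h.1, h₂ h.2⟩
  | ifz x c₁ c₂ h₁ h₂ => exact ⟨h.1.mono hUV, h₁ h.2.1, h₂ h.2.2⟩
  | iflt x y c₁ c₂ h₁ h₂ => exact ⟨h.1.mono hUV, h.2.1.mono hUV, h₁ h.2.2.1, h₂ h.2.2.2⟩

theorem St.Le.mono (h : S.Le U) (hUV : U ≤ V) : S.Le V :=
  ⟨fun r => (h.1 r).trans hUV, fun r => (h.2.1 r).trans hUV, fun k i j => (h.2.2 k i j).trans hUV⟩

theorem Bdd.mono {c : Code} : ∀ {S : St}, Bdd off U c S → U ≤ V → Bdd off V c S := by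
  induction c with
  | skip => exact fun h _ => h
  | op f d x y => exact fun h hUV => ⟨h.1.trans hUV, h.2.1.trans hUV, h.2.2.trans hUV⟩
  | get d k x y => exact fun h hUV => le_trans h hUV
  | put k x y z => exact fun h hUV => ⟨h.1.trans hUV, h.2.trans hUV⟩
  | getc d x => exact fun h hUV => le_trans h hUV
  | putc x z => exact fun h hUV => ⟨h.1.trans hUV, h.2.trans hUV⟩
  | seq c₁ c₂ h₁ h₂ => exact fun h hUV => ⟨h₁ h.1 hUV, h₂ h.2 hUV⟩
  | ifz x c₁ c₂ h₁ h₂ =>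
    intro S h hUV
    refine ⟨h.1.trans hUV, ?_⟩
    have := h.2
    split_ifs at this ⊢
    exacts [h₁ this hUV, h₂ this hUV]
  | iflt x y c₁ c₂ h₁ h₂ =>
    intro S h hUV
    refine ⟨h.1.trans hUV, h.2.1.trans hUV, ?_⟩
    have := h.2.2
    split_ifs at this ⊢
    exacts [h₁ this hUV, h₂ this hUV]

theorem St.Le.val (h : S.Le U) {x : Opd} (hx : x.Ok U) : x.val S ≤ U := by
  cases x with
  | r i => exact h.1 i
  | c k => exact hx

theorem St.Le.setv (h : S.Le U) {r x : ℕ} (hx : x ≤ U) : (S.setv r x).Le U := by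
  refine ⟨fun y => ?_, h.2.1, h.2.2⟩
  simp only [St.setv_v]
  split_ifs
  exacts [hx, h.1 y]

theorem St.Le.setc (h : S.Le U) {r x : ℕ} (hx : x ≤ U) : (S.setc r x).Le U := by
  refine ⟨h.1, fun y => ?_, h.2.2⟩
  simp only [St.setc_cov, Function.update_apply]
  split_ifs
  exacts [hx, h.2.1 y]

theorem St.Le.seta (h : S.Le U) {k i j x : ℕ} (hx : x ≤ U) : (S.seta k i j x).Le U := by
  refine ⟨h.1, h.2.1, fun k' i' j' => ?_⟩
  simp only [St.seta_a]
  split_ifs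
  · simp only [Function.update_apply]
    split_ifs
    · simp only [Function.update_apply]
      split_ifs
      exacts [hx, h.2.2 ..]
    · exact h.2.2 ..
  · exact h.2.2 ..

/-- An address is a polynomial of degree four in the indices. Its coefficients are absorbed by
twelve further factors, each at least 2; this is where the exponent 16 comes from. -/
theorem addr_le (hU : 2 ≤ U) (hoff : off ≤ U) {k x y : ℕ} (hk : k ≤ U) (hx : x ≤ U)
    (hy : y ≤ U) : addr off k x y ≤ U ^ 16 := by
  have h1 : pr x y ≤ 5 * U ^ 2 := by
    unfold pr
    nlinarith [Nat.mul_le_mul (Nat.add_le_add hx hy) (Nat.add_le_add hx hy)]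
  have h2 : pr k (pr x y) ≤ 37 * U ^ 4 := by
    have h3 : k + pr x y ≤ 6 * U ^ 2 := by nlinarith
    have h4 : k ≤ U ^ 4 := hk.trans (Nat.le_self_pow (by norm_num) U)
    have := Nat.mul_le_mul h3 h3
    unfold pr at this ⊢
    nlinarith
  have h3 : off ≤ U ^ 4 := hoff.trans (Nat.le_self_pow (by norm_num) U)
  have h4 : 2 ^ 12 ≤ U ^ 12 := Nat.pow_le_pow_left hU 12
  calc addr off k x y ≤ 2 ^ 12 * U ^ 4 := by unfold addr; omega
    _ ≤ U ^ 12 * U ^ 4 := Nat.mul_le_mul_right _ h4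
    _ = U ^ 16 := by rw [← pow_add]

/-- Every elementary operation raises the bound on the words at most to its 16th power, so a program
of constant depth keeps words polynomial. This needs the restriction to four operations in
`Code.Ok`: a left shift could make a word exponentially large. -/
theorem grow (c : Code) : ∀ {U : ℕ} {S : St}, 2 ≤ U → off ≤ U → c.Ok U → S.Le U →
    Bdd off (U ^ 16 ^ c.depth) c S ∧ (exec off c S).Le (U ^ 16 ^ c.depth) := by
  have le16 : ∀ {U x : ℕ}, x ≤ U → x ≤ U ^ 16 ^ 1 := fun h =>
    h.trans (Nat.le_self_pow (by norm_num) _)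
  have lem : ∀ {U : ℕ} (a b : ℕ), 2 ≤ U → U ^ 16 ^ a ≤ U ^ 16 ^ (a + b) := fun a b h =>
    Nat.pow_le_pow_right (by omega) (Nat.pow_le_pow_right (by norm_num) (by omega))
  have lem' : ∀ {U : ℕ} (a b : ℕ), 2 ≤ U → U ^ 16 ^ b ≤ U ^ 16 ^ (a + b) := fun a b h =>
    Nat.pow_le_pow_right (by omega) (Nat.pow_le_pow_right (by norm_num) (by omega))
  induction c with
  | skip => intro U S h1 h2 h3 h4; exact ⟨trivial, by simpa [Code.depth, exec] using h4⟩
  | op f d x y =>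
    intro U S h1 h2 h3 h4
    have hx := h4.val h3.2.1
    have hy := h4.val h3.2.2
    have hf : f.eval (x.val S) (y.val S) ≤ U ^ 16 ^ 1 := by
      have h2U : U * U ≤ U ^ 16 ^ 1 := by
        rw [← pow_two]; exact Nat.pow_le_pow_right (by omega) (by norm_num)
      rcases h3.1 with rfl | rfl | rfl | rfl
      · have : 2 * U ≤ U * U := Nat.mul_le_mul_right _ h1
        simp only [WordOp.eval]; omega
      · exact le16 ((Nat.sub_le _ _).trans hx)
      · exact (Nat.mul_le_mul hx hy).trans h2U
      · exact le16 ((Nat.div_le_self _ _).trans hx)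
    exact ⟨⟨le16 hx, le16 hy, hf⟩, (h4.mono (le16 le_rfl)).setv hf⟩
  | get d k x y =>
    intro U S h1 h2 h3 h4
    refine ⟨addr_le h1 h2 h3.1 (h4.val h3.2.1) (h4.val h3.2.2), ?_⟩
    exact (h4.mono (le16 le_rfl)).setv (le16 (h4.2.2 ..))
  | put k x y z =>
    intro U S h1 h2 h3 h4
    refine ⟨⟨by simpa [Code.depth] using addr_le h1 h2 h3.1 (h4.val h3.2.1) (h4.val h3.2.2.1),
      le16 (h4.val h3.2.2.2)⟩, ?_⟩
    exact (h4.mono (le16 le_rfl)).seta (le16 (h4.val h3.2.2.2))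
  | getc d x =>
    intro U S h1 h2 h3 h4
    exact ⟨le16 (h4.val h3), (h4.mono (le16 le_rfl)).setv (le16 (h4.2.1 _))⟩
  | putc x z =>
    intro U S h1 h2 h3 h4
    exact ⟨⟨le16 (h4.val h3.1), le16 (h4.val h3.2)⟩,
      (h4.mono (le16 le_rfl)).setc (le16 (h4.val h3.2))⟩
  | seq c₁ c₂ h₁ h₂ =>
    intro U S h1 h2 h3 h4
    obtain ⟨a1, a2⟩ := h₁ h1 h2 h3.1 h4
    have hU : U ≤ U ^ 16 ^ c₁.depth := Nat.le_self_pow (by positivity) _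
    obtain ⟨b1, b2⟩ := h₂ (h1.trans hU) (h2.trans hU) (h3.2.mono hU) a2
    rw [← pow_mul, ← pow_add] at b1 b2
    exact ⟨⟨a1.mono (lem _ _ h1), b1⟩, b2⟩
  | ifz x c₁ c₂ h₁ h₂ =>
    intro U S h1 h2 h3 h4
    have hU : U ≤ U ^ 16 ^ (c₁.depth + c₂.depth) := Nat.le_self_pow (by positivity) _
    obtain ⟨a1, a2⟩ := h₁ h1 h2 h3.2.1 h4
    obtain ⟨b1, b2⟩ := h₂ h1 h2 h3.2.2 h4
    simp only [Bdd, exec, Code.depth]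
    refine ⟨⟨(h4.val h3.1).trans hU, ?_⟩, ?_⟩
    · split_ifs
      exacts [a1.mono (lem _ _ h1), b1.mono (lem' _ _ h1)]
    · split_ifs
      exacts [a2.mono (lem _ _ h1), b2.mono (lem' _ _ h1)]
  | iflt x y c₁ c₂ h₁ h₂ =>
    intro U S h1 h2 h3 h4
    have hU : U ≤ U ^ 16 ^ (c₁.depth + c₂.depth) := Nat.le_self_pow (by positivity) _
    obtain ⟨a1, a2⟩ := h₁ h1 h2 h3.2.2.1 h4
    obtain ⟨b1, b2⟩ := h₂ h1 h2 h3.2.2.2 h4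
    simp only [Bdd, exec, Code.depth]
    refine ⟨⟨(h4.val h3.1).trans hU, (h4.val h3.2.1).trans hU, ?_⟩, ?_⟩
    · split_ifs
      exacts [a1.mono (lem _ _ h1), b1.mono (lem' _ _ h1)]
    · split_ifs
      exacts [a2.mono (lem _ _ h1), b2.mono (lem' _ _ h1)]

end

/-! ### The main loop -/

/-- The blocks one after the other, each followed by a jump to the loop. -/
def blocksCode (loop : ℕ) : List Code → ℕ → List Instr
  | [], _ => []
  | b :: bs, p => compile b p ++ .jumpZero 10 loop :: blocksCode loop bs (p + (b.len + 1))

/-- The jump table. -/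
def blocksTable : List Code → ℕ → List Instr
  | [], _ => []
  | b :: bs, p => .jumpZero 10 p :: blocksTable bs (p + (b.len + 1))

theorem length_blocksTable (bs : List Code) : ∀ p, (blocksTable bs p).length = bs.length := by
  induction bs with
  | nil => simp [blocksTable]
  | cons b bs ih => intro p; simp [blocksTable, ih]

def blocksLen : List Code → ℕ
  | [] => 0
  | b :: bs => b.len + 1 + blocksLen bs

theorem length_blocksCode (loop : ℕ) (bs : List Code) :
    ∀ p, (blocksCode loop bs p).length = blocksLen bs := by
  induction bs with
  | nil => simp [blocksCode, blocksLen]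
  | cons b bs ih => intro p; simp [blocksCode, blocksLen, ih, length_compile]; omega

theorem codeAt_block {Q : Program} {loop : ℕ} {b : Code} {bs : List Code} :
    ∀ {i p : ℕ}, CodeAt Q p (blocksCode loop bs p) → bs[i]? = some b →
    ∃ q, (blocksTable bs p)[i]? = some (.jumpZero 10 q) ∧
      CodeAt Q q (compile b q ++ [.jumpZero 10 loop]) := by
  induction bs with
  | nil => intro i p _ h; simp at h
  | cons b' bs ih =>
    intro i p hQ h
    cases i with
    | zero =>
      simp only [List.getElem?_cons_zero, Option.some.injEq] at h
      subst h
      refine ⟨p, by simp [blocksTable], ?_⟩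
      rw [blocksCode, List.append_cons] at hQ
      exact hQ.left
    | succ i =>
      have := hQ.right.tail
      rw [length_compile, add_assoc] at this
      obtain ⟨q, h1, h2⟩ := ih this (by simpa using h)
      exact ⟨q, by simpa [blocksTable] using h1, h2⟩

/-- The program that computes the size `2 * n + 1` of the contiguous array, executes `fg` and then,
as long as the variable `7` is positive, decreases it and executes the block whose number is in the
variable `9`. -/
def assemble (fg : Code) (bs : List Code) : Program :=
  [.op .add 6 3 3, .const 7 1, .op .add 6 6 7] ++ (compile fg 3 ++
    ([.jumpZero (vreg 7) (3 + fg.len + 6 + bs.length + blocksLen bs), .const 7 1,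
      .op .sub (vreg 7) (vreg 7) 7, .const 7 (3 + fg.len + 6), .op .add 7 7 (vreg 9), .jumpReg 7] ++
    (blocksTable bs (3 + fg.len + 6 + bs.length) ++
      blocksCode (3 + fg.len) bs (3 + fg.len + 6 + bs.length))))

theorem length_assemble (fg : Code) (bs : List Code) :
    (assemble fg bs).length = 3 + fg.len + 6 + bs.length + blocksLen bs := by
  simp [assemble, length_compile, length_blocksCode, length_blocksTable]; omega

section

variable {fg : Code} {bs : List Code} {off W N : ℕ} {I : St → Prop}

/-- One microstep preserves `I`, does not need long words and is short. -/
def GoodStep (bs : List Code) (off W N : ℕ) (I : St → Prop) : Prop :=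
  ∀ S, I S → S.v 7 ≠ 0 → ∃ b, bs[S.v 9]? = some b ∧ b.len ≤ N ∧
    Bdd off W b (S.setv 7 (S.v 7 - 1)) ∧ I (exec off b (S.setv 7 (S.v 7 - 1))) ∧
    (exec off b (S.setv 7 (S.v 7 - 1))).v 7 ≤ S.v 7 - 1

/-- Induction on the budget in variable `7`. Around each block there are eight instructions: the
test, two for the decrement, three for the computed jump, the jump in the table and the jump back.
The program length must be a short word because an address in the table is computed in a register.
-/
theorem run_loop (hoff : 0 < off) (hW : (assemble fg bs).length ≤ W)
    (hI : GoodStep bs off W N I) :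
    ∀ (K : ℕ) {c : Config} {S : St}, c.pc = 3 + fg.len → Rel off W c S → I S → S.v 7 ≤ K →
    ∃ k ≤ K * (N + 8) + 1, ∃ c' S', Reach (assemble fg bs) W c k c' ∧
      c'.pc = (assemble fg bs).length ∧ Rel off W c' S' ∧ I S' ∧ S'.v 7 = 0 := by
  have hlen := length_assemble fg bs
  have hA : CodeAt (assemble fg bs) 0 (assemble fg bs) := fun i I h => by simpa using h
  have hB := hA.right.right
  rw [length_compile] at hB
  have hC := hB.left
  have hD := hB.right.left
  have hE := hB.right.right
  rw [length_blocksTable] at hE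
  simp only [List.length_cons, List.length_nil, zero_add, Nat.reduceAdd] at hC hD hE
  intro K
  induction K with
  | zero =>
    intro c S hp hr hS hK
    have h0 : S.v 7 = 0 := by omega
    have e : (Instr.jumpZero (vreg 7) (3 + fg.len + 6 + bs.length + blocksLen bs)).exec c =
        ⟨(assemble fg bs).length, c.reg, c.mem⟩ := by
      simp [Instr.exec, hr.var, h0, hlen]
    have := (Reach.refl (Q := assemble fg bs) c hr.bdd).snoc (by rw [hp]; exact hC.head)
      (by rw [e]; exact (hr.pc _).bdd) hr.bdd
    rw [e] at this
    exact ⟨1, by omega, _, S, this, rfl, hr.pc _, hS, h0⟩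
  | succ K ih =>
    intro c S hp hr hS hK
    by_cases h0 : S.v 7 = 0
    · have e : (Instr.jumpZero (vreg 7) (3 + fg.len + 6 + bs.length + blocksLen bs)).exec c =
          ⟨(assemble fg bs).length, c.reg, c.mem⟩ := by
        simp [Instr.exec, hr.var, h0, hlen]
      have := (Reach.refl (Q := assemble fg bs) c hr.bdd).snoc (by rw [hp]; exact hC.head)
        (by rw [e]; exact (hr.pc _).bdd) hr.bdd
      rw [e] at this
      exact ⟨1, by omega, _, S, this, rfl, hr.pc _, hS, h0⟩
    obtain ⟨b, hb, hbN, hbb, hIb, hb7⟩ := hI S hS h0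
    have hbl : S.v 9 < bs.length := (List.getElem?_eq_some_iff.mp hb).1
    have e : (Instr.jumpZero (vreg 7) (3 + fg.len + 6 + bs.length + blocksLen bs)).exec c =
        ⟨3 + fg.len + 1, c.reg, c.mem⟩ := by
      simp [Instr.exec, hr.var, h0, hp]
    have r0 := (Reach.refl (Q := assemble fg bs) c hr.bdd).snoc (by rw [hp]; exact hC.head)
      (by rw [e]; exact (hr.pc _).bdd) hr.bdd
    rw [e] at r0
    have s0 := hr.pc (3 + fg.len + 1)
    obtain ⟨d1, r1, s1, p1, q1⟩ := r0.opd (x := .c 1) s0 rfl hC.tail.head (by simp)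
      (by simp only [Opd.val]; omega)
    have v7 : d1.reg (vreg 7) = S.v 7 := s1.var 7
    have s2 := s1.setv (d := 7) (x := S.v 7 - 1) (p := 3 + fg.len + 3)
      (by have := (s1.bdd (vreg 7)).1; omega)
    have e2 : (Instr.op .sub (vreg 7) (vreg 7) 7).exec d1 =
        ⟨3 + fg.len + 3, Function.update d1.reg (vreg 7) (S.v 7 - 1), d1.mem⟩ := by
      simp [Instr.exec, v7, q1, p1, WordOp.eval, Opd.val]
    have r2 := r1.snoc (p1 ▸ hC.tail.tail.head) (by rw [e2]; exact s2.bdd) s1.bdd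
    rw [e2] at r2
    obtain ⟨d3, r3, s3, p3, q3⟩ := r2.opd (x := .c (3 + fg.len + 6)) s2 rfl
      hC.tail.tail.tail.head (by simp) (by simp only [Opd.val]; omega)
    have v9 : d3.reg (vreg 9) = S.v 9 := by rw [s3.var 9]; simp
    obtain ⟨d4, r4, s4, p4, q4⟩ := r3.scratch (x := 3 + fg.len + 6 + S.v 9) s3 p3
      hC.tail.tail.tail.tail.head (by simp) (by rw [v9, q3]; simp [WordOp.eval, Opd.val])
      (by omega)
    have e5 : (Instr.jumpReg 7).exec d4 = ⟨3 + fg.len + 6 + S.v 9, d4.reg, d4.mem⟩ := by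
      simp [Instr.exec, q4]
    have r5 := r4.snoc (p4 ▸ hC.tail.tail.tail.tail.tail.head)
      (by rw [e5]; exact (s4.pc _).bdd) s4.bdd
    rw [e5] at r5
    have s5 := s4.pc (3 + fg.len + 6 + S.v 9)
    obtain ⟨q, hq1, hq2⟩ := codeAt_block hE hb
    have hq3 := hD _ _ hq1
    have e6 : (Instr.jumpZero 10 q).exec ⟨3 + fg.len + 6 + S.v 9, d4.reg, d4.mem⟩ =
        ⟨q, d4.reg, d4.mem⟩ := by
      simp [Instr.exec, s4.zero]
    have r6 := r5.snoc hq3 (by rw [e6]; exact (s4.pc _).bdd) s5.bdd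
    rw [e6] at r6
    obtain ⟨k7, hk7, d7, r7, p7, s7⟩ := run_compile hoff b hq2.left rfl (s4.pc q) hbb
    have hq4 := hq2.right.head
    rw [length_compile, ← p7] at hq4
    have e8 : (Instr.jumpZero 10 (3 + fg.len)).exec d7 = ⟨3 + fg.len, d7.reg, d7.mem⟩ := by
      simp [Instr.exec, s7.zero]
    have r8 := (r6.trans r7).snoc hq4 (by rw [e8]; exact (s7.pc _).bdd) s7.bdd
    rw [e8] at r8
    obtain ⟨k9, hk9, c9, S9, r9, p9, s9, i9, z9⟩ := ih rfl (s7.pc (3 + fg.len)) hIb (by omega)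
    refine ⟨_, ?_, c9, S9, r8.trans r9, p9, s9, i9, z9⟩
    rw [Nat.succ_mul]
    omega

/-- Register `6` is zero at the very first call, so each call recomputes it. Therefore the
hypothesis relates the state to the configuration in which register `6` has already been set. -/
theorem run_assemble {n : ℕ} (hW : (assemble fg bs).length ≤ W)
    (hnW : 2 * n + 1 ≤ W)
    (hI : GoodStep bs (2 * n + 1) W N I)
    {c : Config} {S : St} {K : ℕ} (hp : c.pc = 0) (hc : c.BoundedBy W)
    (hr : Rel (2 * n + 1) W ⟨0, Function.update c.reg 6 (2 * n + 1), c.mem⟩ S) (hn : S.v 3 = n)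
    (hfg : Bdd (2 * n + 1) W fg S) (hIS : I (exec (2 * n + 1) fg S))
    (hK : (exec (2 * n + 1) fg S).v 7 ≤ K) :
    ∃ k ≤ fg.len + 4 + K * (N + 8), ∃ c' S', Reach (assemble fg bs) W c k c' ∧
      c'.pc = (assemble fg bs).length ∧ Rel (2 * n + 1) W c' S' ∧ I S' ∧ S'.v 7 = 0 := by
  have hlen := length_assemble fg bs
  have hA : CodeAt (assemble fg bs) 0 (assemble fg bs) := fun i I h => by simpa using h
  have h3 : c.reg 3 = n := by
    rw [← hn, ← hr.var 3]; simp [vreg]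
  have e1 : (Instr.op .add 6 3 3).exec c = ⟨1, Function.update c.reg 6 (2 * n), c.mem⟩ := by
    simp [Instr.exec, h3, hp, WordOp.eval, two_mul]
  have b1 : (⟨1, Function.update c.reg 6 (2 * n), c.mem⟩ : Config).BoundedBy W :=
    boundedBy_reg hc (by omega)
  have r1 := (Reach.refl (Q := assemble fg bs) c hc).snoc (hp ▸ hA.head) (e1 ▸ b1) hc
  rw [e1] at r1
  have e2 : (Instr.const 7 1).exec ⟨1, Function.update c.reg 6 (2 * n), c.mem⟩ =
      ⟨2, Function.update (Function.update c.reg 6 (2 * n)) 7 1, c.mem⟩ := by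
    simp [Instr.exec]
  have b2 : (⟨2, Function.update (Function.update c.reg 6 (2 * n)) 7 1, c.mem⟩ : Config).BoundedBy W :=
    boundedBy_reg b1 (by omega)
  have r2 := r1.snoc hA.tail.head (e2 ▸ b2) b1
  rw [e2] at r2
  have s3 := hr.scratch (T := 7) (x := 1) (p := 3) (by simp) (by omega)
  have e3 : (Instr.op .add 6 6 7).exec
      ⟨2, Function.update (Function.update c.reg 6 (2 * n)) 7 1, c.mem⟩ =
      ⟨3, Function.update (Function.update c.reg 6 (2 * n + 1)) 7 1, c.mem⟩ := by
    simp only [Instr.exec, WordOp.eval, Config.mk.injEq, true_and, and_true]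
    funext i
    simp only [Function.update_apply]
    split_ifs <;> first | rfl | omega
  have r3 := r2.snoc hA.tail.tail.head (e3 ▸ s3.bdd) b2
  rw [e3] at r3
  obtain ⟨k4, hk4, d4, r4, p4, s4⟩ := run_compile (Nat.succ_pos _) fg hA.right.left rfl s3 hfg
  obtain ⟨k5, hk5, c5, S5, r5, p5, s5, i5, z5⟩ :=
    run_loop (Nat.succ_pos _) hW hI K (by rw [p4]; rfl) s4 hIS hK
  exact ⟨_, by omega, c5, S5, (r3.trans r4).trans r5, p5, s5, i5, z5⟩

end

open Opd Code Set

infixr:60 " ;; " => Code.seq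

/-! ### The program

The arrays are: `0` degrees, `1` adjacency lists, `2` positions in the adjacency lists, `3` lists of the
elements of the two covers, `4` queue of pending updates, `5` numbers of the vertices of the static
instance, `6` and `7` sizes and contents of its adjacency lists, `8` its vertices, `9` the list of the
cells of `10` that were written, `10` the registers and the memory of the static program.

The variables are: `0`, `1`, `2` the update, `3` number of vertices, `4` arboricity, `5` time bound,
`6` degree threshold, `7` remaining microsteps, `8` index of the current cover, `9` state, `10` and
`11` sizes of the current and of the new cover, `12` and `13` head and tail of the queue, `14` and `15`
loop counters, `16` number of low vertices in the cover, `17` number of vertices of the static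
instance, `18` number of written cells, `19` output position, `20` size of the cover at the beginning
of the phase, `21`, …, `29` temporary values. -/

def mov (d : ℕ) (x : Opd) : Code := .op .add d x (c 0)

def inc (d : ℕ) : Code := .op .add d (r d) (c 1)

def dec (d : ℕ) : Code := .op .sub d (r d) (c 1)

/-- Resets the temporary variables. -/
def clr : Code := mov 21 (c 0) ;; mov 22 (c 0) ;; mov 23 (c 0) ;; mov 24 (c 0) ;; mov 25 (c 0) ;;
  mov 26 (c 0) ;; mov 27 (c 0) ;; mov 28 (c 0) ;; mov 29 (c 0)

/-- Appends `y` to the adjacency list of `x`. -/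
def halfIns (x y : ℕ) : Code :=
  get 21 0 (r x) (c 0) ;; put 1 (r x) (r 21) (r y) ;; put 2 (r x) (r y) (r 21) ;; inc 21 ;;
  put 0 (r x) (c 0) (r 21)

/-- Removes `y` from the adjacency list of `x`. -/
def halfDel (x y : ℕ) : Code :=
  get 21 2 (r x) (r y) ;; get 22 0 (r x) (c 0) ;; dec 22 ;; get 23 1 (r x) (r 22) ;;
  put 1 (r x) (r 21) (r 23) ;; put 2 (r x) (r 23) (r 21) ;; put 0 (r x) (c 0) (r 22)

/-- Takes an update from the queue and applies it to the adjacency lists. -/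
def popApply : Code :=
  get 24 4 (r 12) (c 0) ;; get 25 4 (r 12) (c 1) ;; get 26 4 (r 12) (c 2) ;; inc 12 ;;
  ifz (r 24) (halfDel 25 26 ;; halfDel 26 25) (halfIns 25 26 ;; halfIns 26 25)

/-- Adds a vertex to the new cover. -/
def addY (x : ℕ) : Code :=
  op .sub 27 (c 1) (r 8) ;; op .mul 28 (r 27) (r 3) ;; inc 28 ;; op .add 28 (r 28) (r x) ;;
  getc 29 (r 28) ;;
  ifz (r 29) (putc (r 28) (c 1) ;; put 3 (r 27) (r 11) (r x) ;; inc 11) skip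

/-- Writes a cell of the array `10`. -/
def wr (κ : ℕ) (x z : Opd) : Code :=
  put 9 (r 18) (c 0) (c κ) ;; put 9 (r 18) (c 1) x ;; inc 18 ;; put 10 (c κ) x z

/-- Appends `y` to the list of `x` in the static instance. -/
def push (x y : ℕ) : Code :=
  get 26 6 (r x) (c 0) ;; put 7 (r x) (r 26) (r y) ;; inc 26 ;; put 6 (r x) (c 0) (r 26)

/-- The blocks `0`, …, `7` belong to the phase itself, so instruction `l` of `P` is block `8 + l`. A
target outside `P` means that `P` halts, and then block `5` reads its output. -/
def goto (P : Program) (l : ℕ) : Code := mov 9 (c (if l < P.length then 8 + l else 5))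

/-- The snapshot is the graph after the first update of the phase. Later updates stay on the queue,
so the adjacency lists are frozen until the queue is replayed. Variable `20` records the size of the
current cover because insertions go on appending to its list. -/
def blkStart : Code := popApply ;; mov 20 (r 10) ;; mov 9 (c 1)

/-- Erases, one vertex per microstep, the cover that was retired by the last swap; its array is
reused for the new cover. -/
def blkClear : Code :=
  ifz (r 11) (mov 9 (c 2) ;; mov 14 (c 0))
    (dec 11 ;; op .sub 27 (c 1) (r 8) ;; get 21 3 (r 27) (r 11) ;; op .mul 28 (r 27) (r 3) ;;
      inc 28 ;; op .add 28 (r 28) (r 21) ;; putc (r 28) (c 0))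

/-- High vertices of the current cover enter the new one, low vertices become the first vertices of
the static instance. Array `5` holds numbers increased by one, so that zero marks a vertex without a
number. -/
def blkCollect : Code :=
  iflt (r 14) (r 20)
    (get 21 3 (r 8) (r 14) ;; inc 14 ;; get 22 0 (r 21) (c 0) ;;
      iflt (r 6) (r 22) (addY 21)
        (put 8 (r 17) (c 0) (r 21) ;; inc 17 ;; put 5 (r 21) (c 0) (r 17)))
    (mov 16 (r 17) ;; mov 14 (c 0) ;; mov 15 (c 0) ;; mov 9 (c 3))

/-- One neighbour per microstep. The number of the scanning vertex is pushed on the list of the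
neighbour. If the neighbour is itself one of the low cover vertices, the edge is also scanned from
its other end, which supplies the other entry; otherwise both entries are pushed now. So each list
receives each neighbour exactly once. -/
def blkScan : Code :=
  iflt (r 14) (r 16)
    (get 21 8 (r 14) (c 0) ;; get 22 0 (r 21) (c 0) ;;
      iflt (r 15) (r 22)
        (get 23 1 (r 21) (r 15) ;; inc 15 ;; get 24 0 (r 23) (c 0) ;;
          iflt (r 6) (r 24) (addY 23)
            (get 25 5 (r 23) (c 0) ;;
              ifz (r 25)
                (put 8 (r 17) (c 0) (r 23) ;; inc 17 ;; put 5 (r 23) (c 0) (r 17) ;;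
                  mov 25 (r 17)) skip ;;
              dec 25 ;; push 25 14 ;; iflt (r 25) (r 16) skip (push 14 25)))
        (mov 15 (c 0) ;; inc 14))
    (mov 14 (c 0) ;; mov 15 (c 0) ;;
      ifz (r 17) (mov 9 (c 6))
        (wr 1 (c 0) (r 17) ;; op .add 19 (r 17) (c 2) ;; wr 1 (c 1) (r 19) ;; mov 9 (c 4)))

/-- Row `0` of array `10` plays the registers of the static program and row `1` its memory. The
vertex count and the start of the first list have been written before; each finished list determines
the start of the next. -/
def blkEmit (P : Program) : Code :=
  iflt (r 14) (r 17)
    (get 21 6 (r 14) (c 0) ;;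
      iflt (r 15) (r 21)
        (get 22 7 (r 14) (r 15) ;; wr 1 (r 19) (r 22) ;; inc 19 ;; inc 15)
        (inc 14 ;; op .add 21 (r 14) (c 1) ;; wr 1 (r 21) (r 19) ;; mov 15 (c 0)))
    (wr 0 (c 0) (r 4) ;; mov 14 (c 0) ;; goto P 0)

def blkOut : Code :=
  iflt (r 14) (r 17)
    (get 21 10 (c 1) (r 14) ;; get 22 8 (r 14) (c 0) ;; inc 14 ;; ifz (r 21) skip (addY 22))
    (mov 9 (c 6))

/-- Only cells that were written are reset, so the next phase finds zeros everywhere and the cost is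
proportional to the work of this phase. -/
def blkClean : Code :=
  ifz (r 18)
    (ifz (r 17) (mov 9 (c 7))
      (dec 17 ;; get 21 8 (r 17) (c 0) ;; put 5 (r 21) (c 0) (c 0) ;; put 6 (r 17) (c 0) (c 0)))
    (dec 18 ;; get 21 9 (r 18) (c 0) ;; get 22 9 (r 18) (c 1) ;; put 10 (r 21) (r 22) (c 0))

/-- An inserted edge contributes its first end to the new cover. When the queue is empty, one write
to cell `0` redirects the pointer to the new cover, and the unused microsteps of the call are
forfeited. -/
def blkApply : Code :=
  iflt (r 12) (r 13) (popApply ;; ifz (r 24) skip (addY 25))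
    (op .sub 8 (c 1) (r 8) ;; op .mul 28 (r 8) (r 3) ;; inc 28 ;; putc (c 0) (r 28) ;;
      mov 21 (r 10) ;; mov 10 (r 11) ;; mov 11 (r 21) ;; mov 12 (c 0) ;; mov 13 (c 0) ;;
      mov 9 (c 0) ;; mov 7 (c 0))

/-- The simulation of the instruction `I` of `P` at position `p`. -/
def simBlock (P : Program) (p : ℕ) : Instr → Code
  | .const d k => wr 0 (c d) (c k) ;; goto P (p + 1)
  | .op f d a b => (get 21 10 (c 0) (c a) ;; get 22 10 (c 0) (c b)) ;; op f 23 (r 21) (r 22) ;;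
      (wr 0 (c d) (r 23) ;; goto P (p + 1))
  | .load d a => get 21 10 (c 0) (c a) ;; get 22 10 (c 1) (r 21) ;; wr 0 (c d) (r 22) ;;
      goto P (p + 1)
  | .store a b => get 21 10 (c 0) (c a) ;; get 22 10 (c 0) (c b) ;; wr 1 (r 21) (r 22) ;;
      goto P (p + 1)
  | .jumpZero a l => get 21 10 (c 0) (c a) ;; ifz (r 21) (goto P l) (goto P (p + 1))
  | .jumpLess a b l => get 21 10 (c 0) (c a) ;; get 22 10 (c 0) (c b) ;;
      iflt (r 21) (r 22) (goto P l) (goto P (p + 1))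
  | .jumpReg a => get 21 10 (c 0) (c a) ;;
      iflt (r 21) (c P.length) (op .add 9 (r 21) (c 8)) (mov 9 (c 5))

/-- Temporary variables are reset before every block, so that the growth of words within one block
is not inherited by the next. -/
def blocks (P : Program) : List Code :=
  ([blkStart, blkClear, blkCollect, blkScan, blkEmit P, blkOut, blkClean, blkApply] ++
    P.mapIdx (simBlock P)).map (clr ;; ·)

/-- The beginning of a call: the update is put on the queue, and an endpoint of a new edge goes into the
current cover. -/
def foreground (L Kc : ℕ) : Code :=
  clr ;; op .mul 6 (r 4) (c (L + 1)) ;; op .mul 28 (r 8) (r 3) ;; inc 28 ;; putc (c 0) (r 28) ;;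
  ifz (r 0) skip
    (op .add 28 (r 28) (r 1) ;; getc 29 (r 28) ;;
      ifz (r 29) (putc (r 28) (c 1) ;; put 3 (r 8) (r 10) (r 1) ;; inc 10) skip) ;;
  put 4 (r 13) (c 0) (r 0) ;; put 4 (r 13) (c 1) (r 1) ;; put 4 (r 13) (c 2) (r 2) ;; inc 13 ;;
  op .div 28 (r 5) (r 3) ;; inc 28 ;; op .mul 28 (r 28) (r 4) ;; op .mul 7 (r 28) (c Kc)

/-! ### Enumerations -/

theorem bijOn_push {g : ℕ → ℕ} {k y : ℕ} {s : Set ℕ} (h : BijOn g (Iio k) s) (hy : y ∉ s) :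
    BijOn (Function.update g k y) (Iio (k + 1)) (insert y s) := by
  refine ⟨fun x hx => ?_, fun x hx x' hx' he => ?_, fun z hz => ?_⟩
  · by_cases hk : x = k
    · subst hk; simp
    · rw [Function.update_of_ne hk]
      exact Or.inr (h.1 (by simp only [mem_Iio] at hx ⊢; omega))
  · simp only [mem_Iio] at hx hx'
    by_cases hk : x = k <;> by_cases hk' : x' = k
    · omega
    · subst hk
      rw [Function.update_self, Function.update_of_ne hk'] at he
      exact absurd (he ▸ h.1 (by simp only [mem_Iio]; omega)) hy
    · subst hk'
      rw [Function.update_self, Function.update_of_ne hk] at he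
      exact absurd (he ▸ h.1 (by simp only [mem_Iio]; omega)) hy
    · rw [Function.update_of_ne hk, Function.update_of_ne hk'] at he
      exact h.2.1 (by simp only [mem_Iio]; omega) (by simp only [mem_Iio]; omega) he
  · rcases hz with rfl | hz
    · exact ⟨k, by simp, by simp⟩
    · obtain ⟨x, hx, rfl⟩ := h.2.2 hz
      have := (mem_Iio.1 hx).ne
      exact ⟨x, by simp only [mem_Iio] at hx ⊢; omega, by simp [this]⟩

theorem bijOn_pop {g : ℕ → ℕ} {k : ℕ} {s : Set ℕ} (h : BijOn g (Iio (k + 1)) s) :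
    BijOn g (Iio k) (s \ {g k}) := by
  refine ⟨fun x hx => ⟨h.1 ?_, fun he => ?_⟩, fun x hx x' hx' he => h.2.1 ?_ ?_ he, ?_⟩
  · simp only [mem_Iio] at hx ⊢; omega
  · have := h.2.1 (by simp only [mem_Iio] at hx ⊢; omega) (by simp) he
    simp only [mem_Iio] at hx; omega
  · simp only [mem_Iio] at hx ⊢; omega
  · simp only [mem_Iio] at hx' ⊢; omega
  · rintro z ⟨hz, hz'⟩
    obtain ⟨x, hx, rfl⟩ := h.2.2 hz
    have : x ≠ k := fun e => hz' (by simp [e])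
    exact ⟨x, by simp only [mem_Iio] at hx ⊢; omega, rfl⟩

theorem ncard_of_bijOn {g : ℕ → ℕ} {k : ℕ} {s : Set ℕ} (h : BijOn g (Iio k) s) : s.ncard = k := by
  rw [← h.image_eq, h.injOn.ncard_image, ← Finset.coe_Iio, ncard_coe_finset, Nat.card_Iio]

theorem finite_of_bijOn {g : ℕ → ℕ} {k : ℕ} {s : Set ℕ} (h : BijOn g (Iio k) s) : s.Finite := by
  rw [← h.image_eq]; exact (finite_Iio k).image g

/-! ### Adjacency lists with deletion -/

/-- The arrays hold adjacency lists of `R`, along with the positions of their elements. -/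
def Rep (R : ℕ → ℕ → Prop) (deg adj pos : ℕ → ℕ → ℕ) : Prop :=
  (∀ x y, R x y → pos x y < deg x 0 ∧ adj x (pos x y) = y) ∧
    ∀ x p, p < deg x 0 → R x (adj x p) ∧ pos x (adj x p) = p

section

variable {R : ℕ → ℕ → Prop} {deg adj pos : ℕ → ℕ → ℕ} {u w : ℕ}

theorem Rep.bijOn (h : Rep R deg adj pos) (x : ℕ) : BijOn (adj x) (Iio (deg x 0)) {y | R x y} :=
  ⟨fun p hp => (h.2 x p hp).1, fun p hp q hq e => by rw [← (h.2 x p hp).2, e, (h.2 x q hq).2],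
    fun y hy => ⟨pos x y, (h.1 x y hy).1, (h.1 x y hy).2⟩⟩

theorem Rep.deg_eq (h : Rep R deg adj pos) (x : ℕ) : {y | R x y}.ncard = deg x 0 :=
  ncard_of_bijOn (h.bijOn x)

theorem Rep.insert (h : Rep R deg adj pos) (huw : ¬ R u w) :
    Rep (fun x y => R x y ∨ x = u ∧ y = w)
      (Function.update deg u (Function.update (deg u) 0 (deg u 0 + 1)))
      (Function.update adj u (Function.update (adj u) (deg u 0) w))
      (Function.update pos u (Function.update (pos u) w (deg u 0))) := by
  constructor
  · intro x y hxy
    by_cases hx : x = u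
    · subst hx
      by_cases hy : y = w
      · subst hy; simp
      · have := h.1 x y (by tauto)
        have h2 := this.1.ne
        simp [hy, h2, this.2]
        omega
    · have := h.1 x y (by tauto)
      simpa [hx] using this
  · intro x p hp
    by_cases hx : x = u
    · subst hx
      simp only [Function.update_self] at hp ⊢
      by_cases hp' : p = deg x 0
      · subst hp'; simp
      · have := h.2 x p (by omega)
        have hne : adj x p ≠ w := fun e => huw (e ▸ this.1)
        simp [hp', hne, this]
    · have := h.2 x p (by simpa [hx] using hp)
      simpa [hx] using this

/-- The last entry of the list is moved into the gap. What remains beyond the end of the list, and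
the old position of `w`, are harmless, since only actual neighbours and positions below the degree
are constrained. -/
theorem Rep.erase (h : Rep R deg adj pos) (huw : R u w) :
    Rep (fun x y => R x y ∧ ¬ (x = u ∧ y = w))
      (Function.update deg u (Function.update (deg u) 0 (deg u 0 - 1)))
      (Function.update adj u (Function.update (adj u) (pos u w) (adj u (deg u 0 - 1))))
      (Function.update pos u (Function.update (pos u) (adj u (deg u 0 - 1)) (pos u w))) := by
  have hw := h.1 u w huw
  have hl := h.2 u (deg u 0 - 1) (by omega)
  constructor
  · rintro x y ⟨hxy, hne⟩
    by_cases hx : x = u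
    · subst hx
      have hy : y ≠ w := by tauto
      have h1 := h.1 x y hxy
      by_cases hz : y = adj x (deg x 0 - 1)
      · rw [← hz]
        have : pos x w ≠ deg x 0 - 1 := fun e => hy (by rw [hz, ← e, hw.2])
        simp only [Function.update_self]
        exact ⟨by omega, trivial⟩
      · have h2 : pos x y ≠ deg x 0 - 1 := fun e => hz (by rw [← e, h1.2])
        have h3 : pos x y ≠ pos x w := fun e => hy (by rw [← h1.2, e, hw.2])
        simp only [Function.update_self, Function.update_of_ne hz, Function.update_of_ne h3]
        exact ⟨by omega, h1.2⟩
    · have := h.1 x y hxy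
      simpa [hx] using this
  · intro x p hp
    by_cases hx : x = u
    · subst hx
      simp only [Function.update_self] at hp ⊢
      by_cases hp' : p = pos x w
      · subst hp'
        simp only [Function.update_self, and_true]
        refine ⟨hl.1, fun e => ?_⟩
        rw [e.2] at hl
        omega
      · have h1 := h.2 x p (by omega)
        have h2 : adj x p ≠ adj x (deg x 0 - 1) := fun e => by
          rw [e] at h1; omega
        simp only [Function.update_of_ne hp', Function.update_of_ne h2]
        refine ⟨⟨h1.1, fun e => hp' ?_⟩, h1.2⟩
        rw [← h1.2, e.2]
    · have := h.2 x p (by simpa [hx] using hp)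
      simpa [hx] using this

end

/-! ### The state of the computation -/

/-- The cover with the index `f`. -/
def cset (n : ℕ) (cov : ℕ → ℕ) (f : ℕ) : Set ℕ := {x | x < n ∧ cov (1 + f * n + x) ≠ 0}

/-- The cells written are on the list; the vertices have the right numbers. -/
structure Scratch (n j tc : ℕ) (id cnt vrt tr pm : ℕ → ℕ → ℕ) : Prop where
  id_vrt : ∀ q < j, vrt q 0 < n ∧ id (vrt q 0) 0 = q + 1
  vrt_id : ∀ x, id x 0 ≠ 0 → ∃ q < j, vrt q 0 = x
  cnt : ∀ x, j ≤ x → cnt x 0 = 0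
  pm : ∀ κ x, pm κ x ≠ 0 → ∃ q < tc, tr q 0 = κ ∧ tr q 1 = x

theorem Scratch.inj {n j tc : ℕ} {id cnt vrt tr pm : ℕ → ℕ → ℕ}
    (h : Scratch n j tc id cnt vrt tr pm) {p q : ℕ} (hp : p < j) (hq : q < j)
    (e : vrt p 0 = vrt q 0) : p = q := by
  have h1 := (h.id_vrt p hp).2
  have h2 := (h.id_vrt q hq).2
  rw [e] at h1
  omega

theorem Scratch.write {n j tc : ℕ} {id cnt vrt tr pm : ℕ → ℕ → ℕ}
    (h : Scratch n j tc id cnt vrt tr pm) (κ x z : ℕ) :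
    Scratch n j (tc + 1) id cnt vrt
      (Function.update tr tc (Function.update (Function.update (tr tc) 0 κ) 1 x))
      (Function.update pm κ (Function.update (pm κ) x z)) where
  id_vrt := h.id_vrt
  vrt_id := h.vrt_id
  cnt := h.cnt
  pm κ' x' hne := by
    by_cases e : κ' = κ ∧ x' = x
    · obtain ⟨rfl, rfl⟩ := e
      exact ⟨tc, by omega, by simp, by simp⟩
    · have : pm κ' x' ≠ 0 := by
        by_cases hk : κ' = κ
        · subst hk
          have hx : x' ≠ x := by tauto
          simpa [hx] using hne
        · simpa [hk] using hne
      obtain ⟨q, hq, h1, h2⟩ := h.pm κ' x' this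
      exact ⟨q, by omega, by simpa [hq.ne] using h1, by simpa [hq.ne] using h2⟩

/-- Adding a vertex `x` without a number. -/
theorem Scratch.alloc {n j tc x : ℕ} {id cnt vrt tr pm : ℕ → ℕ → ℕ}
    (h : Scratch n j tc id cnt vrt tr pm) (hx : x < n) (hid : id x 0 = 0) :
    Scratch n (j + 1) tc (Function.update id x (Function.update (id x) 0 (j + 1))) cnt
      (Function.update vrt j (Function.update (vrt j) 0 x)) tr pm where
  id_vrt q hq := by
    by_cases e : q = j
    · subst e; simp [hx]
    · have := h.id_vrt q (by omega)
      have hne : vrt q 0 ≠ x := fun e => by rw [e, hid] at this; omega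
      simpa [e, hne] using this
  vrt_id y hy := by
    by_cases e : y = x
    · exact ⟨j, by omega, by simp [e]⟩
    · obtain ⟨q, hq, h1⟩ := h.vrt_id y (by simpa [e] using hy)
      exact ⟨q, by omega, by simpa [hq.ne] using h1⟩
  cnt y hy := h.cnt y (by omega)
  pm := h.pm

/-- All words are at most `V`, except for the temporary variables. -/
def LeN (V : ℕ) (S : St) : Prop :=
  (∀ r, (r < 21 ∨ 29 < r) → S.v r ≤ V) ∧ (∀ i, S.cov i ≤ V) ∧ ∀ k i j, S.a k i j ≤ V

section

variable {U V : ℕ} {S : St}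

theorem St.Le.leN (h : S.Le V) : LeN V S := ⟨fun r _ => h.1 r, h.2⟩

theorem LeN.tmp (h : LeN U S) {r x : ℕ} (hr : 21 ≤ r ∧ r ≤ 29) : LeN U (S.setv r x) := by
  refine ⟨fun y hy => ?_, h.2.1, h.2.2⟩
  have : y ≠ r := by omega
  simpa [this] using h.1 y hy

theorem LeN.setv (h : LeN U S) {r x : ℕ} (hx : x ≤ U) : LeN U (S.setv r x) := by
  refine ⟨fun y hy => ?_, h.2.1, h.2.2⟩
  simp only [St.setv_v]
  split_ifs
  exacts [hx, h.1 y hy]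

theorem LeN.setc (h : LeN U S) {r x : ℕ} (hx : x ≤ U) : LeN U (S.setc r x) := by
  refine ⟨h.1, fun y => ?_, h.2.2⟩
  simp only [St.setc_cov, Function.update_apply]
  split_ifs
  exacts [hx, h.2.1 y]

theorem LeN.seta (h : LeN U S) {k i j x : ℕ} (hx : x ≤ U) : LeN U (S.seta k i j x) := by
  refine ⟨h.1, h.2.1, fun k' i' j' => ?_⟩
  simp only [St.seta_a]
  split_ifs
  · simp only [Function.update_apply]
    split_ifs
    · simp only [Function.update_apply]
      split_ifs
      exacts [hx, h.2.2 ..]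
    · exact h.2.2 ..
  · exact h.2.2 ..

/-- The temporary variables are the only words that `LeN` leaves unbounded, and here all of them
become zero. -/
theorem LeN.clr (h : LeN U S) (off : ℕ) : (exec off clr S).Le U := by
  refine ⟨fun y => ?_, ?_, ?_⟩
  · by_cases hy : y < 21 ∨ 29 < y
    · simp only [DynVC.clr, mov, exec, St.setv_v, Opd.val, WordOp.eval, Nat.add_zero]
      split_ifs <;> first | omega | exact h.1 y hy
    · simp only [DynVC.clr, mov, exec, St.setv_v, Opd.val, WordOp.eval, Nat.add_zero]
      split_ifs <;> omega
  · simpa [DynVC.clr, mov, exec] using h.2.1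
  · simpa [DynVC.clr, mov, exec] using h.2.2

end

/-! ### Adding a vertex to the new cover -/

/-- `S'` arises from `S` by adding the vertex `x` to the new cover. -/
structure AddsY (n : ℕ) (S S' : St) (x : ℕ) : Prop where
  v : ∀ r, r ≠ 11 → r ≠ 27 → r ≠ 28 → r ≠ 29 → S'.v r = S.v r
  a : ∀ k, k ≠ 3 → S'.a k = S.a k
  row : S'.a 3 (S.v 8) = S.a 3 (S.v 8)
  zs : cset n S'.cov (S.v 8) = cset n S.cov (S.v 8)
  cov : S'.cov 0 = S.cov 0
  ys : cset n S'.cov (1 - S.v 8) = insert x (cset n S.cov (1 - S.v 8))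
  bij : BijOn (S'.a 3 (1 - S.v 8)) (Iio (S'.v 11)) (cset n S'.cov (1 - S.v 8))
  le : S'.v 11 ≤ S.v 11 + 1
  leN : ∀ V, n ≤ V → 1 ≤ V → LeN V S → LeN V S'

theorem cset_update {n f x z : ℕ} {cov : ℕ → ℕ} (hx : x < n) (hz : z ≠ 0) :
    cset n (Function.update cov (1 + f * n + x) z) f = insert x (cset n cov f) := by
  ext y
  simp only [cset, mem_ofPred_eq, Function.update_apply, mem_insert_iff]
  by_cases e : y = x
  · subst e; simp [hx, hz]
  · have : 1 + f * n + y ≠ 1 + f * n + x := by omega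
    simp [e]

theorem cset_update_zero {n f x : ℕ} {cov : ℕ → ℕ} :
    cset n (Function.update cov (1 + f * n + x) 0) f = cset n cov f \ {x} := by
  ext y
  simp only [cset, mem_ofPred_eq, Function.update_apply, mem_sdiff, mem_singleton_iff]
  by_cases e : y = x
  · subst e; simp
  · simp [e]

theorem cset_update_other {n f g x z : ℕ} {cov : ℕ → ℕ} (hx : x < n) (hf : f ≤ 1) (hg : g ≤ 1)
    (hfg : f ≠ g) : cset n (Function.update cov (1 + f * n + x) z) g = cset n cov g := by
  ext y
  simp only [cset, mem_ofPred_eq, Function.update_apply]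
  refine and_congr_right fun hy => ?_
  have : 1 + g * n + y ≠ 1 + f * n + x := by
    interval_cases f <;> interval_cases g <;> omega
  simp [this]

theorem cset_update_ptr {n f z : ℕ} {cov : ℕ → ℕ} :
    cset n (Function.update cov 0 z) f = cset n cov f := by
  ext y
  simp [cset]

/-- The characteristic vector is consulted first, so the list in array `3` remains an enumeration
without repetition and its counter never exceeds `n`. A vertex already present changes temporary
variables only. -/
theorem exec_addY {n x : ℕ} {S : St} (hn : S.v 3 = n) (hF : S.v 8 ≤ 1) (hx : S.v x < n)
    (hr : x ≠ 11 ∧ x ≠ 27 ∧ x ≠ 28 ∧ x ≠ 29)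
    (hY : BijOn (S.a 3 (1 - S.v 8)) (Iio (S.v 11)) (cset n S.cov (1 - S.v 8))) :
    AddsY n S (exec (2 * n + 1) (addY x) S) (S.v x) := by
  obtain ⟨hr1, hr2, hr3, hr4⟩ := hr
  -- The index is below the size of the contiguous array (one pointer and two covers), so the
  -- reduction has no effect.
  have hmod : ((1 - S.v 8) * n + 1 + S.v x) % (2 * n + 1) = 1 + (1 - S.v 8) * n + S.v x := by
    rw [Nat.mod_eq_of_lt, add_comm _ 1]
    have : (1 - S.v 8) * n ≤ 1 * n := Nat.mul_le_mul_right _ (by omega)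
    omega
  have hmem : S.v x ∈ cset n S.cov (1 - S.v 8) ↔ S.cov (1 + (1 - S.v 8) * n + S.v x) ≠ 0 := by
    simp [cset, hx]
  have hcF : (1 - S.v 8) ≠ S.v 8 := by omega
  by_cases h0 : S.cov (1 + (1 - S.v 8) * n + S.v x) = 0
  · have e : exec (2 * n + 1) (addY x) S =
        (((((((S.setv 27 (1 - S.v 8)).setv 28 ((1 - S.v 8) * n)).setv 28
          ((1 - S.v 8) * n + 1)).setv 28 ((1 - S.v 8) * n + 1 + S.v x)).setv 29 0).setc
          (1 + (1 - S.v 8) * n + S.v x) 1).seta 3 (1 - S.v 8) (S.v 11) (S.v x)).setv 11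
          (S.v 11 + 1) := by
      simp [addY, exec, Opd.val, WordOp.eval, inc, hn, hr2, hr3, hr4, hmod, h0]
    have hne : S.v x ∉ cset n S.cov (1 - S.v 8) := by rw [hmem]; simpa using h0
    rw [e]
    constructor
    · intro r h1 h2 h3 h4; simp [h1, h2, h3, h4]
    · intro k hk; simp [hk]
    · simp [hcF.symm]
    · simpa using cset_update_other hx (by omega) hF hcF
    · simpa using Function.update_of_ne (by omega) _ _
    · simpa using cset_update hx one_ne_zero
    · have := bijOn_push hY hne
      simpa [cset_update hx one_ne_zero] using this
    · simp
    · intro V hnV h1V h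
      have : S.v 11 + 1 ≤ n := by
        have h1 := ncard_of_bijOn (bijOn_push hY hne)
        have h2 : (insert (S.v x) (cset n S.cov (1 - S.v 8))) ⊆ Iio n := by
          rintro y (rfl | hy)
          · exact hx
          · exact hy.1
        have := ncard_le_ncard h2
        rwa [h1, ← Finset.coe_Iio, ncard_coe_finset, Nat.card_Iio] at this
      refine LeN.setv (LeN.seta (LeN.setc ?_ h1V) (by omega)) (by omega)
      exact ((((h.tmp (by simp)).tmp (by simp)).tmp (by simp)).tmp (by simp)).tmp (by simp)
  · have e : exec (2 * n + 1) (addY x) S =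
        ((((S.setv 27 (1 - S.v 8)).setv 28 ((1 - S.v 8) * n)).setv 28 ((1 - S.v 8) * n + 1)).setv 28
          ((1 - S.v 8) * n + 1 + S.v x)).setv 29 (S.cov (1 + (1 - S.v 8) * n + S.v x)) := by
      simp [addY, exec, Opd.val, WordOp.eval, inc, hn, hr2, hr3, hmod, h0]
    have hmem' : S.v x ∈ cset n S.cov (1 - S.v 8) := hmem.2 h0
    rw [e]
    constructor
    · intro r h1 h2 h3 h4; simp [h2, h3, h4]
    · intro k hk; simp
    · simp
    · simp
    · simp
    · simp [hmem']
    · simpa using hY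
    · simp
    · intro V _ _ h
      exact ((((h.tmp (by simp)).tmp (by simp)).tmp (by simp)).tmp (by simp)).tmp (by simp)

/-! ### Applying an update to the adjacency lists -/

/-- `R'` arises from `R` by the update `(b, u, w)`. -/
def Steps (n : ℕ) (R R' : ℕ → ℕ → Prop) (b u w : ℕ) : Prop :=
  u < n ∧ w < n ∧ u ≠ w ∧ (b ≠ 0 → ¬ R u w ∧ ∀ x y, R' x y ↔ (R x y ∨ x = u ∧ y = w) ∨ x = w ∧ y = u) ∧
    (b = 0 → R u w ∧ ∀ x y, R' x y ↔ (R x y ∧ ¬ (x = u ∧ y = w)) ∧ ¬ (x = w ∧ y = u))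

theorem Rep.congr {R R' : ℕ → ℕ → Prop} {deg adj pos : ℕ → ℕ → ℕ} (h : Rep R deg adj pos)
    (hR : ∀ x y, R' x y ↔ R x y) : Rep R' deg adj pos := by
  have : R' = R := by funext x y; exact propext (hR x y)
  rwa [this]

theorem exec_halfIns (off : ℕ) {S : St} {x y : ℕ} {R : ℕ → ℕ → Prop} (hx : 23 < x) (hy : 23 < y)
    (h : Rep R (S.a 0) (S.a 1) (S.a 2)) (hR : ¬ R (S.v x) (S.v y)) :
    ∃ S', exec off (halfIns x y) S = S' ∧ (∀ r, r ≠ 21 → S'.v r = S.v r) ∧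
      (∀ k, 2 < k → S'.a k = S.a k) ∧ S'.cov = S.cov ∧
      Rep (fun a b => R a b ∨ a = S.v x ∧ b = S.v y) (S'.a 0) (S'.a 1) (S'.a 2) ∧
      ∀ V, LeN V S → S.v y ≤ V → S.a 0 (S.v x) 0 + 1 ≤ V → LeN V S' := by
  have h1 : x ≠ 21 := by omega
  have h2 : y ≠ 21 := by omega
  refine ⟨_, rfl, ?_, ?_, ?_, ?_, ?_⟩
  · intro r hr; simp [halfIns, exec, inc, hr]
  · intro k hk
    have h0 : k ≠ 0 := by omega
    have h1 : k ≠ 1 := by omega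
    have h2 : k ≠ 2 := by omega
    simp [halfIns, exec, inc, h0, h1, h2]
  · simp [halfIns, exec, inc]
  · simpa [halfIns, exec, inc, Opd.val, WordOp.eval, h1, h2] using h.insert hR
  · intro V hV hy hd
    simp only [halfIns, exec, inc, Opd.val, WordOp.eval, St.setv_v, St.seta_v, h1, h2,
      if_true, if_false]
    exact ((((hV.tmp (by simp)).seta hy).seta (by omega)).tmp (by simp)).seta hd

theorem exec_halfDel (off : ℕ) {S : St} {x y : ℕ} {R : ℕ → ℕ → Prop} (hx : 23 < x) (hy : 23 < y)
    (h : Rep R (S.a 0) (S.a 1) (S.a 2)) (hR : R (S.v x) (S.v y)) :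
    ∃ S', exec off (halfDel x y) S = S' ∧ (∀ r, r ≠ 21 → r ≠ 22 → r ≠ 23 → S'.v r = S.v r) ∧
      (∀ k, 2 < k → S'.a k = S.a k) ∧ S'.cov = S.cov ∧
      Rep (fun a b => R a b ∧ ¬ (a = S.v x ∧ b = S.v y)) (S'.a 0) (S'.a 1) (S'.a 2) ∧
      ∀ V, LeN V S → LeN V S' := by
  have h1 : x ≠ 21 ∧ x ≠ 22 ∧ x ≠ 23 := by omega
  have h2 : y ≠ 21 := by omega
  refine ⟨_, rfl, ?_, ?_, ?_, ?_, ?_⟩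
  · intro r h1 h2 h3; simp [halfDel, exec, dec, h1, h2, h3]
  · intro k hk
    have h0 : k ≠ 0 := by omega
    have h1 : k ≠ 1 := by omega
    have h2 : k ≠ 2 := by omega
    simp [halfDel, exec, dec, h0, h1, h2]
  · simp [halfDel, exec, dec]
  · simpa [halfDel, exec, dec, Opd.val, WordOp.eval, h1, h2] using h.erase hR
  · intro V hV
    simp only [halfDel, exec, dec, Opd.val, WordOp.eval]
    have a1 := hV.2.2 2 (S.v x) (S.v y)
    have a2 := hV.2.2 0 (S.v x) 0
    have a3 := hV.2.2 1 (S.v x) (S.a 0 (S.v x) 0 - 1)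
    refine LeN.seta (LeN.seta (LeN.seta ?_ ?_) ?_) ?_
    · exact (((hV.tmp (by simp)).tmp (by simp)).tmp (by simp)).tmp (by simp)
    · simpa [h1] using a3
    · simpa using a1
    · simpa [h1] using a2.trans (Nat.le_succ _)

theorem exec_popApply (off : ℕ) {n : ℕ} {S : St} {R R' : ℕ → ℕ → Prop}
    (h : Rep R (S.a 0) (S.a 1) (S.a 2)) (hRn : ∀ x y, R x y → x < n ∧ y < n)
    (hsymm : ∀ x y, R x y → R y x)
    (hst : Steps n R R' (S.a 4 (S.v 12) 0) (S.a 4 (S.v 12) 1) (S.a 4 (S.v 12) 2)) :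
    ∃ S', exec off popApply S = S' ∧ (∀ r, r ≠ 12 → r < 21 ∨ 26 < r → S'.v r = S.v r) ∧
      S'.v 12 = S.v 12 + 1 ∧ S'.v 24 = S.a 4 (S.v 12) 0 ∧ S'.v 25 = S.a 4 (S.v 12) 1 ∧
      (∀ k, 2 < k → S'.a k = S.a k) ∧ S'.cov = S.cov ∧ Rep R' (S'.a 0) (S'.a 1) (S'.a 2) ∧
      ∀ V, n ≤ V → S.v 12 + 1 ≤ V → LeN V S → LeN V S' := by
  obtain ⟨b, hb⟩ : ∃ b, S.a 4 (S.v 12) 0 = b := ⟨_, rfl⟩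
  obtain ⟨u, hu⟩ : ∃ u, S.a 4 (S.v 12) 1 = u := ⟨_, rfl⟩
  obtain ⟨w, hw⟩ : ∃ w, S.a 4 (S.v 12) 2 = w := ⟨_, rfl⟩
  obtain ⟨S1, hS1⟩ : ∃ S1, S1 = (((S.setv 24 b).setv 25 u).setv 26 w).setv 12 (S.v 12 + 1) :=
    ⟨_, rfl⟩
  have e : exec off popApply S = if b = 0 then exec off (halfDel 25 26 ;; halfDel 26 25) S1
      else exec off (halfIns 25 26 ;; halfIns 26 25) S1 := by
    subst hS1 hb hu hw
    simp [popApply, exec, inc, Opd.val, WordOp.eval]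
  simp only [hb, hu, hw] at hst ⊢
  have hrep : Rep R (S1.a 0) (S1.a 1) (S1.a 2) := by simpa [hS1] using h
  have v25 : S1.v 25 = u := by simp [hS1]
  have v26 : S1.v 26 = w := by simp [hS1]
  have v24 : S1.v 24 = b := by simp [hS1]
  have v12 : S1.v 12 = S.v 12 + 1 := by simp [hS1]
  have hv : ∀ r, r ≠ 12 → r < 21 ∨ 26 < r → S1.v r = S.v r := by
    intro r h1 h2
    have h3 : r ≠ 24 ∧ r ≠ 25 ∧ r ≠ 26 := by omega
    simp [hS1, h1, h3]
  have ha : S1.a = S.a := by simp [hS1]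
  have hc : S1.cov = S.cov := by simp [hS1]
  have hL : ∀ V, S.v 12 + 1 ≤ V → LeN V S → LeN V S1 := by
    intro V h12 hV
    rw [hS1]
    exact (((hV.tmp (by simp)).tmp (by simp)).tmp (by simp)).setv h12
  obtain ⟨hun, hwn, huw, hins, hdel⟩ := hst
  by_cases hb0 : b = 0
  · obtain ⟨hR, hR'⟩ := hdel hb0
    rw [if_pos hb0] at e
    obtain ⟨S2, e2, f1, f2, f3, f4, f5⟩ := exec_halfDel off (x := 25) (y := 26) (by simp) (by simp)
      hrep (by rw [v25, v26]; exact hR)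
    obtain ⟨S3, e3, g1, g2, g3, g4, g5⟩ := exec_halfDel off (x := 26) (y := 25) (by simp) (by simp)
      f4 (by
        rw [f1 _ (by simp) (by simp) (by simp), f1 _ (by simp) (by simp) (by simp), v25, v26]
        exact ⟨hsymm _ _ hR, fun e => huw e.2⟩)
    refine ⟨S3, by rw [e]; simp only [exec, e2, e3], ?_, ?_, ?_, ?_, ?_, ?_, ?_, ?_⟩
    · intro r h1 h2
      rw [g1 r (by omega) (by omega) (by omega), f1 r (by omega) (by omega) (by omega), hv r h1 h2]
    · rw [g1 _ (by simp) (by simp) (by simp), f1 _ (by simp) (by simp) (by simp), v12]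
    · rw [g1 _ (by simp) (by simp) (by simp), f1 _ (by simp) (by simp) (by simp), v24]
    · rw [g1 _ (by simp) (by simp) (by simp), f1 _ (by simp) (by simp) (by simp), v25]
    · intro k hk; rw [g2 k hk, f2 k hk, ha]
    · rw [g3, f3, hc]
    · refine g4.congr fun x y => ?_
      rw [f1 _ (by simp) (by simp) (by simp), f1 _ (by simp) (by simp) (by simp), v25, v26]
      exact hR' x y
    · exact fun V _ h12 hV => g5 V (f5 V (hL V h12 hV))
  · obtain ⟨hR, hR'⟩ := hins hb0
    rw [if_neg hb0] at e
    obtain ⟨S2, e2, f1, f2, f3, f4, f5⟩ := exec_halfIns off (x := 25) (y := 26) (by simp) (by simp)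
      hrep (by rw [v25, v26]; exact hR)
    have hwu : ¬ (R w u ∨ w = u ∧ u = w) := by
      rintro (h | h)
      · exact hR (hsymm _ _ h)
      · exact huw h.2
    obtain ⟨S3, e3, g1, g2, g3, g4, g5⟩ := exec_halfIns off (x := 26) (y := 25) (by simp) (by simp)
      f4 (by
        rw [f1 _ (by simp), f1 _ (by simp), v25, v26]
        exact hwu)
    -- A vertex that lacks a neighbour below `n` still has degree below `n`; so the increased degree
    -- is a short word.
    have bound : ∀ {R : ℕ → ℕ → Prop} {deg adj pos : ℕ → ℕ → ℕ} (x y : ℕ), Rep R deg adj pos →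
        (∀ x y, R x y → y < n) → ¬ R x y → y < n → deg x 0 + 1 ≤ n := by
      intro R deg adj pos x y hR hn hxy hy
      have h1 := ncard_of_bijOn (bijOn_push (hR.bijOn x) hxy)
      have h2 : insert y {z | R x z} ⊆ Iio n := by
        rintro z (rfl | hz)
        · exact hy
        · exact hn x z hz
      have := ncard_le_ncard h2
      rwa [h1, ← Finset.coe_Iio, ncard_coe_finset, Nat.card_Iio] at this
    refine ⟨S3, by rw [e]; simp only [exec, e2, e3], ?_, ?_, ?_, ?_, ?_, ?_, ?_, ?_⟩
    · intro r h1 h2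
      rw [g1 r (by omega), f1 r (by omega), hv r h1 h2]
    · rw [g1 _ (by simp), f1 _ (by simp), v12]
    · rw [g1 _ (by simp), f1 _ (by simp), v24]
    · rw [g1 _ (by simp), f1 _ (by simp), v25]
    · intro k hk; rw [g2 k hk, f2 k hk, ha]
    · rw [g3, f3, hc]
    · refine g4.congr fun x y => ?_
      rw [f1 _ (by simp), f1 _ (by simp), v25, v26]
      exact hR' x y
    · intro V hn h12 hV
      refine g5 V (f5 V (hL V h12 hV) ?_ ?_) ?_ ?_
      · rw [v26]; omega
      · rw [v25]
        exact (bound _ w hrep (fun x y h => (hRn x y h).2) hR hwn).trans hn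
      · rw [f1 _ (by simp), v25]; omega
      · rw [f1 _ (by simp), v26]
        refine (bound w u f4 ?_ (by rw [v25, v26]; exact hwu) hun).trans hn
        rintro x y (h | h)
        · exact (hRn x y h).2
        · rw [v26] at h; omega

/-- The data of a run: the parameters, the sequence of graphs (as relations on `ℕ`), the updates, the sizes
`opt` of the minimum vertex covers. `Qual x i` says that `x` is a good size for a cover of the
`i`-th graph. -/
structure Ctx where
  (n α τ L Kc t1 m V Wp : ℕ)
  P : Program
  A : ℕ → ℕ → ℕ → Prop
  (eI eU eV opt T : ℕ → ℕ)
  Qual : ℕ → ℕ → Prop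

namespace Ctx

variable (X : Ctx)

/-- The degree threshold. -/
def d : ℕ := X.α * (X.L + 1)

/-- By the hypothesis on `T`, the static program takes at most `θ` steps per vertex of its input. -/
def θ : ℕ := X.τ / X.n + 1

/-- The number of microsteps of a call. -/
def K : ℕ := X.θ * X.α * X.Kc

/-- The value is dictated by `start_work`. -/
def C : ℕ := 20 + 13 * (2 * X.t1 + 1)

/-- The work of a phase with snapshot `i`. -/
def W0 (i : ℕ) : ℕ := X.C * (1 + X.opt i) * ((X.d + 1) * X.θ)

noncomputable def deg (i x : ℕ) : ℕ := {y | X.A i x y}.ncard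

end Ctx

def instrConsts : Instr → List ℕ
  | .const d k => [d, k]
  | .op _ d a b => [d, a, b]
  | .load d a => [d, a]
  | .store a b => [a, b]
  | .jumpZero a _ => [a]
  | .jumpLess a b _ => [a, b]
  | .jumpReg a => [a]

/-- The input of the static program for the subgraph of `R` that is induced by the `j` vertices
`vrt`. -/
def InputOk (R : ℕ → ℕ → Prop) (j : ℕ) (vrt : ℕ → ℕ) (μ : ℕ → ℕ) : Prop :=
  μ 0 = j ∧ μ 1 = j + 2 ∧ ∃ (cnt : ℕ → ℕ) (itm : ℕ → ℕ → ℕ),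
    (∀ v < j, μ (v + 2) = μ (v + 1) + cnt v) ∧
    (∀ v < j, BijOn (itm v) (Iio (cnt v)) {w | w < j ∧ R (vrt v) (vrt w)}) ∧
    (∀ v < j, ∀ q < cnt v, μ (μ (v + 1) + q) = itm v q) ∧ ∀ y, μ (j + 1) ≤ y → μ y = 0

def inputConfig (α : ℕ) (μ : ℕ → ℕ) : Config := ⟨0, fun i => if i = 0 then α else 0, μ⟩

/-- The interface between the machine and graph theory. `high` and `solve` certify the size of a
freshly computed cover, `fin` says that such a cover is still a coarse approximation after the
updates of two phases, and `hK` makes the machine fast enough for phases to be short. The remaining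
fields describe the update sequence and make `V` large enough for all words between microsteps. -/
structure Ctx.Good (X : Ctx) : Prop where
  n_pos : 0 < X.n
  L_pos : 0 < X.L
  A_lt : ∀ i x y, X.A i x y → x < X.n ∧ y < X.n
  A_symm : ∀ i x y, X.A i x y → X.A i y x
  A_zero : ∀ x y, ¬ X.A 0 x y
  step : ∀ i < X.m, Steps X.n (X.A i) (X.A (i + 1)) (X.eI i) (X.eU i) (X.eV i)
  eI_le : ∀ i, X.eI i ≤ 1
  opt_le : ∀ i, X.opt i ≤ X.n
  opt_succ : ∀ i < X.m, X.opt (i + 1) ≤ X.opt i + 1 ∧ X.opt i ≤ X.opt (i + 1) + 1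
  qual_zero : X.Qual 0 0
  high : ∀ i ≤ X.m, ∀ Y : Set ℕ, (∀ x ∈ Y, x < X.n ∧ X.d < X.deg i x) → X.Qual Y.ncard i
  solve : ∀ i ≤ X.m, ∀ (j : ℕ) (vrt μ : ℕ → ℕ), 1 ≤ j → InjOn vrt (Iio j) →
    (∀ q < j, vrt q < X.n ∧ X.deg i (vrt q) ≤ X.d) → InputOk (X.A i) j vrt μ →
    ∃ s', RunsTo X.P X.Wp (inputConfig X.α μ) (X.T j) s' ∧
      (∀ x < j, ∀ y < j, X.A i (vrt x) (vrt y) → s'.mem x ≠ 0 ∨ s'.mem y ≠ 0) ∧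
      ∀ Y : Set ℕ, (∀ x ∈ Y, x < X.n ∧ X.d < X.deg i x) →
        X.Qual (Y.ncard + {q | q < j ∧ s'.mem q ≠ 0}.ncard) i
  fin : ∀ i ≤ X.m, ∀ s ≤ i, ∀ a ≤ s, ∀ x z, X.Qual x a → z ≤ x + (i - a) →
    X.L * (s - a) ≤ X.opt a → (i = s ∨ s + 1 ≤ i ∧ X.L * (i - s) ≤ X.opt (s + 1)) →
    z ≤ X.t1 * X.opt i
  T_le : ∀ j, 1 ≤ j → j ≤ X.n → X.T j ≤ X.θ * j
  hK : 2 * X.L * (X.C * ((X.d + 1) * X.θ)) + 1 ≤ X.K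
  Wp_le : X.Wp ≤ X.V
  P_le : ∀ I ∈ X.P, ∀ k ∈ instrConsts I, k ≤ X.V
  length_le : X.P.length + 8 ≤ X.V
  V_ge : X.C * (1 + X.n) * ((X.d + 1) * X.θ) + X.K + X.d + 3 * X.n + 10 ≤ X.V
  V_ge' : X.L + 1 ≤ X.V ∧ X.Kc ≤ X.V ∧ X.α ≤ X.V ∧ X.τ ≤ X.V

/-! ### The invariant -/

/-- In `qual`, `a` is the snapshot for which this cover was computed; every update since has added
at most one vertex, and the updates between the snapshot and the swap were few. The slack in
`coarse` covers one update: it may add a vertex and may lower the optimum by one. -/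
structure ZOk (X : Ctx) (i s f zc : ℕ) (cov lst : ℕ → ℕ) : Prop where
  bij : BijOn lst (Iio zc) (cset X.n cov f)
  vc : ∀ x y, X.A i x y → x ∈ cset X.n cov f ∨ y ∈ cset X.n cov f
  qual : ∃ a ≤ s, ∃ x, X.Qual x a ∧ zc ≤ x + (i - a) ∧ X.L * (s - a) ≤ X.opt a
  coarse : zc ≤ X.t1 * (X.opt i + 1) + 1

structure Fix (X : Ctx) (i s n' α' τ' f qt : ℕ) (q : ℕ → ℕ → ℕ) : Prop where
  n_eq : n' = X.n
  α_eq : α' = X.α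
  τ_eq : τ' = X.τ
  f_le : f ≤ 1
  time : i = s + qt
  queue : ∀ k < qt, q k 0 = X.eI (s + k) ∧ q k 1 = X.eU (s + k) ∧ q k 2 = X.eV (s + k)

/-- The part of the invariant that always holds. The number `i` counts the updates, `s` those before
the current phase, and `e` is the number of microsteps that have been counted but not yet made. -/
structure Core (X : Ctx) (i s e : ℕ) (S : St) : Prop where
  le_m : i ≤ X.m
  fix : Fix X i s (S.v 3) (S.v 4) (S.v 5) (S.v 8) (S.v 13) (S.a 4)
  z : ZOk X i s (S.v 8) (S.v 10) S.cov (S.a 3 (S.v 8))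
  y : BijOn (S.a 3 (1 - S.v 8)) (Iio (S.v 11)) (cset X.n S.cov (1 - S.v 8))
  q_le : S.v 12 ≤ S.v 13
  rep : Rep (X.A (s + S.v 12)) (S.a 0) (S.a 1) (S.a 2)
  scr : Scratch X.n (S.v 17) (S.v 18) (S.a 5) (S.a 6) (S.a 8) (S.a 9) (S.a 10)
  le : LeN X.V S
  cnt : S.v 7 + e ≤ X.K

/-- The time bound: `φ` bounds the remaining work of the phase. -/
def Tm (X : Ctx) (s e : ℕ) (S : St) (φ : ℕ) : Prop :=
  X.K * S.v 13 + φ ≤ X.W0 (s + 1) + (S.v 7 + e) + S.v 12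

/-- The bound on the number of changes: `M` changes in previous calls, current cover `C₀` at the beginning
of the call, `y` vertices in the new cover. -/
def Chg (X : Ctx) (M : ℕ) (C₀ : Set ℕ) (i e : ℕ) (S : St) (y : ℕ) : Prop :=
  M + (symmDiff C₀ (cset X.n S.cov (S.v 8))).ncard + S.v 10 + 2 * y + 2 * (S.v 7 + e) ≤
    2 * (X.K + 1) * i

/-- At the start of a call, this is what the time bound of the previous call says about the updates
since the snapshot. It is carried along because the swap, which needs it, may happen in the middle
of a call. -/
def Late (X : Ctx) (i s : ℕ) (S : St) : Prop :=
  1 ≤ S.v 12 ∧ X.L * (i - (s + 1)) ≤ X.opt (s + 1)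

/-- The retired cover is erased only in the next phase; `y_le` keeps the cost of that proportional
to the optimum. -/
structure PIdle (X : Ctx) (s : ℕ) (S : St) : Prop where
  st : S.v 9 = 0
  qh : S.v 12 = 0
  j : S.v 17 = 0
  tc : S.v 18 = 0
  y_le : S.v 11 ≤ X.t1 * (X.opt s + 1) + 1

/-- The members of the current cover at the time of the snapshot. -/
def Prefix (X : Ctx) (s : ℕ) (S : St) : Prop :=
  S.v 20 ≤ S.v 10 ∧ ∀ x y, X.A (s + 1) x y → ∃ q < S.v 20, S.a 3 (S.v 8) q = x ∨ S.a 3 (S.v 8) q = y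

/-- The cover vertices of the snapshot and at most `d` neighbours of each. This bounds the number of
vertices of the static instance, and twice this bounds the total length of its lists. -/
def Ctx.E (X : Ctx) (S : St) : ℕ := S.v 20 * (X.d + 1)

structure PClear (X : Ctx) (s e : ℕ) (S : St) : Prop where
  st : S.v 9 = 1
  qh : S.v 12 = 1
  j : S.v 17 = 0
  tc : S.v 18 = 0
  pre : Prefix X s S
  tm : Tm X s e S (S.v 11 + S.v 20 + (9 + 2 * X.θ) * X.E S + 10)

/-- The new cover contains high vertices only, the static instance contains low vertices only. -/
def HighLow (X : Ctx) (S : St) : Prop :=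
  (∀ x ∈ cset X.n S.cov (1 - S.v 8), X.d < S.a 0 x 0) ∧ ∀ q < S.v 17, S.a 0 (S.a 8 q 0) 0 ≤ X.d

structure PCollect (X : Ctx) (s e : ℕ) (S : St) : Prop where
  st : S.v 9 = 2
  qh : S.v 12 = 1
  tc : S.v 18 = 0
  pre : Prefix X s S
  i_le : S.v 14 ≤ S.v 20
  j_le : S.v 17 ≤ S.v 14
  hl : HighLow X S
  done : ∀ q < S.v 14, S.a 3 (S.v 8) q ∈ cset X.n S.cov (1 - S.v 8) ∨
    ∃ k < S.v 17, S.a 8 k 0 = S.a 3 (S.v 8) q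
  vrt : ∀ k < S.v 17, ∃ q < S.v 14, S.a 3 (S.v 8) q = S.a 8 k 0
  cnt : ∀ x, S.a 6 x 0 = 0
  tm : Tm X s e S ((S.v 20 - S.v 14) + (9 + 2 * X.θ) * X.E S + 9)

/-- The edge from the vertex number `x` to `w` has been scanned. -/
def Scanned (X : Ctx) (s : ℕ) (S : St) (x w : ℕ) : Prop :=
  X.A (s + 1) (S.a 8 x 0) w ∧ (x < S.v 14 ∨ x = S.v 14 ∧ S.a 2 (S.a 8 x 0) w < S.v 15)

def sumCnt (cnt : ℕ → ℕ → ℕ) (j : ℕ) : ℕ := ∑ x ∈ Finset.range j, cnt x 0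

/-- Numbers below `S.v 16` belong to low vertices of the current cover, the others to low neighbours
met during the scan. By `cov`, every edge of the snapshot is covered by the new cover or has an end
that will be scanned. The asymmetry in `lists` reflects that an edge between two low cover vertices
is scanned twice, any other one once. -/
structure PScan (X : Ctx) (s e : ℕ) (S : St) : Prop where
  st : S.v 9 = 3
  qh : S.v 12 = 1
  tc : S.v 18 = 0
  i_le : S.v 14 ≤ S.v 16
  a_le : S.v 16 ≤ S.v 17
  a_le' : S.v 16 ≤ S.v 20
  z_le : S.v 20 ≤ S.v 10
  p_le : S.v 15 ≤ X.d
  p_zero : S.v 14 = S.v 16 → S.v 15 = 0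
  hl : HighLow X S
  cov : ∀ x y, X.A (s + 1) x y → x ∈ cset X.n S.cov (1 - S.v 8) ∨ y ∈ cset X.n S.cov (1 - S.v 8) ∨
    (∃ k < S.v 16, S.a 8 k 0 = x) ∨ ∃ k < S.v 16, S.a 8 k 0 = y
  done : ∀ x < S.v 16, ∀ w, Scanned X s S x w → w ∈ cset X.n S.cov (1 - S.v 8) ∨
    ∃ k < S.v 17, S.a 8 k 0 = w
  lists : ∀ x < S.v 17, BijOn (S.a 7 x) (Iio (S.a 6 x 0)) {y | y < S.v 17 ∧
    ((x < S.v 16 ∧ S.v 16 ≤ y ∧ Scanned X s S x (S.a 8 y 0)) ∨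
      (y < S.v 16 ∧ Scanned X s S y (S.a 8 x 0)))}
  sum_le : sumCnt (S.a 6) (S.v 17) ≤ 2 * (S.v 14 * X.d + S.v 15)
  j_le : S.v 17 ≤ S.v 16 + S.v 14 * X.d + S.v 15
  tm : Tm X s e S ((S.v 16 - S.v 14) * (X.d + 1) - S.v 15 + (8 + 2 * X.θ) * X.E S + 8)

/-- The static instance is ready. -/
structure Built (X : Ctx) (s : ℕ) (S : St) : Prop where
  z_le : S.v 20 ≤ S.v 10
  hl : HighLow X S
  lists : ∀ x < S.v 17, BijOn (S.a 7 x) (Iio (S.a 6 x 0))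
    {y | y < S.v 17 ∧ X.A (s + 1) (S.a 8 x 0) (S.a 8 y 0)}
  edges : ∀ x y, X.A (s + 1) x y → x ∈ cset X.n S.cov (1 - S.v 8) ∨ y ∈ cset X.n S.cov (1 - S.v 8) ∨
    ∃ k < S.v 17, ∃ l < S.v 17, S.a 8 k 0 = x ∧ S.a 8 l 0 = y
  sum_le : sumCnt (S.a 6) (S.v 17) ≤ 2 * X.E S
  j_pos : 1 ≤ S.v 17
  j_le : S.v 17 ≤ X.E S

/-- The position of the list of the vertex number `x` in the input of the static program. -/
def offs (S : St) (x : ℕ) : ℕ := S.v 17 + 2 + sumCnt (S.a 6) x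

structure PEmit (X : Ctx) (s e : ℕ) (S : St) : Prop where
  st : S.v 9 = 4
  qh : S.v 12 = 1
  built : Built X s S
  i_le : S.v 14 ≤ S.v 17
  p_le : S.v 15 ≤ S.a 6 (S.v 14) 0
  o_eq : S.v 19 = offs S (S.v 14) + S.v 15
  regs : ∀ x, S.a 10 0 x = 0
  size : S.a 10 1 0 = S.v 17
  starts : ∀ x ≤ S.v 14, S.a 10 1 (x + 1) = offs S x
  cells : ∀ x < S.v 14, ∀ q < S.a 6 x 0, S.a 10 1 (offs S x + q) = S.a 7 x q
  cells' : ∀ q < S.v 15, S.a 10 1 (offs S (S.v 14) + q) = S.a 7 (S.v 14) q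
  rest : ∀ y, S.v 19 ≤ y → S.a 10 1 y = 0
  tm : Tm X s e S (2 * (2 * X.E S - (sumCnt (S.a 6) (S.v 14) + S.v 15)) + 2 * (S.v 17 - S.v 14) +
    2 * X.T (S.v 17) + S.v 18 + 2 * S.v 17 + 5)

/-- The values `ρ` at the numbers of the vertices select a good cover of the edges that the new cover
does not cover. -/
structure Selects (X : Ctx) (s k : ℕ) (S : St) (ρ : ℕ → ℕ) : Prop where
  cov : ∀ x y, X.A (s + 1) x y → x ∈ cset X.n S.cov (1 - S.v 8) ∨ y ∈ cset X.n S.cov (1 - S.v 8) ∨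
    ∃ q < S.v 17, k ≤ q ∧ ρ q ≠ 0 ∧ (S.a 8 q 0 = x ∨ S.a 8 q 0 = y)
  qual : ∃ x, X.Qual x (s + 1) ∧ S.v 11 + {q | k ≤ q ∧ q < S.v 17 ∧ ρ q ≠ 0}.ncard ≤ x

/-- Array `10` is literally the configuration of the static program after `t` steps. Each remaining
step is charged twice, once for its simulation and once for undoing its write. -/
structure PSim (X : Ctx) (s e : ℕ) (S : St) : Prop where
  qh : S.v 12 = 1
  i_zero : S.v 14 = 0
  run : ∃ μ s', RunsTo X.P X.Wp (inputConfig X.α μ) (X.T (S.v 17)) s' ∧ Selects X s 0 S s'.mem ∧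
    ∃ t ≤ X.T (S.v 17), S.a 10 0 = ((step X.P)^[t] (inputConfig X.α μ)).reg ∧
      S.a 10 1 = ((step X.P)^[t] (inputConfig X.α μ)).mem ∧
      ((step X.P)^[t] (inputConfig X.α μ)).pc < X.P.length ∧
      S.v 9 = 8 + ((step X.P)^[t] (inputConfig X.α μ)).pc ∧
      Tm X s e S (2 * (X.T (S.v 17) - t) + S.v 18 + 2 * S.v 17 + 3)

structure POut (X : Ctx) (s e : ℕ) (S : St) : Prop where
  st : S.v 9 = 5
  qh : S.v 12 = 1
  i_le : S.v 14 ≤ S.v 17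
  sel : Selects X s (S.v 14) S (S.a 10 1)
  tm : Tm X s e S ((S.v 17 - S.v 14) + S.v 18 + S.v 17 + 2)

/-- The new cover is a good cover, except for updates still on the queue. -/
def YOk (X : Ctx) (s : ℕ) (S : St) : Prop :=
  (∀ x y, X.A (s + S.v 12) x y →
    x ∈ cset X.n S.cov (1 - S.v 8) ∨ y ∈ cset X.n S.cov (1 - S.v 8)) ∧
    ∃ x, X.Qual x (s + 1) ∧ S.v 11 ≤ x + (S.v 12 - 1)

structure PClean (X : Ctx) (s e : ℕ) (S : St) : Prop where
  st : S.v 9 = 6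
  qh : S.v 12 = 1
  ok : YOk X s S
  tm : Tm X s e S (S.v 18 + S.v 17 + 1)

structure PApply (X : Ctx) (s e : ℕ) (S : St) : Prop where
  st : S.v 9 = 7
  j : S.v 17 = 0
  tc : S.v 18 = 0
  ok : YOk X s S
  tm : Tm X s e S 0

/-- The last argument of `Chg` is zero until the retired cover has been erased: its vertices were
charged when they were added, and only vertices that the present phase puts into the new cover
count. -/
inductive Phase (X : Ctx) (M : ℕ) (C₀ : Set ℕ) (i s e : ℕ) (S : St) : Prop
  | idle : PIdle X s S → S.v 13 = 0 → S.v 7 = 0 → e = 0 → Chg X M C₀ i e S 0 →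
      Phase X M C₀ i s e S
  | start : PIdle X s S → S.v 13 = 1 → S.v 7 + e = X.K → Chg X M C₀ i e S 0 → Phase X M C₀ i s e S
  | clear : Late X i s S → PClear X s e S → Chg X M C₀ i e S 0 → Phase X M C₀ i s e S
  | collect : Late X i s S → PCollect X s e S → Chg X M C₀ i e S (S.v 11) → Phase X M C₀ i s e S
  | scan : Late X i s S → PScan X s e S → Chg X M C₀ i e S (S.v 11) → Phase X M C₀ i s e S
  | emit : Late X i s S → PEmit X s e S → Chg X M C₀ i e S (S.v 11) → Phase X M C₀ i s e S
  | sim : Late X i s S → PSim X s e S → Chg X M C₀ i e S (S.v 11) → Phase X M C₀ i s e S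
  | out : Late X i s S → POut X s e S → Chg X M C₀ i e S (S.v 11) → Phase X M C₀ i s e S
  | clean : Late X i s S → PClean X s e S → Chg X M C₀ i e S (S.v 11) → Phase X M C₀ i s e S
  | apply : Late X i s S → PApply X s e S → Chg X M C₀ i e S (S.v 11) → Phase X M C₀ i s e S

/-- Kept apart from `Core` because it fails before the first call, when the pointer is still zero.
The foreground part establishes it in every call. -/
def Params (X : Ctx) (S : St) : Prop := S.v 6 = X.d ∧ S.cov 0 = 1 + S.v 8 * X.n

structure Inv (X : Ctx) (M : ℕ) (C₀ : Set ℕ) (i s e : ℕ) (S : St) : Prop where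
  core : Core X i s e S
  par : Params X S
  phase : Phase X M C₀ i s e S

section

variable {X : Ctx} {M : ℕ} {C₀ : Set ℕ} {i s e : ℕ} {S S' : St}

/-- The invariant does not depend on the temporary variables, and a microstep may be paid in advance. -/
theorem Inv.pay (h : Inv X M C₀ i s 0 S) (h7 : S.v 7 ≠ 0) (off : ℕ) :
    Inv X M C₀ i s 1 (exec off clr (S.setv 7 (S.v 7 - 1))) := by
  obtain ⟨S', hS'⟩ : ∃ S', exec off clr (S.setv 7 (S.v 7 - 1)) = S' := ⟨_, rfl⟩
  have hv : ∀ r, r ≠ 7 → r < 21 → S'.v r = S.v r := by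
    intro r h1 h2
    rw [← hS']
    have : r ≠ 21 ∧ r ≠ 22 ∧ r ≠ 23 ∧ r ≠ 24 ∧ r ≠ 25 ∧ r ≠ 26 ∧ r ≠ 27 ∧ r ≠ 28 ∧ r ≠ 29 := by omega
    simp [clr, mov, exec, this, h1]
  have h7' : S'.v 7 + 1 = S.v 7 := by
    rw [← hS']
    simp [clr, mov, exec]
    omega
  have ha : S'.a = S.a := by rw [← hS']; simp [clr, mov, exec]
  have hc : S'.cov = S.cov := by rw [← hS']; simp [clr, mov, exec]
  have hL : LeN X.V S' := by
    rw [← hS']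
    refine ((h.core.le.setv ?_).clr off).leN
    have := h.core.le.1 7 (by simp)
    omega
  rw [hS']
  clear hS'
  have hchg : ∀ {y}, Chg X M C₀ i 0 S y → Chg X M C₀ i 1 S' y := by
    intro y h
    simpa [Chg, hv, hc, h7'] using h
  have htm : ∀ {φ}, Tm X s 0 S φ → Tm X s 1 S' φ := by
    intro y h
    simpa [Tm, hv, h7'] using h
  have hlate : Late X i s S → Late X i s S' := by
    intro h; simpa [Late, hv] using h
  have hpre : Prefix X s S → Prefix X s S' := by
    intro h; simpa [Prefix, hv, ha] using h
  have hhl : HighLow X S → HighLow X S' := by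
    intro h; simpa [HighLow, hv, ha, hc] using h
  have hsel : ∀ {k ρ}, Selects X s k S ρ → Selects X s k S' ρ := by
    intro k ρ h
    exact ⟨by simpa [hv, ha, hc] using h.cov, by simpa [hv] using h.qual⟩
  have hyok : YOk X s S → YOk X s S' := by
    intro h; simpa [YOk, hv, hc] using h
  have hE : X.E S' = X.E S := by simp [Ctx.E, hv]
  have hidle : PIdle X s S → PIdle X s S' := by
    rintro ⟨a1, a2, a3, a4, a5⟩
    exact ⟨by simpa [hv] using a1, by simpa [hv] using a2, by simpa [hv] using a3,
      by simpa [hv] using a4, by simpa [hv] using a5⟩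
  obtain ⟨hcore, hpar, hph⟩ := h
  refine ⟨⟨hcore.le_m, ?_, ?_, ?_, ?_, ?_, ?_, hL, ?_⟩, ?_, ?_⟩
  · simpa [hv, ha] using hcore.fix
  · simpa [hv, ha, hc] using hcore.z
  · simpa [hv, ha, hc] using hcore.y
  · simpa [hv] using hcore.q_le
  · simpa [hv, ha] using hcore.rep
  · simpa [hv, ha] using hcore.scr
  · have := hcore.cnt; omega
  · simpa [Params, hv, hc] using hpar
  · cases hph with
    | idle _ _ h => exact absurd h h7
    | start a b c d => exact .start (hidle a) (by simpa [hv] using b) (by omega) (hchg d)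
    | clear a b c =>
      exact .clear (hlate a) ⟨by simpa [hv] using b.st, by simpa [hv] using b.qh,
        by simpa [hv] using b.j, by simpa [hv] using b.tc, hpre b.pre,
        by simpa [hv, hE] using htm b.tm⟩ (hchg c)
    | collect a b c =>
      exact .collect (hlate a) ⟨by simpa [hv] using b.st, by simpa [hv] using b.qh,
        by simpa [hv] using b.tc, hpre b.pre, by simpa [hv] using b.i_le, by simpa [hv] using b.j_le,
        hhl b.hl, by simpa [hv, ha, hc] using b.done, by simpa [hv, ha] using b.vrt,
        by simpa [ha] using b.cnt, by simpa [hv, hE] using htm b.tm⟩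
        (by simpa [hv] using hchg c)
    | scan a b c =>
      have hs : ∀ x w, Scanned X s S' x w ↔ Scanned X s S x w := by
        intro x w; simp [Scanned, hv, ha]
      exact .scan (hlate a) ⟨by simpa [hv] using b.st, by simpa [hv] using b.qh,
        by simpa [hv] using b.tc, by simpa [hv] using b.i_le, by simpa [hv] using b.a_le,
        by simpa [hv] using b.a_le', by simpa [hv] using b.z_le, by simpa [hv] using b.p_le,
        by simpa [hv] using b.p_zero, hhl b.hl, by simpa [hv, ha, hc] using b.cov,
        by simpa [hv, ha, hc, hs] using b.done, by simpa [hv, ha, hs] using b.lists,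
        by simpa [hv, ha] using b.sum_le, by simpa [hv] using b.j_le,
        by simpa [hv, hE] using htm b.tm⟩ (by simpa [hv] using hchg c)
    | emit a b c =>
      have ho : ∀ x, offs S' x = offs S x := by intro x; simp [offs, hv, ha]
      have hb : Built X s S' := ⟨by simpa [hv] using b.built.z_le, hhl b.built.hl,
        by simpa [hv, ha] using b.built.lists, by simpa [hv, ha, hc] using b.built.edges,
        by simpa [hv, ha, hE] using b.built.sum_le, by simpa [hv] using b.built.j_pos,
        by simpa [hv, hE] using b.built.j_le⟩
      exact .emit (hlate a) ⟨by simpa [hv] using b.st, by simpa [hv] using b.qh, hb,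
        by simpa [hv] using b.i_le, by simpa [hv, ha] using b.p_le, by simpa [hv, ho] using b.o_eq,
        by simpa [ha] using b.regs, by simpa [hv, ha] using b.size,
        by simpa [hv, ha, ho] using b.starts, by simpa [hv, ha, ho] using b.cells,
        by simpa [hv, ha, ho] using b.cells', by simpa [hv, ha] using b.rest,
        by simpa [hv, ha, hE] using htm b.tm⟩ (by simpa [hv] using hchg c)
    | sim a b c =>
      obtain ⟨q1, q2, μ, s', r1, r2, t, ht, r3, r4, r5, r6, r7⟩ := b
      exact .sim (hlate a) ⟨by simpa [hv] using q1, by simpa [hv] using q2, μ, s',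
        by simpa [hv] using r1, hsel r2, t, by simpa [hv] using ht, by simpa [ha] using r3,
        by simpa [ha] using r4, r5, by simpa [hv] using r6, by simpa [hv] using htm r7⟩
        (by simpa [hv] using hchg c)
    | out a b c =>
      exact .out (hlate a) ⟨by simpa [hv] using b.st, by simpa [hv] using b.qh,
        by simpa [hv] using b.i_le, by simpa [hv, ha] using hsel b.sel,
        by simpa [hv] using htm b.tm⟩ (by simpa [hv] using hchg c)
    | clean a b c =>
      exact .clean (hlate a) ⟨by simpa [hv] using b.st, by simpa [hv] using b.qh, hyok b.ok,
        by simpa [hv] using htm b.tm⟩ (by simpa [hv] using hchg c)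
    | apply a b c =>
      exact .apply (hlate a) ⟨by simpa [hv] using b.st, by simpa [hv] using b.j,
        by simpa [hv] using b.tc, hyok b.ok, htm b.tm⟩ (by simpa [hv] using hchg c)

end

/-! ### Microsteps: erasing the retired cover, collecting the current one -/

section

variable {X : Ctx} {M : ℕ} {C₀ : Set ℕ} {i s e : ℕ} {S S' : St}

theorem le_of_bijOn {n k : ℕ} {g : ℕ → ℕ} {t : Set ℕ} (h : BijOn g (Iio k) t) (ht : t ⊆ Iio n) :
    k ≤ n := by
  have := ncard_le_ncard ht
  rwa [ncard_of_bijOn h, ← Finset.coe_Iio, ncard_coe_finset, Nat.card_Iio] at this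

theorem cset_subset {n f : ℕ} {cov : ℕ → ℕ} : cset n cov f ⊆ Iio n := fun _ hx => hx.1

theorem Core.z_le (h : Core X i s e S) : S.v 10 ≤ X.n := le_of_bijOn h.z.bij cset_subset

theorem Core.j_le (h : Core X i s e S) : S.v 17 ≤ X.n := by
  refine le_of_bijOn (g := fun q => S.a 8 q 0) (t := (fun q => S.a 8 q 0) '' Iio (S.v 17))
    (InjOn.bijOn_image fun p hp q hq e => h.scr.inj hp hq e) ?_
  rintro _ ⟨q, hq, rfl⟩
  exact (h.scr.id_vrt q hq).1

theorem Ctx.Good.n_le (hX : X.Good) : 3 * X.n + 10 ≤ X.V := by have := hX.V_ge; omega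

theorem Ctx.Good.W0_le (hX : X.Good) (i : ℕ) : X.W0 i + X.K ≤ X.V := by
  have := hX.V_ge
  have h2 : X.W0 i ≤ X.C * (1 + X.n) * ((X.d + 1) * X.θ) := by
    unfold Ctx.W0
    exact Nat.mul_le_mul_right _ (Nat.mul_le_mul_left _ (Nat.add_le_add_left (hX.opt_le i) 1))
  omega

theorem Ctx.Good.K_pos (hX : X.Good) : 0 < X.K := by have := hX.hK; omega

/-- The remaining work is a short word. -/
theorem Tm.le {φ : ℕ} (h : Tm X s e S φ) (hX : X.Good) (hc : Core X i s e S) : φ ≤ X.V := by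
  have h1 := hX.W0_le (s + 1)
  have h2 := hc.cnt
  have h3 := hc.q_le
  have h4 : S.v 13 ≤ X.K * S.v 13 := Nat.le_mul_of_pos_left _ hX.K_pos
  unfold Tm at h
  omega

/-- The work of a microstep that does not touch the queue. -/
theorem Tm.step {φ φ' : ℕ} (h : Tm X s 1 S φ) (h7 : S'.v 7 = S.v 7) (h12 : S'.v 12 = S.v 12)
    (h13 : S'.v 13 = S.v 13) (hφ : φ' + 1 ≤ φ) : Tm X s 0 S' φ' := by
  unfold Tm at *; rw [h13]; omega

theorem Chg.step {y y' : ℕ} (h : Chg X M C₀ i 1 S y) (h7 : S'.v 7 = S.v 7) (h10 : S'.v 10 = S.v 10)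
    (hc : cset X.n S'.cov (S'.v 8) = cset X.n S.cov (S.v 8)) (hy : y' ≤ y + 1) :
    Chg X M C₀ i 0 S' y' := by
  unfold Chg at *; rw [hc]; omega

/-- The conclusion for a microstep. -/
def Next (X : Ctx) (M : ℕ) (C₀ : Set ℕ) (i : ℕ) (S S' : St) : Prop :=
  (∃ s, Inv X M C₀ i s 0 S') ∧ S'.v 7 ≤ S.v 7

theorem next_clear (hX : X.Good) (hc : Core X i s 1 S) (hp : Params X S) (hl : Late X i s S)
    (h : PClear X s 1 S) (hg : Chg X M C₀ i 1 S 0) :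
    Next X M C₀ i S (exec (2 * X.n + 1) blkClear S) := by
  have hV := hX.n_le
  by_cases h11 : S.v 11 = 0
  · have e : exec (2 * X.n + 1) blkClear S = (S.setv 9 2).setv 14 0 := by
      simp [blkClear, exec, mov, Opd.val, WordOp.eval, h11]
    rw [e]
    refine ⟨⟨s, ⟨hc.le_m, by simpa using hc.fix, by simpa using hc.z, by simpa using hc.y,
      by simpa using hc.q_le, by simpa using hc.rep, by simpa using hc.scr,
      (hc.le.setv (by omega)).setv (by omega), by have := hc.cnt; simp; omega⟩,
      by simpa [Params] using hp, ?_⟩, by simp⟩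
    have hy : cset X.n S.cov (1 - S.v 8) = ∅ := by
      have := hc.y
      rw [h11] at this
      simpa [eq_comm] using this.image_eq
    refine .collect (by simpa [Late] using hl) ?_ (hg.step (by simp) (by simp) (by simp) (by simp [h11]))
    exact {
      st := by simp
      qh := by simpa using h.qh
      tc := by simpa using h.tc
      pre := by simpa [Prefix] using h.pre
      i_le := by simp
      j_le := by simp [h.j]
      hl := by simp [HighLow, hy, h.j]
      done := by simp
      vrt := by simp [h.j]
      cnt := fun x => by simpa using hc.scr.cnt x (by simp [h.j])
      tm := h.tm.step (by simp) (by simp) (by simp) (by simp [Ctx.E]) }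
  · obtain ⟨k, hk⟩ := Nat.exists_eq_succ_of_ne_zero h11
    obtain ⟨x, hx⟩ : ∃ x, S.a 3 (1 - S.v 8) k = x := ⟨_, rfl⟩
    have hy := hc.y
    rw [hk] at hy
    have hxn : x < X.n := hx ▸ (hy.1 (by simp)).1
    have hF := hc.fix.f_le
    have hmod : ((1 - S.v 8) * X.n + 1 + x) % (2 * X.n + 1) = 1 + (1 - S.v 8) * X.n + x := by
      rw [Nat.mod_eq_of_lt, add_comm _ 1]
      have : (1 - S.v 8) * X.n ≤ 1 * X.n := Nat.mul_le_mul_right _ (by omega)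
      omega
    have e : exec (2 * X.n + 1) blkClear S = ((((((S.setv 11 k).setv 27 (1 - S.v 8)).setv 21 x).setv
        28 ((1 - S.v 8) * X.n)).setv 28 ((1 - S.v 8) * X.n + 1)).setv 28
        ((1 - S.v 8) * X.n + 1 + x)).setc (1 + (1 - S.v 8) * X.n + x) 0 := by
      simp [blkClear, exec, dec, inc, Opd.val, WordOp.eval, hk, hx, hc.fix.n_eq, hmod]
    have hz : cset X.n (Function.update S.cov (1 + (1 - S.v 8) * X.n + x) 0) (S.v 8) =
        cset X.n S.cov (S.v 8) := cset_update_other hxn (by omega) hF (by omega)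
    rw [e]
    refine ⟨⟨s, ⟨hc.le_m, by simpa using hc.fix, ?_, ?_,
      by simpa using hc.q_le, by simpa using hc.rep, by simpa using hc.scr,
      ?_, by have := hc.cnt; simp; omega⟩,
      ⟨by simpa using hp.1, by
        have h0 : 0 ≠ 1 + (1 - S.v 8) * X.n + x := by omega
        simpa [h0] using hp.2⟩, ?_⟩,
      by simp⟩
    · have := hc.z
      exact ⟨by simpa [hz] using this.bij, by simpa [hz] using this.vc, by simpa using this.qual,
        by simpa using this.coarse⟩
    · have := bijOn_pop hy
      simpa [cset_update_zero, ← hx] using this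
    · refine LeN.setc ?_ (by omega)
      refine LeN.tmp ?_ (by simp)
      refine LeN.tmp ?_ (by simp)
      refine LeN.tmp ?_ (by simp)
      refine LeN.tmp ?_ (by simp)
      refine LeN.tmp ?_ (by simp)
      refine LeN.setv hc.le ?_
      have := hc.le.1 11 (by simp)
      omega
    · refine .clear (by simpa [Late] using hl) ?_ (hg.step (by simp) (by simp) (by simpa using hz)
        (by simp))
      exact {
        st := by simpa using h.st
        qh := by simpa using h.qh
        j := by simpa using h.j
        tc := by simpa using h.tc
        pre := by simpa [Prefix] using h.pre
        tm := h.tm.step (by simp) (by simp) (by simp) (by simp [Ctx.E]; omega) }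

theorem Core.deg_eq (hc : Core X i s e S) (h12 : S.v 12 = 1) (x : ℕ) :
    X.deg (s + 1) x = S.a 0 x 0 := by
  have := hc.rep.deg_eq x
  rwa [h12] at this

/-- Adding a vertex to the new cover preserves what always holds. -/
theorem AddsY.core {x : ℕ} (h : AddsY X.n S S' x) (hX : X.Good) (hc : Core X i s 1 S) :
    Core X i s 0 S' := by
  have hv := h.v
  have ha := h.a
  refine ⟨hc.le_m, ?_, ?_, ?_, ?_, ?_, ?_, ?_, ?_⟩
  · simpa [hv, ha] using hc.fix
  · have := hc.z
    have hz := h.zs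
    exact ⟨by simpa [hv, hz, h.row] using this.bij, by simpa [hv, hz] using this.vc,
      by simpa [hv] using this.qual, by simpa [hv] using this.coarse⟩
  · simpa [hv] using h.bij
  · simpa [hv] using hc.q_le
  · simpa [hv, ha] using hc.rep
  · simpa [hv, ha] using hc.scr
  · exact h.leN _ (by have := hX.n_le; omega) (by have := hX.n_le; omega) hc.le
  · have := hc.cnt
    simp [hv]
    omega

theorem AddsY.params {x : ℕ} (h : AddsY X.n S S' x) (hp : Params X S) : Params X S' := by
  have hv := h.v
  have hc := h.cov
  simpa [Params, hv, hc] using hp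

theorem next_collect (hX : X.Good) (hc : Core X i s 1 S) (hp : Params X S) (hl : Late X i s S)
    (h : PCollect X s 1 S) (hg : Chg X M C₀ i 1 S (S.v 11)) :
    Next X M C₀ i S (exec (2 * X.n + 1) blkCollect S) := by
  have hV := hX.n_le
  have hzn := hc.z_le
  have hpre := h.pre.1
  have hi := h.i_le
  by_cases hlt : S.v 14 < S.v 20
  · obtain ⟨x, hx⟩ : ∃ x, S.a 3 (S.v 8) (S.v 14) = x := ⟨_, rfl⟩
    have hxz := hc.z.bij.1 (show S.v 14 ∈ Iio (S.v 10) by simp only [mem_Iio]; omega)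
    rw [hx] at hxz
    have hxn : x < X.n := hxz.1
    by_cases hd : X.d < S.a 0 x 0
    · obtain ⟨S1, hS1⟩ : ∃ S1, S1 = ((S.setv 21 x).setv 14 (S.v 14 + 1)).setv 22 (S.a 0 x 0) :=
        ⟨_, rfl⟩
      have e : exec (2 * X.n + 1) blkCollect S = exec (2 * X.n + 1) (addY 21) S1 := by
        simp [blkCollect, exec, inc, Opd.val, WordOp.eval, hlt, hx, hp.1, hd, hS1]
      have hc1 : Core X i s 1 S1 := by
        subst hS1
        exact ⟨hc.le_m, by simpa using hc.fix, by simpa using hc.z, by simpa using hc.y,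
          by simpa using hc.q_le, by simpa using hc.rep, by simpa using hc.scr,
          ((hc.le.tmp (by simp)).setv (by omega)).tmp (by simp), by simpa using hc.cnt⟩
      have hp1 : Params X S1 := by subst hS1; simpa [Params] using hp
      have v21 : S1.v 21 = x := by simp [hS1]
      have hA := exec_addY (x := 21) hc1.fix.n_eq hc1.fix.f_le (by rw [v21]; exact hxn) (by simp) hc1.y
      rw [v21, ← e] at hA
      obtain ⟨S', hS'⟩ : ∃ S', exec (2 * X.n + 1) blkCollect S = S' := ⟨_, rfl⟩
      rw [hS'] at hA ⊢
      have hv := hA.v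
      have ha := hA.a
      have hrow : S'.a 3 (S.v 8) = S.a 3 (S.v 8) := by simpa [hS1] using hA.row
      have hys : cset X.n S'.cov (1 - S.v 8) = insert x (cset X.n S.cov (1 - S.v 8)) := by
        simpa [hS1] using hA.ys
      have hzs : cset X.n S'.cov (S.v 8) = cset X.n S.cov (S.v 8) := by simpa [hS1] using hA.zs
      have hle := hA.le
      have w : ∀ r, r ≠ 11 → r ≠ 14 → r < 21 → S'.v r = S.v r := by
        intro r h1 h2 h3
        have h4 : r ≠ 21 ∧ r ≠ 22 := by omega
        rw [hv r h1 (by omega) (by omega) (by omega), hS1]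
        simp [h2, h4]
      have wa : ∀ k, k ≠ 3 → S'.a k = S.a k := by
        intro k hk; rw [ha k hk, hS1]; simp
      have w14 : S'.v 14 = S.v 14 + 1 := by simp [hv, hS1]
      refine ⟨⟨s, hA.core hX hc1, hA.params hp1, ?_⟩, by simp [hv, hS1]⟩
      refine .collect (by simpa [Late, hv, hS1] using hl) ?_
        (hg.step (by simp [hv, hS1]) (by simp [hv, hS1]) (by simpa [hv, hS1] using hzs)
          (by simpa [hS1] using hle))
      exact {
        st := by simpa [hv, hS1] using h.st
        qh := by simpa [hv, hS1] using h.qh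
        tc := by simpa [hv, hS1] using h.tc
        pre := by simpa [Prefix, hv, hS1, hrow] using h.pre
        i_le := by simp [hv, hS1]; omega
        j_le := by have := h.j_le; simp [hv, hS1]; omega
        hl := by
          simpa [HighLow, w, wa, hys, hd] using h.hl
        done := by
          intro q hq
          have hq' : q < S.v 14 + 1 := by simpa [hv, hS1] using hq
          rw [w 8 (by simp) (by simp) (by simp), w 17 (by simp) (by simp) (by simp), wa 8 (by simp),
            hrow, hys]
          by_cases hqi : q = S.v 14
          · left; rw [hqi, hx]; simp
          · rcases h.done q (by omega) with h1 | h1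
            · left; exact Or.inr h1
            · right; exact h1
        vrt := by
          intro k hk
          obtain ⟨q, hq, h1⟩ := h.vrt k (by simpa [hv, hS1] using hk)
          exact ⟨q, by simp [hv, hS1]; omega, by simpa [hv, hS1, ha, hrow] using h1⟩
        cnt := by simpa [ha, hS1] using h.cnt
        tm := h.tm.step (by simp [hv, hS1]) (by simp [hv, hS1]) (by simp [hv, hS1])
          (by simp [Ctx.E, hv, hS1]; omega) }
    · have e : exec (2 * X.n + 1) blkCollect S = ((((((S.setv 21 x).setv 14 (S.v 14 + 1)).setv 22
          (S.a 0 x 0)).seta 8 (S.v 17) 0 x).setv 17 (S.v 17 + 1)).seta 5 x 0 (S.v 17 + 1)) := by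
        simp [blkCollect, exec, inc, Opd.val, WordOp.eval, hlt, hx, hp.1, hd]
      -- The current cover is enumerated without repetition, so no earlier position can have given
      -- this vertex a number.
      have hvx : ∀ k < S.v 17, S.a 8 k 0 ≠ x := by
        intro k hk he
        obtain ⟨q, hq, h1⟩ := h.vrt k hk
        have := hc.z.bij.2.1 (show q ∈ Iio (S.v 10) by simp only [mem_Iio]; omega)
          (show S.v 14 ∈ Iio (S.v 10) by simp only [mem_Iio]; omega) (by rw [h1, he, hx])
        omega
      have hid : S.a 5 x 0 = 0 := by
        by_contra hne
        obtain ⟨k, hk, h1⟩ := hc.scr.vrt_id x hne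
        exact hvx k hk h1
      have hj := h.j_le
      rw [e]
      refine ⟨⟨s, ⟨hc.le_m, by simpa using hc.fix, by simpa using hc.z, by simpa using hc.y,
        by simpa using hc.q_le, by simpa using hc.rep, by simpa using hc.scr.alloc hxn hid, ?_,
        by have := hc.cnt; simp; omega⟩, by simpa [Params] using hp, ?_⟩, by simp⟩
      · refine LeN.seta (LeN.setv (LeN.seta ?_ (by omega)) (by omega)) (by omega)
        exact ((hc.le.tmp (by simp)).setv (by omega)).tmp (by simp)
      · refine .collect (by simpa [Late] using hl) ?_
          (hg.step (by simp) (by simp) (by simp) (by simp))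
        have hup : ∀ k, k ≠ S.v 17 → Function.update (S.a 8) (S.v 17)
            (Function.update (S.a 8 (S.v 17)) 0 x) k = S.a 8 k := fun k hk => by simp [hk]
        exact {
          st := by simpa using h.st
          qh := by simpa using h.qh
          tc := by simpa using h.tc
          pre := by simpa [Prefix] using h.pre
          i_le := by simp; omega
          j_le := by simp; omega
          hl := by
            refine ⟨by simpa using h.hl.1, fun q hq => ?_⟩
            have hq' : q < S.v 17 + 1 := by simpa using hq
            by_cases hqj : q = S.v 17
            · subst hqj; simpa using hd
            · simpa [hqj] using h.hl.2 q (by omega)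
          done := by
            intro q hq
            have hq' : q < S.v 14 + 1 := by simpa using hq
            by_cases hqi : q = S.v 14
            · right
              subst hqi
              exact ⟨S.v 17, by simp, by simp [hx]⟩
            · rcases h.done q (by omega) with h1 | ⟨k, hk, h1⟩
              · left; simpa using h1
              · right; exact ⟨k, by simp; omega, by simpa [hk.ne] using h1⟩
          vrt := by
            intro k hk
            have hk' : k < S.v 17 + 1 := by simpa using hk
            by_cases hkj : k = S.v 17
            · subst hkj
              exact ⟨S.v 14, by simp, by simp [hx]⟩
            · obtain ⟨q, hq, h1⟩ := h.vrt k (by omega)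
              exact ⟨q, by simp; omega, by simpa [hkj] using h1⟩
          cnt := by simpa using h.cnt
          tm := h.tm.step (by simp) (by simp) (by simp) (by simp [Ctx.E]; omega) }
  · have e : exec (2 * X.n + 1) blkCollect S =
        (((S.setv 16 (S.v 17)).setv 14 0).setv 15 0).setv 9 3 := by
      simp [blkCollect, exec, mov, Opd.val, WordOp.eval, hlt]
    have hi20 : S.v 14 = S.v 20 := by omega
    have hj := h.j_le
    rw [e]
    refine ⟨⟨s, ⟨hc.le_m, by simpa using hc.fix, by simpa using hc.z, by simpa using hc.y,
      by simpa using hc.q_le, by simpa using hc.rep, by simpa using hc.scr, ?_,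
      by have := hc.cnt; simp; omega⟩, by simpa [Params] using hp, ?_⟩, by simp⟩
    · exact (((hc.le.setv (hc.le.1 17 (by simp))).setv (by omega)).setv (by omega)).setv (by omega)
    · refine .scan (by simpa [Late] using hl) ?_ (hg.step (by simp) (by simp) (by simp) (by simp))
      exact {
        st := by simp
        qh := by simpa using h.qh
        tc := by simpa using h.tc
        i_le := by simp
        a_le := by simp
        a_le' := by simp; omega
        z_le := by simpa using hpre
        p_le := by simp
        p_zero := by simp
        hl := by simpa [HighLow] using h.hl
        cov := by
          intro x y hxy
          suffices x ∈ cset X.n S.cov (1 - S.v 8) ∨ y ∈ cset X.n S.cov (1 - S.v 8) ∨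
              (∃ k < S.v 17, S.a 8 k 0 = x) ∨ ∃ k < S.v 17, S.a 8 k 0 = y by simpa using this
          obtain ⟨q, hq, h1 | h1⟩ := h.pre.2 x y hxy
          · rcases h.done q (by omega) with h2 | h2
            · exact .inl (h1 ▸ h2)
            · exact .inr (.inr (.inl (h1 ▸ h2)))
          · rcases h.done q (by omega) with h2 | h2
            · exact .inr (.inl (h1 ▸ h2))
            · exact .inr (.inr (.inr (h1 ▸ h2)))
        done := by
          intro x _ w hw
          simp [Scanned] at hw
        lists := by
          intro x hx
          have h0 := h.cnt x
          simp [Scanned, h0]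
        sum_le := by simp [sumCnt, h.cnt]
        j_le := by simp
        tm := by
          refine h.tm.step (by simp) (by simp) (by simp) ?_
          -- Of the nine fixed units per element of `X.E S`, one pays for the whole scan.
          have : S.v 17 * (X.d + 1) ≤ S.v 20 * (X.d + 1) := Nat.mul_le_mul_right _ (by omega)
          suffices S.v 17 * (X.d + 1) + (8 + 2 * X.θ) * (S.v 20 * (X.d + 1)) + 8 + 1 ≤
              S.v 20 - S.v 14 + (9 + 2 * X.θ) * (S.v 20 * (X.d + 1)) + 9 by simpa [Ctx.E] using this
          have e1 : (9 + 2 * X.θ) * (S.v 20 * (X.d + 1)) =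
            S.v 20 * (X.d + 1) + (8 + 2 * X.θ) * (S.v 20 * (X.d + 1)) := by ring
          omega }

end

/-! ### Scanning the neighbours of low vertices of the cover -/

/-- The edge from the vertex number `x` to `w` is among the scanned ones: all edges from the vertices
number `0`, …, `i - 1`, and the first `p` of the vertex number `i`. -/
def Sc (R : ℕ → ℕ → Prop) (pos vrt : ℕ → ℕ → ℕ) (i p x w : ℕ) : Prop :=
  R (vrt x 0) w ∧ (x < i ∨ x = i ∧ pos (vrt x 0) w < p)

/-- The lists of the static instance hold the scanned edges. -/
def ListsOk (R : ℕ → ℕ → Prop) (pos vrt cnt itm : ℕ → ℕ → ℕ) (a j i p : ℕ) : Prop :=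
  ∀ x < j, BijOn (itm x) (Iio (cnt x 0)) {y | y < j ∧
    ((x < a ∧ a ≤ y ∧ Sc R pos vrt i p x (vrt y 0)) ∨ (y < a ∧ Sc R pos vrt i p y (vrt x 0)))}

section

variable {R : ℕ → ℕ → Prop} {pos vrt cnt itm : ℕ → ℕ → ℕ} {a j i p w : ℕ}

/-- A vertex gets a number when it is first met. Since no scanned edge leads to it, its list is
rightly empty and no other list changes. -/
theorem ListsOk.alloc (h : ListsOk R pos vrt cnt itm a j i p) (haj : a ≤ j) (hcnt : cnt j 0 = 0)
    (hw : ∀ y < a, ¬ Sc R pos vrt i p y w) :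
    ListsOk R pos (Function.update vrt j (Function.update (vrt j) 0 w)) cnt itm a (j + 1) i p := by
  have hsc : ∀ y < a, ∀ w', Sc R pos (Function.update vrt j (Function.update (vrt j) 0 w)) i p y w' ↔
      Sc R pos vrt i p y w' := by
    intro y hy w'
    have : y ≠ j := by omega
    simp [Sc, this]
  intro x hx
  by_cases hxj : x = j
  · subst hxj
    rw [hcnt]
    have : {y | y < x + 1 ∧ ((x < a ∧ a ≤ y ∧ Sc R pos (Function.update vrt x
        (Function.update (vrt x) 0 w)) i p x ((Function.update vrt x
        (Function.update (vrt x) 0 w)) y 0)) ∨ (y < a ∧ Sc R pos (Function.update vrt x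
        (Function.update (vrt x) 0 w)) i p y ((Function.update vrt x
        (Function.update (vrt x) 0 w)) x 0)))} = ∅ := by
      ext y
      simp only [mem_ofPred_eq, mem_empty_iff_false, iff_false, not_and, not_or]
      intro _
      refine ⟨fun h => by omega, fun hy => ?_⟩
      rw [hsc y hy]
      simpa using hw y hy
    rw [this]
    simp
  · have hx' : x < j := by omega
    convert h x hx' using 1
    ext y
    simp only [mem_ofPred_eq]
    by_cases hyj : y = j
    · subst hyj
      constructor
      · rintro ⟨-, ⟨h1, h2, h3⟩ | ⟨h1, -⟩⟩
        · rw [hsc x h1] at h3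
          exact absurd (by simpa using h3) (hw x h1)
        · omega
      · rintro ⟨h, -⟩; omega
    · constructor
      · rintro ⟨h0, ⟨h1, h2, h3⟩ | ⟨h1, h2⟩⟩
        · rw [hsc x h1] at h3
          exact ⟨by omega, .inl ⟨h1, h2, by simpa [hyj] using h3⟩⟩
        · rw [hsc y h1] at h2
          exact ⟨by omega, .inr ⟨h1, by simpa [hxj] using h2⟩⟩
      · rintro ⟨h0, ⟨h1, h2, h3⟩ | ⟨h1, h2⟩⟩
        · exact ⟨by omega, .inl ⟨h1, h2, by rw [hsc x h1]; simpa [hyj] using h3⟩⟩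
        · exact ⟨by omega, .inr ⟨h1, by rw [hsc y h1]; simpa [hxj] using h2⟩⟩

/-- Which edges are scanned after the next one. -/
theorem sc_succ (hR : R (vrt i 0) w) (hp : pos (vrt i 0) w = p)
    (hinj : ∀ w', R (vrt i 0) w' → pos (vrt i 0) w' = p → w' = w) (x w' : ℕ) :
    Sc R pos vrt i (p + 1) x w' ↔ Sc R pos vrt i p x w' ∨ x = i ∧ w' = w := by
  unfold Sc
  constructor
  · rintro ⟨h1, h2 | ⟨rfl, h2⟩⟩
    · exact .inl ⟨h1, .inl h2⟩
    · by_cases h3 : pos (vrt x 0) w' = p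
      · exact .inr ⟨rfl, hinj w' h1 h3⟩
      · exact .inl ⟨h1, .inr ⟨rfl, by omega⟩⟩
  · rintro (⟨h1, h2 | ⟨rfl, h2⟩⟩ | ⟨rfl, rfl⟩)
    · exact ⟨h1, .inl h2⟩
    · exact ⟨h1, .inr ⟨rfl, by omega⟩⟩
    · exact ⟨hR, .inr ⟨rfl, by omega⟩⟩

/-- Appending `y` to the list of `x`. -/
def pushCnt (cnt : ℕ → ℕ → ℕ) (x : ℕ) : ℕ → ℕ → ℕ :=
  Function.update cnt x (Function.update (cnt x) 0 (cnt x 0 + 1))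

def pushItm (cnt itm : ℕ → ℕ → ℕ) (x y : ℕ) : ℕ → ℕ → ℕ :=
  Function.update itm x (Function.update (itm x) (cnt x 0) y)

theorem sumCnt_push {x : ℕ} (hx : x < j) : sumCnt (pushCnt cnt x) j = sumCnt cnt j + 1 := by
  unfold sumCnt
  rw [← Finset.add_sum_erase _ _ (Finset.mem_range.2 hx),
    ← Finset.add_sum_erase (Finset.range j) (fun x => cnt x 0) (Finset.mem_range.2 hx)]
  have : ∑ y ∈ (Finset.range j).erase x, pushCnt cnt x y 0 =
      ∑ y ∈ (Finset.range j).erase x, cnt y 0 := by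
    refine Finset.sum_congr rfl fun y hy => ?_
    have : y ≠ x := (Finset.mem_erase.1 hy).1
    simp [pushCnt, this]
  rw [this]
  simp [pushCnt]
  omega

theorem bijOn_pushItm {x y z : ℕ} {t : ℕ → Set ℕ} (h : BijOn (itm z) (Iio (cnt z 0)) (t z))
    (hy : z = x → y ∉ t x) :
    BijOn (pushItm cnt itm x y z) (Iio (pushCnt cnt x z 0)) {v | v ∈ t z ∨ z = x ∧ v = y} := by
  by_cases hz : z = x
  · subst hz
    have := bijOn_push h (hy rfl)
    have e : {v | v ∈ t z ∨ z = z ∧ v = y} = insert y (t z) := by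
      ext v; simp [or_comm]
    rw [e]
    simpa [pushItm, pushCnt] using this
  · have e : {v | v ∈ t z ∨ z = x ∧ v = y} = t z := by
      ext v; simp [hz]
    rw [e]
    simpa [pushItm, pushCnt, hz] using h

/-- The lists after scanning the edge from the vertex number `i` to the vertex number `k`. -/
theorem ListsOk.scan {k : ℕ} (h : ListsOk R pos vrt cnt itm a j i p) (hia : i < a) (haj : a ≤ j)
    (hk : k < j) (hinjv : ∀ x < j, vrt x 0 = vrt k 0 → x = k)
    (hR : R (vrt i 0) (vrt k 0)) (hp : pos (vrt i 0) (vrt k 0) = p)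
    (hinj : ∀ w', R (vrt i 0) w' → pos (vrt i 0) w' = p → w' = vrt k 0) :
    (k < a → ListsOk R pos vrt (pushCnt cnt k) (pushItm cnt itm k i) a j i (p + 1)) ∧
    (a ≤ k → ListsOk R pos vrt (pushCnt (pushCnt cnt k) i)
      (pushItm (pushCnt cnt k) (pushItm cnt itm k i) i k) a j i (p + 1)) := by
  have hsc := sc_succ hR hp hinj
  -- The edge at position `p` has not been scanned yet, so the entries pushed for it are new and the
  -- lists stay free of repetitions.
  have hno : ¬ Sc R pos vrt i p i (vrt k 0) := by
    rintro ⟨-, h | ⟨-, h⟩⟩ <;> omega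
  have h1 : ∀ x < j, BijOn (pushItm cnt itm k i x) (Iio (pushCnt cnt k x 0))
      {y | y ∈ {y | y < j ∧ ((x < a ∧ a ≤ y ∧ Sc R pos vrt i p x (vrt y 0)) ∨
        (y < a ∧ Sc R pos vrt i p y (vrt x 0)))} ∨ x = k ∧ y = i} := by
    intro x hx
    refine bijOn_pushItm (t := fun x => {y | y < j ∧ ((x < a ∧ a ≤ y ∧ Sc R pos vrt i p x (vrt y 0)) ∨
        (y < a ∧ Sc R pos vrt i p y (vrt x 0)))}) (h x hx) ?_
    rintro rfl ⟨-, ⟨-, h2, -⟩ | ⟨-, h2⟩⟩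
    · omega
    · exact hno h2
  constructor
  · intro hka x hx
    convert h1 x hx using 1
    ext y
    simp only [mem_ofPred_eq, hsc]
    constructor
    · rintro ⟨h0, ⟨h2, h3, h4 | ⟨rfl, h5⟩⟩ | ⟨h2, h3 | ⟨rfl, h4⟩⟩⟩
      · exact .inl ⟨h0, .inl ⟨h2, h3, h4⟩⟩
      · have := hinjv y h0 h5; omega
      · exact .inl ⟨h0, .inr ⟨h2, h3⟩⟩
      · exact .inr ⟨hinjv x hx h4, rfl⟩
    · rintro (⟨h0, ⟨h2, h3, h4⟩ | ⟨h2, h3⟩⟩ | ⟨rfl, rfl⟩)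
      · exact ⟨h0, .inl ⟨h2, h3, .inl h4⟩⟩
      · exact ⟨h0, .inr ⟨h2, .inl h3⟩⟩
      · exact ⟨by omega, .inr ⟨hia, .inr ⟨rfl, rfl⟩⟩⟩
  · intro hka x hx
    have h2 := bijOn_pushItm (x := i) (y := k) (t := fun x => {y | y ∈ {y | y < j ∧
      ((x < a ∧ a ≤ y ∧ Sc R pos vrt i p x (vrt y 0)) ∨
        (y < a ∧ Sc R pos vrt i p y (vrt x 0)))} ∨ x = k ∧ y = i}) (h1 x hx) (by
      rintro rfl (⟨-, ⟨-, -, h2⟩ | ⟨h2, -⟩⟩ | ⟨h2, -⟩)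
      · exact hno h2
      · omega
      · omega)
    convert h2 using 1
    ext y
    simp only [mem_ofPred_eq, hsc]
    constructor
    · rintro ⟨h0, ⟨h2, h3, h4 | ⟨rfl, h5⟩⟩ | ⟨h2, h3 | ⟨rfl, h4⟩⟩⟩
      · exact .inl (.inl ⟨h0, .inl ⟨h2, h3, h4⟩⟩)
      · exact .inr ⟨rfl, hinjv y h0 h5⟩
      · exact .inl (.inl ⟨h0, .inr ⟨h2, h3⟩⟩)
      · exact .inl (.inr ⟨hinjv x hx h4, rfl⟩)
    · rintro ((⟨h0, ⟨h2, h3, h4⟩ | ⟨h2, h3⟩⟩ | ⟨rfl, rfl⟩) | ⟨rfl, rfl⟩)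
      · exact ⟨h0, .inl ⟨h2, h3, .inl h4⟩⟩
      · exact ⟨h0, .inr ⟨h2, .inl h3⟩⟩
      · exact ⟨by omega, .inr ⟨hia, .inr ⟨rfl, rfl⟩⟩⟩
      · exact ⟨hk, .inl ⟨hia, hka, .inr ⟨rfl, rfl⟩⟩⟩

end

/-! ### Microsteps: scanning the neighbours of low cover vertices -/

section

variable {X : Ctx} {M : ℕ} {C₀ : Set ℕ} {i s e : ℕ} {S S' : St}

theorem scanned_iff {x w : ℕ} : Scanned X s S x w ↔
    Sc (X.A (s + 1)) (S.a 2) (S.a 8) (S.v 14) (S.v 15) x w := Iff.rfl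

theorem PScan.listsOk (h : PScan X s e S) :
    ListsOk (X.A (s + 1)) (S.a 2) (S.a 8) (S.a 6) (S.a 7) (S.v 16) (S.v 17) (S.v 14) (S.v 15) :=
  h.lists

theorem next_scan_row (hX : X.Good) (hc : Core X i s 1 S) (hp : Params X S) (hl : Late X i s S)
    (h : PScan X s 1 S) (hg : Chg X M C₀ i 1 S (S.v 11)) (hi : S.v 14 < S.v 16)
    (hd : S.a 0 (S.a 8 (S.v 14) 0) 0 ≤ S.v 15) :
    Next X M C₀ i S (exec (2 * X.n + 1) blkScan S) := by
  have hV := hX.n_le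
  have hjn := hc.j_le
  have haj := h.a_le
  have e : exec (2 * X.n + 1) blkScan S = (((S.setv 21 (S.a 8 (S.v 14) 0)).setv 22
      (S.a 0 (S.a 8 (S.v 14) 0) 0)).setv 15 0).setv 14 (S.v 14 + 1) := by
    simp [blkScan, exec, inc, mov, Opd.val, WordOp.eval, hi, not_lt.2 hd]
  have hrep := hc.rep
  rw [h.qh] at hrep
  -- At the end of a row, all positions of its neighbours are below the counter. So moving to
  -- position `0` of the next row describes the same set of scanned edges.
  have hsc : ∀ x w, Sc (X.A (s + 1)) (S.a 2) (S.a 8) (S.v 14 + 1) 0 x w ↔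
      Sc (X.A (s + 1)) (S.a 2) (S.a 8) (S.v 14) (S.v 15) x w := by
    intro x w
    unfold Sc
    refine and_congr_right fun hR => ⟨?_, ?_⟩
    · rintro (h1 | h1)
      · by_cases hx : x = S.v 14
        · subst hx
          exact .inr ⟨rfl, (hrep.1 _ _ hR).1.trans_le hd⟩
        · left; omega
      · omega
    · rintro (h1 | h1)
      · left; omega
      · left; omega
  rw [e]
  refine ⟨⟨s, ⟨hc.le_m, by simpa using hc.fix, by simpa using hc.z, by simpa using hc.y,
    by simpa using hc.q_le, by simpa using hc.rep, by simpa using hc.scr, ?_,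
    by have := hc.cnt; simp; omega⟩, by simpa [Params] using hp, ?_⟩, by simp⟩
  · exact (((hc.le.tmp (by simp)).tmp (by simp)).setv (by omega)).setv (by omega)
  · refine .scan (by simpa [Late] using hl) ?_ (hg.step (by simp) (by simp) (by simp) (by simp))
    exact {
      st := by simpa using h.st
      qh := by simpa using h.qh
      tc := by simpa using h.tc
      i_le := by simp; omega
      a_le := by simpa using h.a_le
      a_le' := by simpa using h.a_le'
      z_le := by simpa using h.z_le
      p_le := by simp
      p_zero := by simp
      hl := by simpa [HighLow] using h.hl
      cov := by simpa using h.cov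
      done := by
        have := h.done
        simp only [scanned_iff] at this ⊢
        simpa [hsc] using this
      lists := by
        have := h.lists
        simp only [scanned_iff] at this ⊢
        simpa [hsc] using this
      sum_le := by
        have := h.sum_le
        have := h.p_le
        suffices sumCnt (S.a 6) (S.v 17) ≤ 2 * ((S.v 14 + 1) * X.d) by simpa using this
        have e1 : (S.v 14 + 1) * X.d = S.v 14 * X.d + X.d := Nat.succ_mul _ _
        omega
      j_le := by
        have := h.j_le
        have := h.p_le
        suffices S.v 17 ≤ S.v 16 + (S.v 14 + 1) * X.d by simpa using this
        have e1 : (S.v 14 + 1) * X.d = S.v 14 * X.d + X.d := Nat.succ_mul _ _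
        omega
      tm := by
        refine h.tm.step (by simp) (by simp) (by simp) ?_
        have := h.p_le
        suffices (S.v 16 - (S.v 14 + 1)) * (X.d + 1) + (8 + 2 * X.θ) * X.E S + 8 + 1 ≤
          (S.v 16 - S.v 14) * (X.d + 1) - S.v 15 + (8 + 2 * X.θ) * X.E S + 8 by
          simpa [Ctx.E] using this
        have e1 : (S.v 16 - S.v 14) * (X.d + 1) =
          (S.v 16 - (S.v 14 + 1)) * (X.d + 1) + (X.d + 1) := by
          rw [show S.v 16 - S.v 14 = S.v 16 - (S.v 14 + 1) + 1 by omega]; ring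
        omega }

theorem next_scan_high (hX : X.Good) (hc : Core X i s 1 S) (hp : Params X S) (hl : Late X i s S)
    (h : PScan X s 1 S) (hg : Chg X M C₀ i 1 S (S.v 11)) (hi : S.v 14 < S.v 16) {z w : ℕ}
    (hz : S.a 8 (S.v 14) 0 = z) (hd : S.v 15 < S.a 0 z 0) (hw : S.a 1 z (S.v 15) = w)
    (hh : X.d < S.a 0 w 0) :
    Next X M C₀ i S (exec (2 * X.n + 1) blkScan S) := by
  have hV := hX.n_le
  have hjn := hc.j_le
  have haj := h.a_le
  have hrep := hc.rep
  rw [h.qh] at hrep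
  have hzd : S.a 0 z 0 ≤ X.d := hz ▸ h.hl.2 _ (by omega)
  obtain ⟨hR, hpos⟩ := hrep.2 z _ hd
  rw [hw] at hR hpos
  have hwn := (hX.A_lt _ _ _ hR).2
  have hsc := sc_succ (R := X.A (s + 1)) (pos := S.a 2) (vrt := S.a 8) (hz ▸ hR) (hz ▸ hpos) (by
    intro w' h1 h2
    have := (hrep.1 _ _ h1).2
    rw [h2, hz, hw] at this
    exact this.symm)
  obtain ⟨S1, hS1⟩ : ∃ S1, S1 = ((((S.setv 21 z).setv 22 (S.a 0 z 0)).setv 23 w).setv 15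
      (S.v 15 + 1)).setv 24 (S.a 0 w 0) := ⟨_, rfl⟩
  have e : exec (2 * X.n + 1) blkScan S = exec (2 * X.n + 1) (addY 23) S1 := by
    simp [blkScan, exec, inc, Opd.val, WordOp.eval, hi, hz, hd, hw, hp.1, hh, hS1]
  have hc1 : Core X i s 1 S1 := by
    subst hS1
    refine ⟨hc.le_m, by simpa using hc.fix, by simpa using hc.z, by simpa using hc.y,
      by simpa using hc.q_le, by simpa using hc.rep, by simpa using hc.scr, ?_,
      by simpa using hc.cnt⟩
    have := hX.V_ge
    exact ((((hc.le.tmp (by simp)).tmp (by simp)).tmp (by simp)).setv (by omega)).tmp (by simp)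
  have hp1 : Params X S1 := by subst hS1; simpa [Params] using hp
  have v23 : S1.v 23 = w := by simp [hS1]
  have hA := exec_addY (x := 23) hc1.fix.n_eq hc1.fix.f_le (by rw [v23]; exact hwn) (by simp) hc1.y
  rw [v23, ← e] at hA
  obtain ⟨S', hS'⟩ : ∃ S', exec (2 * X.n + 1) blkScan S = S' := ⟨_, rfl⟩
  rw [hS'] at hA ⊢
  have hv := hA.v
  have hys : cset X.n S'.cov (1 - S.v 8) = insert w (cset X.n S.cov (1 - S.v 8)) := by
    simpa [hS1] using hA.ys
  have hzs : cset X.n S'.cov (S.v 8) = cset X.n S.cov (S.v 8) := by simpa [hS1] using hA.zs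
  have hle := hA.le
  have v : ∀ r, r ≠ 11 → r ≠ 15 → r < 21 → S'.v r = S.v r := by
    intro r h1 h2 h3
    have h4 : r ≠ 21 ∧ r ≠ 22 ∧ r ≠ 23 ∧ r ≠ 24 := by omega
    rw [hv r h1 (by omega) (by omega) (by omega), hS1]
    simp [h2, h4]
  have wa : ∀ k, k ≠ 3 → S'.a k = S.a k := by
    intro k hk; rw [hA.a k hk, hS1]; simp
  have v15 : S'.v 15 = S.v 15 + 1 := by simp [hv, hS1]
  have hscan : ∀ x w', Scanned X s S' x w' ↔ Scanned X s S x w' ∨ x = S.v 14 ∧ w' = w := by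
    intro x w'
    rw [scanned_iff, scanned_iff, v15, v 14 (by simp) (by simp) (by simp), wa 2 (by simp),
      wa 8 (by simp)]
    exact hsc x w'
  refine ⟨⟨s, hA.core hX hc1, hA.params hp1, ?_⟩, by simp [hv, hS1]⟩
  refine .scan (by simpa [Late, v] using hl) ?_ (hg.step (by simp [v]) (by simp [v])
    (by simpa [v] using hzs) (by simpa [hS1] using hle))
  exact {
    st := by simpa [v] using h.st
    qh := by simpa [v] using h.qh
    tc := by simpa [v] using h.tc
    i_le := by simpa [v] using h.i_le
    a_le := by simpa [v] using h.a_le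
    a_le' := by simpa [v] using h.a_le'
    z_le := by simpa [v] using h.z_le
    p_le := by rw [v15]; omega
    p_zero := by simp only [v15]; simp [v]; omega
    hl := by simpa [HighLow, v, wa, hys, hh] using h.hl
    cov := by
      intro x y hxy
      have := h.cov x y hxy
      simp only [hys, mem_insert_iff, v 8 (by simp) (by simp) (by simp),
        v 16 (by simp) (by simp) (by simp), wa 8 (by simp)]
      rcases this with h1 | h1 | h1 | h1
      exacts [.inl (.inr h1), .inr (.inl (.inr h1)), .inr (.inr (.inl h1)), .inr (.inr (.inr h1))]
    done := by
      intro x hx w' hw'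
      rw [v 8 (by simp) (by simp) (by simp), v 17 (by simp) (by simp) (by simp), wa 8 (by simp), hys]
      rcases (hscan x w').1 hw' with h1 | ⟨-, rfl⟩
      · rcases h.done x (by simpa [v] using hx) w' h1 with h2 | h2
        · exact .inl (.inr h2)
        · exact .inr h2
      · exact .inl (.inl rfl)
    lists := by
      intro x hx
      have hx' : x < S.v 17 := by simpa [v] using hx
      -- All numbered vertices are low, so a scanned edge to a high vertex affects none of the
      -- lists.
      have key : ∀ y < S.v 17, S.a 8 y 0 ≠ w := by
        intro y hy he
        have := h.hl.2 y hy
        rw [he] at this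
        omega
      have := h.lists x hx'
      simp only [hscan, v 17 (by simp) (by simp) (by simp), v 16 (by simp) (by simp) (by simp),
        wa 7 (by simp), wa 6 (by simp), wa 8 (by simp)]
      convert this using 1
      ext y
      simp only [mem_ofPred_eq]
      refine and_congr_right fun hy => ?_
      simp [key x hx', key y hy]
    sum_le := by
      have := h.sum_le
      simp only [v15, v 17 (by simp) (by simp) (by simp), v 14 (by simp) (by simp) (by simp),
        wa 6 (by simp)]
      omega
    j_le := by
      have := h.j_le
      simp only [v15, v 17 (by simp) (by simp) (by simp), v 14 (by simp) (by simp) (by simp),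
        v 16 (by simp) (by simp) (by simp)]
      omega
    tm := by
      refine h.tm.step (by simp [v]) (by simp [v]) (by simp [v]) ?_
      simp only [Ctx.E, v15, v 14 (by simp) (by simp) (by simp),
        v 16 (by simp) (by simp) (by simp), v 20 (by simp) (by simp) (by simp)]
      have : 1 * (X.d + 1) ≤ (S.v 16 - S.v 14) * (X.d + 1) := Nat.mul_le_mul_right _ (by omega)
      omega }

end

/-! ### Microsteps: linking a low neighbour to the static instance -/

section

variable {X : Ctx} {M : ℕ} {C₀ : Set ℕ} {i s e : ℕ} {S S' T : St}

theorem exec_push (off : ℕ) {x y : ℕ} (hx : x ≠ 26) (hy : y ≠ 26) (S : St) :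
    ∃ S', exec off (push x y) S = S' ∧ (∀ r, r ≠ 26 → S'.v r = S.v r) ∧ S'.cov = S.cov ∧
      (∀ k, k ≠ 6 → k ≠ 7 → S'.a k = S.a k) ∧ S'.a 6 = pushCnt (S.a 6) (S.v x) ∧
      S'.a 7 = pushItm (S.a 6) (S.a 7) (S.v x) (S.v y) ∧
      ∀ V, LeN V S → S.a 6 (S.v x) 0 + 1 ≤ V → S.v y ≤ V → LeN V S' := by
  have e : exec off (push x y) S = (((S.setv 26 (S.a 6 (S.v x) 0)).seta 7 (S.v x)
      (S.a 6 (S.v x) 0) (S.v y)).setv 26 (S.a 6 (S.v x) 0 + 1)).seta 6 (S.v x) 0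
      (S.a 6 (S.v x) 0 + 1) := by
    simp [push, exec, inc, Opd.val, WordOp.eval, hx, hy]
  refine ⟨_, e, ?_, ?_, ?_, ?_, ?_, ?_⟩
  · intro r hr; simp [hr]
  · simp
  · intro k h1 h2; simp [h1, h2]
  · simp [pushCnt]
  · simp [pushItm]
  · intro V hV h1 h2
    exact (((hV.tmp (by simp)).seta h2).tmp (by simp)).seta h1

theorem pushCnt_zero {cnt : ℕ → ℕ → ℕ} {j k : ℕ} (h : ∀ x, j ≤ x → cnt x 0 = 0) (hk : k < j) :
    ∀ x, j ≤ x → pushCnt cnt k x 0 = 0 := by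
  intro x hx
  have : x ≠ k := by omega
  simpa [pushCnt, this] using h x hx

/-- Adding a scanned edge to the static instance. -/
theorem next_scan_link (hX : X.Good) (hc : Core X i s 1 T) (hp : Params X T) (hl : Late X i s T)
    (hst : T.v 9 = 3) (hqh : T.v 12 = 1) (htc : T.v 18 = 0) (haj : T.v 16 ≤ T.v 17)
    (ha' : T.v 16 ≤ T.v 20) (hzl : T.v 20 ≤ T.v 10) (hhl : HighLow X T)
    (hcov : ∀ x y, X.A (s + 1) x y → x ∈ cset X.n T.cov (1 - T.v 8) ∨
      y ∈ cset X.n T.cov (1 - T.v 8) ∨ (∃ k < T.v 16, T.a 8 k 0 = x) ∨ ∃ k < T.v 16, T.a 8 k 0 = y)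
    (hdone : ∀ x < T.v 16, ∀ w, Scanned X s T x w → w ∈ cset X.n T.cov (1 - T.v 8) ∨
      ∃ k < T.v 17, T.a 8 k 0 = w)
    (hlists : ListsOk (X.A (s + 1)) (T.a 2) (T.a 8) (T.a 6) (T.a 7) (T.v 16) (T.v 17) (T.v 14)
      (T.v 15))
    (hsum : sumCnt (T.a 6) (T.v 17) ≤ 2 * (T.v 14 * X.d + T.v 15))
    (hj : T.v 17 ≤ T.v 16 + T.v 14 * X.d + T.v 15 + 1)
    (htm : Tm X s 1 T ((T.v 16 - T.v 14) * (X.d + 1) - T.v 15 + (8 + 2 * X.θ) * X.E T + 8))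
    (hg : Chg X M C₀ i 1 T (T.v 11)) (hi : T.v 14 < T.v 16) {z k : ℕ}
    (hz : T.a 8 (T.v 14) 0 = z) (hd : T.v 15 < T.a 0 z 0) (hk : k < T.v 17)
    (hw : T.a 1 z (T.v 15) = T.a 8 k 0)
    (f : ∀ r, r ≠ 15 → r < 21 → S.v r = T.v r) (f15 : S.v 15 = T.v 15 + 1) (f25 : S.v 25 = k)
    (fa : S.a = T.a) (fc : S.cov = T.cov) (fL : LeN X.V S) :
    Next X M C₀ i T (exec (2 * X.n + 1) (push 25 14 ;; iflt (r 25) (r 16) skip (push 14 25)) S) := by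
  have hV := hX.n_le
  have hjn := hc.j_le
  have hrep := hc.rep
  rw [hqh] at hrep
  have hzd : T.a 0 z 0 ≤ X.d := hz ▸ hhl.2 _ (by omega)
  obtain ⟨hR, hpos⟩ := hrep.2 z _ hd
  rw [hw] at hR hpos
  have hinj : ∀ w', X.A (s + 1) (T.a 8 (T.v 14) 0) w' → T.a 2 (T.a 8 (T.v 14) 0) w' = T.v 15 →
      w' = T.a 8 k 0 := by
    intro w' h1 h2
    have := (hrep.1 _ _ h1).2
    rw [h2, hz, hw] at this
    exact this.symm
  obtain ⟨L1, L2⟩ := hlists.scan hi haj hk (fun x hx he => hc.scr.inj hx hk he) (hz ▸ hR)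
    (hz ▸ hpos) hinj
  have hcn : ∀ x < T.v 17, T.a 6 x 0 ≤ X.n := fun x hx =>
    (le_of_bijOn (hlists x hx) (fun y hy => hy.1)).trans hjn
  have hscan := sc_succ (hz ▸ hR) (hz ▸ hpos) hinj
  obtain ⟨S1, e1, g1, g2, g3, g4, g5, g6⟩ := exec_push (2 * X.n + 1) (x := 25) (y := 14) (by simp)
    (by simp) S
  rw [f25, fa] at g4
  rw [f25, fa, f 14 (by simp) (by simp)] at g5
  rw [f25, fa] at g6
  have hL1 : LeN X.V S1 := by
    refine g6 _ fL ?_ (fL.1 14 (by simp))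
    have := hcn k hk
    omega
  obtain ⟨S', hS'⟩ : ∃ S', exec (2 * X.n + 1)
    (push 25 14 ;; iflt (r 25) (r 16) skip (push 14 25)) S = S' := ⟨_, rfl⟩
  rw [hS']
  have key : (∀ r, r ≠ 15 → r < 21 → S'.v r = T.v r) ∧ S'.v 15 = T.v 15 + 1 ∧ S'.cov = T.cov ∧
      (∀ k, k ≠ 6 → k ≠ 7 → S'.a k = T.a k) ∧ LeN X.V S' ∧
      ListsOk (X.A (s + 1)) (T.a 2) (T.a 8) (S'.a 6) (S'.a 7) (T.v 16) (T.v 17) (T.v 14)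
        (T.v 15 + 1) ∧ sumCnt (S'.a 6) (T.v 17) ≤ sumCnt (T.a 6) (T.v 17) + 2 ∧
      ∀ x, T.v 17 ≤ x → S'.a 6 x 0 = 0 := by
    have hv1 : ∀ r, r ≠ 15 → r < 21 → S1.v r = T.v r := fun r h1 h2 => by
      rw [g1 r (by omega), f r h1 h2]
    have h15 : S1.v 15 = T.v 15 + 1 := by rw [g1 _ (by simp), f15]
    have h25 : S1.v 25 = k := by rw [g1 _ (by simp), f25]
    have h14 : S1.v 14 = T.v 14 := hv1 _ (by simp) (by simp)
    by_cases hka : k < T.v 16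
    · have e2 : S1 = S' := by
        rw [← hS']
        simp [exec, e1, Opd.val, h25, hv1, hka]
      rw [← e2]
      refine ⟨hv1, h15, g2.trans fc, fun k h1 h2 => by rw [g3 k h1 h2, fa], hL1, ?_, ?_, ?_⟩
      · rw [g4, g5]; exact L1 hka
      · rw [g4, sumCnt_push hk]; omega
      · rw [g4]; exact pushCnt_zero hc.scr.cnt hk
    · obtain ⟨S2, e2, k1, k2, k3, k4, k5, k6⟩ := exec_push (2 * X.n + 1) (x := 14) (y := 25)
        (by simp) (by simp) S1
      have e3 : S2 = S' := by
        rw [← hS']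
        simp [exec, e1, e2, Opd.val, h25, hv1, hka]
      rw [h14, g4] at k4
      rw [h14, h25, g4, g5] at k5
      rw [← e3]
      refine ⟨fun r h1 h2 => by rw [k1 r (by omega), hv1 r h1 h2], by rw [k1 _ (by simp), h15],
        k2.trans (g2.trans fc), fun k h1 h2 => by rw [k3 k h1 h2, g3 k h1 h2, fa], ?_, ?_, ?_, ?_⟩
      · refine k6 _ hL1 ?_ ?_
        · rw [h14, g4]
          have h1 := hcn (T.v 14) (by omega)
          have : T.v 14 ≠ k := by omega
          simp [pushCnt, this]
          omega
        · rw [h25]; omega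
      · rw [k4, k5]; exact L2 (by omega)
      · rw [k4, sumCnt_push (by omega), sumCnt_push hk]
      · rw [k4]; exact pushCnt_zero (pushCnt_zero hc.scr.cnt hk) (by omega)
  clear hS' hL1 L1 L2 g1 g2 g3 g4 g5 g6 e1
  obtain ⟨v, v15, hco, wa, hL, hli, hsu, hcz⟩ := key
  have hscan' : ∀ x w', Scanned X s S' x w' ↔ Scanned X s T x w' ∨ x = T.v 14 ∧ w' = T.a 8 k 0 := by
    intro x w'
    rw [scanned_iff, scanned_iff, v15, v 14 (by simp) (by simp), wa 2 (by simp) (by simp),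
      wa 8 (by simp) (by simp)]
    exact hscan x w'
  refine ⟨⟨s, ⟨hc.le_m, by simpa [v, wa] using hc.fix, by simpa [v, wa, hco] using hc.z,
    by simpa [v, wa, hco] using hc.y, by simpa [v] using hc.q_le, by simpa [v, wa] using hc.rep,
    ?_, hL, by have := hc.cnt; simp [v]; omega⟩,
    by simpa [Params, v, hco] using hp, ?_⟩, by simp [v]⟩
  · have := hc.scr
    exact ⟨by simpa [v, wa] using this.id_vrt, by simpa [v, wa] using this.vrt_id,
      by simpa [v] using hcz, by simpa [v, wa] using this.pm⟩
  refine .scan (by simpa [Late, v] using hl) ?_ (hg.step (by simp [v]) (by simp [v])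
    (by simp [v, hco]) (by simp [v]))
  exact {
    st := by simpa [v] using hst
    qh := by simpa [v] using hqh
    tc := by simpa [v] using htc
    i_le := by simp [v]; omega
    a_le := by simpa [v] using haj
    a_le' := by simpa [v] using ha'
    z_le := by simpa [v] using hzl
    p_le := by rw [v15]; omega
    p_zero := by simp [v, v15]; omega
    hl := by simpa [HighLow, v, wa, hco] using hhl
    cov := by simpa [v, wa, hco] using hcov
    done := by
      intro x hx w' hw'
      rw [v 8 (by simp) (by simp), v 17 (by simp) (by simp), wa 8 (by simp) (by simp), hco]
      rcases (hscan' x w').1 hw' with h1 | ⟨-, rfl⟩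
      · exact hdone x (by simpa [v] using hx) w' h1
      · exact .inr ⟨k, hk, rfl⟩
    lists := by
      have := hli
      simp only [scanned_iff, ListsOk] at this ⊢
      simpa [v, wa, v15] using this
    sum_le := by
      simp only [v15, v 17 (by simp) (by simp), v 14 (by simp) (by simp)]
      omega
    j_le := by
      simp only [v15, v 17 (by simp) (by simp), v 14 (by simp) (by simp), v 16 (by simp) (by simp)]
      omega
    tm := by
      refine htm.step (by simp [v]) (by simp [v]) (by simp [v]) ?_
      simp only [Ctx.E, v15, v 14 (by simp) (by simp), v 16 (by simp) (by simp),
        v 20 (by simp) (by simp)]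
      have : 1 * (X.d + 1) ≤ (T.v 16 - T.v 14) * (X.d + 1) := Nat.mul_le_mul_right _ (by omega)
      omega }

theorem next_scan_low (hX : X.Good) (hc : Core X i s 1 S) (hp : Params X S) (hl : Late X i s S)
    (h : PScan X s 1 S) (hg : Chg X M C₀ i 1 S (S.v 11)) (hi : S.v 14 < S.v 16) {z w : ℕ}
    (hz : S.a 8 (S.v 14) 0 = z) (hd : S.v 15 < S.a 0 z 0) (hw : S.a 1 z (S.v 15) = w)
    (hh : S.a 0 w 0 ≤ X.d) :
    Next X M C₀ i S (exec (2 * X.n + 1) blkScan S) := by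
  have hV := hX.n_le
  have hV' := hX.V_ge
  have hjn := hc.j_le
  have haj := h.a_le
  have hrep := hc.rep
  rw [h.qh] at hrep
  have hzd : S.a 0 z 0 ≤ X.d := hz ▸ h.hl.2 _ (by omega)
  have hR := (hrep.2 z _ hd).1
  rw [hw] at hR
  have hwn := (hX.A_lt _ _ _ hR).2
  by_cases hid : S.a 5 w 0 = 0
  · have hvw : ∀ k < S.v 17, S.a 8 k 0 ≠ w := by
      rintro k hk rfl
      have := (hc.scr.id_vrt k hk).2
      omega
    have hns : ∀ y < S.v 16, ¬ Scanned X s S y w := by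
      intro y hy hsc
      rcases h.done y hy w hsc with h1 | ⟨k, hk, h1⟩
      · have := h.hl.1 w h1
        omega
      · exact hvw k hk h1
    -- `T` does not occur in the execution: it is the state in which `w` already has a number but
    -- the edge has not been scanned. It satisfies the invariant up to one extra vertex, so the case
    -- of a new neighbour reduces to that of a known one.
    obtain ⟨T, hT⟩ : ∃ T, T = ((S.seta 8 (S.v 17) 0 w).setv 17 (S.v 17 + 1)).seta 5 w 0
      (S.v 17 + 1) := ⟨_, rfl⟩
    obtain ⟨S1, hS1⟩ : ∃ S1, S1 = (((((((((((S.setv 21 z).setv 22 (S.a 0 z 0)).setv 23 w).setv 15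
      (S.v 15 + 1)).setv 24 (S.a 0 w 0)).setv 25 0).seta 8 (S.v 17) 0 w).setv 17
      (S.v 17 + 1)).seta 5 w 0 (S.v 17 + 1)).setv 25 (S.v 17 + 1)).setv 25 (S.v 17)) := ⟨_, rfl⟩
    have e : exec (2 * X.n + 1) blkScan S =
        exec (2 * X.n + 1) (push 25 14 ;; iflt (r 25) (r 16) skip (push 14 25)) S1 := by
      simp [blkScan, exec, inc, dec, mov, Opd.val, WordOp.eval, hi, hz, hd, hw, hp.1, hid, hS1,
        not_lt.2 hh]
    have hj1 : S.v 17 + 1 ≤ X.n := by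
      refine le_of_bijOn (g := fun q => Function.update (S.a 8) (S.v 17)
        (Function.update (S.a 8 (S.v 17)) 0 w) q 0) (InjOn.bijOn_image fun p hp q hq e =>
          (hc.scr.alloc hwn hid).inj hp hq e) ?_
      rintro _ ⟨q, hq, rfl⟩
      exact ((hc.scr.alloc hwn hid).id_vrt q hq).1
    have hv : ∀ r, r ≠ 17 → T.v r = S.v r := by intro r hr; simp [hT, hr]
    have h17 : T.v 17 = S.v 17 + 1 := by simp [hT]
    have hvr : ∀ k < S.v 17, T.a 8 k = S.a 8 k := by
      intro k hk; simp [hT, hk.ne]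
    have hsc : ∀ x < S.v 16, ∀ w', Scanned X s T x w' ↔ Scanned X s S x w' := by
      intro x hx w'
      simp only [Scanned, hvr x (by omega), hv 14 (by simp), hv 15 (by simp)]
      simp [hT]
    rw [e]
    have hTc : Core X i s 1 T := by
      refine ⟨hc.le_m, by simpa [hT] using hc.fix, by simpa [hT] using hc.z,
        by simpa [hT] using hc.y, by simpa [hT] using hc.q_le, by simpa [hT] using hc.rep,
        by simpa [hT] using hc.scr.alloc hwn hid, ?_, by simpa [hT] using hc.cnt⟩
      rw [hT]
      exact ((hc.le.seta (by omega)).setv (by omega)).seta (by omega)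
    have hhl : HighLow X T := by
      refine ⟨by simpa [hT] using h.hl.1, fun q hq => ?_⟩
      have hq' : q < S.v 17 + 1 := by simpa [hT] using hq
      by_cases hqj : q = S.v 17
      · subst hqj; simpa [hT] using hh
      · rw [hvr q (by omega)]
        simpa [hT] using h.hl.2 q (by omega)
    have := next_scan_link (T := T) (S := S1) (M := M) (C₀ := C₀) hX hTc (by simpa [hT, Params] using hp)
      (by simpa [hT, Late] using hl) (by simpa [hT] using h.st) (by simpa [hT] using h.qh)
      (by simpa [hT] using h.tc) (by simp [hT]; omega) (by simpa [hT] using h.a_le')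
      (by simpa [hT] using h.z_le) hhl ?_ ?_ ?_ ?_ ?_ (by simpa [hT, Tm, Ctx.E] using h.tm)
      (by simpa [hT, Chg] using hg)
      (by simpa [hT] using hi) (z := z) (k := S.v 17) ?_ (by simpa [hT] using hd) (by simp [hT])
      (by simp [hT, hw]) ?_ (by simp [hS1, hT]) (by simp [hS1]) ?_ (by simp [hS1, hT]) ?_
    · exact ⟨this.1, by simpa [hT] using this.2⟩
    · intro x y hxy
      rw [hv 8 (by simp), hv 16 (by simp)]
      have : T.cov = S.cov := by simp [hT]
      rw [this]
      rcases h.cov x y hxy with h1 | h1 | ⟨k, hk, h1⟩ | ⟨k, hk, h1⟩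
      · exact .inl h1
      · exact .inr (.inl h1)
      · exact .inr (.inr (.inl ⟨k, hk, by rwa [hvr k (by omega)]⟩))
      · exact .inr (.inr (.inr ⟨k, hk, by rwa [hvr k (by omega)]⟩))
    · intro x hx w' hw'
      rw [hv 16 (by simp)] at hx
      rw [hsc x hx] at hw'
      rcases h.done x hx w' hw' with h1 | ⟨k, hk, h1⟩
      · left; simpa [hT] using h1
      · exact .inr ⟨k, by omega, by rwa [hvr k hk]⟩
    · have := h.listsOk.alloc haj (hc.scr.cnt _ le_rfl) hns
      simpa [hT] using this
    · rw [h17, sumCnt, Finset.sum_range_succ, ← sumCnt]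
      have h1 := h.sum_le
      have h2 := hc.scr.cnt _ le_rfl
      simpa [hT, h2] using h1
    · have h1 := h.j_le
      simp [hT]
      omega
    · rw [hv 14 (by simp), hvr _ (by omega), hz]
    · intro r h1 h2
      have h3 : r ≠ 21 ∧ r ≠ 22 ∧ r ≠ 23 ∧ r ≠ 24 ∧ r ≠ 25 := by omega
      simp [hS1, hT, h1, h3]
    · simp only [hS1, hT]; rfl
    · rw [hS1]
      refine ((LeN.seta (LeN.setv (LeN.seta ?_ ?_) ?_) ?_).tmp (by simp)).tmp (by simp) <;> try omega
      exact (((((hc.le.tmp (by simp)).tmp (by simp)).tmp (by simp)).setv (by omega)).tmp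
        (by simp)).tmp (by simp)
  · obtain ⟨k, hk, hkw⟩ := hc.scr.vrt_id w hid
    have hidk := (hc.scr.id_vrt k hk).2
    rw [hkw] at hidk
    obtain ⟨S1, hS1⟩ : ∃ S1, S1 = ((((((S.setv 21 z).setv 22 (S.a 0 z 0)).setv 23 w).setv 15
      (S.v 15 + 1)).setv 24 (S.a 0 w 0)).setv 25 (k + 1)).setv 25 k := ⟨_, rfl⟩
    have e : exec (2 * X.n + 1) blkScan S =
        exec (2 * X.n + 1) (push 25 14 ;; iflt (r 25) (r 16) skip (push 14 25)) S1 := by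
      simp [blkScan, exec, inc, dec, mov, Opd.val, WordOp.eval, hi, hz, hd, hw, hp.1, hidk, hS1,
        not_lt.2 hh]
    rw [e]
    refine next_scan_link (T := S) hX hc hp hl h.st h.qh h.tc haj h.a_le' h.z_le h.hl h.cov h.done
      h.listsOk h.sum_le (by have := h.j_le; omega) h.tm hg hi hz hd hk (by rw [hw, hkw]) ?_
      (by simp [hS1]) (by simp [hS1]) (by simp [hS1]) (by simp [hS1]) ?_
    · intro r h1 h2
      have h3 : r ≠ 21 ∧ r ≠ 22 ∧ r ≠ 23 ∧ r ≠ 24 ∧ r ≠ 25 := by omega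
      simp [hS1, h1, h3]
    · rw [hS1]
      exact ((((((hc.le.tmp (by simp)).tmp (by simp)).tmp (by simp)).setv (by omega)).tmp
        (by simp)).tmp (by simp)).tmp (by simp)

end

/-! ### Logged writes and the end of the scan -/

section

variable {X : Ctx} {M : ℕ} {C₀ : Set ℕ} {i s e : ℕ} {S S' T : St}

/-- The array `10` after a write. -/
def wrPm (pm : ℕ → ℕ → ℕ) (κ x z : ℕ) : ℕ → ℕ → ℕ :=
  Function.update pm κ (Function.update (pm κ) x z)

@[simp] theorem wrPm_self (pm : ℕ → ℕ → ℕ) (κ x z : ℕ) :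
    wrPm pm κ x z κ = Function.update (pm κ) x z := by simp [wrPm]

theorem wrPm_of_ne (pm : ℕ → ℕ → ℕ) {κ κ' : ℕ} (h : κ' ≠ κ) (x z : ℕ) :
    wrPm pm κ x z κ' = pm κ' := by simp [wrPm, h]

theorem exec_wr (off κ : ℕ) {x z : Opd} (hx : x ≠ r 18) (hz : z ≠ r 18) (S : St) :
    ∃ S', exec off (wr κ x z) S = S' ∧ (∀ r, r ≠ 18 → S'.v r = S.v r) ∧ S'.v 18 = S.v 18 + 1 ∧
      S'.cov = S.cov ∧ (∀ k, k ≠ 9 → k ≠ 10 → S'.a k = S.a k) ∧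
      S'.a 10 = wrPm (S.a 10) κ (x.val S) (z.val S) ∧
      (∀ n j, Scratch n j (S.v 18) (S.a 5) (S.a 6) (S.a 8) (S.a 9) (S.a 10) →
        Scratch n j (S'.v 18) (S'.a 5) (S'.a 6) (S'.a 8) (S'.a 9) (S'.a 10)) ∧
      ∀ V, LeN V S → S.v 18 + 1 ≤ V → κ ≤ V → x.val S ≤ V → z.val S ≤ V → LeN V S' := by
  have vx : ∀ y, x.val (S.setv 18 y) = x.val S := by
    intro y
    cases x with
    | r i =>
      have : i ≠ 18 := fun h => hx (by rw [h])
      simp [Opd.val, this]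
    | c k => rfl
  have vz : ∀ y, z.val (S.setv 18 y) = z.val S := by
    intro y
    cases z with
    | r i =>
      have : i ≠ 18 := fun h => hz (by rw [h])
      simp [Opd.val, this]
    | c k => rfl
  have va : ∀ (x : Opd) (S : St) (k i j y : ℕ), x.val (S.seta k i j y) = x.val S := by
    intro x S k i j y
    cases x <;> rfl
  have hc : ∀ (S : St) (k i j y z : ℕ), (S.seta k i j y).setv 18 z = (S.setv 18 z).seta k i j y :=
    fun _ _ _ _ _ _ => rfl
  have e : exec off (wr κ x z) S = ((((S.seta 9 (S.v 18) 0 κ).seta 9 (S.v 18) 1 (x.val S)).setv 18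
      (S.v 18 + 1)).seta 10 κ (x.val S) (z.val S)) := by
    simp only [wr, exec, inc, WordOp.eval, hc, va, vx, vz]
    simp [Opd.val]
  refine ⟨_, e, ?_, ?_, ?_, ?_, ?_, ?_, ?_⟩
  · intro r hr; simp [hr]
  · simp
  · simp
  · intro k h1 h2; simp [h1, h2]
  · simp [wrPm]
  · intro n j h
    simpa using h.write κ (x.val S) (z.val S)
  · intro V hV h1 h2 h3 h4
    exact (((hV.seta h2).seta h3).setv h1).seta h4

theorem Ctx.E_le (hX : X.Good) (hc : Core X i s e S) (h : S.v 20 ≤ S.v 10) :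
    2 * X.E S + 3 * X.n + 10 ≤ X.V := by
  have h1 := hc.z_le
  have h2 := hX.V_ge
  have h3 : X.E S ≤ (1 + X.n) * ((X.d + 1) * X.θ) := by
    unfold Ctx.E
    refine Nat.mul_le_mul (by omega) (Nat.le_mul_of_pos_right _ ?_)
    exact Nat.succ_pos _
  have h4 : 20 * ((1 + X.n) * ((X.d + 1) * X.θ)) ≤ X.C * ((1 + X.n) * ((X.d + 1) * X.θ)) :=
    Nat.mul_le_mul_right _ (by unfold Ctx.C; omega)
  rw [mul_assoc] at h2
  omega

theorem Core.s_lt (hc : Core X i s e S) (h12 : S.v 12 = 1) : s + 1 ≤ X.m := by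
  have h1 := hc.q_le
  have h2 := hc.fix.time
  have h3 := hc.le_m
  omega

/-- All edges at low cover vertices have been scanned and the current cover covers the snapshot.
Hence the lists describe the subgraph induced by the numbered vertices, and every edge outside it
has an end in the new cover. An empty instance bypasses the static program, whose guarantee requires
at least one vertex; then the high vertices alone are a good cover. -/
theorem next_scan_end (hX : X.Good) (hc : Core X i s 1 S) (hp : Params X S) (hl : Late X i s S)
    (h : PScan X s 1 S) (hg : Chg X M C₀ i 1 S (S.v 11)) (hi : S.v 16 ≤ S.v 14) :
    Next X M C₀ i S (exec (2 * X.n + 1) blkScan S) := by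
  have hV := hX.n_le
  have hjn := hc.j_le
  have haj := h.a_le
  have hia : S.v 14 = S.v 16 := le_antisymm h.i_le hi
  have hp0 := h.p_zero hia
  have hsm := hc.s_lt h.qh
  by_cases hj : S.v 17 = 0
  · have e : exec (2 * X.n + 1) blkScan S = ((S.setv 14 0).setv 15 0).setv 9 6 := by
      simp [blkScan, exec, mov, Opd.val, WordOp.eval, not_lt.2 hi, hj]
    rw [e]
    refine ⟨⟨s, ⟨hc.le_m, by simpa using hc.fix, by simpa using hc.z, by simpa using hc.y,
      by simpa using hc.q_le, by simpa using hc.rep, by simpa using hc.scr, ?_,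
      by have := hc.cnt; simp; omega⟩, by simpa [Params] using hp, ?_⟩, by simp⟩
    · exact ((hc.le.setv (by omega)).setv (by omega)).setv (by omega)
    · refine .clean (by simpa [Late] using hl) ?_ (hg.step (by simp) (by simp) (by simp) (by simp))
      refine ⟨by simp, by simpa using h.qh, ⟨?_, ?_⟩, h.tm.step (by simp) (by simp) (by simp) ?_⟩
      · intro x y hxy
        rcases h.cov x y (by simpa [h.qh] using hxy) with h1 | h1 | ⟨k, hk, -⟩ | ⟨k, hk, -⟩
        · left; simpa using h1
        · right; simpa using h1
        · omega
        · omega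
      · refine ⟨_, hX.high (s + 1) hsm (cset X.n S.cov (1 - S.v 8)) fun x hx => ⟨hx.1, ?_⟩, ?_⟩
        · rw [hc.deg_eq h.qh]; exact h.hl.1 x hx
        · rw [ncard_of_bijOn hc.y]; simp
      · simp [hj, h.tc]
  · obtain ⟨S1, hS1⟩ : ∃ S1, S1 = (S.setv 14 0).setv 15 0 := ⟨_, rfl⟩
    have hv1 : ∀ r, r ≠ 14 → r ≠ 15 → S1.v r = S.v r := by intro r h1 h2; simp [hS1, h1, h2]
    have ha1 : S1.a = S.a := by simp [hS1]
    have hc1 : S1.cov = S.cov := by simp [hS1]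
    obtain ⟨S2, e2, a1, a2, a3, a4, a5, a6, a7⟩ := exec_wr (2 * X.n + 1) 1 (x := c 0) (z := r 17)
      (by simp) (by simp) S1
    obtain ⟨S3, hS3⟩ : ∃ S3, S3 = S2.setv 19 (S.v 17 + 2) := ⟨_, rfl⟩
    obtain ⟨S4, e4, b1, b2, b3, b4, b5, b6, b7⟩ := exec_wr (2 * X.n + 1) 1 (x := c 1) (z := r 19)
      (by simp) (by simp) S3
    have h217 : S2.v 17 = S.v 17 := by rw [a1 _ (by simp), hv1 _ (by simp) (by simp)]
    have e : exec (2 * X.n + 1) blkScan S = S4.setv 9 4 := by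
      have e3 : exec (2 * X.n + 1) blkScan S = exec (2 * X.n + 1) (wr 1 (c 0) (r 17) ;;
        op .add 19 (r 17) (c 2) ;; wr 1 (c 1) (r 19) ;; mov 9 (c 4)) S1 := by
        simp [blkScan, exec, mov, Opd.val, WordOp.eval, not_lt.2 hi, hj, hS1]
      rw [e3]
      simp [exec, e2, Opd.val, WordOp.eval, mov, h217, ← hS3, e4]
    obtain ⟨S', hS'⟩ : ∃ S', S4.setv 9 4 = S' := ⟨_, rfl⟩
    have v : ∀ r, r ≠ 9 → r ≠ 14 → r ≠ 15 → r ≠ 18 → r ≠ 19 → S'.v r = S.v r := by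
      intro r h1 h2 h3 h4 h5
      rw [← hS', St.setv_v, if_neg h1, b1 r h4, hS3, St.setv_v, if_neg h5, a1 r h4, hv1 r h2 h3]
    have h18 : S'.v 18 = 2 := by
      rw [← hS', St.setv_v, if_neg (by simp), b2, hS3, St.setv_v, if_neg (by simp), a2,
        hv1 _ (by simp) (by simp), h.tc]
    have h19 : S'.v 19 = S.v 17 + 2 := by
      rw [← hS', St.setv_v, if_neg (by simp), b1 _ (by simp), hS3, St.setv_v, if_pos rfl]
    have h14 : S'.v 14 = 0 := by
      rw [← hS', St.setv_v, if_neg (by simp), b1 _ (by simp), hS3, St.setv_v, if_neg (by simp),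
        a1 _ (by simp), hS1]
      simp
    have h15 : S'.v 15 = 0 := by
      rw [← hS', St.setv_v, if_neg (by simp), b1 _ (by simp), hS3, St.setv_v, if_neg (by simp),
        a1 _ (by simp), hS1]
      simp
    have hcv : S'.cov = S.cov := by
      rw [← hS', St.setv_cov, b3, hS3, St.setv_cov, a3, hc1]
    have wa : ∀ k, k ≠ 9 → k ≠ 10 → S'.a k = S.a k := by
      intro k h1 h2
      rw [← hS', St.setv_a, b4 k h1 h2, hS3, St.setv_a, a4 k h1 h2, ha1]
    have h10 : S'.a 10 = wrPm (wrPm (S.a 10) 1 0 (S.v 17)) 1 1 (S.v 17 + 2) := by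
      rw [← hS', St.setv_a, b5, hS3, St.setv_a, a5, ha1]
      simp only [Opd.val, St.setv_v, if_pos]
      rw [hv1 _ (by simp) (by simp)]
    -- With an empty log, array `10` is zero everywhere, as the static program expects of its
    -- registers and of the memory beyond its input.
    have hz0 : ∀ κ x, S.a 10 κ x = 0 := by
      intro κ x
      by_contra hne
      obtain ⟨q, hq, -⟩ := hc.scr.pm κ x hne
      rw [h.tc] at hq; omega
    have hL : LeN X.V S' := by
      rw [← hS']
      refine LeN.setv (b7 _ ?_ ?_ (by omega) ?_ ?_) (by omega)
      · rw [hS3]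
        refine LeN.setv (a7 _ ?_ ?_ (by omega) ?_ ?_) (by omega)
        · rw [hS1]; exact (hc.le.setv (by omega)).setv (by omega)
        · rw [hv1 _ (by simp) (by simp), h.tc]; omega
        · simp [Opd.val]
        · simp only [Opd.val]; rw [hv1 _ (by simp) (by simp)]; omega
      · rw [hS3, St.setv_v, if_neg (by simp), a2, hv1 _ (by simp) (by simp), h.tc]; omega
      · simp only [Opd.val]; omega
      · simp only [Opd.val, hS3, St.setv_v, if_pos]; omega
    have hscr : Scratch X.n (S.v 17) (S'.v 18) (S'.a 5) (S'.a 6) (S'.a 8) (S'.a 9) (S'.a 10) := by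
      rw [← hS']
      refine b6 _ _ ?_
      rw [hS3]
      refine a6 _ _ ?_
      simpa [hS1] using hc.scr
    rw [e, hS']
    clear a1 a2 a3 a4 a5 a6 a7 b1 b2 b3 b4 b5 b6 b7 e2 e4
    have hsc : ∀ x w, Scanned X s S x w ↔ X.A (s + 1) (S.a 8 x 0) w ∧ x < S.v 16 := by
      intro x w
      simp [Scanned, hia, hp0]
    have hE : X.E S' = X.E S := by simp [Ctx.E, v]
    have haE : S.v 16 * (X.d + 1) ≤ X.E S := Nat.mul_le_mul_right _ h.a_le'
    have hd1 : S.v 16 * (X.d + 1) = S.v 16 * X.d + S.v 16 := Nat.mul_succ _ _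
    have hjE : S.v 17 ≤ X.E S := by
      have := h.j_le
      rw [hia, hp0] at this
      omega
    refine ⟨⟨s, ⟨hc.le_m, by simpa [v, wa] using hc.fix, by simpa [v, wa, hcv] using hc.z,
      by simpa [v, wa, hcv] using hc.y, by simpa [v] using hc.q_le, by simpa [v, wa] using hc.rep,
      by simpa [v] using hscr, hL, by have := hc.cnt; simp [v]; omega⟩,
      by simpa [Params, v, hcv] using hp, ?_⟩, by simp [v]⟩
    refine .emit (by simpa [Late, v] using hl) ?_ (hg.step (by simp [v]) (by simp [v])
      (by simp [v, hcv]) (by simp [v]))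
    exact {
      st := by simp [← hS']
      qh := by simpa [v] using h.qh
      built := {
        z_le := by simpa [v] using h.z_le
        hl := by simpa [HighLow, v, wa, hcv] using h.hl
        lists := by
          intro x hx
          simp only [v 17 (by simp) (by simp) (by simp) (by simp) (by simp)] at hx ⊢
          simp only [wa 7 (by simp) (by simp), wa 6 (by simp) (by simp), wa 8 (by simp) (by simp)]
          have := h.lists x hx
          simp only [hsc] at this
          convert this using 1
          ext y
          simp only [mem_ofPred_eq]
          refine and_congr_right fun hy => ⟨fun hA => ?_, ?_⟩
          · have key : x < S.v 16 ∨ y < S.v 16 := by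
              rcases h.cov _ _ hA with h1 | h1 | ⟨k, hk, h1⟩ | ⟨k, hk, h1⟩
              · have := h.hl.1 _ h1
                have := h.hl.2 x hx
                omega
              · have := h.hl.1 _ h1
                have := h.hl.2 y hy
                omega
              · exact .inl (hc.scr.inj (by omega) hx h1 ▸ hk)
              · exact .inr (hc.scr.inj (by omega) hy h1 ▸ hk)
            by_cases hya : y < S.v 16
            · exact .inr ⟨hya, hX.A_symm _ _ _ hA, hya⟩
            · have hxa : x < S.v 16 := by omega
              exact .inl ⟨hxa, by omega, hA, hxa⟩
          · rintro (⟨-, -, h1, -⟩ | ⟨-, h1, -⟩)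
            · exact h1
            · exact hX.A_symm _ _ _ h1
        edges := by
          intro x y hxy
          simp only [v 17 (by simp) (by simp) (by simp) (by simp) (by simp),
            v 8 (by simp) (by simp) (by simp) (by simp) (by simp), wa 8 (by simp) (by simp), hcv]
          rcases h.cov x y hxy with h1 | h1 | ⟨k, hk, h1⟩ | ⟨k, hk, h1⟩
          · exact .inl h1
          · exact .inr (.inl h1)
          · rcases h.done k hk y ((hsc _ _).2 ⟨h1 ▸ hxy, hk⟩) with h2 | ⟨l, hl, h2⟩
            · exact .inr (.inl h2)
            · exact .inr (.inr ⟨k, by omega, l, hl, h1, h2⟩)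
          · rcases h.done k hk x ((hsc _ _).2 ⟨h1 ▸ hX.A_symm _ _ _ hxy, hk⟩) with h2 | ⟨l, hl, h2⟩
            · exact .inl h2
            · exact .inr (.inr ⟨l, hl, k, by omega, h2, h1⟩)
        sum_le := by
          have := h.sum_le
          rw [hia, hp0] at this
          simp only [v 17 (by simp) (by simp) (by simp) (by simp) (by simp), hE,
            wa 6 (by simp) (by simp)]
          omega
        j_pos := by simp [v]; omega
        j_le := by simpa [v, hE] using hjE }
      i_le := by rw [h14]; omega
      p_le := by rw [h15]; omega
      o_eq := by
        rw [h19, h15, h14, offs, v 17 (by simp) (by simp) (by simp) (by simp) (by simp)]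
        simp [sumCnt]
      regs := fun x => by rw [h10, wrPm_of_ne _ (by simp), wrPm_of_ne _ (by simp), hz0]
      size := by simp [h10, v]
      starts := by
        intro x hx
        have : x = 0 := by omega
        subst this
        simp [h10, offs, v, sumCnt]
      cells := by
        intro x hx
        omega
      cells' := by
        intro x hx
        omega
      rest := by
        intro y hy
        rw [h19] at hy
        have h1 : y ≠ 0 := by omega
        have h2 : y ≠ 1 := by omega
        simp [h10, h1, h2, hz0]
      tm := by
        refine h.tm.step (by simp [v]) (by simp [v]) (by simp [v]) ?_
        -- The coefficient `8 + 2θ`: four units for writing and undoing the at most `2E` list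
        -- entries, two for the list starts, `2θ` for simulating the program and undoing its writes,
        -- one for reading the output, one for releasing the numbers.
        have hT := hX.T_le (S.v 17) (by omega) hjn
        have hT' : X.θ * S.v 17 ≤ X.θ * X.E S := Nat.mul_le_mul_left _ hjE
        have h1 : (8 + 2 * X.θ) * X.E S = 8 * X.E S + 2 * (X.θ * X.E S) := by ring
        simp only [hE, h14, h15, h18, v 17 (by simp) (by simp) (by simp) (by simp) (by simp)]
        simp only [sumCnt, Finset.range_zero, Finset.sum_empty]
        omega }

/-- The phase after `t` steps of the static program. -/
theorem phase_sim {μ : ℕ → ℕ} {s' : Config} {t : ℕ} (hl : Late X i s S)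
    (hg : Chg X M C₀ i 0 S (S.v 11)) (hqh : S.v 12 = 1) (hi : S.v 14 = 0)
    (hrun : RunsTo X.P X.Wp (inputConfig X.α μ) (X.T (S.v 17)) s')
    (hsel : Selects X s 0 S s'.mem) (ht : t ≤ X.T (S.v 17))
    (hreg : S.a 10 0 = ((step X.P)^[t] (inputConfig X.α μ)).reg)
    (hmem : S.a 10 1 = ((step X.P)^[t] (inputConfig X.α μ)).mem)
    (h9 : S.v 9 = if ((step X.P)^[t] (inputConfig X.α μ)).pc < X.P.length then
      8 + ((step X.P)^[t] (inputConfig X.α μ)).pc else 5)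
    (htm : Tm X s 0 S (2 * (X.T (S.v 17) - t) + S.v 18 + 2 * S.v 17 + 3)) :
    Phase X M C₀ i s 0 S := by
  by_cases hpc : ((step X.P)^[t] (inputConfig X.α μ)).pc < X.P.length
  · rw [if_pos hpc] at h9
    exact .sim hl ⟨hqh, hi, μ, s', hrun, hsel, t, ht, hreg, hmem, hpc, h9, htm⟩ hg
  · rw [if_neg hpc] at h9
    -- The program counter has left `P`, so the remaining steps of the allotted time do nothing and
    -- the present configuration is the final one.
    have : s' = (step X.P)^[t] (inputConfig X.α μ) := by
      rw [← hrun.1, show X.T (S.v 17) = (X.T (S.v 17) - t) + t by omega, Function.iterate_add_apply,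
        iterate_of_halted (by omega)]
    refine .out hl ⟨h9, hqh, by omega, by rw [hi, hmem, ← this]; exact hsel, ?_⟩ hg
    unfold Tm at htm ⊢
    omega

end

/-! ### Microsteps: writing the input of the static program -/

section

variable {X : Ctx} {M : ℕ} {C₀ : Set ℕ} {i s e : ℕ} {S S' T : St}

theorem offs_succ (S : St) (x : ℕ) : offs S (x + 1) = offs S x + S.a 6 x 0 := by
  simp [offs, sumCnt, Finset.sum_range_succ, add_assoc]

theorem offs_mono (S : St) : Monotone (offs S) :=
  monotone_nat_of_le_succ fun x => by rw [offs_succ]; omega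

theorem le_offs (S : St) (x : ℕ) : S.v 17 + 2 ≤ offs S x := by unfold offs; omega

theorem Built.congr (h : Built X s S) (v : ∀ r, r ≠ 14 → r ≠ 15 → r ≠ 18 → r ≠ 19 → r ≠ 9 → r < 21 →
    S'.v r = S.v r) (wa : ∀ k, k ≠ 9 → k ≠ 10 → S'.a k = S.a k) (hc : S'.cov = S.cov) :
    Built X s S' := by
  have v17 : S'.v 17 = S.v 17 := v _ (by simp) (by simp) (by simp) (by simp) (by simp) (by simp)
  have v20 : S'.v 20 = S.v 20 := v _ (by simp) (by simp) (by simp) (by simp) (by simp) (by simp)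
  have v10 : S'.v 10 = S.v 10 := v _ (by simp) (by simp) (by simp) (by simp) (by simp) (by simp)
  have v8 : S'.v 8 = S.v 8 := v _ (by simp) (by simp) (by simp) (by simp) (by simp) (by simp)
  exact ⟨by simpa [v10, v20] using h.z_le, by simpa [HighLow, v8, v17, wa, hc] using h.hl,
    by simpa [v17, wa] using h.lists, by simpa [v17, v8, wa, hc] using h.edges,
    by simpa [v17, v20, wa, Ctx.E] using h.sum_le, by simpa [v17] using h.j_pos,
    by simpa [v17, v20, Ctx.E] using h.j_le⟩

/-- Writing the next cell of the input of the static program. -/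
theorem next_emit_cell (hX : X.Good) (hc : Core X i s 1 S) (hp : Params X S) (hl : Late X i s S)
    (h : PEmit X s 1 S) (hg : Chg X M C₀ i 1 S (S.v 11)) (hi : S.v 14 < S.v 17)
    (hq : S.v 15 < S.a 6 (S.v 14) 0) :
    Next X M C₀ i S (exec (2 * X.n + 1) (blkEmit X.P) S) := by
  have hV := hX.n_le
  have hEV := Ctx.E_le hX hc h.built.z_le
  have hjn := hc.j_le
  have htm := h.tm.le hX hc
  obtain ⟨S1, hS1⟩ : ∃ S1, S1 = (S.setv 21 (S.a 6 (S.v 14) 0)).setv 22 (S.a 7 (S.v 14) (S.v 15)) :=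
    ⟨_, rfl⟩
  have ha1 : S1.a = S.a := by simp [hS1]
  have hc1 : S1.cov = S.cov := by simp [hS1]
  have hv1 : ∀ r, r < 21 → S1.v r = S.v r := by
    intro r hr
    have : r ≠ 21 ∧ r ≠ 22 := by omega
    simp [hS1, this]
  obtain ⟨S2, e2, a1, a2, a3, a4, a5, a6, a7⟩ := exec_wr (2 * X.n + 1) 1 (x := r 19) (z := r 22)
    (by simp) (by simp) S1
  have e : exec (2 * X.n + 1) (blkEmit X.P) S = (S2.setv 19 (S.v 19 + 1)).setv 15 (S.v 15 + 1) := by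
    have e3 : exec (2 * X.n + 1) (blkEmit X.P) S =
        exec (2 * X.n + 1) (wr 1 (r 19) (r 22) ;; inc 19 ;; inc 15) S1 := by
      simp [blkEmit, exec, Opd.val, hi, hq, hS1]
    rw [e3]
    simp [exec, inc, e2, Opd.val, WordOp.eval, a1, hv1]
  obtain ⟨S', hS'⟩ : ∃ S', (S2.setv 19 (S.v 19 + 1)).setv 15 (S.v 15 + 1) = S' := ⟨_, rfl⟩
  have v : ∀ r, r ≠ 15 → r ≠ 18 → r ≠ 19 → r < 21 → S'.v r = S.v r := by
    intro r h1 h2 h3 h4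
    rw [← hS', St.setv_v, if_neg h1, St.setv_v, if_neg h3, a1 r h2, hv1 r h4]
  have v15 : S'.v 15 = S.v 15 + 1 := by simp [← hS']
  have v19 : S'.v 19 = S.v 19 + 1 := by simp [← hS']
  have v18 : S'.v 18 = S.v 18 + 1 := by simp [← hS', a2, hv1]
  have hcv : S'.cov = S.cov := by simp [← hS', a3, hc1]
  have wa : ∀ k, k ≠ 9 → k ≠ 10 → S'.a k = S.a k := by
    intro k h1 h2; rw [← hS', St.setv_a, St.setv_a, a4 k h1 h2, ha1]
  have h10 : S'.a 10 = wrPm (S.a 10) 1 (S.v 19) (S.a 7 (S.v 14) (S.v 15)) := by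
    rw [← hS', St.setv_a, St.setv_a, a5, ha1]
    simp [Opd.val, hS1]
  have h101 : ∀ y, y ≠ S.v 19 → S'.a 10 1 y = S.a 10 1 y := by
    intro y hy; rw [h10]; simp [hy]
  have ho := h.o_eq
  have ho2 := offs_succ S (S.v 14)
  have hlo := le_offs S (S.v 14)
  have hso : ∀ x, offs S' x = offs S x := by
    intro x
    rw [offs, offs, v 17 (by simp) (by simp) (by simp) (by simp), wa 6 (by simp) (by simp)]
  have hsum : sumCnt (S.a 6) (S.v 14) + S.a 6 (S.v 14) 0 ≤ 2 * X.E S := by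
    refine le_trans ?_ h.built.sum_le
    have := offs_mono S hi
    rw [Nat.succ_eq_add_one, offs_succ] at this
    unfold offs at this
    omega
  have ho3 : S.v 19 = S.v 17 + 2 + sumCnt (S.a 6) (S.v 14) + S.v 15 := ho
  have hE : X.E S' = X.E S := by simp [Ctx.E, v]
  rw [e, hS']
  refine ⟨⟨s, ⟨hc.le_m, by simpa [v, wa] using hc.fix, by simpa [v, wa, hcv] using hc.z,
      by simpa [v, wa, hcv] using hc.y, by simpa [v] using hc.q_le, by simpa [v, wa] using hc.rep,
      ?_, ?_, by have := hc.cnt; simp [v]; omega⟩,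
      by simpa [Params, v, hcv] using hp, ?_⟩, by simp [v]⟩
  · rw [v 17 (by simp) (by simp) (by simp) (by simp), ← hS']
    simp only [St.setv_a]
    have := a6 X.n (S.v 17) (by simpa [hS1] using hc.scr)
    simpa using this
  · rw [← hS']
    refine LeN.setv (LeN.setv (a7 _ ?_ ?_ (by omega) ?_ ?_) ?_) ?_
    · rw [hS1]; exact (hc.le.tmp (by simp)).tmp (by simp)
    · rw [hv1 _ (by simp)]; omega
    · simp only [Opd.val]; rw [hv1 _ (by simp)]; exact hc.le.1 19 (by simp)
    · simpa [Opd.val, hS1] using hc.le.2.2 _ _ _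
    · omega
    · omega
  refine .emit (by simpa [Late, v] using hl) ?_ (hg.step (by simp [v]) (by simp [v])
      (by simp [v, hcv]) (by simp [v]))
  exact {
    st := by simpa [v] using h.st
    qh := by simpa [v] using h.qh
    built := h.built.congr (fun r _ h2 h3 h4 _ h6 => v r h2 h3 h4 h6) wa hcv
    i_le := by simpa [v] using h.i_le
    p_le := by
      rw [v15, v 14 (by simp) (by simp) (by simp) (by simp), wa 6 (by simp) (by simp)]
      omega
    o_eq := by
      rw [v15, v 14 (by simp) (by simp) (by simp) (by simp), v19, hso]
      omega
    regs := fun x => by rw [h10, wrPm_of_ne _ (by simp), h.regs]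
    size := by
      rw [h101 _ (by omega), h.size, v 17 (by simp) (by simp) (by simp) (by simp)]
    starts := by
      intro x hx
      rw [v 14 (by simp) (by simp) (by simp) (by simp)] at hx
      rw [h101 _ (by omega), h.starts x hx, hso]
    cells := by
      intro x hx q hq'
      rw [v 14 (by simp) (by simp) (by simp) (by simp)] at hx
      rw [wa 6 (by simp) (by simp)] at hq'
      have h1 := offs_mono S hx
      rw [Nat.succ_eq_add_one, offs_succ] at h1
      rw [hso, wa 7 (by simp) (by simp), h101 _ (by omega), h.cells x hx q hq']
    cells' := by
      intro q hq'
      rw [v15] at hq'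
      rw [hso, wa 7 (by simp) (by simp), v 14 (by simp) (by simp) (by simp) (by simp)]
      by_cases hqp : q = S.v 15
      · rw [hqp, ← ho, h10]; simp
      · rw [h101 _ (by omega), h.cells' q (by omega)]
    rest := by
      intro y hy
      rw [v19] at hy
      rw [h101 _ (by omega), h.rest y (by omega)]
    tm := by
      refine h.tm.step (by simp [v]) (by simp [v]) (by simp [v]) ?_
      rw [hE, v15, v18, v 14 (by simp) (by simp) (by simp) (by simp),
        v 17 (by simp) (by simp) (by simp) (by simp), wa 6 (by simp) (by simp)]
      omega }

/-- The end of a row of the input of the static program. -/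
theorem next_emit_row (hX : X.Good) (hc : Core X i s 1 S) (hp : Params X S) (hl : Late X i s S)
    (h : PEmit X s 1 S) (hg : Chg X M C₀ i 1 S (S.v 11)) (hi : S.v 14 < S.v 17)
    (hq : S.a 6 (S.v 14) 0 ≤ S.v 15) :
    Next X M C₀ i S (exec (2 * X.n + 1) (blkEmit X.P) S) := by
  have hV := hX.n_le
  have hjn := hc.j_le
  have htm := h.tm.le hX hc
  have hq' : S.v 15 = S.a 6 (S.v 14) 0 := le_antisymm h.p_le hq
  obtain ⟨S1, hS1⟩ : ∃ S1, S1 = ((S.setv 21 (S.a 6 (S.v 14) 0)).setv 14 (S.v 14 + 1)).setv 21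
    (S.v 14 + 2) := ⟨_, rfl⟩
  have ha1 : S1.a = S.a := by simp [hS1]
  have hc1 : S1.cov = S.cov := by simp [hS1]
  have hv1 : ∀ r, r ≠ 14 → r < 21 → S1.v r = S.v r := by
    intro r h1 h2
    have : r ≠ 21 := by omega
    simp [hS1, this, h1]
  obtain ⟨S2, e2, a1, a2, a3, a4, a5, a6, a7⟩ := exec_wr (2 * X.n + 1) 1 (x := r 21) (z := r 19)
    (by simp) (by simp) S1
  have e : exec (2 * X.n + 1) (blkEmit X.P) S = S2.setv 15 0 := by
    have e3 : exec (2 * X.n + 1) (blkEmit X.P) S =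
        exec (2 * X.n + 1) (wr 1 (r 21) (r 19) ;; mov 15 (c 0)) S1 := by
      simp [blkEmit, exec, inc, WordOp.eval, Opd.val, hi, not_lt.2 hq, hS1]
    rw [e3]
    simp [exec, mov, e2, Opd.val, WordOp.eval]
  obtain ⟨S', hS'⟩ : ∃ S', S2.setv 15 0 = S' := ⟨_, rfl⟩
  have v : ∀ r, r ≠ 14 → r ≠ 15 → r ≠ 18 → r < 21 → S'.v r = S.v r := by
    intro r h1 h2 h3 h4
    rw [← hS', St.setv_v, if_neg h2, a1 r h3, hv1 r h1 h4]
  have v14 : S'.v 14 = S.v 14 + 1 := by simp [← hS', a1, hS1]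
  have v15 : S'.v 15 = 0 := by simp [← hS']
  have v18 : S'.v 18 = S.v 18 + 1 := by simp [← hS', a2, hv1]
  have hcv : S'.cov = S.cov := by simp [← hS', a3, hc1]
  have wa : ∀ k, k ≠ 9 → k ≠ 10 → S'.a k = S.a k := by
    intro k h1 h2; rw [← hS', St.setv_a, a4 k h1 h2, ha1]
  have h10 : S'.a 10 = wrPm (S.a 10) 1 (S.v 14 + 2) (S.v 19) := by
    rw [← hS', St.setv_a, a5, ha1]
    simp [Opd.val, hS1]
  have h101 : ∀ y, y ≠ S.v 14 + 2 → S'.a 10 1 y = S.a 10 1 y := by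
    intro y hy; rw [h10]; simp [hy]
  have ho := h.o_eq
  have ho2 := offs_succ S (S.v 14)
  have hso : ∀ x, offs S' x = offs S x := by
    intro x
    rw [offs, offs, v 17 (by simp) (by simp) (by simp) (by simp), wa 6 (by simp) (by simp)]
  have hE : X.E S' = X.E S := by simp [Ctx.E, v]
  have hsu : sumCnt (S.a 6) (S.v 14 + 1) = sumCnt (S.a 6) (S.v 14) + S.a 6 (S.v 14) 0 := by
    simp [sumCnt, Finset.sum_range_succ]
  rw [e, hS']
  refine ⟨⟨s, ⟨hc.le_m, by simpa [v, wa] using hc.fix, by simpa [v, wa, hcv] using hc.z,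
      by simpa [v, wa, hcv] using hc.y, by simpa [v] using hc.q_le, by simpa [v, wa] using hc.rep,
      ?_, ?_, by have := hc.cnt; simp [v]; omega⟩,
      by simpa [Params, v, hcv] using hp, ?_⟩, by simp [v]⟩
  · rw [v 17 (by simp) (by simp) (by simp) (by simp), ← hS']
    simp only [St.setv_a]
    have := a6 X.n (S.v 17) (by simpa [hS1] using hc.scr)
    simpa using this
  · rw [← hS']
    refine LeN.setv (a7 _ ?_ ?_ (by omega) ?_ ?_) (by omega)
    · rw [hS1]; exact ((hc.le.tmp (by simp)).setv (by omega)).tmp (by simp)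
    · rw [hv1 _ (by simp) (by simp)]; omega
    · simp only [Opd.val, hS1, St.setv_v, if_pos]; omega
    · simp only [Opd.val]; rw [hv1 _ (by simp) (by simp)]; exact hc.le.1 19 (by simp)
  refine .emit (by simpa [Late, v] using hl) ?_ (hg.step (by simp [v]) (by simp [v])
      (by simp [v, hcv]) (by simp [v]))
  exact {
    st := by simpa [v] using h.st
    qh := by simpa [v] using h.qh
    built := h.built.congr (fun r h1 h2 h3 _ _ h6 => v r h1 h2 h3 h6) wa hcv
    i_le := by rw [v14, v 17 (by simp) (by simp) (by simp) (by simp)]; omega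
    p_le := by rw [v15]; omega
    o_eq := by
      rw [v15, v14, v 19 (by simp) (by simp) (by simp) (by simp), hso]
      omega
    regs := fun x => by rw [h10, wrPm_of_ne _ (by simp), h.regs]
    size := by
      rw [h101 _ (by omega), h.size, v 17 (by simp) (by simp) (by simp) (by simp)]
    starts := by
      intro x hx
      rw [v14] at hx
      rw [hso]
      by_cases hxi : x = S.v 14 + 1
      · subst hxi
        rw [h10]
        simp
        omega
      · rw [h101 _ (by omega), h.starts x (by omega)]
    cells := by
      intro x hx q hq2
      have hlo := le_offs S x
      rw [v14] at hx
      rw [wa 6 (by simp) (by simp)] at hq2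
      rw [hso, wa 7 (by simp) (by simp), h101 _ (by omega)]
      by_cases hxi : x = S.v 14
      · subst hxi
        exact h.cells' q (by omega)
      · exact h.cells x (by omega) q hq2
    cells' := by
      intro q hq2
      omega
    rest := by
      intro y hy
      have hlo := le_offs S (S.v 14)
      rw [v 19 (by simp) (by simp) (by simp) (by simp)] at hy
      rw [h101 _ (by omega), h.rest y (by omega)]
    tm := by
      refine h.tm.step (by simp [v]) (by simp [v]) (by simp [v]) ?_
      rw [hE, v15, v18, v14, v 17 (by simp) (by simp) (by simp) (by simp), wa 6 (by simp) (by simp),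
        hsu]
      omega }

theorem exec_goto (off : ℕ) (P : Program) (l : ℕ) (S : St) :
    exec off (goto P l) S = S.setv 9 (if l < P.length then 8 + l else 5) := by
  simp [goto, mov, exec, Opd.val, WordOp.eval]

/-- The start of the simulation of the static program. -/
theorem next_emit_end (hX : X.Good) (hc : Core X i s 1 S) (hp : Params X S) (hl : Late X i s S)
    (h : PEmit X s 1 S) (hg : Chg X M C₀ i 1 S (S.v 11)) (hi : S.v 17 ≤ S.v 14) :
    Next X M C₀ i S (exec (2 * X.n + 1) (blkEmit X.P) S) := by
  have hV := hX.n_le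
  have hV' := hX.V_ge'
  have hlen := hX.length_le
  have hjn := hc.j_le
  have htm := h.tm.le hX hc
  have hij : S.v 14 = S.v 17 := le_antisymm h.i_le hi
  -- The position is bounded by the length of row `S.v 14`, and beyond the last row this length is
  -- zero.
  have hp0 : S.v 15 = 0 := by
    have := h.p_le
    rw [hc.scr.cnt _ hi] at this
    omega
  have hsm := hc.s_lt h.qh
  obtain ⟨S2, e2, a1, a2, a3, a4, a5, a6, a7⟩ := exec_wr (2 * X.n + 1) 0 (x := c 0) (z := r 4)
    (by simp) (by simp) S
  have e : exec (2 * X.n + 1) (blkEmit X.P) S =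
      (S2.setv 14 0).setv 9 (if 0 < X.P.length then 8 + 0 else 5) := by
    simp only [blkEmit, exec, Opd.val, not_lt.2 hi, if_false, e2, mov, WordOp.eval, exec_goto]
  obtain ⟨S', hS'⟩ : ∃ S', (S2.setv 14 0).setv 9 (if 0 < X.P.length then 8 + 0 else 5) = S' :=
    ⟨_, rfl⟩
  have v : ∀ r, r ≠ 9 → r ≠ 14 → r ≠ 18 → r < 21 → S'.v r = S.v r := by
    intro r h1 h2 h3 h4
    rw [← hS', St.setv_v, if_neg h1, St.setv_v, if_neg h2, a1 r h3]
  have v17 : S'.v 17 = S.v 17 := v _ (by simp) (by simp) (by simp) (by simp)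
  have v14 : S'.v 14 = 0 := by simp [← hS']
  have v18 : S'.v 18 = S.v 18 + 1 := by simp [← hS', a2]
  have hcv : S'.cov = S.cov := by simp [← hS', a3]
  have wa : ∀ k, k ≠ 9 → k ≠ 10 → S'.a k = S.a k := by
    intro k h1 h2; rw [← hS', St.setv_a, St.setv_a, a4 k h1 h2]
  have h10 : S'.a 10 = wrPm (S.a 10) 0 0 X.α := by
    rw [← hS', St.setv_a, St.setv_a, a5]
    simp [Opd.val, hc.fix.α_eq]
  have hso : ∀ x, x ≤ S.v 17 → S.a 10 1 (x + 1) = offs S x := fun x hx => h.starts x (by omega)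
  have hin : InputOk (X.A (s + 1)) (S.v 17) (fun q => S.a 8 q 0) (S.a 10 1) := by
    refine ⟨h.size, ?_, fun v => S.a 6 v 0, S.a 7, ?_, h.built.lists, ?_, ?_⟩
    · rw [hso 0 (by omega)]; simp [offs, sumCnt]
    · intro v hv
      rw [hso (v + 1) (by omega), hso v (by omega), offs_succ]
    · intro v hv q hq
      rw [hso v (by omega)]
      exact h.cells v (by omega) q hq
    · intro y hy
      rw [hso _ le_rfl] at hy
      refine h.rest y ?_
      rw [h.o_eq, hp0, hij]
      exact hy
  obtain ⟨s', hrun, hvc, hqual⟩ := hX.solve (s + 1) hsm (S.v 17) (fun q => S.a 8 q 0) (S.a 10 1)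
    h.built.j_pos (fun p hp q hq he => hc.scr.inj hp hq he)
    (fun q hq => ⟨(hc.scr.id_vrt q hq).1, by rw [hc.deg_eq h.qh]; exact h.built.hl.2 q hq⟩) hin
  rw [e, hS']
  refine ⟨⟨s, ⟨hc.le_m, by simpa [v, wa] using hc.fix, by simpa [v, wa, hcv] using hc.z,
      by simpa [v, wa, hcv] using hc.y, by simpa [v] using hc.q_le, by simpa [v, wa] using hc.rep,
      ?_, ?_, by have := hc.cnt; simp [v]; omega⟩,
      by simpa [Params, v, hcv] using hp, ?_⟩, by simp [v]⟩
  · rw [v17, ← hS']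
    simp only [St.setv_a]
    have := a6 X.n (S.v 17) hc.scr
    simpa using this
  · rw [← hS']
    refine LeN.setv (LeN.setv (a7 _ hc.le (by omega) (by omega) (by simp [Opd.val]) ?_) (by omega)) ?_
    · exact hc.le.1 4 (by simp)
    · split_ifs <;> omega
  refine phase_sim (μ := S.a 10 1) (s' := s') (t := 0) (by simpa [Late, v] using hl)
    (hg.step (by simp [v]) (by simp [v]) (by simp [v, hcv]) (by simp [v]))
    (by simpa [v] using h.qh) v14 (by rwa [v17]) ?_ (Nat.zero_le _) ?_ ?_ ?_ ?_
  · constructor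
    · intro x y hxy
      simp only [v 8 (by simp) (by simp) (by simp) (by simp), v17, hcv, wa 8 (by simp) (by simp)]
      rcases h.built.edges x y hxy with h1 | h1 | ⟨k, hk, l, hl, h1, h2⟩
      · exact .inl h1
      · exact .inr (.inl h1)
      · rcases hvc k hk l hl (by rw [h1, h2]; exact hxy) with h3 | h3
        · exact .inr (.inr ⟨k, hk, Nat.zero_le _, h3, .inl h1⟩)
        · exact .inr (.inr ⟨l, hl, Nat.zero_le _, h3, .inr h2⟩)
    · refine ⟨_, hqual (cset X.n S.cov (1 - S.v 8)) fun x hx => ⟨hx.1, ?_⟩, ?_⟩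
      · rw [hc.deg_eq h.qh]; exact h.built.hl.1 x hx
      · rw [ncard_of_bijOn hc.y, v17, v 11 (by simp) (by simp) (by simp) (by simp)]
        simp
  · rw [h10]
    funext x
    simp only [wrPm_self, Function.iterate_zero, id_eq, inputConfig, Function.update_apply, h.regs]
  · rw [h10, wrPm_of_ne _ (by simp)]
    rfl
  · simp [← hS', inputConfig]
  · refine h.tm.step (by simp [v]) (by simp [v]) (by simp [v]) ?_
    rw [v17, v18]
    omega

theorem next_emit (hX : X.Good) (hc : Core X i s 1 S) (hp : Params X S) (hl : Late X i s S)
    (h : PEmit X s 1 S) (hg : Chg X M C₀ i 1 S (S.v 11)) :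
    Next X M C₀ i S (exec (2 * X.n + 1) (blkEmit X.P) S) := by
  by_cases hi : S.v 14 < S.v 17
  · by_cases hq : S.v 15 < S.a 6 (S.v 14) 0
    · exact next_emit_cell hX hc hp hl h hg hi hq
    · exact next_emit_row hX hc hp hl h hg hi (not_lt.1 hq)
  · exact next_emit_end hX hc hp hl h hg (not_lt.1 hi)

theorem next_scan (hX : X.Good) (hc : Core X i s 1 S) (hp : Params X S) (hl : Late X i s S)
    (h : PScan X s 1 S) (hg : Chg X M C₀ i 1 S (S.v 11)) :
    Next X M C₀ i S (exec (2 * X.n + 1) blkScan S) := by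
  by_cases hi : S.v 14 < S.v 16
  · by_cases hd : S.v 15 < S.a 0 (S.a 8 (S.v 14) 0) 0
    · by_cases hh : X.d < S.a 0 (S.a 1 (S.a 8 (S.v 14) 0) (S.v 15)) 0
      · exact next_scan_high hX hc hp hl h hg hi rfl hd rfl hh
      · exact next_scan_low hX hc hp hl h hg hi rfl hd rfl (not_lt.1 hh)
    · exact next_scan_row hX hc hp hl h hg hi (not_lt.1 hd)
  · exact next_scan_end hX hc hp hl h hg (not_lt.1 hi)

end

/-! ### Microsteps: simulating the static program -/

section

variable {X : Ctx} {M : ℕ} {C₀ : Set ℕ} {i s e : ℕ} {S S' T : St}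

/-- The `t`-th configuration of the static program on the input `μ`. -/
def Ctx.conf (X : Ctx) (μ : ℕ → ℕ) (t : ℕ) : Config := (step X.P)^[t] (inputConfig X.α μ)

/-- The part common to all instructions. A simulated step lowers the remaining charge by two and
lengthens the log by at most one, so at least the one microstep is paid for. -/
theorem next_sim_of (hc : Core X i s 1 S) (hp : Params X S) (hl : Late X i s S)
    (hqh : S.v 12 = 1) (hi : S.v 14 = 0) (hg : Chg X M C₀ i 1 S (S.v 11)) {μ : ℕ → ℕ} {s' : Config}
    {t : ℕ} (hrun : RunsTo X.P X.Wp (inputConfig X.α μ) (X.T (S.v 17)) s')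
    (hsel : Selects X s 0 S s'.mem) (ht : t < X.T (S.v 17))
    (htm : Tm X s 1 S (2 * (X.T (S.v 17) - t) + S.v 18 + 2 * S.v 17 + 3))
    (v : ∀ r, r ≠ 9 → r ≠ 18 → r < 21 → S'.v r = S.v r) (v18 : S'.v 18 ≤ S.v 18 + 1)
    (hcv : S'.cov = S.cov) (wa : ∀ k, k ≠ 9 → k ≠ 10 → S'.a k = S.a k)
    (hscr : Scratch X.n (S.v 17) (S'.v 18) (S'.a 5) (S'.a 6) (S'.a 8) (S'.a 9) (S'.a 10))
    (hL : LeN X.V S') (h0 : S'.a 10 0 = (X.conf μ (t + 1)).reg)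
    (h1 : S'.a 10 1 = (X.conf μ (t + 1)).mem)
    (h9 : S'.v 9 = if (X.conf μ (t + 1)).pc < X.P.length then 8 + (X.conf μ (t + 1)).pc else 5) :
    Next X M C₀ i S S' := by
  have v17 : S'.v 17 = S.v 17 := v _ (by simp) (by simp) (by simp)
  refine ⟨⟨s, ⟨hc.le_m, by simpa [v, wa] using hc.fix, by simpa [v, wa, hcv] using hc.z,
      by simpa [v, wa, hcv] using hc.y, by simpa [v] using hc.q_le, by simpa [v, wa] using hc.rep,
      by rwa [v17], hL, by have := hc.cnt; simp [v]; omega⟩,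
      by simpa [Params, v, hcv] using hp, ?_⟩, by simp [v]⟩
  refine phase_sim (μ := μ) (s' := s') (t := t + 1) (by simpa [Late, v] using hl)
    (hg.step (by simp [v]) (by simp [v]) (by simp [v, hcv]) (by simp [v]))
    (by simpa [v] using hqh) (by simpa [v] using hi) (by rwa [v17]) ?_ (by rw [v17]; omega) h0 h1 h9 ?_
  · exact ⟨by simpa [v, wa, hcv] using hsel.cov, by simpa [v] using hsel.qual⟩
  · refine htm.step (by simp [v]) (by simp [v]) (by simp [v]) ?_
    rw [v17]
    omega

/-- The simulation of an instruction that writes a word. -/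
theorem next_sim_wr (hX : X.Good) (hc : Core X i s 1 S) (hp : Params X S) (hl : Late X i s S)
    (hqh : S.v 12 = 1) (hi : S.v 14 = 0) (hg : Chg X M C₀ i 1 S (S.v 11)) {μ : ℕ → ℕ} {s' : Config}
    {t : ℕ} (hrun : RunsTo X.P X.Wp (inputConfig X.α μ) (X.T (S.v 17)) s')
    (hsel : Selects X s 0 S s'.mem) (ht : t < X.T (S.v 17))
    (htm : Tm X s 1 S (2 * (X.T (S.v 17) - t) + S.v 18 + 2 * S.v 17 + 3))
    (v : ∀ r, r < 21 → T.v r = S.v r) (ha : T.a = S.a) (hcv : T.cov = S.cov) (hL : LeN X.V T)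
    {κ : ℕ} {x z : Opd} (hx : x ≠ r 18) (hz : z ≠ r 18) (hκ : κ ≤ X.V) (hxV : x.val T ≤ X.V)
    (hzV : z.val T ≤ X.V)
    (h0 : wrPm (S.a 10) κ (x.val T) (z.val T) 0 = (X.conf μ (t + 1)).reg)
    (h1 : wrPm (S.a 10) κ (x.val T) (z.val T) 1 = (X.conf μ (t + 1)).mem) :
    Next X M C₀ i S (exec (2 * X.n + 1) (wr κ x z ;; goto X.P (X.conf μ (t + 1)).pc) T) := by
  have hlen := hX.length_le
  have hV18 := htm.le hX hc
  obtain ⟨S2, e2, a1, a2, a3, a4, a5, a6, a7⟩ := exec_wr (2 * X.n + 1) κ hx hz T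
  obtain ⟨S', hS'⟩ : ∃ S', exec (2 * X.n + 1) (wr κ x z ;; goto X.P (X.conf μ (t + 1)).pc) T = S' :=
    ⟨_, rfl⟩
  rw [hS']
  simp only [exec, e2, exec_goto] at hS'
  have hv18 : S'.v 18 = S2.v 18 := by simp [← hS']
  have ha2 : S'.a = S2.a := by simp [← hS']
  refine next_sim_of hc hp hl hqh hi hg hrun hsel ht htm ?_ ?_ ?_ ?_ ?_ ?_ ?_ ?_ ?_
  · intro r h1 h2 h3
    rw [← hS', St.setv_v, if_neg h1, a1 r h2, v r h3]
  · rw [hv18, a2, v _ (by simp)]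
  · rw [← hS', St.setv_cov, a3, hcv]
  · intro k h1 h2
    rw [ha2, a4 k h1 h2, ha]
  · rw [hv18, ha2]
    refine a6 _ _ ?_
    rw [ha, v _ (by simp)]
    exact hc.scr
  · rw [← hS']
    refine LeN.setv (a7 _ hL ?_ hκ hxV hzV) ?_
    · rw [v _ (by simp)]; omega
    · split_ifs <;> omega
  · rw [ha2, a5, ha, h0]
  · rw [ha2, a5, ha, h1]
  · simp [← hS']

/-- The simulation of a jump. -/
theorem next_sim_jump (hX : X.Good) (hc : Core X i s 1 S) (hp : Params X S) (hl : Late X i s S)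
    (hqh : S.v 12 = 1) (hi : S.v 14 = 0) (hg : Chg X M C₀ i 1 S (S.v 11)) {μ : ℕ → ℕ} {s' : Config}
    {t : ℕ} (hrun : RunsTo X.P X.Wp (inputConfig X.α μ) (X.T (S.v 17)) s')
    (hsel : Selects X s 0 S s'.mem) (ht : t < X.T (S.v 17))
    (htm : Tm X s 1 S (2 * (X.T (S.v 17) - t) + S.v 18 + 2 * S.v 17 + 3))
    (v : ∀ r, r < 21 → T.v r = S.v r) (ha : T.a = S.a) (hcv : T.cov = S.cov) (hL : LeN X.V T)
    (h0 : S.a 10 0 = (X.conf μ (t + 1)).reg) (h1 : S.a 10 1 = (X.conf μ (t + 1)).mem) {k : ℕ}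
    (hk : k = if (X.conf μ (t + 1)).pc < X.P.length then 8 + (X.conf μ (t + 1)).pc else 5) :
    Next X M C₀ i S (T.setv 9 k) := by
  have hlen := hX.length_le
  refine next_sim_of hc hp hl hqh hi hg hrun hsel ht htm ?_ ?_ ?_ ?_ ?_ ?_ ?_ ?_ ?_
  · intro r h1 h2 h3
    rw [St.setv_v, if_neg h1, v r h3]
  · simp [v]
  · simpa using hcv
  · intro k h1 h2; simp [ha]
  · simpa [v, ha] using hc.scr
  · refine hL.setv ?_
    rw [hk]
    split_ifs <;> omega
  · simpa [ha] using h0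
  · simpa [ha] using h1
  · simpa using hk

/-- If `t` were the full time bound, the static program would have halted, contrary to its program
counter still being inside the program. -/
theorem PSim.next_conf {μ : ℕ → ℕ} {s' : Config} {t j : ℕ}
    (hrun : RunsTo X.P X.Wp (inputConfig X.α μ) (X.T j) s') (ht : t ≤ X.T j)
    (hpc : (X.conf μ t).pc < X.P.length) :
    t < X.T j ∧ (X.conf μ t).BoundedBy X.Wp ∧ (X.conf μ (t + 1)).BoundedBy X.Wp ∧
      ∃ I, X.P[(X.conf μ t).pc]? = some I ∧ I ∈ X.P ∧ X.conf μ (t + 1) = I.exec (X.conf μ t) := by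
  have h1 : t < X.T j := by
    refine lt_of_le_of_ne ht fun e => ?_
    have h1 := hrun.1
    have h2 := hrun.2.1
    rw [← h1, ← e] at h2
    exact absurd hpc (not_lt.2 h2)
  refine ⟨h1, hrun.2.2 t ht, hrun.2.2 (t + 1) h1, _, List.getElem?_eq_getElem hpc,
    List.getElem_mem hpc, ?_⟩
  unfold Ctx.conf at hpc ⊢
  rw [Function.iterate_succ_apply', step, List.getElem?_eq_getElem hpc]

/-- The bounds on operands and result are part of the conclusion because `grow` does not apply to
simulated arithmetic, which may be a shift. They are inherited from the guaranteed run of the static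
program, in which the result is a register of the next configuration. -/
theorem next_sim (hX : X.Good) (hc : Core X i s 1 S) (hp : Params X S) (hl : Late X i s S)
    (h : PSim X s 1 S) (hg : Chg X M C₀ i 1 S (S.v 11)) :
    ∃ p I, X.P[p]? = some I ∧ S.v 9 = 8 + p ∧
      (∀ f d a b, I = .op f d a b → S.a 10 0 a ≤ X.V ∧ S.a 10 0 b ≤ X.V ∧
        f.eval (S.a 10 0 a) (S.a 10 0 b) ≤ X.V) ∧
      Next X M C₀ i S (exec (2 * X.n + 1) (simBlock X.P p I) S) := by
  obtain ⟨hqh, hi, μ, s', hrun, hsel, t, ht, hreg, hmem, hpc, h9, htm⟩ := h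
  obtain ⟨htT, hb, hb', I, hPc, hIP, hconf⟩ := PSim.next_conf hrun ht hpc
  change S.a 10 0 = (X.conf μ t).reg at hreg
  change S.a 10 1 = (X.conf μ t).mem at hmem
  have hWp := hX.Wp_le
  have hV := hX.n_le
  change (X.conf μ t).pc < X.P.length at hpc
  change S.v 9 = 8 + (X.conf μ t).pc at h9
  obtain ⟨cf, hcf⟩ : ∃ cf, X.conf μ t = cf := ⟨_, rfl⟩
  rw [hcf] at hb hconf hreg hmem hpc h9 hPc
  have hPI := hX.P_le I hIP
  refine ⟨cf.pc, I, hPc, h9, ?_, ?_⟩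
  · intro f d a b hI
    rw [hreg]
    refine ⟨(hb a).1.trans hWp, (hb b).1.trans hWp, ?_⟩
    have := (hb' d).1
    rw [hconf, hI] at this
    simp only [Instr.exec, Function.update_self] at this
    exact this.trans hWp
  · have wrap : ∀ {κ : ℕ} {x z : Opd} {T : St} {l : ℕ}, (∀ r, r < 21 → T.v r = S.v r) → T.a = S.a →
        T.cov = S.cov → LeN X.V T → x ≠ r 18 → z ≠ r 18 → κ ≤ 1 → x.val T ≤ X.V → z.val T ≤ X.V →
        wrPm (S.a 10) κ (x.val T) (z.val T) 0 = (X.conf μ (t + 1)).reg →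
        wrPm (S.a 10) κ (x.val T) (z.val T) 1 = (X.conf μ (t + 1)).mem →
        (X.conf μ (t + 1)).pc = l →
        Next X M C₀ i S (exec (2 * X.n + 1) (wr κ x z ;; goto X.P l) T) := by
      intro κ x z T l b1 b2 b3 b4 b5 b6 b7 b8 b9 b10 b11 b12
      rw [← b12]
      exact next_sim_wr hX hc hp hl hqh hi hg hrun hsel htT htm b1 b2 b3 b4 b5 b6 (by omega) b8 b9
        b10 b11
    have wrap' : ∀ {T : St} {k : ℕ}, (∀ r, r < 21 → T.v r = S.v r) → T.a = S.a →
        T.cov = S.cov → LeN X.V T → S.a 10 0 = (X.conf μ (t + 1)).reg →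
        S.a 10 1 = (X.conf μ (t + 1)).mem →
        (k = if (X.conf μ (t + 1)).pc < X.P.length then 8 + (X.conf μ (t + 1)).pc else 5) →
        Next X M C₀ i S (T.setv 9 k) := fun b1 b2 b3 b4 b5 b6 b7 =>
      next_sim_jump hX hc hp hl hqh hi hg hrun hsel htT htm b1 b2 b3 b4 b5 b6 b7
    have tmpv : ∀ {k x r : ℕ} {T : St}, 21 ≤ k → r < 21 → (T.setv k x).v r = T.v r := by
      intro k x r T h1 h2
      rw [St.setv_v, if_neg (by omega)]
    clear hg htm hrun hsel hp hl hPc hIP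
    cases I with
    | const d k =>
      have hd := hPI d (by simp [instrConsts])
      have hk := hPI k (by simp [instrConsts])
      refine wrap (fun _ _ => rfl) rfl rfl hc.le (by simp) (by simp) (by simp) hd hk ?_ ?_ ?_
      · simp [hconf, Instr.exec, Opd.val, hreg]
      · simp [hconf, Instr.exec, Opd.val, hmem, wrPm]
      · simp [hconf, Instr.exec]
    | op f d a b =>
      have hd := hPI d (by simp [instrConsts])
      have hw : f.eval (cf.reg a) (cf.reg b) ≤ X.V := by
        have := (hb' d).1
        rw [hconf] at this
        simp only [Instr.exec, Function.update_self] at this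
        exact this.trans hWp
      have e : exec (2 * X.n + 1) (simBlock X.P cf.pc (.op f d a b)) S =
          exec (2 * X.n + 1) (wr 0 (c d) (r 23) ;; goto X.P (cf.pc + 1))
            (((S.setv 21 (cf.reg a)).setv 22 (cf.reg b)).setv 23 (f.eval (cf.reg a) (cf.reg b))) := by
        simp [simBlock, exec, Opd.val, hreg]
      rw [e]
      refine wrap (fun _ hr => ?_) rfl rfl ?_ (by simp) (by simp) (by simp) hd ?_ ?_ ?_ ?_
      · rw [tmpv (by simp) hr, tmpv (by simp) hr, tmpv (by simp) hr]
      · exact ((hc.le.tmp (by simp)).tmp (by simp)).tmp (by simp)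
      · simpa [Opd.val] using hw
      · simp [hconf, Instr.exec, Opd.val, hreg]
      · simp [hconf, Instr.exec, Opd.val, hmem, wrPm]
      · simp [hconf, Instr.exec]
    | load d a =>
      have hd := hPI d (by simp [instrConsts])
      have e : exec (2 * X.n + 1) (simBlock X.P cf.pc (.load d a)) S =
          exec (2 * X.n + 1) (wr 0 (c d) (r 22) ;; goto X.P (cf.pc + 1))
            ((S.setv 21 (cf.reg a)).setv 22 (cf.mem (cf.reg a))) := by
        simp [simBlock, exec, Opd.val, hreg, hmem]
      rw [e]
      refine wrap (fun _ hr => ?_) rfl rfl ?_ (by simp) (by simp) (by simp) hd ?_ ?_ ?_ ?_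
      · rw [tmpv (by simp) hr, tmpv (by simp) hr]
      · exact (hc.le.tmp (by simp)).tmp (by simp)
      · simpa [Opd.val] using (hb _).2.trans hWp
      · simp [hconf, Instr.exec, Opd.val, hreg]
      · simp [hconf, Instr.exec, Opd.val, hmem, wrPm]
      · simp [hconf, Instr.exec]
    | store a b =>
      have e : exec (2 * X.n + 1) (simBlock X.P cf.pc (.store a b)) S =
          exec (2 * X.n + 1) (wr 1 (r 21) (r 22) ;; goto X.P (cf.pc + 1))
            ((S.setv 21 (cf.reg a)).setv 22 (cf.reg b)) := by
        simp [simBlock, exec, Opd.val, hreg]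
      rw [e]
      refine wrap (fun _ hr => ?_) rfl rfl ?_ (by simp) (by simp) (by simp) ?_ ?_ ?_ ?_ ?_
      · rw [tmpv (by simp) hr, tmpv (by simp) hr]
      · exact (hc.le.tmp (by simp)).tmp (by simp)
      · simpa [Opd.val] using (hb a).1.trans hWp
      · simpa [Opd.val] using (hb b).1.trans hWp
      · simp [hconf, Instr.exec, Opd.val, hreg, wrPm]
      · simp [hconf, Instr.exec, Opd.val, hmem]
      · simp [hconf, Instr.exec]
    | jumpZero a l =>
      have e : exec (2 * X.n + 1) (simBlock X.P cf.pc (.jumpZero a l)) S =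
          (S.setv 21 (cf.reg a)).setv 9 (if (X.conf μ (t + 1)).pc < X.P.length then
            8 + (X.conf μ (t + 1)).pc else 5) := by
        by_cases hz : cf.reg a = 0
        · simp [simBlock, exec, Opd.val, hreg, hz, exec_goto, hconf, Instr.exec]
        · simp [simBlock, exec, Opd.val, hreg, hz, exec_goto, hconf, Instr.exec]
      rw [e]
      refine wrap' (fun _ hr => ?_) rfl rfl ?_ ?_ ?_ rfl
      · rw [tmpv (by simp) hr]
      · exact hc.le.tmp (by simp)
      · simp [hconf, Instr.exec, hreg]
      · simp [hconf, Instr.exec, hmem]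
    | jumpLess a b l =>
      have e : exec (2 * X.n + 1) (simBlock X.P cf.pc (.jumpLess a b l)) S =
          ((S.setv 21 (cf.reg a)).setv 22 (cf.reg b)).setv 9
            (if (X.conf μ (t + 1)).pc < X.P.length then 8 + (X.conf μ (t + 1)).pc else 5) := by
        by_cases hz : cf.reg a < cf.reg b
        · simp [simBlock, exec, Opd.val, hreg, hz, exec_goto, hconf, Instr.exec]
        · simp [simBlock, exec, Opd.val, hreg, hz, exec_goto, hconf, Instr.exec]
      rw [e]
      refine wrap' (fun _ hr => ?_) rfl rfl ?_ ?_ ?_ rfl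
      · rw [tmpv (by simp) hr, tmpv (by simp) hr]
      · exact (hc.le.tmp (by simp)).tmp (by simp)
      · simp [hconf, Instr.exec, hreg]
      · simp [hconf, Instr.exec, hmem]
    | jumpReg a =>
      have e : exec (2 * X.n + 1) (simBlock X.P cf.pc (.jumpReg a)) S =
          (S.setv 21 (cf.reg a)).setv 9 (if (X.conf μ (t + 1)).pc < X.P.length then
            8 + (X.conf μ (t + 1)).pc else 5) := by
        by_cases hz : cf.reg a < X.P.length
        · simp [simBlock, exec, Opd.val, hreg, hz, hconf, Instr.exec, WordOp.eval, add_comm]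
        · simp [simBlock, exec, Opd.val, hreg, hz, hconf, Instr.exec, WordOp.eval, mov]
      rw [e]
      refine wrap' (fun _ hr => ?_) rfl rfl ?_ ?_ ?_ rfl
      · rw [tmpv (by simp) hr]
      · exact hc.le.tmp (by simp)
      · simp [hconf, Instr.exec, hreg]
      · simp [hconf, Instr.exec, hmem]

end

/-! ### Microsteps: reading the output, cleaning up, starting a phase -/

section

variable {X : Ctx} {M : ℕ} {C₀ : Set ℕ} {i s e : ℕ} {S S' T : St}

theorem Selects.mono {k : ℕ} {ρ : ℕ → ℕ} (h : Selects X s k S ρ) (h0 : ρ k = 0) :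
    Selects X s (k + 1) S ρ := by
  have hne : ∀ q, ρ q ≠ 0 → q ≠ k := by rintro q hq rfl; exact hq h0
  refine ⟨fun x y hxy => ?_, ?_⟩
  · rcases h.cov x y hxy with h1 | h1 | ⟨q, hq, hkq, h1, h2⟩
    · exact .inl h1
    · exact .inr (.inl h1)
    · have := hne q h1
      exact .inr (.inr ⟨q, hq, by omega, h1, h2⟩)
  · obtain ⟨x, hx, hle⟩ := h.qual
    refine ⟨x, hx, le_trans (Nat.add_le_add_left (ncard_le_ncard ?_ ?_) _) hle⟩
    · rintro q ⟨h1, h2, h3⟩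
      exact ⟨by omega, h2, h3⟩
    · exact (finite_Iio (S.v 17)).subset fun q hq => hq.2.1

theorem next_out (hX : X.Good) (hc : Core X i s 1 S) (hp : Params X S) (hl : Late X i s S)
    (h : POut X s 1 S) (hg : Chg X M C₀ i 1 S (S.v 11)) :
    Next X M C₀ i S (exec (2 * X.n + 1) blkOut S) := by
  have hV := hX.n_le
  have hjn := hc.j_le
  by_cases hi : S.v 14 < S.v 17
  · obtain ⟨w, hw⟩ : ∃ w, S.a 8 (S.v 14) 0 = w := ⟨_, rfl⟩
    obtain ⟨z, hz⟩ : ∃ z, S.a 10 1 (S.v 14) = z := ⟨_, rfl⟩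
    have hwn : w < X.n := hw ▸ (hc.scr.id_vrt _ hi).1
    obtain ⟨S1, hS1⟩ : ∃ S1, S1 = ((S.setv 21 z).setv 22 w).setv 14 (S.v 14 + 1) := ⟨_, rfl⟩
    have hc1 : Core X i s 1 S1 := by
      subst hS1
      exact ⟨hc.le_m, by simpa using hc.fix, by simpa using hc.z, by simpa using hc.y,
        by simpa using hc.q_le, by simpa using hc.rep, by simpa using hc.scr,
        ((hc.le.tmp (by simp)).tmp (by simp)).setv (by omega), by simpa using hc.cnt⟩
    have hp1 : Params X S1 := by subst hS1; simpa [Params] using hp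
    by_cases hz0 : z = 0
    · have e : exec (2 * X.n + 1) blkOut S = S1 := by
        simp [blkOut, exec, inc, Opd.val, WordOp.eval, hi, hw, hz, hz0, hS1]
      rw [e]
      refine ⟨⟨s, ⟨hc1.le_m, hc1.fix, hc1.z, hc1.y, hc1.q_le, hc1.rep, hc1.scr, hc1.le, ?_⟩, hp1, ?_⟩,
        by simp [hS1]⟩
      · have := hc1.cnt; omega
      have hsel := h.sel.mono (by rw [hz, hz0])
      refine .out (by simpa [Late, hS1] using hl) ?_
        (hg.step (by simp [hS1]) (by simp [hS1]) (by simp [hS1]) (by simp [hS1]))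
      exact {
        st := by simpa [hS1] using h.st
        qh := by simpa [hS1] using h.qh
        i_le := by simp [hS1]; omega
        sel := ⟨by simpa [hS1] using hsel.cov, by simpa [hS1] using hsel.qual⟩
        tm := h.tm.step (by simp [hS1]) (by simp [hS1]) (by simp [hS1]) (by simp [hS1]; omega) }
    · have e : exec (2 * X.n + 1) blkOut S = exec (2 * X.n + 1) (addY 22) S1 := by
        simp [blkOut, exec, inc, Opd.val, WordOp.eval, hi, hw, hz, hz0, hS1]
      have v22 : S1.v 22 = w := by simp [hS1]
      have hA := exec_addY (x := 22) hc1.fix.n_eq hc1.fix.f_le (by rw [v22]; exact hwn) (by simp) hc1.y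
      rw [v22, ← e] at hA
      obtain ⟨S', hS'⟩ : ∃ S', exec (2 * X.n + 1) blkOut S = S' := ⟨_, rfl⟩
      rw [hS'] at hA ⊢
      have hv := hA.v
      have hys : cset X.n S'.cov (1 - S.v 8) = insert w (cset X.n S.cov (1 - S.v 8)) := by
        simpa [hS1] using hA.ys
      have hzs : cset X.n S'.cov (S.v 8) = cset X.n S.cov (S.v 8) := by simpa [hS1] using hA.zs
      have hle : S'.v 11 ≤ S.v 11 + 1 := by simpa [hS1] using hA.le
      have v : ∀ r, r ≠ 11 → r ≠ 14 → r < 21 → S'.v r = S.v r := by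
        intro r h1 h2 h3
        have h4 : r ≠ 21 ∧ r ≠ 22 := by omega
        rw [hv r h1 (by omega) (by omega) (by omega), hS1]
        simp [h2, h4]
      have wa : ∀ k, k ≠ 3 → S'.a k = S.a k := by
        intro k hk; rw [hA.a k hk, hS1]; simp
      have v14 : S'.v 14 = S.v 14 + 1 := by simp [hv, hS1]
      refine ⟨⟨s, hA.core hX hc1, hA.params hp1, ?_⟩, by simp [hv, hS1]⟩
      refine .out (by simpa [Late, v] using hl) ?_
        (hg.step (by simp [v]) (by simp [v]) (by simpa [v] using hzs) hle)
      exact {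
        st := by simpa [v] using h.st
        qh := by simpa [v] using h.qh
        i_le := by simp [v, v14]; omega
        sel := by
          constructor
          · intro x y hxy
            simp only [v 8 (by simp) (by simp) (by simp), v 17 (by simp) (by simp) (by simp), v14,
              wa 10 (by simp), wa 8 (by simp), hys, mem_insert_iff]
            rcases h.sel.cov x y hxy with h1 | h1 | ⟨q, hq, hkq, h1, h2⟩
            · exact .inl (.inr h1)
            · exact .inr (.inl (.inr h1))
            · by_cases hqi : q = S.v 14
              · rw [hqi, hw] at h2
                rcases h2 with h2 | h2
                · exact .inl (.inl h2.symm)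
                · exact .inr (.inl (.inl h2.symm))
              · exact .inr (.inr ⟨q, hq, by omega, h1, h2⟩)
          · obtain ⟨x, hx, hle'⟩ := h.sel.qual
            refine ⟨x, hx, ?_⟩
            rw [v14, v 17 (by simp) (by simp) (by simp), wa 10 (by simp)]
            have e1 : {q | S.v 14 ≤ q ∧ q < S.v 17 ∧ S.a 10 1 q ≠ 0} =
                insert (S.v 14) {q | S.v 14 + 1 ≤ q ∧ q < S.v 17 ∧ S.a 10 1 q ≠ 0} := by
              ext q
              simp only [mem_ofPred_eq, mem_insert_iff]
              constructor
              · rintro ⟨h1, h2, h3⟩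
                by_cases hqi : q = S.v 14
                · exact .inl hqi
                · exact .inr ⟨by omega, h2, h3⟩
              · rintro (rfl | ⟨h1, h2, h3⟩)
                · exact ⟨le_rfl, hi, by rw [hz]; exact hz0⟩
                · exact ⟨by omega, h2, h3⟩
            rw [e1, ncard_insert_of_notMem (by simp)
              ((finite_Iio (S.v 17)).subset fun q hq => hq.2.1)] at hle'
            omega
        tm := h.tm.step (by simp [v]) (by simp [v]) (by simp [v]) (by simp [v, v14]; omega) }
  · have e : exec (2 * X.n + 1) blkOut S = S.setv 9 6 := by
      simp [blkOut, exec, mov, Opd.val, WordOp.eval, hi]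
    rw [e]
    refine ⟨⟨s, ⟨hc.le_m, by simpa using hc.fix, by simpa using hc.z, by simpa using hc.y,
      by simpa using hc.q_le, by simpa using hc.rep, by simpa using hc.scr, hc.le.setv (by omega),
      by have := hc.cnt; simp; omega⟩, by simpa [Params] using hp, ?_⟩, by simp⟩
    refine .clean (by simpa [Late] using hl) ?_ (hg.step (by simp) (by simp) (by simp) (by simp))
    refine ⟨by simp, by simpa using h.qh, ⟨?_, ?_⟩, h.tm.step (by simp) (by simp) (by simp) ?_⟩
    · intro x y hxy
      rcases h.sel.cov x y (by simpa [h.qh] using hxy) with h1 | h1 | ⟨q, hq, hkq, -⟩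
      · left; simpa using h1
      · right; simpa using h1
      · omega
    · obtain ⟨x, hx, hle⟩ := h.sel.qual
      exact ⟨x, hx, by simp; omega⟩
    · simp

/-- A cell written several times is logged several times. That is harmless, since the invariant only
asks that nonzero cells be logged. -/
theorem Scratch.pop {n j tc : ℕ} {id cnt vrt tr pm : ℕ → ℕ → ℕ}
    (h : Scratch n j (tc + 1) id cnt vrt tr pm) :
    Scratch n j tc id cnt vrt tr (wrPm pm (tr tc 0) (tr tc 1) 0) where
  id_vrt := h.id_vrt
  vrt_id := h.vrt_id
  cnt := h.cnt
  pm κ x hne := by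
    by_cases e : κ = tr tc 0 ∧ x = tr tc 1
    · obtain ⟨rfl, rfl⟩ := e
      simp at hne
    · have hp : pm κ x ≠ 0 := by
        by_cases hk : κ = tr tc 0
        · subst hk
          have hx : x ≠ tr tc 1 := by tauto
          simpa [hx] using hne
        · rwa [wrPm_of_ne _ hk] at hne
      obtain ⟨q, hq, h1, h2⟩ := h.pm κ x hp
      refine ⟨q, ?_, h1, h2⟩
      have : q ≠ tc := by rintro rfl; exact e ⟨h1.symm, h2.symm⟩
      omega

theorem Scratch.dealloc {n j tc : ℕ} {id cnt vrt tr pm : ℕ → ℕ → ℕ}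
    (h : Scratch n (j + 1) tc id cnt vrt tr pm) :
    Scratch n j tc (Function.update id (vrt j 0) (Function.update (id (vrt j 0)) 0 0))
      (Function.update cnt j (Function.update (cnt j) 0 0)) vrt tr pm where
  id_vrt q hq := by
    have hne : vrt q 0 ≠ vrt j 0 := fun e => by
      have := h.inj (by omega) (by omega) e
      omega
    simpa [hne] using h.id_vrt q (by omega)
  vrt_id x hx := by
    have hxv : x ≠ vrt j 0 := by rintro rfl; simp at hx
    obtain ⟨q, hq, h1⟩ := h.vrt_id x (by simpa [hxv] using hx)
    refine ⟨q, ?_, h1⟩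
    have : q ≠ j := by rintro rfl; exact hxv h1.symm
    omega
  cnt x hx := by
    by_cases e : x = j
    · subst e; simp
    · simpa [e] using h.cnt x (by omega)
  pm := h.pm

theorem next_clean (hX : X.Good) (hc : Core X i s 1 S) (hp : Params X S) (hl : Late X i s S)
    (h : PClean X s 1 S) (hg : Chg X M C₀ i 1 S (S.v 11)) :
    Next X M C₀ i S (exec (2 * X.n + 1) blkClean S) := by
  have hV := hX.n_le
  have hjn := hc.j_le
  have h18 := hc.le.1 18 (by simp)
  by_cases ht : S.v 18 = 0
  · by_cases hj : S.v 17 = 0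
    · have e : exec (2 * X.n + 1) blkClean S = S.setv 9 7 := by
        simp [blkClean, exec, mov, Opd.val, WordOp.eval, ht, hj]
      rw [e]
      refine ⟨⟨s, ⟨hc.le_m, by simpa using hc.fix, by simpa using hc.z, by simpa using hc.y,
        by simpa using hc.q_le, by simpa using hc.rep, by simpa using hc.scr, hc.le.setv (by omega),
        by have := hc.cnt; simp; omega⟩, by simpa [Params] using hp, ?_⟩, by simp⟩
      refine .apply (by simpa [Late] using hl) ?_ (hg.step (by simp) (by simp) (by simp) (by simp))
      exact ⟨by simp, by simpa using hj, by simpa using ht, by simpa [YOk] using h.ok,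
        h.tm.step (by simp) (by simp) (by simp) (by simp)⟩
    · obtain ⟨j, hj'⟩ := Nat.exists_eq_succ_of_ne_zero hj
      have e : exec (2 * X.n + 1) blkClean S = (((S.setv 17 j).setv 21 (S.a 8 j 0)).seta 5
          (S.a 8 j 0) 0 0).seta 6 j 0 0 := by
        simp [blkClean, exec, mov, dec, Opd.val, WordOp.eval, ht, hj']
      have hscr := hc.scr
      rw [hj'] at hscr
      rw [e]
      refine ⟨⟨s, ⟨hc.le_m, by simpa using hc.fix, by simpa using hc.z, by simpa using hc.y,
        by simpa using hc.q_le, by simpa using hc.rep, by simpa using hscr.dealloc, ?_,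
        by have := hc.cnt; simp; omega⟩, by simpa [Params] using hp, ?_⟩, by simp⟩
      · exact (((hc.le.setv (by omega)).tmp (by simp)).seta (by omega)).seta (by omega)
      refine .clean (by simpa [Late] using hl) ?_ (hg.step (by simp) (by simp) (by simp) (by simp))
      exact ⟨by simpa using h.st, by simpa using h.qh, by simpa [YOk] using h.ok,
        h.tm.step (by simp) (by simp) (by simp) (by simp; omega)⟩
  · obtain ⟨tc, ht'⟩ := Nat.exists_eq_succ_of_ne_zero ht
    have e : exec (2 * X.n + 1) blkClean S = (((S.setv 18 tc).setv 21 (S.a 9 tc 0)).setv 22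
        (S.a 9 tc 1)).seta 10 (S.a 9 tc 0) (S.a 9 tc 1) 0 := by
      simp [blkClean, exec, dec, Opd.val, WordOp.eval, ht']
    have hscr := hc.scr
    rw [ht'] at hscr
    rw [e]
    refine ⟨⟨s, ⟨hc.le_m, by simpa using hc.fix, by simpa using hc.z, by simpa using hc.y,
      by simpa using hc.q_le, by simpa using hc.rep, by simpa [wrPm] using hscr.pop, ?_,
      by have := hc.cnt; simp; omega⟩, by simpa [Params] using hp, ?_⟩, by simp⟩
    · exact (((hc.le.setv (by omega)).tmp (by simp)).tmp (by simp)).seta (by omega)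
    refine .clean (by simpa [Late] using hl) ?_ (hg.step (by simp) (by simp) (by simp) (by simp))
    exact ⟨by simpa using h.st, by simpa using h.qh, by simpa [YOk] using h.ok,
      h.tm.step (by simp) (by simp) (by simp) (by simp; omega)⟩

/-- Clearing costs `y`, collecting `z`, and the rest `9 + 2θ ≤ 11θ` units for each of the `z(d + 1)`
potential vertices. Both `y` and `z` are linear in the optimum at the snapshot, since the optimum
moves by at most one per update. The factor 13 is 11 + 1 + 1 for the three summands, and 20 absorbs
the additive constant. -/
theorem start_work {t1 θ d o o' y z : ℕ} (hθ : 1 ≤ θ) (hy : y ≤ t1 * (o + 1) + 1) (ho : o ≤ o' + 1)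
    (hz : z ≤ t1 * (o' + 1) + 1) : y + z + (9 + 2 * θ) * (z * (d + 1)) + 10 ≤
      (20 + 13 * (2 * t1 + 1)) * (1 + o') * ((d + 1) * θ) := by
  obtain ⟨p, hp⟩ : ∃ p, p = 1 + o' := ⟨_, rfl⟩
  obtain ⟨D, hD⟩ : ∃ D, D = (d + 1) * θ := ⟨_, rfl⟩
  have hD1 : 1 ≤ D := by rw [hD]; exact Nat.mul_pos (Nat.succ_pos _) hθ
  have h1 : y ≤ (2 * t1 + 1) * p := by
    have h2 : t1 * (o + 1) ≤ t1 * (2 * p) := Nat.mul_le_mul_left _ (by omega)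
    have h3 : (2 * t1 + 1) * p = t1 * (2 * p) + p := by ring
    omega
  have h2 : z ≤ (t1 + 1) * p := by
    have h2 : t1 * (o' + 1) = t1 * p := by rw [hp, add_comm]
    have h3 : (t1 + 1) * p = t1 * p + p := by ring
    omega
  have ho1 : 1 ≤ p * D := Nat.mul_pos (by omega) hD1
  have hoD : p ≤ p * D := Nat.le_mul_of_pos_right _ hD1
  have h3 : (9 + 2 * θ) * (z * (d + 1)) ≤ 11 * ((t1 + 1) * (p * D)) := by
    calc (9 + 2 * θ) * (z * (d + 1)) ≤ (11 * θ) * (((t1 + 1) * p) * (d + 1)) :=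
          Nat.mul_le_mul (by omega) (Nat.mul_le_mul_right _ h2)
      _ = 11 * ((t1 + 1) * (p * D)) := by rw [hD]; ring
  have h4 : (2 * t1 + 1) * p ≤ (2 * t1 + 1) * (p * D) := Nat.mul_le_mul_left _ hoD
  have h5 : (t1 + 1) * p ≤ (t1 + 1) * (p * D) := Nat.mul_le_mul_left _ hoD
  have h6 : (20 + 13 * (2 * t1 + 1)) * (p * D) = 11 * ((t1 + 1) * (p * D)) +
    (2 * t1 + 1) * (p * D) + (t1 + 1) * (p * D) + 20 * (p * D) + 12 * (t1 * (p * D)) := by ring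
  rw [← hp, ← hD, mul_assoc]
  omega

theorem next_start (hX : X.Good) (hc : Core X i s 1 S) (hp : Params X S)
    (h : PIdle X s S) (h13 : S.v 13 = 1) (h7 : S.v 7 + 1 = X.K) (hg : Chg X M C₀ i 1 S 0) :
    Next X M C₀ i S (exec (2 * X.n + 1) blkStart S) := by
  have hV := hX.n_le
  have hn0 := hX.n_pos
  have hq := hc.fix.queue 0 (by omega)
  have htime := hc.fix.time
  rw [h13] at htime
  have hsm : s + 1 ≤ X.m := by have := hc.le_m; omega
  have hrep := hc.rep
  rw [h.qh, add_zero] at hrep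
  have hst : Steps X.n (X.A s) (X.A (s + 1)) (S.a 4 (S.v 12) 0) (S.a 4 (S.v 12) 1)
      (S.a 4 (S.v 12) 2) := by
    rw [h.qh, hq.1, hq.2.1, hq.2.2]
    exact hX.step s (by omega)
  obtain ⟨S1, e1, a1, a2, a3, a4, a5, a6, a7, a8⟩ := exec_popApply (2 * X.n + 1) hrep
    (hX.A_lt s) (hX.A_symm s) hst
  have e : exec (2 * X.n + 1) blkStart S = (S1.setv 20 (S.v 10)).setv 9 1 := by
    simp [blkStart, exec, e1, mov, Opd.val, WordOp.eval, a1]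
  obtain ⟨S', hS'⟩ : ∃ S', (S1.setv 20 (S.v 10)).setv 9 1 = S' := ⟨_, rfl⟩
  have v : ∀ r, r ≠ 9 → r ≠ 12 → r < 20 → S'.v r = S.v r := by
    intro r h1 h2 h3
    rw [← hS', St.setv_v, if_neg h1, St.setv_v, if_neg (by omega), a1 r h2 (by omega)]
  have v12 : S'.v 12 = 1 := by simp [← hS', a2, h.qh]
  have v20 : S'.v 20 = S.v 10 := by simp [← hS']
  have wa : ∀ k, 2 < k → S'.a k = S.a k := by intro k hk; rw [← hS']; simpa using a5 k hk
  have hcv : S'.cov = S.cov := by simp [← hS', a6]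
  have hrep' : Rep (X.A (s + 1)) (S'.a 0) (S'.a 1) (S'.a 2) := by simpa [← hS'] using a7
  have hL : LeN X.V S' := by
    rw [← hS']
    refine LeN.setv (LeN.setv (a8 _ (by omega) (by rw [h.qh]; omega) hc.le) ?_) (by omega)
    have := hc.z_le; omega
  rw [e, hS']
  refine ⟨⟨s, ⟨hc.le_m, by simpa [v, wa] using hc.fix, by simpa [v, wa, hcv] using hc.z,
    by simpa [v, wa, hcv] using hc.y, by simp [v, v12, h13], by rwa [v12],
    by simpa [v, wa] using hc.scr, hL, by have := hc.cnt; simp [v]; omega⟩,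
    by simpa [Params, v, hcv] using hp, ?_⟩, by simp [v]⟩
  refine .clear ⟨by rw [v12], by simp [htime]⟩ ?_
    (hg.step (by simp [v]) (by simp [v]) (by simp [v, hcv]) (by simp))
  have hpre : Prefix X s S' := by
    refine ⟨by simp [v20, v], fun x y hxy => ?_⟩
    rw [v20, v 8 (by simp) (by simp) (by simp), wa 3 (by simp)]
    -- Here the current graph is the snapshot itself, and the foreground part has already repaired
    -- the current cover for its last update.
    rcases hc.z.vc x y (by rwa [htime]) with h1 | h1
    · obtain ⟨q, hq, h2⟩ := hc.z.bij.2.2 h1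
      exact ⟨q, hq, .inl h2⟩
    · obtain ⟨q, hq, h2⟩ := hc.z.bij.2.2 h1
      exact ⟨q, hq, .inr h2⟩
  refine ⟨by simp [← hS'], v12, by simpa [v] using h.j, by simpa [v] using h.tc, hpre, ?_⟩
  have hy := h.y_le
  have hz := hc.z.coarse
  have ho := (hX.opt_succ s (by omega)).2
  rw [htime] at hz
  simp only [Tm, v12, v 13 (by simp) (by simp) (by simp), v 7 (by simp) (by simp) (by simp),
    v 11 (by simp) (by simp) (by simp), v20, h13, Ctx.E]
  -- The microstep just made is offset by `S'.v 12 = 1` in the balance, so the entire budget is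
  -- still available.
  suffices S.v 11 + S.v 10 + (9 + 2 * X.θ) * (S.v 10 * (X.d + 1)) + 10 ≤ X.W0 (s + 1) by omega
  unfold Ctx.W0 Ctx.C
  exact start_work (Nat.succ_pos _) hy ho hz

end

/-! ### Microsteps: replaying the queue and swapping the covers -/

section

variable {X : Ctx} {M : ℕ} {C₀ : Set ℕ} {i s e : ℕ} {S S' T : St}

/-- Taking an update from the queue. -/
theorem next_apply_pop (hX : X.Good) (hc : Core X i s 1 S) (hp : Params X S) (hl : Late X i s S)
    (h : PApply X s 1 S) (hg : Chg X M C₀ i 1 S (S.v 11)) (hq : S.v 12 < S.v 13) :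
    Next X M C₀ i S (exec (2 * X.n + 1) blkApply S) := by
  have hV := hX.n_le
  have hl1 := hl.1
  have htime := hc.fix.time
  have him := hc.le_m
  have hqu := hc.fix.queue _ hq
  have hst : Steps X.n (X.A (s + S.v 12)) (X.A (s + S.v 12 + 1)) (S.a 4 (S.v 12) 0)
      (S.a 4 (S.v 12) 1) (S.a 4 (S.v 12) 2) := by
    rw [hqu.1, hqu.2.1, hqu.2.2]
    exact hX.step _ (by omega)
  obtain ⟨S1, e1, a1, a2, a3, a4, a5, a6, a7, a8⟩ := exec_popApply (2 * X.n + 1) hc.rep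
    (hX.A_lt _) (hX.A_symm _) hst
  have v : ∀ r, r ≠ 12 → r < 21 → S1.v r = S.v r := fun r h1 h2 => a1 r h1 (.inl h2)
  have h13V := hc.le.1 13 (by simp)
  have hc1 : Core X i s 1 S1 := by
    refine ⟨him, by simpa [v, a5] using hc.fix, by simpa [v, a5, a6] using hc.z,
      by simpa [v, a5, a6] using hc.y, by simp [v, a2]; omega, by rw [a2, ← add_assoc]; exact a7,
      by simpa [v, a5] using hc.scr, a8 _ (by omega) (by omega) hc.le, by simpa [v] using hc.cnt⟩
  have hp1 : Params X S1 := by simpa [Params, v, a6] using hp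
  have hl' : Late X i s S1 := ⟨by rw [a2]; omega, hl.2⟩
  obtain ⟨x, hx, hle⟩ := h.ok.2
  obtain ⟨-, -, -, hins, hdel⟩ := hst
  -- Taking an update from the queue uses one microstep but also raises the number of applied
  -- updates, so the time balance is unchanged.
  have htm : ∀ S', S'.v 7 = S1.v 7 → S'.v 12 = S1.v 12 → S'.v 13 = S1.v 13 → Tm X s 0 S' 0 := by
    intro S' h1 h2 h3
    have := h.tm
    unfold Tm at this ⊢
    rw [h1, h2, h3, a2, v 7 (by simp) (by simp), v 13 (by simp) (by simp)]
    omega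
  by_cases hb : S.a 4 (S.v 12) 0 = 0
  · have e : exec (2 * X.n + 1) blkApply S = S1 := by
      simp [blkApply, exec, Opd.val, hq, e1, a3, hb]
    rw [e]
    refine ⟨⟨s, ⟨him, hc1.fix, hc1.z, hc1.y, hc1.q_le, hc1.rep, hc1.scr, hc1.le, ?_⟩, hp1, ?_⟩,
      by simp [v]⟩
    · have := hc1.cnt; omega
    refine .apply hl' ?_ (hg.step (by simp [v]) (by simp [v]) (by simp [v, a6]) (by simp [v]))
    refine ⟨by simpa [v] using h.st, by simpa [v] using h.j, by simpa [v] using h.tc, ⟨?_, x, hx, ?_⟩,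
      htm _ rfl rfl rfl⟩
    · intro x y hxy
      rw [a2, ← add_assoc, (hdel hb).2] at hxy
      rw [v 8 (by simp) (by simp), a6]
      exact h.ok.1 x y hxy.1.1
    · rw [v 11 (by simp) (by simp), a2]
      omega
  · have e : exec (2 * X.n + 1) blkApply S = exec (2 * X.n + 1) (addY 25) S1 := by
      simp [blkApply, exec, Opd.val, hq, e1, a3, hb]
    have hun : S1.v 25 < X.n := by
      rw [a4, hqu.2.1]
      exact (hX.step _ (by omega)).1
    have hA := exec_addY (x := 25) hc1.fix.n_eq hc1.fix.f_le hun (by simp) hc1.y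
    rw [← e, a4] at hA
    obtain ⟨S', hS'⟩ : ∃ S', exec (2 * X.n + 1) blkApply S = S' := ⟨_, rfl⟩
    rw [hS'] at hA ⊢
    have w : ∀ r, r ≠ 11 → r < 21 → S'.v r = S1.v r := fun r h1 h2 =>
      hA.v r h1 (by omega) (by omega) (by omega)
    have w' : ∀ r, r ≠ 11 → r ≠ 12 → r < 21 → S'.v r = S.v r := fun r h1 h2 h3 => by
      rw [w r h1 h3, v r h2 h3]
    have hys : cset X.n S'.cov (1 - S.v 8) =
        insert (S.a 4 (S.v 12) 1) (cset X.n S.cov (1 - S.v 8)) := by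
      simpa [v, a6] using hA.ys
    have hzs : cset X.n S'.cov (S.v 8) = cset X.n S.cov (S.v 8) := by simpa [v, a6] using hA.zs
    have hle' : S'.v 11 ≤ S.v 11 + 1 := by simpa [v] using hA.le
    refine ⟨⟨s, hA.core hX hc1, hA.params hp1, ?_⟩, by simp [w']⟩
    refine .apply ⟨by rw [w _ (by simp) (by simp)]; exact hl'.1, hl'.2⟩ ?_
      (hg.step (by simp [w']) (by simp [w']) (by simpa [w'] using hzs) hle')
    refine ⟨by simpa [w'] using h.st, by simpa [w'] using h.j, by simpa [w'] using h.tc,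
      ⟨?_, x, hx, ?_⟩, htm _ (w _ (by simp) (by simp)) (w _ (by simp) (by simp))
        (w _ (by simp) (by simp))⟩
    · intro x y hxy
      rw [w 12 (by simp) (by simp), a2, ← add_assoc, (hins hb).2] at hxy
      rw [w' 8 (by simp) (by simp) (by simp), hys]
      rcases hxy with (hxy | ⟨rfl, -⟩) | ⟨-, rfl⟩
      · rcases h.ok.1 x y hxy with h1 | h1
        · exact .inl (.inr h1)
        · exact .inr (.inr h1)
      · exact .inl (.inl rfl)
      · exact .inr (.inl rfl)
    · rw [w 12 (by simp) (by simp), a2]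
      omega

/-- The pessimistic count of a swap: every vertex of either cover is taken to be changed. -/
theorem ncard_symmDiff_le {A B C : Set ℕ} (hA : A.Finite) (hB : B.Finite) (hC : C.Finite) :
    (symmDiff A C).ncard ≤ (symmDiff A B).ncard + B.ncard + C.ncard := by
  have h1 : symmDiff A C ⊆ symmDiff A B ∪ B ∪ C := by
    intro x hx
    simp only [mem_symmDiff, mem_union] at hx ⊢
    tauto
  have h2 := ncard_le_ncard h1 (((hA.symmDiff hB).union hB).union hC)
  have h3 := ncard_union_le (symmDiff A B ∪ B) C
  have h4 := ncard_union_le (symmDiff A B) B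
  omega

/-- The end of a phase: the new cover becomes the current one. -/
theorem next_apply_swap (hX : X.Good) (hc : Core X i s 1 S) (hp : Params X S) (hl : Late X i s S)
    (h : PApply X s 1 S) (hg : Chg X M C₀ i 1 S (S.v 11)) (hC : C₀.Finite) (hq : S.v 13 ≤ S.v 12) :
    Next X M C₀ i S (exec (2 * X.n + 1) blkApply S) := by
  have hV := hX.n_le
  have hl1 := hl.1
  have hF := hc.fix.f_le
  have htime := hc.fix.time
  have him := hc.le_m
  have hqe : S.v 12 = S.v 13 := le_antisymm hc.q_le hq
  have hFV : 1 + (1 - S.v 8) * X.n ≤ X.V := by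
    have : (1 - S.v 8) * X.n ≤ 1 * X.n := Nat.mul_le_mul_right _ (by omega)
    omega
  have hFF : 1 - (1 - S.v 8) = S.v 8 := by omega
  have e : exec (2 * X.n + 1) blkApply S = (((((((((((S.setv 8 (1 - S.v 8)).setv 28
      ((1 - S.v 8) * X.n)).setv 28 ((1 - S.v 8) * X.n + 1)).setc 0 (1 + (1 - S.v 8) * X.n)).setv 21
      (S.v 10)).setv 10 (S.v 11)).setv 11 (S.v 10)).setv 12 0).setv 13 0).setv 9 0).setv 7 0) := by
    simp [blkApply, exec, mov, inc, Opd.val, WordOp.eval, not_lt.2 hq, hc.fix.n_eq, add_comm]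
  obtain ⟨S', hS'⟩ : ∃ S', exec (2 * X.n + 1) blkApply S = S' := ⟨_, rfl⟩
  rw [hS'] at e ⊢
  have v : ∀ r, r ≠ 7 → r ≠ 8 → r ≠ 9 → r ≠ 10 → r ≠ 11 → r ≠ 12 → r ≠ 13 → r < 21 →
      S'.v r = S.v r := by
    intro r h1 h2 h3 h4 h5 h6 h7 h8
    have h9 : r ≠ 21 ∧ r ≠ 28 := by omega
    simp [e, h1, h2, h3, h4, h5, h6, h7, h9]
  have v7 : S'.v 7 = 0 := by simp [e]
  have v8 : S'.v 8 = 1 - S.v 8 := by simp [e]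
  have v9 : S'.v 9 = 0 := by simp [e]
  have v10 : S'.v 10 = S.v 11 := by simp [e]
  have v11 : S'.v 11 = S.v 10 := by simp [e]
  have v12 : S'.v 12 = 0 := by simp [e]
  have v13 : S'.v 13 = 0 := by simp [e]
  have ha : S'.a = S.a := by simp [e]
  have hcs : ∀ f, cset X.n S'.cov f = cset X.n S.cov f := by intro f; simp [e, cset_update_ptr]
  have hc0 : S'.cov 0 = 1 + (1 - S.v 8) * X.n := by simp [e]
  have hL : LeN X.V S' := by
    rw [e]
    refine LeN.setv ?_ (by omega)
    refine LeN.setv ?_ (by omega)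
    refine LeN.setv ?_ (by omega)
    refine LeN.setv ?_ (by omega)
    refine LeN.setv ?_ (hc.le.1 10 (by simp))
    refine LeN.setv ?_ (hc.le.1 11 (by simp))
    refine LeN.tmp ?_ (by simp)
    refine LeN.setc ?_ hFV
    refine LeN.tmp ?_ (by simp)
    refine LeN.tmp ?_ (by simp)
    exact hc.le.setv (by omega)
  clear hS' e
  obtain ⟨x, hx, hle⟩ := h.ok.2
  have hi1 : i - (s + 1) = S.v 12 - 1 := by omega
  -- At the moment of the swap the new cover has aged only since its snapshot `s + 1`; the second
  -- period, in which it is served, has length zero.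
  have hqual : S.v 11 ≤ X.t1 * X.opt i :=
    hX.fin i him i le_rfl (s + 1) (by omega) x _ hx (by omega) hl.2 (.inl rfl)
  refine ⟨⟨i, ⟨him, ?_, ⟨?_, ?_, ?_, ?_⟩, ?_, by simp [v12], ?_, ?_, hL, by rw [v7]; omega⟩, ?_, ?_⟩,
    by rw [v7]; omega⟩
  · refine ⟨by simpa [v] using hc.fix.n_eq, by simpa [v] using hc.fix.α_eq,
      by simpa [v] using hc.fix.τ_eq, by rw [v8]; omega, by rw [v13, add_zero], ?_⟩
    intro k hk
    rw [v13] at hk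
    omega
  · rw [v8, v10, hcs, ha]
    exact hc.y
  · rw [v8, hcs]
    have := h.ok.1
    rwa [hqe, ← htime] at this
  · refine ⟨s + 1, by omega, x, hx, ?_, hl.2⟩
    rw [v10]
    omega
  · rw [v10]
    refine hqual.trans ?_
    have : X.t1 * X.opt i ≤ X.t1 * (X.opt i + 1) := Nat.mul_le_mul_left _ (by omega)
    omega
  · rw [v8, v11, hcs, ha, hFF]
    exact hc.z.bij
  · rw [v12, ha, add_zero]
    have := hc.rep
    rwa [hqe, ← htime] at this
  · simpa [v, ha] using hc.scr
  · exact ⟨by simpa [v] using hp.1, by rw [hc0, v8]⟩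
  · refine .idle ⟨v9, v12, by simpa [v] using h.j, by simpa [v] using h.tc, ?_⟩ v13 v7 rfl ?_
    · rw [v11]
      exact hc.z.coarse
    -- The stored size of the old cover pays for its removal. Of the two units stored per vertex of
    -- the new cover, one pays for its appearance now and one stays for its future removal.
    · unfold Chg at hg ⊢
      rw [v8, v10, v7, hcs]
      have h1 := ncard_of_bijOn hc.z.bij
      have h2 := ncard_of_bijOn hc.y
      have := ncard_symmDiff_le hC (finite_of_bijOn hc.z.bij) (finite_of_bijOn hc.y)
      rw [h1, h2] at this
      omega

end

/-! ### From one call to the next -/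

section

variable {X : Ctx} {M : ℕ} {C₀ : Set ℕ} {i s e : ℕ} {S S' T : St}

/-- The situation between two calls. -/
structure Rest (X : Ctx) (M : ℕ) (C₀ : Set ℕ) (i s : ℕ) (S : St) : Prop where
  core : Core X i s 0 S
  cnt : S.v 7 = 0
  phase : Phase X M C₀ i s 0 S

/-- With no microsteps left after q updates of the phase, `K * q` is at most the work of the phase
plus q. The summand 1 in the lower bound for `K` cancels this q, which is the cost of replaying the
queue. What remains is `2Lq ≤ 1 + opt`, and since `Lq ≥ 1` one copy of `Lq` absorbs the 1. -/
theorem Tm.rest {φ : ℕ} (h : Tm X s 0 S φ) (hX : X.Good) (hc : Core X i s 0 S) (h7 : S.v 7 = 0)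
    (h12 : 1 ≤ S.v 12) : s + 1 ≤ i ∧ X.L * (i - s) ≤ X.opt (s + 1) := by
  have h1 := hc.fix.time
  have h2 := hc.q_le
  have hK := hX.hK
  have hL := hX.L_pos
  refine ⟨by omega, ?_⟩
  have hqt : i - s = S.v 13 := by omega
  rw [hqt]
  unfold Tm Ctx.W0 at h
  obtain ⟨w, hw⟩ : ∃ w, w = X.C * ((X.d + 1) * X.θ) := ⟨_, rfl⟩
  have hw0 : 0 < w := by
    rw [hw]
    exact Nat.mul_pos (by unfold Ctx.C; omega) (Nat.mul_pos (Nat.succ_pos _) (Nat.succ_pos _))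
  have e : X.C * (1 + X.opt (s + 1)) * ((X.d + 1) * X.θ) = (1 + X.opt (s + 1)) * w := by
    rw [hw]; ring
  rw [e, h7] at h
  rw [← hw] at hK
  have h3 : (2 * X.L * w + 1) * S.v 13 ≤ X.K * S.v 13 := Nat.mul_le_mul_right _ hK
  have h4 : (2 * X.L * w + 1) * S.v 13 = (2 * (X.L * S.v 13)) * w + S.v 13 := by ring
  have h5 : (2 * (X.L * S.v 13)) * w ≤ (1 + X.opt (s + 1)) * w := by omega
  have h6 := Nat.le_of_mul_le_mul_right h5 hw0
  have h7 : 1 ≤ X.L * S.v 13 := Nat.mul_pos hL (by omega)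
  omega

theorem Rest.late (h : Rest X M C₀ i s S) (hX : X.Good) :
    i = s ∨ s + 1 ≤ i ∧ X.L * (i - s) ≤ X.opt (s + 1) := by
  have h7 := h.cnt
  have hc := h.core
  have htime := hc.fix.time
  have hK := hX.K_pos
  cases h.phase with
  | idle a b c d => left; omega
  | start a b c d => omega
  | clear a b c => exact .inr (b.tm.rest hX hc h7 a.1)
  | collect a b c => exact .inr (b.tm.rest hX hc h7 a.1)
  | scan a b c => exact .inr (b.tm.rest hX hc h7 a.1)
  | emit a b c => exact .inr (b.tm.rest hX hc h7 a.1)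
  | sim a b c =>
    obtain ⟨-, -, _, _, -, -, _, -, -, -, -, -, htm⟩ := b
    exact .inr (htm.rest hX hc h7 a.1)
  | out a b c => exact .inr (b.tm.rest hX hc h7 a.1)
  | clean a b c => exact .inr (b.tm.rest hX hc h7 a.1)
  | apply a b c => exact .inr (b.tm.rest hX hc h7 a.1)

theorem Phase.chg (h : Phase X M C₀ i s 0 S) (h7 : S.v 7 = 0) :
    M + (symmDiff C₀ (cset X.n S.cov (S.v 8))).ncard ≤ 2 * (X.K + 1) * i := by
  have key : ∀ y, Chg X M C₀ i 0 S y →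
      M + (symmDiff C₀ (cset X.n S.cov (S.v 8))).ncard ≤ 2 * (X.K + 1) * i := by
    intro y hy
    unfold Chg at hy
    omega
  cases h with
  | idle a b c d e => exact key _ e
  | start a b c d => exact key _ d
  | _ a b c => exact key _ c

/-- The effect of the first part of a call. -/
theorem exec_foreground (hX : X.Good) (him : i < X.m) (hn : S.v 3 = X.n) (hα : S.v 4 = X.α)
    (hτ : S.v 5 = X.τ) (hF : S.v 8 ≤ 1)
    (hZ : BijOn (S.a 3 (S.v 8)) (Iio (S.v 10)) (cset X.n S.cov (S.v 8))) (hle : LeN X.V S)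
    (h0 : S.v 0 = X.eI i) (h1 : S.v 1 = X.eU i) (h2 : S.v 2 = X.eV i)
    (hqV : S.v 13 + 1 ≤ X.V) :
    ∃ S', exec (2 * X.n + 1) (foreground X.L X.Kc) S = S' ∧
      (∀ r, r ≠ 6 → r ≠ 7 → r ≠ 10 → r ≠ 13 → r < 21 → S'.v r = S.v r) ∧ S'.v 6 = X.d ∧
      S'.v 7 = X.K ∧ S.v 10 ≤ S'.v 10 ∧ S'.v 10 ≤ S.v 10 + 1 ∧ S'.v 13 = S.v 13 + 1 ∧
      (∀ k, k ≠ 3 → k ≠ 4 → S'.a k = S.a k) ∧ S'.a 3 (1 - S.v 8) = S.a 3 (1 - S.v 8) ∧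
      (∀ q < S.v 10, S'.a 3 (S.v 8) q = S.a 3 (S.v 8) q) ∧
      (∀ k < S.v 13, S'.a 4 k = S.a 4 k) ∧
      (S'.a 4 (S.v 13) 0 = X.eI i ∧ S'.a 4 (S.v 13) 1 = X.eU i ∧ S'.a 4 (S.v 13) 2 = X.eV i) ∧
      S'.cov 0 = 1 + S.v 8 * X.n ∧
      cset X.n S'.cov (1 - S.v 8) = cset X.n S.cov (1 - S.v 8) ∧
      cset X.n S'.cov (S.v 8) =
        (if X.eI i = 0 then cset X.n S.cov (S.v 8) else insert (X.eU i) (cset X.n S.cov (S.v 8))) ∧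
      BijOn (S'.a 3 (S.v 8)) (Iio (S'.v 10)) (cset X.n S'.cov (S.v 8)) ∧ LeN X.V S' := by
  have hV := hX.n_le
  have hFF : 1 - S.v 8 ≠ S.v 8 := by omega
  obtain ⟨hun, hwn, -⟩ := hX.step i him
  have hI1 := hX.eI_le i
  have hFn : S.v 8 * X.n ≤ 1 * X.n := Nat.mul_le_mul_right _ hF
  have hzn := le_of_bijOn hZ cset_subset
  have hKV : X.K ≤ X.V := by have := hX.V_ge; omega
  have hdV : X.d ≤ X.V := by have := hX.V_ge; omega
  obtain ⟨S1, hS1⟩ : ∃ S1, S1 = ((((exec (2 * X.n + 1) clr S).setv 6 X.d).setv 28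
    (S.v 8 * X.n)).setv 28 (S.v 8 * X.n + 1)).setc 0 (S.v 8 * X.n + 1) := ⟨_, rfl⟩
  obtain ⟨S2, hS2⟩ : ∃ S2, S2 = exec (2 * X.n + 1) (ifz (r 0) skip
    (op .add 28 (r 28) (r 1) ;; getc 29 (r 28) ;;
      ifz (r 29) (putc (r 28) (c 1) ;; put 3 (r 8) (r 10) (r 1) ;; inc 10) skip)) S1 := ⟨_, rfl⟩
  have w : ∀ r, r ≠ 6 → r < 21 → S1.v r = S.v r := by
    intro r h1 h2
    have : r ≠ 21 ∧ r ≠ 22 ∧ r ≠ 23 ∧ r ≠ 24 ∧ r ≠ 25 ∧ r ≠ 26 ∧ r ≠ 27 ∧ r ≠ 28 ∧ r ≠ 29 := by omega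
    simp [hS1, clr, mov, exec, this, h1]
  have w6 : S1.v 6 = X.d := by simp [hS1]
  have w28 : S1.v 28 = S.v 8 * X.n + 1 := by simp [hS1]
  have wa : S1.a = S.a := by simp [hS1, clr, mov, exec]
  have wc : S1.cov = Function.update S.cov 0 (S.v 8 * X.n + 1) := by simp [hS1, clr, mov, exec]
  have hL1 : LeN X.V S1 := by
    rw [hS1]
    exact LeN.setc (LeN.tmp (LeN.tmp (LeN.setv (hle.clr _).leN hdV) (by simp)) (by simp)) (by omega)
  have hmod : (S.v 8 * X.n + 1 + X.eU i) % (2 * X.n + 1) = 1 + S.v 8 * X.n + X.eU i := by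
    rw [Nat.mod_eq_of_lt, add_comm _ 1]
    omega
  have key : (∀ r, r ≠ 6 → r ≠ 10 → r < 21 → S2.v r = S.v r) ∧ S2.v 6 = X.d ∧
      S.v 10 ≤ S2.v 10 ∧ S2.v 10 ≤ S.v 10 + 1 ∧ (∀ k, k ≠ 3 → S2.a k = S.a k) ∧
      S2.a 3 (1 - S.v 8) = S.a 3 (1 - S.v 8) ∧
      (∀ q < S.v 10, S2.a 3 (S.v 8) q = S.a 3 (S.v 8) q) ∧ S2.cov 0 = 1 + S.v 8 * X.n ∧
      cset X.n S2.cov (1 - S.v 8) = cset X.n S.cov (1 - S.v 8) ∧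
      cset X.n S2.cov (S.v 8) =
        (if X.eI i = 0 then cset X.n S.cov (S.v 8) else insert (X.eU i) (cset X.n S.cov (S.v 8))) ∧
      BijOn (S2.a 3 (S.v 8)) (Iio (S2.v 10)) (cset X.n S2.cov (S.v 8)) ∧ LeN X.V S2 := by
    by_cases hu : X.eI i ≠ 0 ∧ S.cov (1 + S.v 8 * X.n + X.eU i) = 0
    · have e : S2 = ((((S1.setv 28 (S.v 8 * X.n + 1 + X.eU i)).setv 29 0).setc
          (1 + S.v 8 * X.n + X.eU i) 1).seta 3 (S.v 8) (S.v 10) (X.eU i)).setv 10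
          (S.v 10 + 1) := by
        rw [hS2]
        simp [exec, inc, Opd.val, WordOp.eval, w, h0, h1, hu.1, w28, hmod, wc, hu.2]
      have hum : X.eU i ∉ cset X.n S.cov (S.v 8) := by simp [cset, hu.2]
      have hz2 : cset X.n S2.cov (S.v 8) = insert (X.eU i) (cset X.n S.cov (S.v 8)) := by
        rw [e]
        simp only [St.setv_cov, St.seta_cov, St.setc_cov]
        rw [cset_update hun one_ne_zero, wc, cset_update_ptr]
      refine ⟨?_, by simp [e, w6], by simp [e], by simp [e], ?_, ?_, ?_, ?_, ?_, ?_, ?_, ?_⟩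
      · intro r h1 h2 h3
        have : r ≠ 28 ∧ r ≠ 29 := by omega
        simp [e, h2, this, w r h1 h3]
      · intro k hk; simp [e, hk, wa]
      · simp [e, wa, hFF]
      · intro q hq
        simp [e, wa, hq.ne]
      · have h0u : 0 ≠ 1 + S.v 8 * X.n + X.eU i := by omega
        simp only [e, St.setv_cov, St.seta_cov, St.setc_cov]
        rw [Function.update_of_ne h0u, wc]
        simp [add_comm]
      · rw [e]
        simp only [St.setv_cov, St.seta_cov, St.setc_cov]
        rw [cset_update_other hun hF (by omega) hFF.symm, wc, cset_update_ptr]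
      · rw [hz2, if_neg hu.1]
      · rw [hz2]
        have := bijOn_push hZ hum
        simpa [e, wa] using this
      · rw [e]
        refine LeN.setv (LeN.seta (LeN.setc ?_ (by omega)) (by omega)) (by omega)
        exact (hL1.tmp (by simp)).tmp (by simp)
    · have b5 : X.eI i ≠ 0 → X.eU i ∈ cset X.n S.cov (S.v 8) := fun hb => ⟨hun, fun h => hu ⟨hb, h⟩⟩
      obtain ⟨b1, b2, b3, b4⟩ : (∀ r, r < 21 → S2.v r = S1.v r) ∧ S2.a = S1.a ∧ S2.cov = S1.cov ∧
          LeN X.V S2 := by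
        by_cases hb : X.eI i = 0
        · have e : S2 = S1 := by
            rw [hS2]
            simp [exec, Opd.val, w, h0, hb]
          exact ⟨by simp [e], by rw [e], by rw [e], by rw [e]; exact hL1⟩
        · have hu' : S.cov (1 + S.v 8 * X.n + X.eU i) ≠ 0 := fun h => hu ⟨hb, h⟩
          have e : S2 = (S1.setv 28 (S.v 8 * X.n + 1 + X.eU i)).setv 29
              (S.cov (1 + S.v 8 * X.n + X.eU i)) := by
            rw [hS2]
            simp [exec, Opd.val, WordOp.eval, w, h0, h1, hb, w28, hmod, wc, hu']
          refine ⟨?_, by rw [e]; rfl, by rw [e]; rfl, ?_⟩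
          · intro r hr
            have : r ≠ 28 ∧ r ≠ 29 := by omega
            simp [e, this]
          · rw [e]; exact (hL1.tmp (by simp)).tmp (by simp)
      have hz2 : ∀ f, cset X.n S2.cov f = cset X.n S.cov f := by
        intro f; rw [b3, wc, cset_update_ptr]
      refine ⟨fun r h1 _ h3 => by rw [b1 r h3, w r h1 h3], by rw [b1 _ (by simp), w6],
        by rw [b1 _ (by simp), w _ (by simp) (by simp)],
        by rw [b1 _ (by simp), w _ (by simp) (by simp)]; omega,
        fun k _ => by rw [b2, wa], by rw [b2, wa], fun q _ => by rw [b2, wa],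
        by rw [b3, wc]; simp [add_comm], hz2 _, ?_, ?_, b4⟩
      · rw [hz2]
        split_ifs with hb
        · rfl
        · exact (insert_eq_of_mem (b5 hb)).symm
      · rw [hz2, b2, wa, b1 _ (by simp), w _ (by simp) (by simp)]
        exact hZ
  obtain ⟨c1, c2, c3, c4, c5, c6, c7, c8, c9, c10, c11, c12⟩ := key
  have e : exec (2 * X.n + 1) (foreground X.L X.Kc) S = ((((((((S2.seta 4 (S.v 13) 0 (X.eI i)).seta
      4 (S.v 13) 1 (X.eU i)).seta 4 (S.v 13) 2 (X.eV i)).setv 13 (S.v 13 + 1)).setv 28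
      (X.τ / X.n)).setv 28 X.θ).setv 28 (X.θ * X.α)).setv 7 X.K) := by
    have e1 : exec (2 * X.n + 1) (foreground X.L X.Kc) S = exec (2 * X.n + 1)
        (put 4 (r 13) (c 0) (r 0) ;; put 4 (r 13) (c 1) (r 1) ;; put 4 (r 13) (c 2) (r 2) ;; inc 13 ;;
        op .div 28 (r 5) (r 3) ;; inc 28 ;; op .mul 28 (r 28) (r 4) ;; op .mul 7 (r 28) (c X.Kc))
        S2 := by
      rw [hS2]
      have : exec (2 * X.n + 1) (clr ;; op .mul 6 (r 4) (c (X.L + 1)) ;; op .mul 28 (r 8) (r 3) ;;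
          inc 28 ;; putc (c 0) (r 28)) S = S1 := by
        rw [hS1]
        simp [exec, clr, mov, inc, Opd.val, WordOp.eval, hα, hn, Ctx.d]
      rw [← this]
      rfl
    rw [e1]
    simp [exec, inc, Opd.val, WordOp.eval, c1, h0, h1, h2, hα, hn, hτ,
      Ctx.θ, Ctx.K]
  refine ⟨_, e, ?_, by simp [c2], by simp, by simpa using c3, by simpa using c4, by simp, ?_,
    by simpa using c6, by simpa using c7, ?_, by simp, by simpa using c8, by simpa using c9,
    by simpa using c10, by simpa using c11, ?_⟩
  · intro r h1 h2 h3 h4 h5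
    have : r ≠ 28 := by omega
    simp [h2, h4, this, c1 r h1 h3 h5]
  · intro k h1 h2
    simp [h2, c5 k h1]
  · intro k hk
    simp [hk.ne, c5]
  · refine LeN.setv (LeN.tmp (LeN.tmp (LeN.tmp (LeN.setv (LeN.seta (LeN.seta (LeN.seta c12 ?_) ?_)
      ?_) hqV) (by simp)) (by simp)) (by simp)) hKV <;> omega

/-- The phase is indifferent to a longer queue, to a vertex appended to the current cover beyond the
recorded prefix, and to a new budget of microsteps. The allowance `2(K + 1)` of `Chg` is spent on
`2K` for the new microsteps, one for the size of the cover and one for the change; the changes of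
the previous call are added to the total, and the comparison starts afresh from the present cover.
-/
theorem Rest.inv_foreground (h : Rest X M C₀ i s S) (hX : X.Good) (him : i < X.m)
    (tv : ∀ r, 3 ≤ r → T.v r = S.v r) (ta : T.a = S.a) (tc : T.cov = S.cov) (tL : LeN X.V T)
    (h0 : T.v 0 = X.eI i) (h1 : T.v 1 = X.eU i) (h2 : T.v 2 = X.eV i) :
    Inv X (M + (symmDiff C₀ (cset X.n S.cov (S.v 8))).ncard) (cset X.n S.cov (S.v 8)) (i + 1) s 0
      (exec (2 * X.n + 1) (foreground X.L X.Kc) T) ∧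
    (exec (2 * X.n + 1) (foreground X.L X.Kc) T).v 7 = X.K := by
  have hlate := h.late hX
  obtain ⟨hc, h7, hph⟩ := h
  have hV := hX.n_le
  have htime := hc.fix.time
  have hL := hX.L_pos
  have hq13 : X.L * S.v 13 ≤ X.opt (s + 1) := by
    rcases hlate with h | h
    · have : S.v 13 = 0 := by omega
      simp [this]
    · rw [show S.v 13 = i - s by omega]; exact h.2
  have hqV : S.v 13 + 1 ≤ X.V := by
    have h1 := hX.opt_le (s + 1)
    have h2 : S.v 13 ≤ X.L * S.v 13 := Nat.le_mul_of_pos_left _ hL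
    omega
  obtain ⟨hun, hwn, huw, hins, hdel⟩ := hX.step i him
  obtain ⟨S', e, v, v6, v7, v10, v10', v13, wa, way, waz, wq, wq', wc, hys, hzs, hbij, hLe⟩ :=
    exec_foreground (S := T) hX him (by simpa [tv] using hc.fix.n_eq)
      (by simpa [tv] using hc.fix.α_eq) (by simpa [tv] using hc.fix.τ_eq)
      (by simpa [tv] using hc.fix.f_le) (by simpa [tv, ta, tc] using hc.z.bij) tL h0 h1 h2
      (by simpa [tv] using hqV)
  rw [e]
  clear e
  simp only [ta, tc, tv 10 (by simp), tv 8 (by simp), tv 13 (by simp)] at v10 v10' v13 wa way waz wq wq' wc hys hzs hbij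
  replace v : ∀ r, 3 ≤ r → r ≠ 6 → r ≠ 7 → r ≠ 10 → r ≠ 13 → r < 21 → S'.v r = S.v r :=
    fun r h h1 h2 h3 h4 h5 => by rw [v r h1 h2 h3 h4 h5, tv r h]
  have hzfin := finite_of_bijOn hc.z.bij
  have hsym : (symmDiff (cset X.n S.cov (S.v 8)) (cset X.n S'.cov (S.v 8))).ncard ≤ 1 := by
    rw [hzs]
    split_ifs
    · simp
    · have : symmDiff (cset X.n S.cov (S.v 8)) (insert (X.eU i) (cset X.n S.cov (S.v 8))) ⊆
          {X.eU i} := by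
        intro x hx
        simp only [mem_symmDiff, mem_insert_iff, mem_singleton_iff] at hx ⊢
        tauto
      simpa using ncard_le_ncard this
  have v8 : S'.v 8 = S.v 8 := v _ (by simp) (by simp) (by simp) (by simp) (by simp) (by simp)
  have hchg : ∀ {y y'}, Chg X M C₀ i 0 S y → y' = y →
      Chg X (M + (symmDiff C₀ (cset X.n S.cov (S.v 8))).ncard) (cset X.n S.cov (S.v 8)) (i + 1) 0 S'
        y' := by
    rintro y y' hy rfl
    unfold Chg at hy ⊢
    rw [v8, v7]
    have : 2 * (X.K + 1) * (i + 1) = 2 * (X.K + 1) * i + 2 * (X.K + 1) := by ring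
    omega
  have htm : ∀ {φ}, Tm X s 0 S φ → Tm X s 0 S' φ := by
    intro φ hφ
    unfold Tm at hφ ⊢
    rw [v13, v7, v 12 (by simp) (by simp) (by simp) (by simp) (by simp) (by simp)]
    have : X.K * (S.v 13 + 1) = X.K * S.v 13 + X.K := by ring
    omega
  have hlt : Late X i s S → Late X (i + 1) s S' := by
    rintro ⟨h1, h2⟩
    refine ⟨by rwa [v 12 (by simp) (by simp) (by simp) (by simp) (by simp) (by simp)], ?_⟩
    rw [show i + 1 - (s + 1) = S.v 13 by omega]
    exact hq13
  have hhl : HighLow X S → HighLow X S' := by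
    intro h; simpa [HighLow, v, wa, hys] using h
  have hpre : Prefix X s S → Prefix X s S' := by
    rintro ⟨h1, h2⟩
    refine ⟨by simp [v]; omega, fun x y hxy => ?_⟩
    obtain ⟨q, hq, h3⟩ := h2 x y hxy
    exact ⟨q, by simpa [v] using hq, by rw [v8, waz q (by omega)]; exact h3⟩
  have hsel : ∀ {k ρ}, Selects X s k S ρ → Selects X s k S' ρ := by
    intro k ρ h
    exact ⟨by simpa [v, wa, hys] using h.cov, by simpa [v] using h.qual⟩
  have hyok : YOk X s S → YOk X s S' := by
    intro h; simpa [YOk, v, hys] using h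
  have hE : X.E S' = X.E S := by simp [Ctx.E, v]
  refine ⟨⟨⟨him, ⟨by simpa [v] using hc.fix.n_eq, by simpa [v] using hc.fix.α_eq,
    by simpa [v] using hc.fix.τ_eq, by simpa [v] using hc.fix.f_le, by omega, ?_⟩,
    ⟨by rwa [v8], ?_, ?_, ?_⟩, ?_, ?_, ?_, ?_, hLe, by omega⟩, ⟨v6, by rw [wc, v8]⟩, ?_⟩, v7⟩
  · intro k hk
    rw [v13] at hk
    by_cases hk' : k = S.v 13
    · rw [hk', ← htime]; exact wq'
    · rw [wq k (by omega)]
      exact hc.fix.queue k (by omega)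
  · intro x y hxy
    rw [v8, hzs]
    by_cases hb : X.eI i = 0
    · rw [if_pos hb]
      exact hc.z.vc x y (((hdel hb).2 x y).1 hxy).1.1
    · rw [if_neg hb]
      rcases ((hins hb).2 x y).1 hxy with (hxy | ⟨rfl, -⟩) | ⟨-, rfl⟩
      · rcases hc.z.vc x y hxy with h1 | h1
        · exact .inl (.inr h1)
        · exact .inr (.inr h1)
      · exact .inl (.inl rfl)
      · exact .inr (.inl rfl)
  · obtain ⟨a, ha, x, hx, h1, h2⟩ := hc.z.qual
    exact ⟨a, ha, x, hx, by omega, h2⟩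
  · obtain ⟨a, ha, x, hx, h1, h2⟩ := hc.z.qual
    -- Before the update the cover has at most `t1 * opt` vertices. The update adds at most one
    -- vertex and lowers the optimum by at most one, which is the slack in `coarse`.
    have h3 := hX.fin i hc.le_m s (by omega) a ha x _ hx h1 h2 hlate
    have h4 := (hX.opt_succ i him).2
    have h5 : X.t1 * X.opt i ≤ X.t1 * (X.opt (i + 1) + 1) := Nat.mul_le_mul_left _ h4
    omega
  · rw [v8, hys, way, v 11 (by simp) (by simp) (by simp) (by simp) (by simp) (by simp)]
    exact hc.y
  · rw [v 12 (by simp) (by simp) (by simp) (by simp) (by simp) (by simp), v13]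
    have := hc.q_le
    omega
  · simpa [v, wa] using hc.rep
  · simpa [v, wa] using hc.scr
  have hidle : PIdle X s S → PIdle X s S' := by
    rintro ⟨a1, a2, a3, a4, a5⟩
    exact ⟨by simpa [v] using a1, by simpa [v] using a2, by simpa [v] using a3,
      by simpa [v] using a4, by simpa [v] using a5⟩
  have w11 : S'.v 11 = S.v 11 := v _ (by simp) (by simp) (by simp) (by simp) (by simp) (by simp)
  cases hph with
  | idle a b c d g => exact .start (hidle a) (by omega) (by omega) (hchg g rfl)
  | start a b c d =>
    have := hX.K_pos
    omega
  | clear a b c =>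
    exact .clear (hlt a) ⟨by simpa [v] using b.st, by simpa [v] using b.qh,
      by simpa [v] using b.j, by simpa [v] using b.tc, hpre b.pre,
      by simpa [v, hE] using htm b.tm⟩ (hchg c rfl)
  | collect a b c =>
    have h14 : ∀ q < S.v 14, S'.a 3 (S.v 8) q = S.a 3 (S.v 8) q := fun q hq =>
      waz q (by have := b.i_le; have := b.pre.1; omega)
    refine .collect (hlt a) ⟨by simpa [v] using b.st, by simpa [v] using b.qh,
      by simpa [v] using b.tc, hpre b.pre, by simpa [v] using b.i_le, by simpa [v] using b.j_le,
      hhl b.hl, ?_, ?_,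
      by simpa [wa] using b.cnt, by simpa [v, hE] using htm b.tm⟩ (hchg c w11)
    · intro q hq
      have hq' : q < S.v 14 := by simpa [v] using hq
      simpa [v, wa, hys, h14 q hq'] using b.done q hq'
    · intro k hk
      obtain ⟨q, hq, h1⟩ := b.vrt k (by simpa [v] using hk)
      exact ⟨q, by simpa [v] using hq, by simpa [v, wa, h14 q hq] using h1⟩
  | scan a b c =>
    have hs : ∀ x w, Scanned X s S' x w ↔ Scanned X s S x w := by
      intro x w; simp [Scanned, v, wa]
    refine .scan (hlt a) ⟨by simpa [v] using b.st, by simpa [v] using b.qh,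
      by simpa [v] using b.tc, by simpa [v] using b.i_le, by simpa [v] using b.a_le,
      by simpa [v] using b.a_le', ?_, by simpa [v] using b.p_le,
      by simpa [v] using b.p_zero, hhl b.hl, by simpa [v, wa, hys] using b.cov,
      by simpa [v, wa, hys, hs] using b.done, by simpa [v, wa, hs] using b.lists,
      by simpa [v, wa] using b.sum_le, by simpa [v] using b.j_le,
      by simpa [v, hE] using htm b.tm⟩ (hchg c w11)
    have := b.z_le
    simp [v]
    omega
  | emit a b c =>
    have ho : ∀ x, offs S' x = offs S x := by intro x; simp [offs, v, wa]
    have hb : Built X s S' := ⟨by have := b.built.z_le; simp [v]; omega, hhl b.built.hl,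
      by simpa [v, wa] using b.built.lists, by simpa [v, wa, hys] using b.built.edges,
      by simpa [v, wa, hE] using b.built.sum_le, by simpa [v] using b.built.j_pos,
      by simpa [v, hE] using b.built.j_le⟩
    exact .emit (hlt a) ⟨by simpa [v] using b.st, by simpa [v] using b.qh, hb,
      by simpa [v] using b.i_le, by simpa [v, wa] using b.p_le, by simpa [v, ho] using b.o_eq,
      by simpa [wa] using b.regs, by simpa [v, wa] using b.size,
      by simpa [v, wa, ho] using b.starts, by simpa [v, wa, ho] using b.cells,
      by simpa [v, wa, ho] using b.cells', by simpa [v, wa] using b.rest,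
      by simpa [v, wa, hE] using htm b.tm⟩ (hchg c w11)
  | sim a b c =>
    obtain ⟨q1, q2, μ, s', r1, r2, t, ht, r3, r4, r5, r6, r7⟩ := b
    exact .sim (hlt a) ⟨by simpa [v] using q1, by simpa [v] using q2, μ, s',
      by simpa [v] using r1, hsel r2, t, by simpa [v] using ht, by simpa [wa] using r3,
      by simpa [wa] using r4, r5, by simpa [v] using r6, by simpa [v] using htm r7⟩ (hchg c w11)
  | out a b c =>
    exact .out (hlt a) ⟨by simpa [v] using b.st, by simpa [v] using b.qh,
      by simpa [v] using b.i_le, by simpa [v, wa] using hsel b.sel,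
      by simpa [v] using htm b.tm⟩ (hchg c w11)
  | clean a b c =>
    exact .clean (hlt a) ⟨by simpa [v] using b.st, by simpa [v] using b.qh, hyok b.ok,
      by simpa [v] using htm b.tm⟩ (hchg c w11)
  | apply a b c =>
    exact .apply (hlt a) ⟨by simpa [v] using b.st, by simpa [v] using b.j,
      by simpa [v] using b.tc, hyok b.ok, htm b.tm⟩ (hchg c w11)

end

/-! ### A call on the machine -/

section

variable {X : Ctx} {M : ℕ} {C₀ : Set ℕ} {i s e W : ℕ} {S S' T : St}

theorem exec_clr_v (off : ℕ) (S : St) {r : ℕ} (hr : r < 21) : (exec off clr S).v r = S.v r := by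
  have : r ≠ 21 ∧ r ≠ 22 ∧ r ≠ 23 ∧ r ≠ 24 ∧ r ≠ 25 ∧ r ≠ 26 ∧ r ≠ 27 ∧ r ≠ 28 ∧ r ≠ 29 := by omega
  simp [clr, mov, exec, this]

theorem bdd_clr (off W : ℕ) (S : St) : Bdd off W clr S := by
  simp [clr, mov, Bdd, Opd.val, WordOp.eval]

theorem Ctx.Good.bdd (hX : X.Good) (hW : X.V ^ 16 ^ 50 ≤ W) {b : Code} (hok : b.Ok X.V)
    (hd : b.depth ≤ 50) (hS : S.Le X.V) : Bdd (2 * X.n + 1) W b S := by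
  have hV := hX.n_le
  refine (grow (off := 2 * X.n + 1) b (by omega) (by omega) hok hS).1.mono (le_trans ?_ hW)
  exact Nat.pow_le_pow_right (by omega) (Nat.pow_le_pow_right (by norm_num) hd)

theorem Ctx.le_W (X : Ctx) (hW : X.V ^ 16 ^ 50 ≤ W) : X.V ≤ W :=
  (Nat.le_self_pow (by positivity) _).trans hW

theorem wr_ok {V κ : ℕ} (hV : 10 ≤ V) {x z : Opd} (hκ : κ ≤ V) (hx : x.Ok V) (hz : z.Ok V) :
    (wr κ x z).Ok V := by
  have h1 : 1 ≤ V := by omega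
  have h9 : 9 ≤ V := by omega
  exact ⟨⟨h9, trivial, Nat.zero_le _, hκ⟩, ⟨h9, trivial, h1, hx⟩, ⟨.inl rfl, trivial, h1⟩,
    ⟨hV, hκ, hx, hz⟩⟩

theorem goto_ok {V l : ℕ} {P : Program} (hV : P.length + 8 ≤ V) : (goto P l).Ok V := by
  have : (if l < P.length then 8 + l else 5) ≤ V := by split_ifs <;> omega
  simp [goto, mov, Code.Ok, Opd.Ok, this]

/-- The properties of a block that the bounds on time and words need. -/
def Short (V : ℕ) (b : Code) : Prop := b.Ok V ∧ b.depth ≤ 50 ∧ b.len ≤ 370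

theorem short_blocks {V : ℕ} {P : Program} (hV : 10 ≤ V) (hP : P.length + 8 ≤ V) :
    Short V blkStart ∧ Short V blkClear ∧ Short V blkCollect ∧ Short V blkScan ∧
      Short V (blkEmit P) ∧ Short V blkOut ∧ Short V blkClean ∧ Short V blkApply := by
  have h1 : 1 ≤ V := by omega
  have h2 : 2 ≤ V := by omega
  have h3 : 3 ≤ V := by omega
  have h4 : 4 ≤ V := by omega
  have h5 : 5 ≤ V := by omega
  have h6 : 6 ≤ V := by omega
  have h7 : 7 ≤ V := by omega
  have h8 : 8 ≤ V := by omega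
  have h9 : 9 ≤ V := by omega
  have hg := goto_ok (l := 0) hP
  refine ⟨⟨?_, by decide, by decide⟩, ⟨?_, by decide, by decide⟩, ⟨?_, by decide, by decide⟩,
    ⟨?_, by decide, by decide⟩, ⟨?_, ?_, ?_⟩, ⟨?_, by decide, by decide⟩, ⟨?_, by decide, by decide⟩,
    ⟨?_, by decide, by decide⟩⟩
  · simp [blkStart, popApply, halfIns, halfDel, inc, dec, mov, Code.Ok, Opd.Ok, *]
  · simp [blkClear, inc, dec, mov, Code.Ok, Opd.Ok, *]
  · simp [blkCollect, addY, inc, mov, Code.Ok, Opd.Ok, *]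
  · simp [blkScan, addY, push, wr, inc, dec, mov, Code.Ok, Opd.Ok, *]
  · simp [blkEmit, wr, inc, mov, Code.Ok, Opd.Ok, *]
  · simp [blkEmit, wr, inc, mov, goto, Code.depth]
  · simp [blkEmit, wr, inc, mov, goto, Code.len]
  · simp [blkOut, addY, inc, mov, Code.Ok, Opd.Ok, *]
  · simp [blkClean, dec, mov, Code.Ok, Opd.Ok, *]
  · simp [blkApply, popApply, addY, halfIns, halfDel, inc, dec, mov, Code.Ok, Opd.Ok, *]

theorem len_simBlock (P : Program) (p : ℕ) (I : Instr) : (simBlock P p I).len ≤ 370 := by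
  cases I <;> simp [simBlock, wr, goto, mov, inc, Code.len]

/-- The simulation of an instruction does not need long words if the result is a short word. -/
theorem Ctx.Good.bdd_simBlock (hX : X.Good) (hW : X.V ^ 16 ^ 50 ≤ W) (hS : S.Le X.V) {p : ℕ}
    {I : Instr} (hI : X.P[p]? = some I)
    (hop : ∀ f d a b, I = .op f d a b → S.a 10 0 a ≤ X.V ∧ S.a 10 0 b ≤ X.V ∧
        f.eval (S.a 10 0 a) (S.a 10 0 b) ≤ X.V) :
    Bdd (2 * X.n + 1) W (simBlock X.P p I) S := by
  have hV := hX.n_le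
  have hVW := X.le_W hW
  have hV10 : 10 ≤ X.V := by omega
  have h1 : 1 ≤ X.V := by omega
  have hg : ∀ l, (goto X.P l).Ok X.V := fun l => goto_ok hX.length_le
  have hlen : X.P.length ≤ X.V ∧ 8 ≤ X.V ∧ 5 ≤ X.V := by have := hX.length_le; omega
  have hc := hX.P_le I (List.mem_of_getElem? hI)
  cases I with
  | op f d a b =>
    obtain ⟨h1, h2, h3⟩ := hop f d a b rfl
    have hd := hc d (by simp [instrConsts])
    have ha := hc a (by simp [instrConsts])
    have hb := hc b (by simp [instrConsts])
    -- The arithmetic instruction is not covered by `grow` and is bounded by `hop` instead. The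
    -- bracketing in `simBlock` isolates it between two parts to which `grow` applies.
    refine ⟨hX.bdd hW ?_ (by simp [Code.depth]) hS, ⟨?_, ?_, ?_⟩, hX.bdd hW
      ⟨wr_ok hV10 (by omega) hd trivial, hg _⟩ ?_ ?_⟩
    · simp [Code.Ok, Opd.Ok, *]
    · simpa [exec, Opd.val] using h1.trans hVW
    · simpa [exec, Opd.val] using h2.trans hVW
    · simpa [exec, Opd.val] using h3.trans hVW
    · simp [wr, goto, mov, inc, Code.depth]
    · simp only [exec]
      exact ((hS.setv (hS.2.2 _ _ _)).setv (hS.2.2 _ _ _)).setv (by simpa [exec, Opd.val] using h3)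
  | const d k =>
    have hd := hc d (by simp [instrConsts])
    have hk := hc k (by simp [instrConsts])
    exact hX.bdd hW ⟨wr_ok hV10 (by omega) hd hk, hg _⟩
      (by simp [simBlock, wr, goto, mov, inc, Code.depth]) hS
  | load d a =>
    have hd := hc d (by simp [instrConsts])
    have ha := hc a (by simp [instrConsts])
    refine hX.bdd hW ⟨?_, ?_, wr_ok hV10 (by omega) hd trivial, hg _⟩
      (by simp [simBlock, wr, goto, mov, inc, Code.depth]) hS
    · exact ⟨hV10, Nat.zero_le _, ha⟩
    · exact ⟨hV10, h1, trivial⟩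
  | store a b =>
    have ha := hc a (by simp [instrConsts])
    have hb := hc b (by simp [instrConsts])
    refine hX.bdd hW ⟨?_, ?_, wr_ok hV10 (by omega) trivial trivial, hg _⟩
      (by simp [simBlock, wr, goto, mov, inc, Code.depth]) hS
    · exact ⟨hV10, Nat.zero_le _, ha⟩
    · exact ⟨hV10, Nat.zero_le _, hb⟩
  | jumpZero a l =>
    have ha := hc a (by simp [instrConsts])
    exact hX.bdd hW ⟨⟨hV10, Nat.zero_le _, ha⟩, trivial, hg _, hg _⟩
      (by simp [simBlock, goto, mov, Code.depth]) hS
  | jumpLess a b l =>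
    have ha := hc a (by simp [instrConsts])
    have hb := hc b (by simp [instrConsts])
    exact hX.bdd hW ⟨⟨hV10, Nat.zero_le _, ha⟩, ⟨hV10, Nat.zero_le _, hb⟩, trivial, trivial, hg _, hg _⟩
      (by simp [simBlock, goto, mov, Code.depth]) hS
  | jumpReg a =>
    have ha := hc a (by simp [instrConsts])
    refine hX.bdd hW ?_ (by simp [simBlock, mov, Code.depth]) hS
    simp [simBlock, mov, Code.Ok, Opd.Ok, *]

theorem getElem?_blocks {P : Program} {k : ℕ} {b : Code} (hk : ([blkStart, blkClear, blkCollect,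
    blkScan, blkEmit P, blkOut, blkClean, blkApply] : List Code)[k]? = some b) :
    (blocks P)[k]? = some (clr ;; b) := by
  have hlt := (List.getElem?_eq_some_iff.mp hk).1
  rw [blocks, List.getElem?_map, List.getElem?_append_left hlt, hk]
  rfl

theorem getElem?_blocks_sim {P : Program} {p : ℕ} {I : Instr} (hI : P[p]? = some I) :
    (blocks P)[8 + p]? = some (clr ;; simBlock P p I) := by
  rw [blocks, List.getElem?_map, List.getElem?_append_right (by simp)]
  simp [List.getElem?_mapIdx, hI]

/-- The variable `9` names the phase, and so the block. The length 400 is 370 for the block plus 27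
for resetting the temporary variables, rounded up. -/
theorem Ctx.Good.goodStep (hX : X.Good) (hC : C₀.Finite) (hW : X.V ^ 16 ^ 50 ≤ W) :
    GoodStep (blocks X.P) (2 * X.n + 1) W 400 (fun S => ∃ s, Inv X M C₀ i s 0 S) := by
  rintro S ⟨s, hI⟩ h7
  have hV := hX.n_le
  obtain ⟨S1, hS1⟩ : ∃ S1, exec (2 * X.n + 1) clr (S.setv 7 (S.v 7 - 1)) = S1 := ⟨_, rfl⟩
  have hpay := hI.pay h7 (2 * X.n + 1)
  have hle : S1.Le X.V := by
    rw [← hS1]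
    refine (hI.core.le.setv ?_).clr _
    have := hI.core.le.1 7 (by simp)
    omega
  rw [hS1] at hpay
  have w9 : S1.v 9 = S.v 9 := by rw [← hS1, exec_clr_v _ _ (by simp)]; simp
  have w7 : S1.v 7 = S.v 7 - 1 := by rw [← hS1, exec_clr_v _ _ (by simp)]; simp
  have fin : ∀ {b : Code}, (blocks X.P)[S1.v 9]? = some (clr ;; b) → b.len ≤ 370 →
      Bdd (2 * X.n + 1) W b S1 → Next X M C₀ i S1 (exec (2 * X.n + 1) b S1) →
      ∃ b, (blocks X.P)[S.v 9]? = some b ∧ b.len ≤ 400 ∧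
        Bdd (2 * X.n + 1) W b (S.setv 7 (S.v 7 - 1)) ∧
        (∃ s, Inv X M C₀ i s 0 (exec (2 * X.n + 1) b (S.setv 7 (S.v 7 - 1)))) ∧
        (exec (2 * X.n + 1) b (S.setv 7 (S.v 7 - 1))).v 7 ≤ S.v 7 - 1 := by
    intro b h1 h2 h3 h4
    rw [w9] at h1
    refine ⟨_, h1, ?_, ⟨bdd_clr _ _ _, by rwa [hS1]⟩, ?_, ?_⟩
    · simp only [Code.len, clr, mov]; omega
    · simp only [exec, hS1]; exact h4.1
    · simp only [exec, hS1]; rw [← w7]; exact h4.2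
  obtain ⟨hc, hp, hph⟩ := hpay
  obtain ⟨q0, q1, q2, q3, q4, q5, q6, q7⟩ := short_blocks (P := X.P) (by omega : 10 ≤ X.V) hX.length_le
  have fin' : ∀ {b : Code} {k : ℕ}, S1.v 9 = k → ([blkStart, blkClear, blkCollect,
      blkScan, blkEmit X.P, blkOut, blkClean, blkApply] : List Code)[k]? = some b → Short X.V b →
      Next X M C₀ i S1 (exec (2 * X.n + 1) b S1) → _ := fun h1 h2 h3 h4 =>
    fin (by rw [h1]; exact getElem?_blocks h2) h3.2.2 (hX.bdd hW h3.1 h3.2.1 hle) h4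
  cases hph with
  -- An idle machine has no budget, whereas here one microstep has been paid in advance.
  | idle a b c d => omega
  | start a b c d => exact fin' a.st rfl q0 (next_start hX hc hp a b c d)
  | clear a b c => exact fin' b.st rfl q1 (next_clear hX hc hp a b c)
  | collect a b c => exact fin' b.st rfl q2 (next_collect hX hc hp a b c)
  | scan a b c => exact fin' b.st rfl q3 (next_scan hX hc hp a b c)
  | emit a b c => exact fin' b.st rfl q4 (next_emit hX hc hp a b c)
  | sim a b c =>
    obtain ⟨p, I, h1, h2, h3, h4⟩ := next_sim hX hc hp a b c
    exact fin (by rw [h2]; exact getElem?_blocks_sim h1) (len_simBlock _ _ _)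
      (hX.bdd_simBlock hW hle h1 h3) h4
  | out a b c => exact fin' b.st rfl q5 (next_out hX hc hp a b c)
  | clean a b c => exact fin' b.st rfl q6 (next_clean hX hc hp a b c)
  | apply a b c =>
    refine fin' b.st rfl q7 ?_
    by_cases hq : S1.v 12 < S1.v 13
    · exact next_apply_pop hX hc hp a b c hq
    · exact next_apply_swap hX hc hp a b c hC (not_lt.1 hq)

/-- The state of the machine between two calls; the register `6` need not be initialized. -/
def RelRest (X : Ctx) (W : ℕ) (cfg : Config) (S : St) : Prop :=
  cfg.BoundedBy W ∧ Rel (2 * X.n + 1) W ⟨0, Function.update cfg.reg 6 (2 * X.n + 1), cfg.mem⟩ S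

/-- The call of the update procedure. -/
def callConfig (b u w : ℕ) (cfg : Config) : Config :=
  ⟨0, Function.update (Function.update (Function.update cfg.reg 0 b) 1 u) 2 w, cfg.mem⟩

theorem RelRest.call {cfg : Config} (h : RelRest X W cfg S) {b u w : ℕ} (hb : b ≤ W) (hu : u ≤ W)
    (hw : w ≤ W) : RelRest X W (callConfig b u w cfg) (((S.setv 0 b).setv 1 u).setv 2 w) := by
  refine ⟨?_, ?_⟩
  · exact boundedBy_reg (p := 0) (boundedBy_reg (p := 0) (boundedBy_reg (p := 0) h.1 hb) hu) hw
  · have := ((h.2.setv (d := 0) (p := 0) hb).setv (d := 1) (p := 0) hu).setv (d := 2) (p := 0) hw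
    have e : Function.update (callConfig b u w cfg).reg 6 (2 * X.n + 1) =
        Function.update (Function.update (Function.update
          (Function.update cfg.reg 6 (2 * X.n + 1)) (vreg 0) b) (vreg 1) u) (vreg 2) w := by
      funext x
      simp only [callConfig, vreg, Function.update_apply]
      split_ifs <;> first | rfl | omega
    rw [e]
    exact this

theorem Ctx.Good.bdd_foreground (hX : X.Good) (hW : X.V ^ 16 ^ 50 ≤ W) (hS : LeN X.V S) :
    Bdd (2 * X.n + 1) W (foreground X.L X.Kc) S := by
  have hV := hX.n_le
  have hV' := hX.V_ge'
  have h1 : 1 ≤ X.V := by omega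
  have h2 : 2 ≤ X.V := by omega
  have h3 : 3 ≤ X.V := by omega
  have h4 : 4 ≤ X.V := by omega
  refine ⟨bdd_clr _ _ _, hX.bdd hW ?_ ?_ (hS.clr _)⟩
  · simp [inc, Code.Ok, Opd.Ok, *]
  · simp [inc, Code.depth]

/-- The time of a call. -/
def Ctx.callTime (X : Ctx) : ℕ := (foreground X.L X.Kc).len + 4 + X.K * 408

def Ctx.program (X : Ctx) : Program := assemble (foreground X.L X.Kc) (blocks X.P)

theorem Rest.run (h : Rest X M C₀ i s S) (hX : X.Good) (him : i < X.m) (hW : X.V ^ 16 ^ 50 ≤ W)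
    (hlen : X.program.length ≤ W) {cfg : Config} (hcfg : RelRest X W cfg S) :
    ∃ c' S' s', RunsTo X.program W (callConfig (X.eI i) (X.eU i) (X.eV i) cfg) X.callTime c' ∧
      RelRest X W c' S' ∧ Params X S' ∧
      Rest X (M + (symmDiff C₀ (cset X.n S.cov (S.v 8))).ncard) (cset X.n S.cov (S.v 8)) (i + 1) s'
        S' := by
  have hV := hX.n_le
  have hVW := X.le_W hW
  obtain ⟨hun, hwn, -⟩ := hX.step i him
  have hI1 := hX.eI_le i
  obtain ⟨T, hT⟩ : ∃ T, T = ((S.setv 0 (X.eI i)).setv 1 (X.eU i)).setv 2 (X.eV i) := ⟨_, rfl⟩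
  have hr := hcfg.call (b := X.eI i) (u := X.eU i) (w := X.eV i) (by omega) (by omega) (by omega)
  rw [← hT] at hr
  have hL : LeN X.V T := by
    rw [hT]
    exact ((h.core.le.setv (by omega)).setv (by omega)).setv (by omega)
  have tv : ∀ r, 3 ≤ r → T.v r = S.v r := by
    intro r hr
    have : r ≠ 0 ∧ r ≠ 1 ∧ r ≠ 2 := by omega
    simp [hT, this]
  obtain ⟨hinv, h7⟩ := h.inv_foreground (T := T) hX him tv (by simp [hT]) (by simp [hT]) hL (by simp [hT])
    (by simp [hT]) (by simp [hT])
  obtain ⟨k, hk, c', S', hreach, hpc, hrel, ⟨s', hI'⟩, h7'⟩ := run_assemble (n := X.n)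
    (fg := foreground X.L X.Kc) (bs := blocks X.P) (W := W) (N := 400) (K := X.K) hlen (by omega)
    (hX.goodStep (M := M + (symmDiff C₀ (cset X.n S.cov (S.v 8))).ncard)
      (C₀ := cset X.n S.cov (S.v 8)) (i := i + 1) (finite_of_bijOn h.core.z.bij) hW)
    (c := callConfig (X.eI i) (X.eU i) (X.eV i) cfg) rfl hr.1 hr.2
    (by rw [tv _ le_rfl]; exact h.core.fix.n_eq) (hX.bdd_foreground hW hL) ⟨s, hinv⟩ h7.le
  refine ⟨c', S', s', hreach.runsTo hpc.ge hk, ⟨hrel.bdd, ?_⟩, hI'.par, hI'.core, h7', hI'.phase⟩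
  -- After a call register `6` holds its proper value, so setting it again changes nothing.
  have : Function.update c'.reg 6 (2 * X.n + 1) = c'.reg := by
    rw [← hrel.off_eq, Function.update_eq_self]
  rw [this]
  exact hrel.pc 0

end

/-! ### All calls in sequence -/

section

variable {X : Ctx} {M : ℕ} {C₀ : Set ℕ} {i s e W : ℕ} {S S' T : St}

/-- The initial state. -/
def Ctx.initSt (X : Ctx) : St :=
  ⟨fun r => if r = 3 then X.n else if r = 4 then X.α else if r = 5 then X.τ else 0, fun _ => 0,
    fun _ _ _ => 0⟩

theorem Ctx.Good.relRest_init (hX : X.Good) (hVW : X.V ≤ W) :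
    RelRest X W (initConfig X.n X.α X.τ) X.initSt := by
  have hV := hX.n_le
  have hV' := hX.V_ge'
  have hb : (initConfig X.n X.α X.τ).BoundedBy W := by
    intro i
    simp only [initConfig]
    refine ⟨?_, Nat.zero_le _⟩
    split_ifs <;> omega
  refine ⟨hb, boundedBy_reg (p := 0) hb (by omega), ?_, by simp, by simp [initConfig], ?_, ?_⟩
  · intro r
    have : vreg r ≠ 6 := vreg_ne le_rfl (by simp)
    show Function.update _ 6 _ (vreg r) = _
    rw [Function.update_of_ne this]
    simp only [initConfig, Ctx.initSt, vreg]
    split_ifs <;> first | rfl | omega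
  · intro i _; rfl
  · intro k x y; rfl

theorem Ctx.Good.rest_init (hX : X.Good) : Rest X 0 ∅ 0 0 X.initSt := by
  have hV' := hX.V_ge'
  have hV := hX.n_le
  have hcs : ∀ f, cset X.n X.initSt.cov f = ∅ := by intro f; ext x; simp [cset, Ctx.initSt]
  have hv : ∀ r, 5 < r → X.initSt.v r = 0 := by
    intro r hr
    have : r ≠ 3 ∧ r ≠ 4 ∧ r ≠ 5 := by omega
    simp [Ctx.initSt, this]
  have ha : ∀ k, X.initSt.a k = fun _ _ => 0 := fun k => rfl
  refine ⟨⟨Nat.zero_le _, ⟨rfl, rfl, rfl, by simp [hv], by simp [hv], by simp [hv]⟩,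
    ⟨?_, ?_, ?_, by simp [hv]⟩, ?_, by simp [hv], ?_, ?_, ?_, by simp [hv]⟩, by simp [hv], ?_⟩
  · simp [hv, hcs]
  · intro x y hxy; exact absurd hxy (hX.A_zero x y)
  · exact ⟨0, le_rfl, 0, hX.qual_zero, by simp [hv], by simp⟩
  · simp [hv, hcs]
  · rw [hv 12 (by simp)]
    refine ⟨fun x y hxy => absurd hxy (hX.A_zero x y), fun x p hp => ?_⟩
    simp [ha] at hp
  · refine ⟨?_, ?_, ?_, ?_⟩ <;> simp [ha, hv]
  · refine ⟨fun r _ => ?_, fun i => Nat.zero_le _, fun k i j => Nat.zero_le _⟩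
    simp only [Ctx.initSt]
    split_ifs <;> omega
  · refine .idle ⟨by simp [hv], by simp [hv], by simp [hv], by simp [hv], by simp [hv]⟩ (by simp [hv])
      (by simp [hv]) rfl ?_
    simp [Chg, hv, hcs]

/-- The cover that a configuration represents, as a set of numbers. -/
def coverNat (n : ℕ) (cfg : Config) : Set ℕ := {x | x < n ∧ cfg.mem (cfg.mem 0 + x) ≠ 0}

theorem coverNat_eq (hX : X.Good) (hc : Core X i s e S) (hp : Params X S) {cfg : Config}
    (h : RelRest X W cfg S) : coverNat X.n cfg = cset X.n S.cov (S.v 8) := by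
  have hF := hc.fix.f_le
  have hn := hX.n_pos
  have hFn : S.v 8 * X.n ≤ 1 * X.n := Nat.mul_le_mul_right _ hF
  have h0 : cfg.mem 0 = 1 + S.v 8 * X.n := by rw [← hp.2]; exact h.2.cov 0 (by omega)
  ext x
  simp only [coverNat, cset, mem_ofPred_eq]
  refine and_congr_right fun hx => ?_
  rw [h0]
  have := h.2.cov (1 + S.v 8 * X.n + x) (by omega)
  rw [← this]

/-- The configurations between the calls. -/
def Ctx.confs (X : Ctx) : ℕ → Config
  | 0 => initConfig X.n X.α X.τ
  | i + 1 => (step X.program)^[X.callTime]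
      (callConfig (X.eI i) (X.eU i) (X.eV i) (Ctx.confs X i))

theorem Ctx.Good.confs (hX : X.Good) (hW : X.V ^ 16 ^ 50 ≤ W) (hlen : X.program.length ≤ W) :
    ∀ i ≤ X.m, (∀ k < i, RunsTo X.program W
        (callConfig (X.eI k) (X.eU k) (X.eV k) (X.confs k)) X.callTime (X.confs (k + 1))) ∧
      ∃ M C₀ s S, Rest X M C₀ i s S ∧ RelRest X W (X.confs i) S ∧
        coverNat X.n (X.confs i) = cset X.n S.cov (S.v 8) ∧
        M + (symmDiff C₀ (coverNat X.n (X.confs i))).ncard = ∑ k ∈ Finset.range i,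
          (symmDiff (coverNat X.n (X.confs k)) (coverNat X.n (X.confs (k + 1)))).ncard := by
  intro i
  induction i with
  | zero =>
    intro _
    refine ⟨by simp, 0, ∅, 0, X.initSt, hX.rest_init, hX.relRest_init (X.le_W hW), ?_, ?_⟩
    -- Initially the pointer is zero and points into a memory of zeros, so the configuration
    -- represents the empty cover although the pointer has not been set.
    · ext x
      simp [coverNat, cset, Ctx.initSt, Ctx.confs, initConfig]
    · have : coverNat X.n (X.confs 0) = ∅ := by
        ext x
        simp [coverNat, Ctx.confs, initConfig]
      simp [this]
  | succ i ih =>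
    intro hi
    obtain ⟨h1, M, C₀, s, S, h2, h3, h4, h5⟩ := ih (by omega)
    obtain ⟨c', S', s', h6, h7, h8, h9⟩ := h2.run hX (by omega) hW hlen h3
    have hc' : X.confs (i + 1) = c' := h6.1
    refine ⟨fun k hk => ?_, _, _, s', S', h9, by rwa [hc'], ?_, ?_⟩
    · rcases Nat.lt_succ_iff_lt_or_eq.1 hk with hk | rfl
      · exact h1 k hk
      · rwa [hc']
    · rw [hc']; exact coverNat_eq hX h9.core h8 h7
    · rw [Finset.sum_range_succ, ← h5, ← h4]

/-- The conclusion about the machine. -/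
theorem Ctx.Good.exists_confs (hX : X.Good) (hW : X.V ^ 16 ^ 50 ≤ W)
    (hlen : X.program.length ≤ W) :
    (∀ i < X.m, RunsTo X.program W (callConfig (X.eI i) (X.eU i) (X.eV i) (X.confs i)) X.callTime
      (X.confs (i + 1))) ∧
    (∀ i ≤ X.m, (∀ x y, X.A i x y → x ∈ coverNat X.n (X.confs i) ∨ y ∈ coverNat X.n (X.confs i)) ∧
      ∃ s ≤ i, ∃ a ≤ s, ∃ x, X.Qual x a ∧ (coverNat X.n (X.confs i)).ncard ≤ x + (i - a) ∧
        X.L * (s - a) ≤ X.opt a ∧ (i = s ∨ s + 1 ≤ i ∧ X.L * (i - s) ≤ X.opt (s + 1))) ∧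
    ∑ k ∈ Finset.range X.m,
      (symmDiff (coverNat X.n (X.confs k)) (coverNat X.n (X.confs (k + 1)))).ncard ≤
        2 * (X.K + 1) * X.m := by
  refine ⟨(hX.confs hW hlen X.m le_rfl).1, fun i hi => ?_, ?_⟩
  · obtain ⟨-, M, C₀, s, S, h2, h3, h4, h5⟩ := hX.confs hW hlen i hi
    obtain ⟨a, ha, x, hx, h6, h7⟩ := h2.core.z.qual
    have := h2.core.fix.time
    rw [h4]
    exact ⟨h2.core.z.vc, s, by omega, a, ha, x, hx, by rwa [ncard_of_bijOn h2.core.z.bij], h7,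
      h2.late hX⟩
  · obtain ⟨-, M, C₀, s, S, h2, h3, h4, h5⟩ := hX.confs hW hlen X.m le_rfl
    rw [← h5, h4]
    exact h2.phase.chg h2.cnt

end

/-! ### Vertex covers and vertices of high degree -/

section

variable {n : ℕ} {G G' : SimpleGraph (Fin n)}

/-- The size of a minimum vertex cover. -/
noncomputable def minVC (G : SimpleGraph (Fin n)) : ℕ :=
  sInf {k | ∃ D : Set (Fin n), G.IsVertexCover D ∧ D.ncard = k}

theorem exists_minVC (G : SimpleGraph (Fin n)) : ∃ D, G.IsVertexCover D ∧ D.ncard = minVC G :=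
  Nat.sInf_mem (s := {k | ∃ D : Set (Fin n), G.IsVertexCover D ∧ D.ncard = k})
    ⟨_, univ, G.isVertexCover_univ, rfl⟩

theorem minVC_le {D : Set (Fin n)} (hD : G.IsVertexCover D) : minVC G ≤ D.ncard :=
  Nat.sInf_le ⟨D, hD, rfl⟩

theorem minVC_le_card (G : SimpleGraph (Fin n)) : minVC G ≤ n := by
  simpa using minVC_le G.isVertexCover_univ

theorem minVC_bot : minVC (⊥ : SimpleGraph (Fin n)) = 0 := by
  simpa using minVC_le (SimpleGraph.isVertexCover_bot (∅ : Set (Fin n)))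

theorem minVC_le_add_one {u v : Fin n} (h : G' ≤ G ⊔ SimpleGraph.edge u v) :
    minVC G' ≤ minVC G + 1 := by
  obtain ⟨D, hD, hc⟩ := exists_minVC G
  refine (minVC_le (D := insert u D) fun x y hxy => ?_).trans ((ncard_insert_le _ _).trans (by omega))
  have := h hxy
  rw [SimpleGraph.sup_adj, SimpleGraph.edge_adj] at this
  rcases this with h | ⟨h | h, -⟩
  · exact (hD h).imp (mem_insert_of_mem _) (mem_insert_of_mem _)
  · exact .inl (by simp [h.1])
  · exact .inr (by simp [h.2])

theorem ncard_edgeSet_induce_le {α : ℕ} (h : arboricity G ≤ α) {U : Finset (Fin n)} (hU : 2 ≤ U.card) :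
    (G.induce (U : Set (Fin n))).edgeSet.ncard ≤ α * (U.card - 1) := by
  have h1 : ⌈((G.induce (U : Set (Fin n))).edgeSet.ncard : ℚ) / ((U.card : ℚ) - 1)⌉₊ ≤ α :=
    (Finset.le_sup (f := fun U : Finset (Fin n) =>
      ⌈((G.induce (U : Set (Fin n))).edgeSet.ncard : ℚ) / ((U.card : ℚ) - 1)⌉₊)
      (by simpa using hU)).trans h
  have h2 : (2 : ℚ) ≤ U.card := by exact_mod_cast hU
  have h3 := Nat.ceil_le.1 h1
  rw [div_le_iff₀ (by linarith)] at h3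
  have h4 : ((U.card - 1 : ℕ) : ℚ) = U.card - 1 := by
    rw [Nat.cast_sub (by omega)]; simp
  rw [← h4] at h3
  exact_mod_cast h3

/-- Few vertices of high degree are outside of a vertex cover. -/
theorem high_sdiff_le {α L : ℕ} (h : arboricity G ≤ α) (hα : 1 ≤ α) {Y D : Set (Fin n)}
    (hY : ∀ x ∈ Y, α * (L + 1) < (G.neighborSet x).ncard) (hD : G.IsVertexCover D) :
    L * (Y \ D).ncard ≤ D.ncard := by
  classical
  rcases (Y \ D).eq_empty_or_nonempty with h0 | ⟨x₀, hx₀⟩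
  · simp [h0]
  set I : Finset (Fin n) := (Y \ D).toFinset with hI
  set U : Finset (Fin n) := I ∪ D.toFinset with hU
  have hIm : ∀ x, x ∈ I ↔ x ∈ Y ∧ x ∉ D := by intro x; simp [hI]
  have hnb : ∀ x ∈ I, ∀ y, G.Adj x y → y ∈ D := by
    intro x hx y hxy
    exact (hD hxy).resolve_left ((hIm x).1 hx).2
  have hIc : (Y \ D).ncard = I.card := by rw [hI, ncard_eq_toFinset_card']
  have hDc : D.ncard = D.toFinset.card := ncard_eq_toFinset_card' D
  have hUc : U.card = I.card + D.toFinset.card := by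
    rw [hU, Finset.card_union_of_disjoint]
    rw [Finset.disjoint_left]
    intro x hx hx'
    exact ((hIm x).1 hx).2 (by simpa using hx')
  have hI1 : 0 < I.card := Finset.card_pos.2 ⟨x₀, by simpa [hI] using hx₀⟩
  -- The arboricity speaks only of sets with at least two elements; a high vertex has a neighbour,
  -- which lies in `D`.
  have hD1 : 0 < D.toFinset.card := by
    have : 0 < (G.neighborSet x₀).ncard := (Nat.zero_le _).trans_lt (hY x₀ hx₀.1)
    obtain ⟨y, hy⟩ := (ncard_pos).1 this
    exact Finset.card_pos.2 ⟨y, by simpa using hnb x₀ (by simpa [hI] using hx₀) y hy⟩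
  have h1 := ncard_edgeSet_induce_le h (U := U) (by omega)
  -- The vertices of `I` are outside the cover `D`, so their neighbours lie in `D` and no edge is
  -- counted from both ends. The sum of their degrees is therefore at most the number of edges
  -- inside `U`.
  have h2 : (I.sigma fun x => (G.neighborSet x).toFinset).card ≤
      (G.induce (U : Set (Fin n))).edgeSet.ncard := by
    rw [← ncard_image_of_injective _ (Sym2.map.injective (Subtype.val_injective
      (p := (· ∈ (U : Set (Fin n))))))]
    rw [ncard_eq_toFinset_card']
    refine Finset.card_le_card_of_injOn (fun p => s(p.1, p.2)) ?_ ?_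
    · rintro ⟨x, y⟩ hp
      simp only [Finset.coe_sigma, mem_sigma_iff, Finset.mem_coe, mem_toFinset,
        SimpleGraph.mem_neighborSet] at hp
      have hx : x ∈ U := by rw [hU]; exact Finset.mem_union_left _ hp.1
      have hy : y ∈ U := by
        rw [hU]; exact Finset.mem_union_right _ (by simpa using hnb x hp.1 y hp.2)
      simp only [Finset.mem_coe, mem_toFinset]
      exact ⟨s(⟨x, hx⟩, ⟨y, hy⟩), by simpa using hp.2, by simp⟩
    · rintro ⟨x, y⟩ hp ⟨x', y'⟩ hp' he
      simp only [Finset.coe_sigma, mem_sigma_iff, Finset.mem_coe, mem_toFinset,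
        SimpleGraph.mem_neighborSet] at hp hp'
      simp only [Sym2.eq_iff] at he
      rcases he with ⟨rfl, rfl⟩ | ⟨rfl, rfl⟩
      · rfl
      · exact absurd (hnb _ hp'.1 _ hp'.2) ((hIm _).1 hp.1).2
  rw [Finset.card_sigma] at h2
  have h3 : I.card * (α * (L + 1)) ≤ ∑ x ∈ I, (G.neighborSet x).toFinset.card := by
    rw [← smul_eq_mul]
    refine Finset.card_nsmul_le_sum _ _ _ fun x hx => ?_
    rw [← ncard_eq_toFinset_card']
    exact (hY x ((hIm x).1 hx).1).le
  have h4 : α * (U.card - 1) ≤ α * (I.card + D.toFinset.card) := Nat.mul_le_mul_left _ (by omega)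
  have h5 : I.card * (α * (L + 1)) ≤ α * (I.card + D.toFinset.card) := by omega
  rw [hIc, hDc]
  have h6 : α * (L * I.card) ≤ α * D.toFinset.card := by nlinarith
  exact Nat.le_of_mul_le_mul_left h6 hα

/-- High vertices together with a good cover of a graph on low vertices. -/
theorem high_low_le {α L j : ℕ} {t : ℝ} (ht : 1 ≤ t) (hL : 0 < L) (h : arboricity G ≤ α) (hα : 1 ≤ α)
    {Y : Set (Fin n)} (hY : ∀ x ∈ Y, α * (L + 1) < (G.neighborSet x).ncard) {f : Fin j → Fin n}
    (hf : f.Injective) (hfY : ∀ q, f q ∉ Y) {C : Set (Fin j)}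
    (hC : IsApproxVC (G.comap f) t C) :
    ((Y.ncard + C.ncard : ℕ) : ℝ) ≤ (t + 1 / L) * minVC G := by
  obtain ⟨D, hD, hc⟩ := exists_minVC G
  have h1 := high_sdiff_le h hα hY hD
  have h2 := hC.2 (f ⁻¹' D) fun x y hxy => hD hxy
  have h3 : (f ⁻¹' D).ncard ≤ (D \ Y).ncard := by
    refine ncard_le_ncard_of_injOn f (fun x hx => ⟨hx, hfY x⟩) hf.injOn
  have h4 := ncard_inter_add_ncard_sdiff_eq_ncard D Y
  have h5 := ncard_inter_add_ncard_sdiff_eq_ncard Y D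
  rw [inter_comm] at h5
  rw [← hc]
  have hL' : (0 : ℝ) < L := by exact_mod_cast hL
  have h6 : ((Y \ D).ncard : ℝ) ≤ 1 / L * D.ncard := by
    rw [one_div, inv_mul_eq_div, le_div_iff₀ hL', mul_comm]
    exact_mod_cast h1
  have h3' : ((f ⁻¹' D).ncard : ℝ) ≤ (D \ Y).ncard := by exact_mod_cast h3
  have h4' : ((D ∩ Y).ncard : ℝ) + (D \ Y).ncard = D.ncard := by exact_mod_cast h4
  have h5' : ((D ∩ Y).ncard : ℝ) + (Y \ D).ncard = Y.ncard := by exact_mod_cast h5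
  push_cast
  have h7 : (0 : ℝ) ≤ (D ∩ Y).ncard := Nat.cast_nonneg _
  -- The bounds are `|C| ≤ t|D \ Y|` and `|Y| = |D ∩ Y| + |Y \ D|` with `|Y \ D| ≤ |D| / L`. Since
  -- `t ≥ 1`, `|D ∩ Y|` is at most `t|D ∩ Y|` and completes `t|D|`.
  nlinarith

/-- The case of an empty static instance. -/
theorem high_le {α L : ℕ} {t : ℝ} (ht : 1 ≤ t) (hL : 0 < L) (h : arboricity G ≤ α) (hα : 1 ≤ α)
    {Y : Set (Fin n)} (hY : ∀ x ∈ Y, α * (L + 1) < (G.neighborSet x).ncard) :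
    (Y.ncard : ℝ) ≤ (t + 1 / L) * minVC G := by
  simpa using high_low_le (j := 0) ht hL h hα hY (f := Fin.elim0) (fun x => x.elim0) (fun x => x.elim0)
    (C := ∅) ⟨fun x => x.elim0, fun D _ => by simp; positivity⟩

end

/-! ### Numbers as vertices -/

section

variable {n : ℕ} {G G' : SimpleGraph (Fin n)}

/-- Adjacency as a relation between numbers. -/
def natAdj (G : SimpleGraph (Fin n)) (x y : ℕ) : Prop := ∃ a b : Fin n, G.Adj a b ∧ (a : ℕ) = x ∧ (b : ℕ) = y

theorem natAdj_coe {a b : Fin n} : natAdj G a b ↔ G.Adj a b := by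
  constructor
  · rintro ⟨a', b', h, ha, hb⟩
    rwa [← Fin.ext ha, ← Fin.ext hb]
  · exact fun h => ⟨a, b, h, rfl, rfl⟩

theorem natAdj.lt {x y : ℕ} (h : natAdj G x y) : x < n ∧ y < n := by
  obtain ⟨a, b, -, rfl, rfl⟩ := h
  exact ⟨a.2, b.2⟩

theorem natAdj.symm {x y : ℕ} (h : natAdj G x y) : natAdj G y x := by
  obtain ⟨a, b, h, rfl, rfl⟩ := h
  exact ⟨b, a, h.symm, rfl, rfl⟩

theorem ncard_preimage_val {Y : Set ℕ} (hY : ∀ x ∈ Y, x < n) :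
    ((fun a : Fin n => (a : ℕ)) ⁻¹' Y).ncard = Y.ncard := by
  rw [← ncard_image_of_injective _ Fin.val_injective, image_preimage_eq_of_subset]
  intro x hx
  exact ⟨⟨x, hY x hx⟩, rfl⟩

theorem ncard_natAdj (a : Fin n) : {y | natAdj G a y}.ncard = (G.neighborSet a).ncard := by
  rw [← ncard_preimage_val (n := n) (Y := {y | natAdj G a y}) (fun y hy => (natAdj.lt hy).2)]
  congr 1
  ext b
  exact natAdj_coe

theorem steps_natAdj {e : Update n} (h : e.Takes G G') :
    Steps n (natAdj G) (natAdj G') (if e.ins then 1 else 0) e.u e.v := by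
  obtain ⟨h1, h2⟩ := h
  have key : ∀ x y : ℕ, ∀ q : ℕ → ℕ → Prop, (∀ x y, q x y → x < n ∧ y < n) →
    (∀ a b : Fin n, G'.Adj a b ↔ q a b) → (natAdj G' x y ↔ q x y) := by
    intro x y q hq h
    constructor
    · rintro ⟨a, b, hab, rfl, rfl⟩; exact (h a b).1 hab
    · intro hxy
      have := hq x y hxy
      exact ⟨⟨x, this.1⟩, ⟨y, this.2⟩, (h _ _).2 hxy, rfl, rfl⟩
  refine ⟨e.u.2, e.v.2, fun h => h1 (Fin.ext h), fun hb => ?_, fun hb => ?_⟩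
  · have hins : e.ins = true := by
      by_contra h; simp [h] at hb
    rw [if_pos hins] at h2
    refine ⟨fun h => h2.1 (natAdj_coe.1 h), fun x y => key x y
      (fun x y => (natAdj G x y ∨ x = e.u ∧ y = e.v) ∨ x = e.v ∧ y = e.u) ?_ fun a b => ?_⟩
    · rintro x y ((h | h) | h)
      · exact h.lt
      · exact ⟨h.1 ▸ e.u.2, h.2 ▸ e.v.2⟩
      · exact ⟨h.1 ▸ e.v.2, h.2 ▸ e.u.2⟩
    · rw [h2.2, SimpleGraph.sup_adj, SimpleGraph.edge_adj, natAdj_coe]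
      simp only [Fin.val_inj]
      have : (a = e.u ∧ b = e.v ∨ a = e.v ∧ b = e.u) → a ≠ b := by
        rintro (⟨rfl, rfl⟩ | ⟨rfl, rfl⟩)
        · exact h1
        · exact h1.symm
      tauto
  · have hins : ¬ e.ins = true := by
      intro h; simp [h] at hb
    rw [if_neg hins] at h2
    refine ⟨natAdj_coe.2 h2.1, fun x y => key x y
      (fun x y => (natAdj G x y ∧ ¬ (x = e.u ∧ y = e.v)) ∧ ¬ (x = e.v ∧ y = e.u)) ?_ fun a b => ?_⟩
    · rintro x y ⟨⟨h, -⟩, -⟩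
      exact h.lt
    · rw [h2.2, SimpleGraph.sdiff_adj, SimpleGraph.edge_adj, natAdj_coe]
      simp only [Fin.val_inj]
      have : G.Adj a b → a ≠ b := fun h => h.ne
      tauto

theorem minVC_takes {e : Update n} (h : e.Takes G G') :
    minVC G' ≤ minVC G + 1 ∧ minVC G ≤ minVC G' + 1 := by
  obtain ⟨h1, h2⟩ := h
  split_ifs at h2
  · rw [h2.2]
    exact ⟨minVC_le_add_one le_rfl, minVC_le_add_one (u := e.u) (v := e.v) (le_sup_left.trans le_sup_left)⟩
  · rw [h2.2]
    refine ⟨minVC_le_add_one (u := e.u) (v := e.v) (sdiff_le.trans le_sup_left),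
      minVC_le_add_one (u := e.u) (v := e.v) ?_⟩
    rw [sdiff_sup_self]
    exact le_sup_left

/-- The graph on the vertices `vrt`. -/
theorem InputOk.isAdjLists {j : ℕ} {vrt μ : ℕ → ℕ} {f : Fin j → Fin n}
    (hf : ∀ q : Fin j, (f q : ℕ) = vrt q) (h : InputOk (natAdj G) j vrt μ) :
    IsAdjLists (G.comap f) μ := by
  obtain ⟨h0, h1, cnt, itm, h2, h3, h4, h5⟩ := h
  have hadj : ∀ v w : Fin j, natAdj G (vrt v) (vrt w) ↔ (G.comap f).Adj v w := by
    intro v w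
    rw [← hf, ← hf, natAdj_coe]; rfl
  refine ⟨h0, h1, fun v => ?_, fun v w => ?_, h5⟩
  · rw [h2 v v.2]
    congr 1
    have := (h3 v v.2).image_eq
    have hc : {w | w < j ∧ natAdj G (vrt v) (vrt w)}.ncard = cnt v := by
      rw [← this, (h3 v v.2).injOn.ncard_image]
      simp [← Finset.coe_Iio]
    rw [← hc, ← ncard_preimage_val (n := j) (fun y hy => hy.1)]
    congr 1
    ext w
    simp [hadj]
  · rw [h2 v v.2, ← hadj]
    constructor
    · intro hvw
      obtain ⟨q, hq, hq'⟩ := (h3 v v.2).surjOn ⟨w.2, hvw⟩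
      exact ⟨μ (v + 1) + q, by omega, by simpa using hq, by rw [h4 v v.2 q hq, hq']⟩
    · rintro ⟨i, hi, hi', hw⟩
      have hq : i - μ (v + 1) < cnt v := by omega
      have h6 := h4 v v.2 _ hq
      rw [Nat.add_sub_cancel' hi, hw] at h6
      have := ((h3 v v.2).mapsTo hq).2
      rwa [← h6] at this

theorem coverNat_coe (cfg : Config) : (fun a : Fin n => (a : ℕ)) ⁻¹' coverNat n cfg = cfg.cover n := by
  ext a
  simp [coverNat, Config.cover]

theorem ncard_cover (cfg : Config) : (cfg.cover n).ncard = (coverNat n cfg).ncard := by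
  rw [← coverNat_coe, ncard_preimage_val fun x hx => hx.1]

theorem ncard_symmDiff_cover (cfg cfg' : Config) :
    (symmDiff (cfg.cover n) (cfg'.cover n)).ncard =
      (symmDiff (coverNat n cfg) (coverNat n cfg')).ncard := by
  rw [← ncard_preimage_val (n := n) (Y := symmDiff _ _)]
  · congr 1
    ext a
    simp [Set.mem_symmDiff, coverNat, Config.cover]
  · rintro x (h | h)
    · exact h.1.1
    · exact h.1.1

theorem RunsTo.mono {P : Program} {W W' τ : ℕ} {s s' : Config} (h : RunsTo P W s τ s') (hW : W ≤ W') :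
    RunsTo P W' s τ s' :=
  ⟨h.1, h.2.1, fun i hi r => ⟨(h.2.2 i hi r).1.trans hW, (h.2.2 i hi r).2.trans hW⟩⟩

end

/-! ### The algorithm on a sequence of graphs -/

/-- The degradation of a cover during two phases. -/
theorem stale_cover_le {t L x y z a₁ a₂ : ℝ} (ht : 1 ≤ t) (hL : 13 ≤ L) (ha : 0 ≤ a₁) (hb : 0 ≤ a₂)
    (h1 : z ≤ (t + 1 / L) * y + (a₁ + a₂)) (h2 : L * a₁ ≤ y)
    (h3 : (L - 1) * a₂ ≤ x) (h4 : y ≤ x + (a₁ + a₂)) : z ≤ (t + 13 * t / L) * x := by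
  have hx : 0 ≤ x := le_trans (mul_nonneg (by linarith) hb) h3
  have h5 : (L - 1) * y ≤ L * x + L * a₂ := by nlinarith
  have h6 : 12 * a₂ ≤ x := by nlinarith
  -- Since `L ≥ 13`, `L / (L - 1) ≤ 13 / 12`. The following steps bound `y` by `1.2x` and `Ly` by
  -- `Lx + 2.3x`. Collecting terms, the total loss is below `6tx / L`, so the constant 13 leaves
  -- room.
  have h7 : 12 * (L * a₂) ≤ 13 * x := by nlinarith
  have hy : 0 ≤ y := le_trans (mul_nonneg (by linarith) ha) h2
  have h8 : 10 * y ≤ 12 * x := by nlinarith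
  have h9 : 10 * (L * y) ≤ 10 * (L * x) + 23 * x := by nlinarith
  have h10 : L * z ≤ t * (L * y) + y + (L * a₁ + L * a₂) := by
    have := mul_le_mul_of_nonneg_left h1 (show 0 ≤ L by linarith)
    have e : L * ((t + 1 / L) * y + (a₁ + a₂)) = t * (L * y) + y + (L * a₁ + L * a₂) := by
      field_simp
    linarith
  have h11 : 10 * (t * (L * y)) ≤ 10 * (t * (L * x)) + 23 * (t * x) := by nlinarith
  have h12 : x ≤ t * x := by nlinarith
  have e : (t + 13 * t / L) * x = (t * (L * x) + 13 * (t * x)) / L := by field_simp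
  rw [e, le_div_iff₀ (by linarith)]
  nlinarith

theorem lipschitz_le {f : ℕ → ℕ} {m : ℕ} (h : ∀ i < m, f (i + 1) ≤ f i + 1 ∧ f i ≤ f (i + 1) + 1)
    {a b : ℕ} (hab : a ≤ b) (hb : b ≤ m) : f a ≤ f b + (b - a) := by
  induction b, hab using Nat.le_induction with
  | base => omega
  | succ b hab ih =>
    have := ih (by omega)
    have := (h b (by omega)).2
    omega

/-- The cover ages for `s - a` updates while it is being made and for `i - s` while it is served.
The second period is known to be short compared with the optimum at its own beginning; passing to
the optimum at time `i` costs at most `i - s`, which is why `L` becomes `L - 1` in the real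
inequality. -/
theorem stale_nat_le {f : ℕ → ℕ} {m L : ℕ} {t : ℝ} (ht : 1 ≤ t) (hL : 13 ≤ L)
    (h : ∀ i < m, f (i + 1) ≤ f i + 1 ∧ f i ≤ f (i + 1) + 1) {i s a x z : ℕ} (hi : i ≤ m) (hs : s ≤ i)
    (ha : a ≤ s) (hx : (x : ℝ) ≤ (t + 1 / L) * f a) (hz : z ≤ x + (i - a))
    (h1 : L * (s - a) ≤ f a) (h2 : i = s ∨ s + 1 ≤ i ∧ L * (i - s) ≤ f (s + 1)) :
    (z : ℝ) ≤ (t + 13 * t / L) * f i := by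
  have hz' : (z : ℝ) ≤ x + ((s - a : ℕ) + (i - s : ℕ)) := by
    have : z ≤ x + ((s - a) + (i - s)) := by omega
    exact_mod_cast this
  refine stale_cover_le (L := L) (a₁ := ((s - a : ℕ) : ℝ)) (a₂ := ((i - s : ℕ) : ℝ)) (y := f a) ht
    (by exact_mod_cast hL) (by positivity) (by positivity) (by linarith) (by exact_mod_cast h1) ?_ ?_
  · have h3 : L * (i - s) ≤ f i + (i - s) := by
      rcases h2 with rfl | ⟨h2, h3⟩
      · simp
      · have := lipschitz_le h h2 hi
        omega
    have h4 : ((L : ℝ)) * ((i - s : ℕ) : ℝ) ≤ f i + ((i - s : ℕ) : ℝ) := by exact_mod_cast h3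
    linarith
  · have := lipschitz_le h (ha.trans hs) hi
    have : f a ≤ f i + ((s - a) + (i - s)) := by omega
    exact_mod_cast this

/-- The constant in the bound of the work of a phase. -/
def workConst (t₁ : ℕ) : ℕ := 20 + 13 * (2 * t₁ + 1)

/-- The constant in the number of microsteps of a call. -/
def callConst (t₁ L : ℕ) : ℕ := 6 * L ^ 2 * workConst t₁ + 1

/-- An exponent such that all numbers that occur are at most `(n + α + T n + 2) ^ e`. -/
def wordExp (t₁ L k : ℕ) (P : Program) : ℕ :=
  workConst t₁ * (L + 2) + callConst t₁ L + (L + 1) + 10 + (P.flatMap instrConsts).sum + P.length + 8 +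
    k + 3

/-- The run of the algorithm on a sequence of graphs. -/
noncomputable def runCtx {n : ℕ} (G : ℕ → SimpleGraph (Fin n)) (e : ℕ → Update n) (m α L t₁ k : ℕ)
    (t : ℝ) (P : Program) (T : ℕ → ℕ) : Ctx where
  n := n
  α := α
  τ := T n
  L := L
  Kc := callConst t₁ L
  t1 := t₁
  m := m
  V := (n + α + T n + 2) ^ wordExp t₁ L k P
  Wp := (n + α + T n + 2) ^ k
  P := P
  A i := natAdj (G i)
  eI i := if (e i).ins then 1 else 0
  eU i := (e i).u
  eV i := (e i).v
  opt i := minVC (G i)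
  T := T
  Qual x i := (x : ℝ) ≤ (t + 1 / L) * minVC (G i)

theorem time_le {n τ : ℕ} {T : ℕ → ℕ}
    (hT : ∀ j : ℕ, 1 ≤ j → j ≤ n → (T j : ℝ) / j ≤ (τ : ℝ) / n) (j : ℕ) (hj : 1 ≤ j) (hn : j ≤ n) :
    T j ≤ (τ / n + 1) * j ∧ T j ≤ τ := by
  have h := hT j hj hn
  have hj' : (0 : ℝ) < j := by exact_mod_cast hj
  have hn' : (0 : ℝ) < n := by exact_mod_cast (show 0 < n by omega)
  have hjn : (j : ℝ) ≤ n := by exact_mod_cast hn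
  rw [div_le_iff₀ hj'] at h
  constructor
  · have h1 : τ < (τ / n + 1) * n := by
      have h := Nat.lt_div_mul_add (a := τ) (b := n) (show 0 < n by omega)
      rw [add_mul, one_mul]; exact h
    have h2 : (τ : ℝ) / n ≤ (τ / n + 1 : ℕ) := by
      rw [div_le_iff₀ hn']
      exact_mod_cast h1.le
    have : (T j : ℝ) ≤ (τ / n + 1 : ℕ) * j := h.trans (mul_le_mul_of_nonneg_right h2 hj'.le)
    exact_mod_cast this
  · have : (T j : ℝ) ≤ τ := by
      refine h.trans ?_
      rw [div_mul_eq_mul_div, div_le_iff₀ hn']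
      exact mul_le_mul_of_nonneg_left hjn (Nat.cast_nonneg _)
    exact_mod_cast this

/-- From `a ≤ 2 ^ a`, constants can be moved into the exponent. This turns every constant factor
into a larger constant in the word size. -/
theorem le_pow_of_two_le {N a E : ℕ} (hN : 2 ≤ N) (h : a ≤ E) : a ≤ N ^ E :=
  (Nat.lt_two_pow_self).le.trans ((Nat.pow_le_pow_left hN a).trans
    (Nat.pow_le_pow_right (by omega) h))

theorem mul_pow_le {N a b E : ℕ} (hN : 2 ≤ N) (h : a + b ≤ E) : a * N ^ b ≤ N ^ E := by
  calc a * N ^ b ≤ N ^ a * N ^ b := Nat.mul_le_mul_right _ (le_pow_of_two_le hN le_rfl)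
    _ = N ^ (a + b) := (pow_add ..).symm
    _ ≤ N ^ E := Nat.pow_le_pow_right (by omega) h

/-- Here the graphs enter. `high` and `solve` come from the count of high vertices together with the
guarantee of the static program on the induced subgraph of low vertices, which is contained in the
current graph; `fin` comes from the ageing estimate. -/
theorem goodRun {n α L t₁ k m : ℕ} {t : ℝ} {P : Program} {T : ℕ → ℕ} {𝒢 : Set (SimpleGraph (Fin n))}
    {G : ℕ → SimpleGraph (Fin n)} {e : ℕ → Update n} (ht : 1 ≤ t) (hL : 13 ≤ L)
    (ht₁ : t + 13 * t / L ≤ t₁) (hα : 1 ≤ α) (h𝒢 : ∀ G ∈ 𝒢, arboricity G ≤ α)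
    (hT : ∀ j : ℕ, 1 ≤ j → j ≤ n → (T j : ℝ) / j ≤ (T n : ℝ) / n) (hP : ComputesVC P k t 𝒢 α T)
    (hG : IsUpdateSeq 𝒢 m e G) : (runCtx G e m α L t₁ k t P T).Good := by
  -- An update sequence comes with at least one update, hence with a vertex.
  have hn : 0 < n := (Nat.zero_le _).trans_lt (e 0).u.2
  set N := n + α + T n + 2 with hN
  have hN2 : 2 ≤ N := by omega
  have hlip : ∀ i < m, minVC (G (i + 1)) ≤ minVC (G i) + 1 ∧ minVC (G i) ≤ minVC (G (i + 1)) + 1 :=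
    fun i hi => minVC_takes (hG.takes i hi)
  have hdeg : ∀ i (Y : Set ℕ), (∀ x ∈ Y, x < n ∧ α * (L + 1) < {y | natAdj (G i) x y}.ncard) →
      ∀ a ∈ (fun a : Fin n => (a : ℕ)) ⁻¹' Y, α * (L + 1) < ((G i).neighborSet a).ncard := by
    intro i Y hY a ha
    rw [← ncard_natAdj]
    exact (hY a ha).2
  have hθ : 1 ≤ T n / n + 1 := Nat.le_add_left _ _
  -- Both `α` and `L` are at least 1. The factor 3, doubled by `2 * L`, is the 6 in `callConst`.
  have hd : α * (L + 1) + 1 ≤ 3 * (α * L) := by nlinarith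
  refine ⟨hn, by simp only [runCtx]; omega, fun i x y h => h.lt, fun i x y h => h.symm, ?_, ?_, ?_,
    fun i => minVC_le_card _, hlip, ?_, ?_, ?_, ?_, fun j h1 h2 => (time_le hT j h1 h2).1, ?_, ?_, ?_,
    ?_, ?_, ?_⟩
  · rintro x y ⟨a, b, hab, -⟩
    rw [hG.start] at hab
    exact hab
  · intro i hi
    exact steps_natAdj (hG.takes i hi)
  · intro i
    simp only [runCtx]
    split_ifs <;> simp
  · simp only [runCtx]
    rw [hG.start, minVC_bot]
    simp
  · intro i hi Y hY
    have := high_le ht (show 0 < L by omega) (h𝒢 _ (hG.mem i hi)) hα (hdeg i Y hY)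
    have h6 := ncard_preimage_val (n := n) fun x hx => (hY x hx).1
    rwa [h6] at this
  · intro i hi j vrt μ hj hvrt hlow hin
    obtain ⟨f, hf⟩ : ∃ f : Fin j → Fin n, ∀ q, (f q : ℕ) = vrt q :=
      ⟨fun q => ⟨vrt q, (hlow q q.2).1⟩, fun q => rfl⟩
    have hfi : f.Injective := by
      intro a b hab
      refine Fin.ext (hvrt a.2 b.2 ?_)
      rw [← hf, ← hf, hab]
    have hjn : j ≤ n := by simpa using Fintype.card_le_of_injective f hfi
    obtain ⟨s', h1, h2⟩ := hP (G i) (hG.mem i hi) j hj ((G i).comap f)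
      ⟨⟨⟨f, fun h => h⟩, hfi⟩⟩ μ (hin.isAdjLists hf)
    refine ⟨s', RunsTo.mono h1 ?_, fun x hx y hy hxy => ?_, fun Y hY => ?_⟩
    · have := (time_le hT j hj hjn).2
      exact Nat.pow_le_pow_left (by omega) _
    · have hxy' : natAdj (G i) (f ⟨x, hx⟩) (f ⟨y, hy⟩) := by rw [hf, hf]; exact hxy
      have hxy'' : (G i).Adj (f ⟨x, hx⟩) (f ⟨y, hy⟩) := natAdj_coe.1 hxy'
      exact h2.1 (v := ⟨x, hx⟩) (w := ⟨y, hy⟩) hxy''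
    · have h3 := high_low_le ht (show 0 < L by omega) (h𝒢 _ (hG.mem i hi)) hα (hdeg i Y hY) hfi
        (fun q hq => ?_) h2
      · have h6 := ncard_preimage_val (n := n) fun x hx => (hY x hx).1
        rw [h6] at h3
        have h4 : {q | q < j ∧ s'.mem q ≠ 0}.ncard = {v : Fin j | s'.mem v ≠ 0}.ncard := by
          rw [← ncard_preimage_val (n := j) (fun y hy => hy.1)]
          congr 1
          ext w
          simp
        rw [h4]
        exact h3
      · have h5 := (hlow q q.2).2
        have h6 := hdeg i Y hY (f q) hq
        rw [← ncard_natAdj, hf] at h6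
        exact absurd h5 (not_le.2 h6)
  · intro i hi s hs a ha x z hx hz h1 h2
    have h3 := stale_nat_le (f := fun i => minVC (G i)) ht hL hlip hi hs ha hx hz h1 h2
    have h4 : (z : ℝ) ≤ t₁ * minVC (G i) :=
      h3.trans (mul_le_mul_of_nonneg_right ht₁ (Nat.cast_nonneg _))
    exact_mod_cast h4
  · show 2 * L * (workConst t₁ * ((α * (L + 1) + 1) * (T n / n + 1))) + 1 ≤
      (T n / n + 1) * α * callConst t₁ L
    calc _ ≤ 2 * L * (workConst t₁ * (3 * (α * L) * (T n / n + 1))) + (T n / n + 1) * α := by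
          gcongr
          exact Nat.mul_pos hθ hα
      _ = _ := by rw [callConst]; ring
  · exact Nat.pow_le_pow_right (by omega) (by simp only [wordExp]; omega)
  · intro I hI c hc
    refine le_pow_of_two_le hN2 ?_
    have : c ≤ (P.flatMap instrConsts).sum :=
      List.single_le_sum (by simp) _ (List.mem_flatMap.2 ⟨I, hI, hc⟩)
    simp only [wordExp]
    omega
  · exact le_pow_of_two_le hN2 (by simp only [wordExp, runCtx]; omega)
  · show workConst t₁ * (1 + n) * ((α * (L + 1) + 1) * (T n / n + 1)) +
      (T n / n + 1) * α * callConst t₁ L + α * (L + 1) + 3 * n + 10 ≤ N ^ wordExp t₁ L k P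
    have hdiv : T n / n + 1 ≤ N := by have := Nat.div_le_self (T n) n; omega
    have h1 : 1 + n ≤ N := by omega
    have h2 : α ≤ N := by omega
    have h3 : α * (L + 1) + 1 ≤ N * (L + 2) := by nlinarith
    have hN3 : N ≤ N ^ 3 := Nat.le_self_pow (by norm_num) _
    have hN23 : N ^ 2 ≤ N ^ 3 := Nat.pow_le_pow_right (by omega) (by norm_num)
    calc _ ≤ workConst t₁ * N * ((N * (L + 2)) * N) + N * N * callConst t₁ L + N * (L + 1) + 10 * N := by
          have : 3 * n + 10 ≤ 10 * N := by omega
          have h4 : workConst t₁ * (1 + n) * ((α * (L + 1) + 1) * (T n / n + 1)) ≤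
            workConst t₁ * N * ((N * (L + 2)) * N) := by gcongr
          have h5 : (T n / n + 1) * α * callConst t₁ L ≤ N * N * callConst t₁ L := by gcongr
          have h6 : α * (L + 1) ≤ N * (L + 1) := by gcongr
          omega
      _ = workConst t₁ * (L + 2) * N ^ 3 + callConst t₁ L * N ^ 2 + (L + 1) * N + 10 * N := by ring
      _ ≤ workConst t₁ * (L + 2) * N ^ 3 + callConst t₁ L * N ^ 3 + (L + 1) * N ^ 3 + 10 * N ^ 3 := by
          gcongr
      _ = (workConst t₁ * (L + 2) + callConst t₁ L + (L + 1) + 10) * N ^ 3 := by ring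
      _ ≤ _ := mul_pow_le hN2 (by simp only [wordExp]; omega)
  · have hV : N ≤ N ^ wordExp t₁ L k P := Nat.le_self_pow (by simp [wordExp]) _
    refine ⟨le_pow_of_two_le hN2 ?_, le_pow_of_two_le hN2 ?_, ?_, ?_⟩
    · simp only [wordExp, runCtx]; omega
    · simp only [wordExp, runCtx]; omega
    · exact le_trans (by simp only [runCtx]; omega) hV
    · exact le_trans (by simp only [runCtx]; omega) hV

/-- The dynamic program. -/
def dynProgram (t₁ L : ℕ) (P : Program) : Program := assemble (foreground L (callConst t₁ L)) (blocks P)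

theorem len_foreground (L Kc : ℕ) : (foreground L Kc).len ≤ 500 := by
  simp [foreground, clr, inc, mov, Code.len]

/-- The number of steps of a call, and twice the number of microsteps, in terms of the number of
microsteps. -/
theorem Ctx.Good.callTime_le {X : Ctx} (hX : X.Good) :
    X.callTime ≤ 1000 * X.K ∧ 2 * (X.K + 1) ≤ 1000 * X.K := by
  have h1 := len_foreground X.L X.Kc
  have h2 : 1 ≤ X.K := by have := hX.hK; omega
  simp only [Ctx.callTime]
  omega

/-- The constant is 1000 · 2 · 7 · 14²: machine steps per microstep, rounding of `θ` (here `n ≤ τ`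
is used), the summand 1 in `callConst`, and the bound on `L`. -/
theorem microsteps_le {n α L t₁ τ : ℕ} {t δ : ℝ} (hn : 0 < n) (hτ : n ≤ τ) (ht : 1 ≤ t) (hδ : 0 < δ)
    (hδ1 : δ ≤ 1) (hL : (L : ℝ) ≤ 14 * t / δ) :
    ((1000 * ((τ / n + 1) * α * callConst t₁ L) : ℕ) : ℝ) ≤
      (τ : ℝ) / ((1 / (2744000 * t ^ 2 * workConst t₁)) * ((n : ℝ) / α) * δ ^ 2) := by
  have hn' : (0 : ℝ) < n := by exact_mod_cast hn
  have hτ' : (n : ℝ) ≤ τ := by exact_mod_cast hτ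
  have hC : (1 : ℝ) ≤ workConst t₁ := by
    have : 1 ≤ workConst t₁ := by simp only [workConst]; omega
    exact_mod_cast this
  have hdiv : ((τ / n : ℕ) : ℝ) ≤ (τ : ℝ) / n := Nat.cast_div_le
  have h1 : (1 : ℝ) ≤ (τ : ℝ) / n := by rwa [le_div_iff₀ hn', one_mul]
  have h2 : (((τ / n + 1 : ℕ)) : ℝ) ≤ 2 * ((τ : ℝ) / n) := by push_cast; linarith
  have h3 : (L : ℝ) ^ 2 ≤ (14 * t / δ) ^ 2 := by gcongr
  have h4 : (1 : ℝ) ≤ (14 * t / δ) ^ 2 := by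
    have : 1 ≤ 14 * t / δ := by rw [le_div_iff₀ hδ]; linarith
    nlinarith
  have h5 : ((callConst t₁ L : ℕ) : ℝ) ≤ 7 * ((14 * t / δ) ^ 2 * workConst t₁) := by
    simp only [callConst]
    push_cast
    have h6 : (L : ℝ) ^ 2 * workConst t₁ ≤ (14 * t / δ) ^ 2 * workConst t₁ := by gcongr
    nlinarith
  calc ((1000 * ((τ / n + 1) * α * callConst t₁ L) : ℕ) : ℝ)
      = 1000 * (((τ / n + 1 : ℕ) : ℝ) * α * (callConst t₁ L : ℕ)) := by push_cast; ring
    _ ≤ 1000 * (2 * ((τ : ℝ) / n) * α * (7 * ((14 * t / δ) ^ 2 * workConst t₁))) := by gcongr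
    _ = _ := by
        rcases Nat.eq_zero_or_pos α with rfl | hα
        · simp
        · have : (0 : ℝ) < α := by exact_mod_cast hα
          field_simp
          ring

theorem maintainsVC_dynProgram {n α L t₁ k : ℕ} {t ε : ℝ} {P : Program} {T : ℕ → ℕ}
    {𝒢 : Set (SimpleGraph (Fin n))} (ht : 1 ≤ t) (hε : 0 < ε) (hL : 13 ≤ L)
    (hL1 : 13 * t / L ≤ min ε 1) (hL2 : (L : ℝ) ≤ 14 * t / min ε 1)
    (ht₁ : t + 1 ≤ t₁) (hα : 1 ≤ α) (h𝒢 : ∀ G ∈ 𝒢, arboricity G ≤ α) (hTn : n ≤ T n)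
    (hT : ∀ j : ℕ, 1 ≤ j → j ≤ n → (T j : ℝ) / j ≤ (T n : ℝ) / n) (hP : ComputesVC P k t 𝒢 α T) :
    MaintainsVC (dynProgram t₁ L P)
      ((n + α + T n + 2) ^ (wordExp t₁ L k P * 16 ^ 50 + (dynProgram t₁ L P).length)) (t + ε) 𝒢 α (T n)
      ((T n : ℝ) / ((1 / (2744000 * t ^ 2 * workConst t₁)) * ((n : ℝ) / α) * (min ε 1) ^ 2)) := by
  intro m e G hG
  have hn : 0 < n := (Nat.zero_le _).trans_lt (e 0).u.2
  have hδ : 0 < min ε 1 := lt_min hε one_pos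
  have hX := goodRun ht hL (t₁ := t₁) (by linarith [min_le_right ε 1]) hα h𝒢 hT hP hG
  obtain ⟨X, hXdef⟩ : ∃ X, runCtx G e m α L t₁ k t P T = X := ⟨_, rfl⟩
  have hN2 : 2 ≤ n + α + T n + 2 := by omega
  have hB := microsteps_le (t₁ := t₁) (α := α) hn hTn ht hδ (min_le_right _ _) hL2
  have hK : X.K = (T n / n + 1) * α * callConst t₁ L := by rw [← hXdef]; rfl
  have hprog : X.program = dynProgram t₁ L P := by rw [← hXdef]; rfl
  rw [hXdef] at hX
  obtain ⟨h1, h2, h3⟩ := hX.exists_confs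
    (W := (n + α + T n + 2) ^ (wordExp t₁ L k P * 16 ^ 50 + (dynProgram t₁ L P).length)) (by
      have : X.V = (n + α + T n + 2) ^ wordExp t₁ L k P := by rw [← hXdef]; rfl
      rw [this, ← pow_mul]
      exact Nat.pow_le_pow_right (by omega) (Nat.le_add_right _ _)) (by
      rw [hprog]
      exact le_pow_of_two_le hN2 (Nat.le_add_left _ _))
  obtain ⟨h4, h5⟩ := hX.callTime_le
  rw [← hK] at hB
  have hm : X.m = m := by rw [← hXdef]; rfl
  have hXn : X.n = n := by rw [← hXdef]; rfl
  have hA : X.A = fun i => natAdj (G i) := by rw [← hXdef]; rfl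
  refine ⟨X.confs, by rw [← hXdef]; rfl, fun i hi => ⟨X.callTime, ?_, ?_⟩, fun i hi => ⟨?_, ?_⟩, ?_⟩
  · refine le_trans ?_ hB
    exact_mod_cast h4
  · have := h1 i (by omega)
    rw [hprog] at this
    rw [← hXdef] at this ⊢
    exact this
  · intro a b hab
    have := (h2 i (by omega)).1 a b (by rw [hA]; exact natAdj_coe.2 hab)
    rw [hXn] at this
    rw [← coverNat_coe]
    exact this
  · intro D hD
    obtain ⟨-, s, hs, a, ha, x, hx, h6, h7, h8⟩ := h2 i (by omega)
    rw [ncard_cover]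
    rw [hXn] at h6
    have hopt : X.opt = fun i => minVC (G i) := by rw [← hXdef]; rfl
    have hXL : X.L = L := by rw [← hXdef]; rfl
    have hq : (x : ℝ) ≤ (t + 1 / L) * minVC (G a) := by rw [← hXdef] at hx; exact hx
    rw [hopt, hXL] at h7 h8
    have h9 := stale_nat_le (f := fun i => minVC (G i)) ht hL
      (fun i hi => minVC_takes (hG.takes i hi)) hi hs ha hq h6 h7 h8
    have h10 : (minVC (G i) : ℝ) ≤ D.ncard := by exact_mod_cast minVC_le hD
    have h11 : t + 13 * t / L ≤ t + ε := by linarith [min_le_left ε 1]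
    calc _ ≤ (t + 13 * t / L) * minVC (G i) := h9
      _ ≤ (t + ε) * D.ncard := by gcongr
  · rw [hm, hXn] at h3
    calc _ = ((∑ k ∈ Finset.range m, (symmDiff (coverNat n (X.confs k))
            (coverNat n (X.confs (k + 1)))).ncard : ℕ) : ℝ) := by
          simp only [ncard_symmDiff_cover]
      _ ≤ ((1000 * X.K * m : ℕ) : ℝ) := by
          exact_mod_cast h3.trans (Nat.mul_le_mul_right _ h5)
      _ = ((1000 * X.K : ℕ) : ℝ) * m := by push_cast; ring
      _ ≤ _ := mul_le_mul_of_nonneg_right hB (Nat.cast_nonneg _)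

/-- Rounding `13t / δ` up costs less than 1, hence less than another `t / δ`, since `δ ≤ 1 ≤ t`. -/
theorem exists_phase_param {t δ : ℝ} (ht : 1 ≤ t) (hδ : 0 < δ) (hδ1 : δ ≤ 1) :
    ∃ L : ℕ, 13 ≤ L ∧ 13 * t / L ≤ δ ∧ (L : ℝ) ≤ 14 * t / δ := by
  have h1 : 13 ≤ 13 * t / δ := by rw [le_div_iff₀ hδ]; nlinarith
  have h2 := Nat.le_ceil (13 * t / δ)
  have h3 := Nat.ceil_lt_add_one (show 0 ≤ 13 * t / δ by linarith)
  have h4 : (13 : ℝ) ≤ ⌈13 * t / δ⌉₊ := h1.trans h2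
  refine ⟨⌈13 * t / δ⌉₊, by exact_mod_cast h4, ?_, ?_⟩
  · rw [div_le_iff₀ (by linarith)]
    rw [div_le_iff₀ hδ] at h2
    linarith
  · have h5 : 1 ≤ t / δ := by rw [le_div_iff₀ hδ]; linarith
    have e1 : 13 * t / δ = 13 * (t / δ) := by ring
    have e2 : 14 * t / δ = 14 * (t / δ) := by ring
    rw [e1] at h3 ⊢
    rw [e2]
    linarith

end DynVC

open DynVC in
theorem theorem5 (t : ℝ) (ht : 1 ≤ t) :
    ∃ c : ℝ, 0 < c ∧
      ∀ (ε : ℝ), 0 < ε → ∀ (P : Program) (k : ℕ),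
        ∃ (Q : Program) (k' : ℕ),
          ∀ (n α : ℕ) (𝒢 : Set (SimpleGraph (Fin n))) (T : ℕ → ℕ), 1 ≤ α →
            (∀ G ∈ 𝒢, arboricity G ≤ α) →
            (∀ G ∈ 𝒢, ∀ H : SimpleGraph (Fin n), H ≤ G → H ∈ 𝒢) →
            n ≤ T n →
            (∀ j : ℕ, 1 ≤ j → j ≤ n → (T j : ℝ) / j ≤ (T n : ℝ) / n) →
            ComputesVC P k t 𝒢 α T →
            MaintainsVC Q ((n + α + T n + 2) ^ k') (t + ε) 𝒢 α (T n)
              ((T n : ℝ) / (c * ((n : ℝ) / α) * (min ε 1) ^ 2)) := by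
  -- Because `L` is chosen for `min ε 1`, the ratio never exceeds `t + 1`. So the integer that
  -- bounds cover sizes in the work of a phase, and with it the constant, depends on `t` only.
  obtain ⟨t₁, ht₁⟩ := exists_nat_ge (t + 1)
  have hC : 0 < workConst t₁ := by simp only [workConst]; omega
  refine ⟨1 / (2744000 * t ^ 2 * workConst t₁), by positivity, fun ε hε P k => ?_⟩
  obtain ⟨L, hL, hL1, hL2⟩ := exists_phase_param ht (lt_min hε one_pos) (min_le_right ε 1)
  exact ⟨dynProgram t₁ L P, _, fun n α 𝒢 T hα h𝒢 _ hTn hT hP =>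
    maintainsVC_dynProgram ht hε hL hL1 hL2 ht₁ hα h𝒢 hTn hT hP⟩
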